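/- Let $M$ be a complex manifold and $w\in\mathbb Z$; let $z$ be the coordinate on $\mathbb C\subset\mathbb P^1$, $\pi:\mathbb P^1\times M\to M$ the projection, $\mathcal T_M$ the sheaf of holomorphic vector fields and $\mathcal O(\cdot)$ the sheaf of holomorphic sections. **Definitions.** A *Frobenius type structure* on a holomorphic vector bundle $K\to M$ is a tuple $(\nabla^r,C,\mathcal U,\mathcal V,g)$ where $\nabla^r$ is a flat holomorphic connection on $K$; $C$ is a Higgs field, i.e. an $\mathcal O_M$-linear map $\mathcal O(K)\to\Omega^1_M\otimes\mathcal O(K)$ with $C_XC_Y=C_YC_X$, satisfying $\nabla^r(C)=0$, i.e. $\nabla^r_X(C_Y)-\nabla^r_Y(C_X)-C_{[X,Y]}=0$; $\mathcal U,\mathcal V$ are holomorphic endomorphisms of $K$ with $[C,\mathcal U]=0$, $\nabla^r(\mathcal V)=0$ and $\nabla^r(\mathcal U)-[C,\mathcal V]+C=0$; $g$ is a holomorphic symmetric nondegenerate $\nabla^r$-flat bilinear pairing on $K$ with $g(C_Xa,b)=g(a,C_Xb)$, $g(\mathcal Ua,b)=g(a,\mathcal Ub)$, $g(\mathcal Va,b)=-g(a,\mathcal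 Vb)$. A *$(trTLEP(w))$-structure* on a holomorphic vector bundle $H\to\mathbb P^1\times M$, whose restriction to $\mathbb P^1\times\{t\}$ is trivial for every $t\in M$, is a pair $(\nabla,P)$ where * $\nabla$ is a flat holomorphic connection on $H|_{\mathbb C^*\times M}$ with a pole of Poincaré rank 1 along $\{0\}\times M$, i.e. $\nabla:\mathcal O(H)\to\bigl(\tfrac1z\mathcal O\cdot\Omega^1_M+\tfrac1z\mathcal O\,\tfrac{dz}z\bigr)\otimes\mathcal O(H)$ there, and a logarithmic pole along $\{\infty\}\times M$, i.e. $\nabla:\mathcal O(H)\to\bigl(\mathcal O\cdot\Omega^1_M+\mathcal O\,\tfrac{dz}z\bigr)\otimes\mathcal O(H)$ there; * $P:H_{(z,t)}\times H_{(-z,t)}\to\mathbb C$, $(z,t)\in\mathbb C^*\times M$, is a $\mathbb C$-bilinear, nondegenerate, $(-1)^w$-symmetric, $\nabla$-flat pairing such that $z^{-w}P$, as a pairing of a section $a$ near $(z,t)$ and a section $b$ near $(-z,t)$, extends to a holomorphic nondegenerate pairing over $\mathbb C\times M$ and over $(\mathbb P^1\setminus\{0\})\times M$. Isomorphisms of such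 structures are isomorphisms of the holomorphic bundles which respect all data. **Theorem.** There is a one-to-one correspondence (up to isomorphism) between $(trTLEP(w))$-structures on holomorphic vector bundles over $\mathbb P^1\times M$ and Frobenius type structures on holomorphic vector bundles over $M$. It is given by (a) and (b), which are inverse to one another. (a) Let $(\nabla^r,C,\mathcal U,\mathcal V,g)$ be a Frobenius type structure on $K$. Extend it canonically to $H:=\pi^*K$. Then $$\nabla:=\nabla^r+\frac1zC+\Bigl(\frac1z\mathcal U-\mathcal V+\frac w2\,\mathrm{id}\Bigr)\frac{dz}z,\qquad P(a,b):=z^w g(a,b)\quad(a\in H_{(z,t)}=K_t,\ b\in H_{(-z,t)}=K_t)$$ define a $(trTLEP(w))$-structure on $H$. (b) Let $(\nabla,P)$ be a $(trTLEP(w))$-structure on $H$, and $K:=H|_{\{0\}\times M}$. For $X\in\mathcal T_M$ and holomorphic sections $a,b$ of $H$ near $\{0\}\times M$ put $C_X[a]:=z\nabla_Xa|_{z=0}$, $\mathcal U[a]:=z^2\nabla_{\partial_z}a|_{z=0}$, $g([a],[b]):=z^{-w}P(a,b)|_{z=0}$. On $H|_{\{\infty\}\times M}$ let $\nabla^{res}_X[a]:=\nabla_Xa|_{z=\infty}$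 and $\mathcal V^{res}[a]:=-\nabla_{z\partial_z}a|_{z=\infty}$ for holomorphic sections $a$ near $\{\infty\}\times M$. Since $H|_{\mathbb P^1\times\{t\}}$ is trivial for every $t$, there are canonical isomorphisms $\psi:H_{(z,t)}\to K_t$, $z\in\mathbb P^1$. Let $\nabla^r$ and $\mathcal V$ on $K$ be the shifts with $\psi$ of $\nabla^{res}$ and of $\mathcal V^{res}+\frac w2\,\mathrm{id}$. These data are well defined, $(\nabla^r,C,\mathcal U,\mathcal V,g)$ is a Frobenius type structure on $K$, the map $\psi:H\to\pi^*K$ is an isomorphism of holomorphic vector bundles, and it carries $(\nabla,P)$ to the $(trTLEP(w))$-structure which (a) assigns to $(\nabla^r,C,\mathcal U,\mathcal V,g)$. Conversely, applying (a) and then (b) to a Frobenius type structure on $K$ gives back this structure, under the canonical isomorphism $K\cong(\pi^*K)|_{\{0\}\times M}$. Two Frobenius type structures are isomorphic if and only if the $(trTLEP(w))$-structures assigned to them by (a) are isomorphic. -/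

import Mathlib

universe v

open Bundle Filter Set
open scoped Manifold ContDiff Topology

/-! ## The complex projective line as a complex manifold -/

namespace RiemannSphere

/-- The underlying space of the projective line: `ℂ` together with a point `∞`. -/
abbrev P1 : Type := OnePoint ℂ

/-- The inversion `z ↦ 1/z` of the projective line, exchanging `0` and `∞`. -/
noncomputable def invFun (p : P1) : P1 :=
  OnePoint.elim p ((0 : ℂ) : P1) (fun z => if z = 0 then OnePoint.infty else ((z⁻¹ : ℂ) : P1))

theorem invFun_infty : invFun OnePoint.infty = ((0 : ℂ) : P1) := rfl

theorem invFun_zero : invFun ((0 : ℂ) : P1) = OnePoint.infty := by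
  simp [invFun]

theorem invFun_coe {z : ℂ} (hz : z ≠ 0) : invFun (z : P1) = ((z⁻¹ : ℂ) : P1) := by
  simp [invFun, hz]

theorem invFun_invFun (p : P1) : invFun (invFun p) = p := by
  induction p using OnePoint.rec with
  | infty => rw [invFun_infty, invFun_zero]
  | coe z =>
    by_cases hz : z = 0
    · subst hz; rw [invFun_zero, invFun_infty]
    · rw [invFun_coe hz, invFun_coe (inv_ne_zero hz), inv_inv]

theorem continuous_invFun : Continuous invFun := by
  rw [continuous_iff_continuousAt]
  intro p
  induction p using OnePoint.rec with
  | infty =>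
    rw [OnePoint.continuousAt_infty', invFun_infty, coclosedCompact_eq_cocompact,
      ← Metric.cobounded_eq_cocompact]
    have h : Tendsto (fun z : ℂ => ((z⁻¹ : ℂ) : P1)) (Bornology.cobounded ℂ)
        (𝓝 ((0 : ℂ) : P1)) :=
      (OnePoint.continuous_coe.tendsto (0 : ℂ)).comp tendsto_inv₀_cobounded
    refine h.congr' ?_
    filter_upwards [Bornology.eventually_ne_cobounded (0 : ℂ)] with z hz
    simp [invFun_coe hz]
  | coe z =>
    rw [OnePoint.continuousAt_coe]
    by_cases hz : z = 0
    · subst hz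
      rw [continuousAt_iff_punctured_nhds]
      have h : Tendsto (fun z : ℂ => ((z⁻¹ : ℂ) : P1)) (𝓝[≠] 0) (𝓝 (OnePoint.infty : P1)) := by
        have h1 := OnePoint.tendsto_coe_infty (X := ℂ)
        rw [coclosedCompact_eq_cocompact, ← Metric.cobounded_eq_cocompact] at h1
        exact h1.comp tendsto_inv₀_nhdsNE_zero
      simp only [Function.comp_apply, invFun_zero]
      refine h.congr' ?_
      filter_upwards [self_mem_nhdsWithin] with z hz
      simp [invFun_coe hz]
    · have h : ContinuousAt (fun z : ℂ => ((z⁻¹ : ℂ) : P1)) z :=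
        OnePoint.continuous_coe.continuousAt.comp (continuousAt_inv₀ hz)
      refine h.congr ?_
      filter_upwards [isOpen_ne.mem_nhds hz] with y hy
      simp [invFun_coe hy]

/-- The inversion as a homeomorphism. -/
noncomputable def invHomeo : P1 ≃ₜ P1 where
  toFun := invFun
  invFun := invFun
  left_inv := invFun_invFun
  right_inv := invFun_invFun
  continuous_toFun := continuous_invFun
  continuous_invFun := continuous_invFun

/-- The chart `z` on `P1 \ {∞}`. -/
noncomputable def chartZero : OpenPartialHomeomorph P1 ℂ :=
  (OnePoint.isOpenEmbedding_coe.toOpenPartialHomeomorph ((↑) : ℂ → P1)).symm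

/-- The chart `1/z` on `P1 \ {0}`. -/
noncomputable def chartInfty : OpenPartialHomeomorph P1 ℂ :=
  invHomeo.toOpenPartialHomeomorph.trans chartZero

theorem chartZero_source : chartZero.source = range ((↑) : ℂ → P1) := by
  simp [chartZero]

theorem chartZero_target : chartZero.target = univ := by
  simp [chartZero]

theorem chartZero_symm_apply (z : ℂ) : chartZero.symm z = (z : P1) := by
  simp [chartZero]

theorem chartZero_coe (z : ℂ) : chartZero (z : P1) = z := by
  have h := chartZero.right_inv (x := z) (by simp [chartZero_target])
  rwa [chartZero_symm_apply] at h

theorem infty_mem_chartInfty_source : (OnePoint.infty : P1) ∈ chartInfty.source := by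
  simp [chartInfty, chartZero_source, invHomeo, invFun_infty]

open scoped Classical in
/-- The two standard charts `z` and `1/z`; at every finite point the preferred chart is `z`. -/
noncomputable instance : ChartedSpace ℂ P1 where
  atlas := {chartZero, chartInfty}
  chartAt p := if p = OnePoint.infty then chartInfty else chartZero
  mem_chart_source p := by
    by_cases hp : p = OnePoint.infty
    · subst hp; simpa using infty_mem_chartInfty_source
    · rw [if_neg hp, chartZero_source]
      exact OnePoint.ne_infty_iff_exists.1 hp
  chart_mem_atlas p := by
    by_cases hp : p = OnePoint.infty <;> simp [hp]

theorem chartAt_coe (z : ℂ) : chartAt ℂ (z : P1) = chartZero :=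
  if_neg (OnePoint.coe_ne_infty z)

theorem chartAt_infty : chartAt ℂ (OnePoint.infty : P1) = chartInfty :=
  if_pos rfl

instance : IsManifold 𝓘(ℂ, ℂ) ω P1 := by
  have key : ∀ z : ℂ, z ≠ 0 → chartZero (invFun (z : P1)) = z⁻¹ := by
    intro z hz
    rw [invFun_coe hz, chartZero_coe]
  apply isManifold_of_contDiffOn
  rintro e e' (rfl | rfl) (rfl | rfl)
  · refine contDiffOn_id.congr ?_
    intro z _
    simp [chartZero_symm_apply, chartZero_coe]
  · have hsub : ∀ z : ℂ, z ∈ (𝓘(ℂ, ℂ).symm ⁻¹' (chartZero.symm.trans chartInfty).source ∩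
        range 𝓘(ℂ, ℂ)) → z ≠ 0 := by
      rintro z ⟨hz, -⟩ rfl
      simp [chartInfty, chartZero_symm_apply, invHomeo, invFun_zero, chartZero_source] at hz
    refine ContDiffOn.congr (f := fun z : ℂ => z⁻¹) ?_ ?_
    · intro z hz
      exact (contDiffAt_inv ℂ (hsub z hz)).contDiffWithinAt
    · intro z hz
      simpa [chartInfty, chartZero_symm_apply, invHomeo] using key z (hsub z hz)
  · have hsub : ∀ z : ℂ, z ∈ (𝓘(ℂ, ℂ).symm ⁻¹' (chartInfty.symm.trans chartZero).source ∩
        range 𝓘(ℂ, ℂ)) → z ≠ 0 := by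
      rintro z ⟨hz, -⟩ rfl
      simp [chartInfty, chartZero_symm_apply, invHomeo, invFun_zero, chartZero_source] at hz
    refine ContDiffOn.congr (f := fun z : ℂ => z⁻¹) ?_ ?_
    · intro z hz
      exact (contDiffAt_inv ℂ (hsub z hz)).contDiffWithinAt
    · intro z hz
      simpa [chartInfty, chartZero_symm_apply, invHomeo] using key z (hsub z hz)
  · refine contDiffOn_id.congr ?_
    intro z hz
    have hz' : z ∈ chartInfty.target := by
      simp [chartInfty, chartZero_target]
    simpa using chartInfty.right_inv hz'

/-- The coordinate function `z` (with the irrelevant value `0` at `∞`). -/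
noncomputable def zCoord (p : P1) : ℂ := OnePoint.elim p 0 id

/-- The involution `z ↦ -z`, with `∞ ↦ ∞`. -/
noncomputable def neg (p : P1) : P1 := OnePoint.map (fun z => -z) p

/-- The complement of `{0, ∞}`. -/
def Cstar : Set P1 := {p | p ≠ ((0 : ℂ) : P1) ∧ p ≠ OnePoint.infty}

end RiemannSphere

/-! ## Pullback bundles: instances on the fibres -/

namespace Bundle.Pullback

variable {B B' : Type*} {E : B → Type*} (f : B' → B)

instance instAddCommGroupFiber [i : ∀ x, AddCommGroup (E x)] (x : B') :
    AddCommGroup ((f *ᵖ E) x) :=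
  { (inferInstance : AddCommMonoid ((f *ᵖ E) x)) with
    neg := (i (f x)).neg
    sub := (i (f x)).sub
    sub_eq_add_neg := (i (f x)).sub_eq_add_neg
    zsmul := (i (f x)).zsmul
    zsmul_zero' := (i (f x)).zsmul_zero'
    zsmul_succ' := (i (f x)).zsmul_succ'
    zsmul_neg' := (i (f x)).zsmul_neg'
    neg_add_cancel := (i (f x)).neg_add_cancel }

instance instIsTopologicalAddGroupFiber [∀ x, AddCommGroup (E x)] [∀ x, TopologicalSpace (E x)]
    [i : ∀ x, IsTopologicalAddGroup (E x)] (x : B') : IsTopologicalAddGroup ((f *ᵖ E) x) :=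
  i (f x)

instance instContinuousSMulFiber [∀ x, AddCommGroup (E x)] [∀ x, Module ℂ (E x)]
    [∀ x, TopologicalSpace (E x)] [i : ∀ x, ContinuousSMul ℂ (E x)] (x : B') :
    ContinuousSMul ℂ ((f *ᵖ E) x) :=
  i (f x)

end Bundle.Pullback

/-! ## Holomorphic sections and connections

Over `ℂ` the smoothness class `ω` is holomorphy. A local holomorphic section is represented by a
section defined everywhere, only the germ of which at the points in question matters. -/

namespace HolBundle

section General

variable {EB : Type*} [NormedAddCommGroup EB] [NormedSpace ℂ EB]
  {HB : Type*} [TopologicalSpace HB] (I : ModelWithCorners ℂ EB HB)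
  {B : Type*} [TopologicalSpace B] [ChartedSpace HB B]
  (F : Type*) [NormedAddCommGroup F] [NormedSpace ℂ F]

/-- The function `h` is holomorphic near `x`. -/
def HolFunAt (h : B → ℂ) (x : B) : Prop := ContMDiffAt I 𝓘(ℂ, ℂ) ω h x

/-- The section `σ` of the bundle `V` (with model fibre `F`) is holomorphic near `x`. -/
def HolSecAt {V : B → Type*} [TopologicalSpace (TotalSpace F V)] [∀ x, TopologicalSpace (V x)]
    [FiberBundle F V] (σ : Π x, V x) (x : B) : Prop :=
  ContMDiffAt I (I.prod 𝓘(ℂ, F)) ω (fun y => TotalSpace.mk' F y (σ y)) x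

/-- The vector field `X` is holomorphic near `x`. -/
def HolVFAt [IsManifold I 1 B] (X : Π x : B, TangentSpace I x) (x : B) : Prop :=
  HolSecAt I EB X x

/-- An isomorphism of holomorphic vector bundles over `B`: linear isomorphisms of the fibres
which identify the sheaves of holomorphic sections. -/
structure HolIso (V V' : B → Type*)
    [TopologicalSpace (TotalSpace F V)] [∀ x, AddCommGroup (V x)] [∀ x, Module ℂ (V x)]
    [∀ x, TopologicalSpace (V x)] [FiberBundle F V]
    [TopologicalSpace (TotalSpace F V')] [∀ x, AddCommGroup (V' x)] [∀ x, Module ℂ (V' x)]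
    [∀ x, TopologicalSpace (V' x)] [FiberBundle F V'] where
  toEquiv : Π x, V x ≃ₗ[ℂ] V' x
  holSec_iff : ∀ (σ : Π x, V x) (x : B),
    HolSecAt I F σ x ↔ HolSecAt I F (fun y => toEquiv y (σ y)) x

/-- A holomorphic connection on the restriction of the holomorphic vector bundle `V` to the open
set `S`. The value `toFun σ x (X x)` is `(∇_X σ)(x)`. The last field only fixes the irrelevant
values, so that two connections are equal if and only if they agree on local sections over `S`. -/
structure HolConnection [IsManifold I 1 B] (V : B → Type*)
    [TopologicalSpace (TotalSpace F V)] [∀ x, AddCommGroup (V x)] [∀ x, Module ℂ (V x)]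
    [∀ x, TopologicalSpace (V x)] [∀ x, IsTopologicalAddGroup (V x)]
    [∀ x, ContinuousSMul ℂ (V x)] [FiberBundle F V] (S : Set B) where
  toFun : (Π x, V x) → Π x, TangentSpace I x →L[ℂ] V x
  isCov : IsCovariantDerivativeOn F toFun S
  hol : ∀ x ∈ S, ∀ (σ : Π x, V x) (X : Π x : B, TangentSpace I x),
    HolSecAt I F σ x → HolVFAt I X x → HolSecAt I F (fun y => toFun σ y (X y)) x
  eq_zero : ∀ (σ : Π x, V x) (x : B),
    ¬ (x ∈ S ∧ MDifferentiableAt I (I.prod 𝓘(ℂ, F)) (fun y => TotalSpace.mk' F y (σ y)) x) →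
      toFun σ x = 0

variable {I F}

/-- The curvature `[∇_X, ∇_Y] - ∇_{[X,Y]}` vanishes over `S`. -/
def HolConnection.IsFlat [IsManifold I 1 B] {V : B → Type*}
    [TopologicalSpace (TotalSpace F V)] [∀ x, AddCommGroup (V x)] [∀ x, Module ℂ (V x)]
    [∀ x, TopologicalSpace (V x)] [∀ x, IsTopologicalAddGroup (V x)]
    [∀ x, ContinuousSMul ℂ (V x)] [FiberBundle F V] {S : Set B}
    (D : HolConnection I F V S) : Prop :=
  ∀ x ∈ S, ∀ (σ : Π x, V x) (X Y : Π x : B, TangentSpace I x),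
    HolSecAt I F σ x → HolVFAt I X x → HolVFAt I Y x →
      D.toFun (fun y => D.toFun σ y (Y y)) x (X x) - D.toFun (fun y => D.toFun σ y (X y)) x (Y x)
        - D.toFun σ x (VectorField.mlieBracket I X Y x) = 0

/-! ## Frobenius type structures -/

variable (I F)

/-- A Frobenius type structure `(∇^r, C, U, V, g)` on the holomorphic vector bundle `K → B`. -/
structure FrobeniusTypeStructure [IsManifold I 1 B] (K : B → Type*)
    [TopologicalSpace (TotalSpace F K)] [∀ x, AddCommGroup (K x)] [∀ x, Module ℂ (K x)]
    [∀ x, TopologicalSpace (K x)] [∀ x, IsTopologicalAddGroup (K x)]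
    [∀ x, ContinuousSMul ℂ (K x)] [FiberBundle F K] where
  /-- the flat holomorphic connection `∇^r` -/
  conn : HolConnection I F K univ
  conn_flat : conn.IsFlat
  /-- the Higgs field; `C t X` is the endomorphism `C_X` of the fibre at `t` -/
  C : Π t : B, TangentSpace I t →ₗ[ℂ] K t →ₗ[ℂ] K t
  C_hol : ∀ (t : B) (s : Π t, K t) (X : Π t : B, TangentSpace I t),
    HolSecAt I F s t → HolVFAt I X t → HolSecAt I F (fun y => C y (X y) (s y)) t
  C_comm : ∀ (t : B) (X Y : TangentSpace I t) (a : K t), C t X (C t Y a) = C t Y (C t X a)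
  /-- `∇^r(C) = 0`, that is, `∇^r_X(C_Y) - ∇^r_Y(C_X) - C_{[X,Y]} = 0` -/
  conn_C : ∀ (t : B) (s : Π t, K t) (X Y : Π t : B, TangentSpace I t),
    HolSecAt I F s t → HolVFAt I X t → HolVFAt I Y t →
      (conn.toFun (fun y => C y (Y y) (s y)) t (X t) - C t (Y t) (conn.toFun s t (X t)))
        - (conn.toFun (fun y => C y (X y) (s y)) t (Y t) - C t (X t) (conn.toFun s t (Y t)))
        - C t (VectorField.mlieBracket I X Y t) (s t) = 0
  U : Π t : B, K t →ₗ[ℂ] K t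
  U_hol : ∀ (t : B) (s : Π t, K t), HolSecAt I F s t → HolSecAt I F (fun y => U y (s y)) t
  C_U : ∀ (t : B) (X : TangentSpace I t) (a : K t), C t X (U t a) = U t (C t X a)
  V : Π t : B, K t →ₗ[ℂ] K t
  V_hol : ∀ (t : B) (s : Π t, K t), HolSecAt I F s t → HolSecAt I F (fun y => V y (s y)) t
  V_flat : ∀ (t : B) (s : Π t, K t) (X : TangentSpace I t), HolSecAt I F s t →
    conn.toFun (fun y => V y (s y)) t X = V t (conn.toFun s t X)
  /-- `∇^r(U) - [C, V] + C = 0` -/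
  conn_U : ∀ (t : B) (s : Π t, K t) (X : TangentSpace I t), HolSecAt I F s t →
    (conn.toFun (fun y => U y (s y)) t X - U t (conn.toFun s t X))
      - (C t X (V t (s t)) - V t (C t X (s t))) + C t X (s t) = 0
  g : Π t : B, K t →ₗ[ℂ] K t →ₗ[ℂ] ℂ
  g_hol : ∀ (t : B) (a b : Π t, K t), HolSecAt I F a t → HolSecAt I F b t →
    HolFunAt I (fun y => g y (a y) (b y)) t
  g_symm : ∀ (t : B) (a b : K t), g t a b = g t b a
  g_nondeg : ∀ t : B, (g t).Nondegenerate
  g_flat : ∀ (t : B) (a b : Π t, K t) (X : TangentSpace I t),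
    HolSecAt I F a t → HolSecAt I F b t →
      mvfderiv I (fun y => g y (a y) (b y)) t X
        = g t (conn.toFun a t X) (b t) + g t (a t) (conn.toFun b t X)
  g_C : ∀ (t : B) (X : TangentSpace I t) (a b : K t), g t (C t X a) b = g t a (C t X b)
  g_U : ∀ (t : B) (a b : K t), g t (U t a) b = g t a (U t b)
  g_V : ∀ (t : B) (a b : K t), g t (V t a) b = - g t a (V t b)

variable {I F}

/-- The bundle isomorphism `φ : K → K'` carries one Frobenius type structure to the other. -/
structure FrobeniusTypeStructure.IsIso [IsManifold I 1 B] {K K' : B → Type*}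
    [TopologicalSpace (TotalSpace F K)] [∀ x, AddCommGroup (K x)] [∀ x, Module ℂ (K x)]
    [∀ x, TopologicalSpace (K x)] [∀ x, IsTopologicalAddGroup (K x)]
    [∀ x, ContinuousSMul ℂ (K x)] [FiberBundle F K]
    [TopologicalSpace (TotalSpace F K')] [∀ x, AddCommGroup (K' x)] [∀ x, Module ℂ (K' x)]
    [∀ x, TopologicalSpace (K' x)] [∀ x, IsTopologicalAddGroup (K' x)]
    [∀ x, ContinuousSMul ℂ (K' x)] [FiberBundle F K']
    (Φ : FrobeniusTypeStructure I F K) (Φ' : FrobeniusTypeStructure I F K')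
    (φ : HolIso I F K K') : Prop where
  conn : ∀ (t : B) (s : Π t, K t) (X : TangentSpace I t), HolSecAt I F s t →
    φ.toEquiv t (Φ.conn.toFun s t X) = Φ'.conn.toFun (fun y => φ.toEquiv y (s y)) t X
  C : ∀ (t : B) (X : TangentSpace I t) (a : K t),
    φ.toEquiv t (Φ.C t X a) = Φ'.C t X (φ.toEquiv t a)
  U : ∀ (t : B) (a : K t), φ.toEquiv t (Φ.U t a) = Φ'.U t (φ.toEquiv t a)
  V : ∀ (t : B) (a : K t), φ.toEquiv t (Φ.V t a) = Φ'.V t (φ.toEquiv t a)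
  g : ∀ (t : B) (a b : K t), Φ.g t a b = Φ'.g t (φ.toEquiv t a) (φ.toEquiv t b)

end General

/-! ## `(trTLEP(w))`-structures -/

section Twistor

open RiemannSphere

variable (E : Type*) [NormedAddCommGroup E] [NormedSpace ℂ E]
  (M : Type*) [TopologicalSpace M] [ChartedSpace E M]

/-- The projection `P1 × M → M`. -/
noncomputable def projM : C^ω⟮𝓘(ℂ, ℂ).prod 𝓘(ℂ, E), P1 × M; 𝓘(ℂ, E), M⟯ :=
  ⟨fun x => x.2, contMDiff_snd⟩

/-- The inclusion `t ↦ (p, t)` of `{p} × M`. -/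
noncomputable def inclM (p : P1) : C^ω⟮𝓘(ℂ, E), M; 𝓘(ℂ, ℂ).prod 𝓘(ℂ, E), P1 × M⟯ :=
  ⟨fun t => (p, t), contMDiff_const.prodMk contMDiff_id⟩

variable {M}

/-- The inclusion `p ↦ (p, t)` of `P1 × {t}`. -/
noncomputable def inclP1 (t : M) : C^ω⟮𝓘(ℂ, ℂ), P1; 𝓘(ℂ, ℂ).prod 𝓘(ℂ, E), P1 × M⟯ :=
  ⟨fun p => (p, t), contMDiff_id.prodMk contMDiff_const⟩

variable {E}

/-- The tangent vector `ζ ∂_z + v` of `P1 × M` at a point with finite first coordinate. (Tangent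
vectors are expressed in the preferred chart, which is `z` at the finite points of `P1`.) -/
def tvec (x : P1 × M) (ζ : ℂ) (v : TangentSpace 𝓘(ℂ, E) x.2) :
    TangentSpace (𝓘(ℂ, ℂ).prod 𝓘(ℂ, E)) x :=
  ((ζ, v) : ℂ × E)

variable (E) (F : Type*) [NormedAddCommGroup F] [NormedSpace ℂ F]

/-- The section `σ`, given on `ℂ^* × M`, extends near `x` to a holomorphic section whose value at
`x` is `a`. -/
def ExtendsTo {H : P1 × M → Type*} [TopologicalSpace (TotalSpace F H)]
    [∀ x, TopologicalSpace (H x)] [FiberBundle F H] (σ : Π x, H x) (x : P1 × M) (a : H x) : Prop :=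
  ∃ τ : Π x, H x, HolSecAt (𝓘(ℂ, ℂ).prod 𝓘(ℂ, E)) F τ x ∧
    (∀ᶠ y in 𝓝 x, y.1 ∈ Cstar → τ y = σ y) ∧ τ x = a

section Pairing

variable {H : P1 × M → Type*} [∀ x, AddCommGroup (H x)] [∀ x, Module ℂ (H x)]

/-- For pairings `P : H_(z,t) × H_(-z,t) → ℂ`, the function `(z,t) ↦ P(a(z,t), b(-z,t))`. -/
noncomputable def pairFun (P : Π (p : P1) (t : M), H (p, t) →ₗ[ℂ] H (neg p, t) →ₗ[ℂ] ℂ) (a b : Π x, H x) :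
    P1 × M → ℂ :=
  fun y => P y.1 y.2 (a (y.1, y.2)) (b (neg y.1, y.2))

/-- Over `D × M`, where `f` is a coordinate on `D`, the pairing takes values in `f^k · 𝒪` and
`f^(-k) · P` extends to a nondegenerate holomorphic pairing. -/
def PairingExtends [TopologicalSpace (TotalSpace F H)] [∀ x, TopologicalSpace (H x)]
    [FiberBundle F H] (P : Π (p : P1) (t : M), H (p, t) →ₗ[ℂ] H (neg p, t) →ₗ[ℂ] ℂ)
    (D : Set P1) (f : P1 → ℂ) (k : ℤ) : Prop :=
  ∃ Q : Π (p : P1) (t : M), H (p, t) →ₗ[ℂ] H (neg p, t) →ₗ[ℂ] ℂ,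
    (∀ p ∈ D, p ∈ Cstar → ∀ t, P p t = f p ^ k • Q p t) ∧
    (∀ p ∈ D, ∀ t, (Q p t).Nondegenerate) ∧
    ∀ p ∈ D, ∀ (t : M) (a b : Π x, H x),
      HolSecAt (𝓘(ℂ, ℂ).prod 𝓘(ℂ, E)) F a (p, t) →
      HolSecAt (𝓘(ℂ, ℂ).prod 𝓘(ℂ, E)) F b (neg p, t) →
      HolFunAt (𝓘(ℂ, ℂ).prod 𝓘(ℂ, E)) (pairFun Q a b) (p, t)

end Pairing

variable [IsManifold 𝓘(ℂ, E) ω M]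

/-- A `(trTLEP(w))`-structure `(∇, P)` on the holomorphic vector bundle `H → P1 × M`. Here `∇` and
`P` live over `ℂ^* × M`. -/
structure TrTLEPStructure (w : ℤ) (H : P1 × M → Type*)
    [TopologicalSpace (TotalSpace F H)] [∀ x, AddCommGroup (H x)] [∀ x, Module ℂ (H x)]
    [∀ x, TopologicalSpace (H x)] [∀ x, IsTopologicalAddGroup (H x)]
    [∀ x, ContinuousSMul ℂ (H x)] [FiberBundle F H] where
  /-- the restriction of `H` to each `P1 × {t}` is a trivial holomorphic bundle -/
  trivial_fibers : ∀ t : M,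
    Nonempty (HolIso 𝓘(ℂ, ℂ) F (inclP1 E t *ᵖ H) (Bundle.Trivial P1 F))
  conn : HolConnection (𝓘(ℂ, ℂ).prod 𝓘(ℂ, E)) F H {x | x.1 ∈ Cstar}
  conn_flat : conn.IsFlat
  /-- Pole of Poincaré rank 1 along `{0} × M`: `∇` maps `𝒪(H)` to
  `(z⁻¹ 𝒪 · Ω_M + z⁻¹ 𝒪 · dz/z) ⊗ 𝒪(H)`; this is the `Ω_M`-part, contracted with `X`. -/
  pole_zero_M : ∀ (t : M) (σ : Π x, H x) (X : Π t : M, TangentSpace 𝓘(ℂ, E) t),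
    HolSecAt (𝓘(ℂ, ℂ).prod 𝓘(ℂ, E)) F σ (((0 : ℂ) : P1), t) → HolVFAt 𝓘(ℂ, E) X t →
      ∃ a, ExtendsTo E F (fun y => zCoord y.1 • conn.toFun σ y (tvec y 0 (X y.2)))
        (((0 : ℂ) : P1), t) a
  /-- the `dz/z`-part: contraction with `z ∂_z` -/
  pole_zero_z : ∀ (t : M) (σ : Π x, H x),
    HolSecAt (𝓘(ℂ, ℂ).prod 𝓘(ℂ, E)) F σ (((0 : ℂ) : P1), t) →
      ∃ a, ExtendsTo E F (fun y => zCoord y.1 • conn.toFun σ y (tvec y (zCoord y.1) 0))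
        (((0 : ℂ) : P1), t) a
  /-- Logarithmic pole along `{∞} × M`: `∇` maps `𝒪(H)` to `(𝒪 · Ω_M + 𝒪 · dz/z) ⊗ 𝒪(H)`. -/
  pole_infty_M : ∀ (t : M) (σ : Π x, H x) (X : Π t : M, TangentSpace 𝓘(ℂ, E) t),
    HolSecAt (𝓘(ℂ, ℂ).prod 𝓘(ℂ, E)) F σ ((OnePoint.infty : P1), t) → HolVFAt 𝓘(ℂ, E) X t →
      ∃ a, ExtendsTo E F (fun y => conn.toFun σ y (tvec y 0 (X y.2)))
        ((OnePoint.infty : P1), t) a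
  pole_infty_z : ∀ (t : M) (σ : Π x, H x),
    HolSecAt (𝓘(ℂ, ℂ).prod 𝓘(ℂ, E)) F σ ((OnePoint.infty : P1), t) →
      ∃ a, ExtendsTo E F (fun y => conn.toFun σ y (tvec y (zCoord y.1) 0))
        ((OnePoint.infty : P1), t) a
  P : Π (p : P1) (t : M), H (p, t) →ₗ[ℂ] H (neg p, t) →ₗ[ℂ] ℂ
  /-- fixes the irrelevant values of `P` over `0` and `∞` -/
  P_eq_zero : ∀ p ∉ Cstar, ∀ t : M, P p t = 0
  /-- `P` is `(-1)^w`-symmetric; the vectors are written as values of arbitrary sections because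
  `-(-p) = p` is not a definitional equality. -/
  P_symm : ∀ p ∈ Cstar, ∀ (t : M) (a b : Π x, H x),
    pairFun P a b (p, t) = (-1 : ℂ) ^ w * pairFun P b a (neg p, t)
  /-- `X P(a,b) = P(∇_X a, b) + P(a, ∇_X b)` -/
  P_flat_M : ∀ p ∈ Cstar, ∀ (t : M) (a b : Π x, H x) (v : TangentSpace 𝓘(ℂ, E) t),
    HolSecAt (𝓘(ℂ, ℂ).prod 𝓘(ℂ, E)) F a (p, t) →
    HolSecAt (𝓘(ℂ, ℂ).prod 𝓘(ℂ, E)) F b (neg p, t) →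
      mvfderiv (𝓘(ℂ, ℂ).prod 𝓘(ℂ, E)) (pairFun P a b) (p, t) (tvec (p, t) 0 v)
        = P p t (conn.toFun a (p, t) (tvec (p, t) 0 v)) (b (neg p, t))
          + P p t (a (p, t)) (conn.toFun b (neg p, t) (tvec (neg p, t) 0 v))
  /-- `z ∂_z P(a,b) = P(∇_{z∂_z} a, b) + P(a, ∇_{z∂_z} b)` -/
  P_flat_z : ∀ p ∈ Cstar, ∀ (t : M) (a b : Π x, H x),
    HolSecAt (𝓘(ℂ, ℂ).prod 𝓘(ℂ, E)) F a (p, t) →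
    HolSecAt (𝓘(ℂ, ℂ).prod 𝓘(ℂ, E)) F b (neg p, t) →
      mvfderiv (𝓘(ℂ, ℂ).prod 𝓘(ℂ, E)) (pairFun P a b) (p, t) (tvec (p, t) (zCoord p) 0)
        = P p t (conn.toFun a (p, t) (tvec (p, t) (zCoord p) 0)) (b (neg p, t))
          + P p t (a (p, t)) (conn.toFun b (neg p, t) (tvec (neg p, t) (zCoord (neg p)) 0))
  /-- nondegenerate with values in `z^w 𝒪` over `ℂ × M` -/
  P_zero : PairingExtends E F P {p | p ≠ OnePoint.infty} zCoord w
  /-- nondegenerate with values in `(1/z)^(-w) 𝒪` over `(P1 \ {0}) × M` -/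
  P_infty : PairingExtends E F P {p | p ≠ ((0 : ℂ) : P1)} (fun p => (zCoord p)⁻¹) (-w)

variable {E F}

section Structures

variable {w : ℤ} {H : P1 × M → Type*}
  [TopologicalSpace (TotalSpace F H)] [∀ x, AddCommGroup (H x)] [∀ x, Module ℂ (H x)]
  [∀ x, TopologicalSpace (H x)] [∀ x, IsTopologicalAddGroup (H x)]
  [∀ x, ContinuousSMul ℂ (H x)] [FiberBundle F H]

/-- The canonical projection `ψ : H_(p,t) → H_(0,t)`, by means of a trivialization of `H` on
`P1 × {t}`. It does not depend on the trivialization, because holomorphic functions on `P1` are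
constant. -/
noncomputable def TrTLEPStructure.psi (T : TrTLEPStructure E F w H) (x : P1 × M) :
    H x ≃ₗ[ℂ] H (((0 : ℂ) : P1), x.2) :=
  ((T.trivial_fibers x.2).some.toEquiv x.1).trans
    ((T.trivial_fibers x.2).some.toEquiv ((0 : ℂ) : P1)).symm

/-- `Φ` is the structure `(∇^r, C, U, V, g)` on `K = H|_{{0} × M}` which is read off from the
`(trTLEP(w))`-structure `T = (∇, P)` on `H`. -/
structure TrTLEPStructure.Induces (T : TrTLEPStructure E F w H)
    (Φ : FrobeniusTypeStructure 𝓘(ℂ, E) F (inclM E M ((0 : ℂ) : P1) *ᵖ H)) : Prop where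
  /-- `C_X [σ] = (z ∇_X σ) mod z` -/
  C : ∀ (t : M) (σ : Π x, H x) (X : Π t : M, TangentSpace 𝓘(ℂ, E) t),
    HolSecAt (𝓘(ℂ, ℂ).prod 𝓘(ℂ, E)) F σ (((0 : ℂ) : P1), t) → HolVFAt 𝓘(ℂ, E) X t →
      ExtendsTo E F (fun y => zCoord y.1 • T.conn.toFun σ y (tvec y 0 (X y.2)))
        (((0 : ℂ) : P1), t) (Φ.C t (X t) (σ (((0 : ℂ) : P1), t)))
  /-- `U [σ] = (z² ∇_{∂_z} σ) mod z` -/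
  U : ∀ (t : M) (σ : Π x, H x),
    HolSecAt (𝓘(ℂ, ℂ).prod 𝓘(ℂ, E)) F σ (((0 : ℂ) : P1), t) →
      ExtendsTo E F (fun y => zCoord y.1 ^ 2 • T.conn.toFun σ y (tvec y 1 0))
        (((0 : ℂ) : P1), t) (Φ.U t (σ (((0 : ℂ) : P1), t)))
  /-- `g([a],[b]) = (z^(-w) P(a,b)) mod z` -/
  g : ∀ (t : M) (a b : Π x, H x),
    HolSecAt (𝓘(ℂ, ℂ).prod 𝓘(ℂ, E)) F a (((0 : ℂ) : P1), t) →
    HolSecAt (𝓘(ℂ, ℂ).prod 𝓘(ℂ, E)) F b (((0 : ℂ) : P1), t) →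
      ∃ h : P1 × M → ℂ, HolFunAt (𝓘(ℂ, ℂ).prod 𝓘(ℂ, E)) h (((0 : ℂ) : P1), t) ∧
        (∀ᶠ y in 𝓝 (((0 : ℂ) : P1), t), y.1 ∈ Cstar →
          h y = zCoord y.1 ^ (-w) * pairFun T.P a b y) ∧
        h (((0 : ℂ) : P1), t) = Φ.g t (a (((0 : ℂ) : P1), t)) (b (((0 : ℂ) : P1), t))
  /-- `∇^r` is the shift with `ψ` of the residual connection `∇^res_X [σ] = (∇_X σ) mod 1/z` on
  `H|_{{∞} × M}` -/
  conn : ∀ (t : M) (σ : Π x, H x) (X : Π t : M, TangentSpace 𝓘(ℂ, E) t),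
    HolSecAt (𝓘(ℂ, ℂ).prod 𝓘(ℂ, E)) F σ ((OnePoint.infty : P1), t) → HolVFAt 𝓘(ℂ, E) X t →
      ExtendsTo E F (fun y => T.conn.toFun σ y (tvec y 0 (X y.2))) ((OnePoint.infty : P1), t)
        ((T.psi ((OnePoint.infty : P1), t)).symm
          (Φ.conn.toFun (fun t' : M => T.psi ((OnePoint.infty : P1), t')
            (σ ((OnePoint.infty : P1), t'))) t (X t)))
  /-- `V` is the shift with `ψ` of `V^res + w/2`, where `V^res [σ] = (-∇_{z∂_z} σ) mod 1/z` is the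
  residue endomorphism on `H|_{{∞} × M}`; note that `-z ∂_z = f ∂_f` for `f = 1/z`. -/
  V : ∀ (t : M) (σ : Π x, H x),
    HolSecAt (𝓘(ℂ, ℂ).prod 𝓘(ℂ, E)) F σ ((OnePoint.infty : P1), t) →
      ExtendsTo E F (fun y => - T.conn.toFun σ y (tvec y (zCoord y.1) 0))
        ((OnePoint.infty : P1), t)
        ((T.psi ((OnePoint.infty : P1), t)).symm
            (Φ.V t (T.psi ((OnePoint.infty : P1), t) (σ ((OnePoint.infty : P1), t))))
          - ((w : ℂ) / 2) • σ ((OnePoint.infty : P1), t))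

/-- The bundle isomorphism `ψ : H → H'` carries one `(trTLEP(w))`-structure to the other. -/
structure TrTLEPStructure.IsIso {H' : P1 × M → Type*}
    [TopologicalSpace (TotalSpace F H')] [∀ x, AddCommGroup (H' x)] [∀ x, Module ℂ (H' x)]
    [∀ x, TopologicalSpace (H' x)] [∀ x, IsTopologicalAddGroup (H' x)]
    [∀ x, ContinuousSMul ℂ (H' x)] [FiberBundle F H']
    (T : TrTLEPStructure E F w H) (T' : TrTLEPStructure E F w H')
    (ψ : HolIso (𝓘(ℂ, ℂ).prod 𝓘(ℂ, E)) F H H') : Prop where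
  conn : ∀ (x : P1 × M) (σ : Π x, H x) (v : TangentSpace (𝓘(ℂ, ℂ).prod 𝓘(ℂ, E)) x),
    x.1 ∈ Cstar → HolSecAt (𝓘(ℂ, ℂ).prod 𝓘(ℂ, E)) F σ x →
      ψ.toEquiv x (T.conn.toFun σ x v) = T'.conn.toFun (fun y => ψ.toEquiv y (σ y)) x v
  P : ∀ p ∈ Cstar, ∀ (t : M) (a : H (p, t)) (b : H (neg p, t)),
    T.P p t a b = T'.P p t (ψ.toEquiv (p, t) a) (ψ.toEquiv (neg p, t) b)

end Structures

/-- The structure `T = (∇, P)` on `π^*K` is given by the Frobenius type structure `Φ` on `K` by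
`∇ = ∇^r + C/z + (U/z - V + w/2) dz/z` and `P = z^w g`. The first formula is stated on the
sections `π^*s`; there the canonical extension of `∇^r` to `π^*K` takes the value `π^*(∇^r s)`,
and the Leibniz rule determines `∇` on all other sections. -/
structure IsTwistedPullback {w : ℤ} {K : M → Type*}
    [TopologicalSpace (TotalSpace F K)] [∀ x, AddCommGroup (K x)] [∀ x, Module ℂ (K x)]
    [∀ x, TopologicalSpace (K x)] [∀ x, IsTopologicalAddGroup (K x)]
    [∀ x, ContinuousSMul ℂ (K x)] [FiberBundle F K]
    (Φ : FrobeniusTypeStructure 𝓘(ℂ, E) F K)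
    (T : TrTLEPStructure E F w (projM E M *ᵖ K)) : Prop where
  conn : ∀ (z : ℂ) (t : M) (s : Π t, K t) (ζ : ℂ) (v : TangentSpace 𝓘(ℂ, E) t),
    z ≠ 0 → HolSecAt 𝓘(ℂ, E) F s t →
      T.conn.toFun (fun y => s y.2) ((z : P1), t) (tvec ((z : P1), t) ζ v)
        = (Φ.conn.toFun s t v + z⁻¹ • Φ.C t v (s t)
            + (ζ / z) • (z⁻¹ • Φ.U t (s t) - Φ.V t (s t) + ((w : ℂ) / 2) • s t) : K t)
  P : ∀ (z : ℂ) (t : M) (a b : K t), z ≠ 0 → T.P (z : P1) t a b = z ^ w * Φ.g t a b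

end Twistor

end HolBundle

/-! Suppose first that `H` is `π^*K`. For fixed `t`, the derivative of a pulled back section along
the lift of a vector field of `M`, or along `z ∂_z`, is a function on `ℂ^*` with values in the fixed
space `K t`. It has at most a simple pole at `0` and a limit at `∞`, so by Liouville's theorem it is
`a + z⁻¹ b` (`eq_add_inv_smul_of_extendsTo`). Hence `∇ = ∇^r + C/z + (U/z + R) dz/z`
(`exists_isTwist_of_poles`). Likewise `z^(-w) P` extends to all of `P1 × {t}` and is constant there,
so `P = z^w g` (`pairing_eq_zpow_mul`).

Put `R = w/2 - V`. The curvature of such a connection on pulled back sections is a polynomial of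
degree 2 in `z⁻¹` (`IsTwist.curv_lift_lift`, `IsTwist.curv_euler_lift`). Its coefficients are the
defects of the axioms on `∇^r`, `C`, `U`, `V`. The defect of flatness of `P` expands in the same way
into the axioms on `g`, where the shift by `w/2` absorbs the derivative of `z^w`
(`IsTwist.flatDefect_pullSec`). Read from right to left these expansions prove (a), and read from
left to right, coefficient by coefficient, they prove (b). Curvature and flatness defect are linear
over functions, so pulled back frames suffice for (a).

A general `H` is reduced to this case by transport along `ψ : H → π^*K`. The difficulty is that `ψ`
comes from trivializations over each `P1 × {t}` separately, with no regularity in `t`. That it is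
nevertheless holomorphic is `holSecAt_fiberIso_symm`. Near `t₀` the line is covered by finitely many
discs over which `H` is trivial, and a section constant under `ψ` becomes a family of cocycles for
the transition functions. At `t₀` a global section vanishing at `0` is zero. By Montel's theorem it
follows that, for `t` near `t₀`, a cochain is bounded by its coboundary and its value at `0`, with a
constant independent of `t` (`DiscCocycle.exists_bound`). Applied to differences this gives
continuity in `t`. Applied to differences of difference quotients it gives complex derivatives along
lines in `t`. Osgood's lemma then gives joint analyticity.

The two constructions are inverse to one another by uniqueness. The formulas of (a) determine a
connection because pulled back sections contain frames, and the residual data of (b) are values of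
holomorphic extensions from the dense set `ℂ^* × M`. Finally, an isomorphism of pulled back bundles
is constant along `P1`, so isomorphisms on the two sides correspond. -/

set_option linter.unusedSectionVars false

/-! ## Osgood's lemma -/

namespace Osgood

open Metric Complex

/-- A continuous curve in a space of continuous functions is holomorphic if it is pointwise
holomorphic. -/
theorem analyticOnNhd_of_eval {S : Type*} [TopologicalSpace S] [CompactSpace S]
    {F : Type*} [NormedAddCommGroup F] [NormedSpace ℂ F] [CompleteSpace F]
    {g : ℂ → C(S, F)} {U : Set ℂ} (hU : IsOpen U) (hg : ContinuousOn g U)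
    (hd : ∀ s : S, DifferentiableOn ℂ (fun z => g z s) U) : AnalyticOnNhd ℂ g U := by
  intro z₀ hz₀
  obtain ⟨r, hr, hrU⟩ := Metric.nhds_basis_closedBall.mem_iff.1 (hU.mem_nhds hz₀)
  lift r to NNReal using hr.le
  have hr' : 0 < r := by exact_mod_cast hr
  have hci : CircleIntegrable g z₀ r :=
    (hg.mono (sphere_subset_closedBall.trans hrU)).circleIntegrable hr.le
  have hps := (hasFPowerSeriesOn_cauchy_integral hci hr').analyticAt
  -- The Cauchy integral is analytic for any continuous `g`. It equals `g` because evaluation at `s`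
  -- commutes with the integral and Cauchy's formula holds for each scalar parameter `s`.
  refine hps.congr ?_
  filter_upwards [ball_mem_nhds z₀ hr] with w hw
  ext s
  have hev : ∀ φ : C(S, F), φ s = ContinuousMap.evalCLM ℂ s φ := fun φ => rfl
  have hcont : ContinuousOn (fun z : ℂ => (z - w)⁻¹ • g z) (sphere z₀ r) := by
    refine ContinuousOn.smul (f := fun z : ℂ => (z - w)⁻¹) ?_
        (hg.mono (sphere_subset_closedBall.trans hrU))
    refine ContinuousOn.inv₀ (by fun_prop) ?_
    intro z hz h
    rw [sub_eq_zero.1 h] at hz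
    exact (mem_ball.1 hw).ne (mem_sphere.1 hz)
  have hI : CircleIntegrable (fun z => (z - w)⁻¹ • g z) z₀ r := hcont.circleIntegrable hr.le
  have h1 : ContinuousMap.evalCLM ℂ s (∮ z in C(z₀, r), (z - w)⁻¹ • g z)
      = ∮ z in C(z₀, r), (z - w)⁻¹ • g z s := by
    simp only [circleIntegral]
    rw [← ContinuousLinearMap.intervalIntegral_comp_comm]
    · rfl
    · exact hI.out
  rw [hev, map_smul, h1]
  have hd' : DiffContOnCl ℂ (fun z => g z s) (ball z₀ r) := by
    refine DifferentiableOn.diffContOnCl ?_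
    rw [closure_ball _ hr.ne']
    exact (hd s).mono hrU
  exact hd'.two_pi_i_inv_smul_circleIntegral_sub_inv_smul hw

/-- The conclusion of Osgood's lemma for the space `E`. -/
def Holds (E : Type*) [NormedAddCommGroup E] [NormedSpace ℂ E] : Prop :=
  ∀ (F : Type v) [NormedAddCommGroup F] [NormedSpace ℂ F] [CompleteSpace F] (f : E → F) (U : Set E),
    IsOpen U → ContinuousOn f U →
    (∀ x ∈ U, ∀ y : E, DifferentiableAt ℂ (fun s : ℂ => f (x + s • y)) 0) → AnalyticOnNhd ℂ f U

/-- The integral over a circle of a continuous function on the circle. -/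
theorem exists_circleIntegralCLM (F : Type*) [NormedAddCommGroup F] [NormedSpace ℂ F]
    [CompleteSpace F] (c : ℂ) {R : ℝ} (hR : 0 ≤ R) :
    ∃ L : C(sphere c R, F) →L[ℂ] F, ∀ (φ : C(sphere c R, F)) (f : ℂ → F),
      (∀ z : sphere c R, f z = φ z) → L φ = ∮ z in C(c, R), f z := by
  let m : ℝ → sphere c R := fun θ => ⟨circleMap c R θ, circleMap_mem_sphere c hR θ⟩
  have hm : Continuous m := by
    exact (continuous_circleMap c R).subtype_mk _
  have hcont : ∀ φ : C(sphere c R, F), Continuous fun θ : ℝ => deriv (circleMap c R) θ • φ (m θ) :=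
      by
    intro φ
    simp only [deriv_circleMap]
    have := continuous_circleMap 0 R
    fun_prop
  let L₀ : C(sphere c R, F) →ₗ[ℂ] F :=
    { toFun := fun φ => ∫ θ in (0 : ℝ)..2 * Real.pi, deriv (circleMap c R) θ • φ (m θ)
      map_add' := by
        intro φ ψ
        simp only [ContinuousMap.add_apply, smul_add]
        exact intervalIntegral.integral_add ((hcont φ).intervalIntegrable _ _)
          ((hcont ψ).intervalIntegrable _ _)
      map_smul' := by
        intro a φ
        simp only [ContinuousMap.smul_apply, RingHom.id_apply]
        rw [← intervalIntegral.integral_smul]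
        congr 1
        ext θ
        rw [smul_comm] }
  refine ⟨L₀.mkContinuous (R * (2 * Real.pi)) ?_, ?_⟩
  · intro φ
    have h := intervalIntegral.norm_integral_le_of_norm_le_const (a := 0) (b := 2 * Real.pi)
      (f := fun θ => deriv (circleMap c R) θ • φ (m θ)) (C := R * ‖φ‖) ?_
    · refine h.trans (le_of_eq ?_)
      rw [sub_zero, abs_of_pos Real.two_pi_pos]
      ring
    · intro θ _
      rw [norm_smul]
      refine mul_le_mul ?_ (φ.norm_coe_le_norm _) (norm_nonneg _) hR
      simp [deriv_circleMap, abs_of_nonneg hR]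
  · intro φ f hf
    simp only [LinearMap.mkContinuous_apply, circleIntegral]
    refine intervalIntegral.integral_congr ?_
    intro θ _
    have := hf (m θ)
    simp only [m] at this
    simp [m, this]

/-- A continuous function that is holomorphic in `z ∈ ℂ` and along lines in `E` is analytic. -/
theorem analyticOnNhd_prod {E : Type*} [NormedAddCommGroup E] [NormedSpace ℂ E]
    (hE : Holds.{v} E) {F : Type v} [NormedAddCommGroup F] [NormedSpace ℂ F] [CompleteSpace F]
    {f : ℂ × E → F} {U : Set (ℂ × E)} (hU : IsOpen U) (hf : ContinuousOn f U)
    (hz : ∀ x ∈ U, DifferentiableAt ℂ (fun z => f (z, x.2)) x.1)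
    (ht : ∀ x ∈ U, ∀ y : E, DifferentiableAt ℂ (fun s : ℂ => f (x.1, x.2 + s • y)) 0) :
    AnalyticOnNhd ℂ f U := by
  rintro ⟨z₀, t₀⟩ hx₀
  obtain ⟨ρ, hρ, hρU⟩ := Metric.isOpen_iff.1 hU _ hx₀
  obtain ⟨r, hr, hrρ⟩ := exists_between hρ
  have hsub : ∀ z ∈ closedBall z₀ r, ∀ t ∈ ball t₀ ρ, (z, t) ∈ U := by
    intro z hz t ht
    apply hρU
    rw [← ball_prod_same]
    exact ⟨closedBall_subset_ball hrρ hz, ht⟩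
  let S := sphere z₀ r
  have hS : ∀ z : S, (z : ℂ) ∈ closedBall z₀ r := fun z => sphere_subset_closedBall z.2
  have hfS : Continuous fun x : ball t₀ ρ × S => f (x.2, x.1) := by
    rw [continuous_iff_continuousAt]
    intro x
    have h1 : ContinuousAt f ((x.2 : ℂ), (x.1 : E)) :=
      hf.continuousAt (hU.mem_nhds (hsub _ (hS _) _ x.1.2))
    exact ContinuousAt.comp (f := fun x : ball t₀ ρ × S => ((x.2 : ℂ), (x.1 : E))) h1
      (by fun_prop)
  let G₀ : C(ball t₀ ρ, C(S, F)) := ContinuousMap.curry ⟨_, hfS⟩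
  classical
  -- `G t` is the restriction of `f(·, t)` to the circle, a point of a Banach space. The value `0`
  -- outside the ball is never used.
  let G : E → C(S, F) := fun t => if h : t ∈ ball t₀ ρ then G₀ ⟨t, h⟩ else 0
  have hG : ∀ t ∈ ball t₀ ρ, ∀ z : S, G t z = f (z, t) := by
    intro t ht z
    simp only [G, dif_pos ht]
    rfl
  have hGc : ContinuousOn G (ball t₀ ρ) := by
    rw [continuousOn_iff_continuous_domRestrict]
    refine G₀.continuous.congr ?_
    rintro ⟨t, ht⟩
    simp [G, mem_ball.1 ht]
  have hGl : ∀ t ∈ ball t₀ ρ, ∀ y : E, DifferentiableAt ℂ (fun s : ℂ => G (t + s • y)) 0 := by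
    intro t ht' y
    have hc : Continuous fun s : ℂ => t + s • y := by fun_prop
    have ho : IsOpen ((fun s : ℂ => t + s • y) ⁻¹' ball t₀ ρ) := isOpen_ball.preimage hc
    refine (analyticOnNhd_of_eval ho (hGc.comp hc.continuousOn fun s hs => hs) ?_ 0
      (by simpa using ht')).differentiableAt
    intro z s hs
    refine DifferentiableAt.differentiableWithinAt ?_
    have h1 := ht (z, t + s • y) (hsub _ (hS z) _ hs) y
    have h2 : DifferentiableAt ℂ (fun s' : ℂ => f (z, t + s • y + (s' - s) • y)) s := by
      refine DifferentiableAt.comp (g := fun s' : ℂ => f (z, t + s • y + s' • y))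
        (f := fun s' : ℂ => s' - s) s ?_ (by fun_prop)
      simpa using h1
    refine h2.congr_of_eventuallyEq ?_
    filter_upwards [ho.mem_nhds hs] with s' hs'
    simp only [Function.comp, hG _ hs', sub_smul]
    congr 2
    abel
  have hGa : AnalyticOnNhd ℂ G (ball t₀ ρ) := hE _ G _ isOpen_ball hGc hGl
  have hne : ∀ z : ball z₀ r, ∀ ζ : S, (ζ : ℂ) - z ≠ 0 := by
    intro z ζ h
    have h1 := mem_sphere.1 ζ.2
    rw [sub_eq_zero.1 h] at h1
    exact (mem_ball.1 z.2).ne h1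
  have hkc : Continuous fun x : ball z₀ r × S => ((x.2 : ℂ) - x.1)⁻¹ :=
    Continuous.inv₀ (by fun_prop) fun x => hne x.1 x.2
  let k₀ : C(ball z₀ r, C(S, ℂ)) := ContinuousMap.curry ⟨_, hkc⟩
  let k : ℂ → C(S, ℂ) := fun z => if h : z ∈ ball z₀ r then k₀ ⟨z, h⟩ else 0
  have hk : ∀ z ∈ ball z₀ r, ∀ ζ : S, k z ζ = ((ζ : ℂ) - z)⁻¹ := by
    intro z hz ζ
    simp only [k, dif_pos hz]
    rfl
  have hka : AnalyticOnNhd ℂ k (ball z₀ r) := by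
    refine analyticOnNhd_of_eval isOpen_ball ?_ ?_
    · rw [continuousOn_iff_continuous_domRestrict]
      refine k₀.continuous.congr ?_
      rintro ⟨z, hz⟩
      simp [k, mem_ball.1 hz]
    · intro ζ
      refine DifferentiableOn.congr (f := fun z => ((ζ : ℂ) - z)⁻¹) ?_ fun z hz => hk z hz ζ
      intro z hz
      have := hne ⟨z, hz⟩ ζ
      exact (DifferentiableAt.inv (by fun_prop) this).differentiableWithinAt
  obtain ⟨L, hL⟩ := exists_circleIntegralCLM F z₀ hr.le
  -- In Cauchy's formula for `f(·, t)` the kernel depends analytically on `z` only and the boundary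
  -- values on `t` only. The integral is a continuous linear functional of their product, so the
  -- formula is jointly analytic.
  have hmain : AnalyticAt ℂ (fun x : ℂ × E => (2 * Real.pi * Complex.I : ℂ)⁻¹ • L (k x.1 • G x.2))
      (z₀, t₀) := by
    have h1 : AnalyticAt ℂ (fun x : ℂ × E => k x.1) (z₀, t₀) :=
      (hka z₀ (mem_ball_self hr)).comp_of_eq analyticAt_fst rfl
    have h2 : AnalyticAt ℂ (fun x : ℂ × E => G x.2) (z₀, t₀) :=
      (hGa t₀ (mem_ball_self hρ)).comp_of_eq analyticAt_snd rfl
    let B : C(S, ℂ) →L[ℂ] C(S, F) →L[ℂ] C(S, F) :=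
      LinearMap.mkContinuous₂
        { toFun := fun φ =>
            { toFun := fun ψ => φ • ψ
              map_add' := fun a b => by ext; simp
              map_smul' := fun c a => ContinuousMap.ext fun s => smul_comm (φ s) c (a s) }
          map_add' := fun a b => by ext; simp [add_smul]
          map_smul' := fun c a => by ext; simp [mul_smul] } 1 (by
        intro φ ψ
        rw [one_mul]
        refine (ContinuousMap.norm_le _ (by positivity)).2 fun s => ?_
        refine (norm_smul_le (φ s) (ψ s)).trans ?_
        gcongr
        · exact φ.norm_coe_le_norm s
        · exact ψ.norm_coe_le_norm s)
    have h3 : AnalyticAt ℂ (fun x : ℂ × E => B (k x.1) (G x.2)) (z₀, t₀) :=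
      (ContinuousLinearMap.analyticAt_bilinear B _).comp₂ h1 h2
    exact analyticAt_const.smul ((L.analyticAt _).comp h3)
  refine hmain.congr ?_
  filter_upwards [prod_mem_nhds (ball_mem_nhds z₀ hr) (ball_mem_nhds t₀ hρ)] with x hx
  obtain ⟨hx1, hx2⟩ := hx
  rw [hL (k x.1 • G x.2) (fun ζ => (ζ - x.1)⁻¹ • f (ζ, x.2))]
  · have hd : DiffContOnCl ℂ (fun ζ => f (ζ, x.2)) (ball z₀ r) := by
      refine DifferentiableOn.diffContOnCl ?_
      rw [closure_ball _ hr.ne']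
      intro ζ hζ
      exact (hz (ζ, x.2) (hsub _ hζ _ hx2)).differentiableWithinAt
    exact hd.two_pi_i_inv_smul_circleIntegral_sub_inv_smul hx1
  · intro ζ
    simp only [ContinuousMap.smul_apply', hk _ hx1, hG _ hx2]

/-- Induction on the dimension: the first coordinate is split off and plays the role of `z` in
`analyticOnNhd_prod`. -/
theorem holds_fin : ∀ n : ℕ, Holds.{v} (Fin n → ℂ)
  | 0 => by
    intro F _ _ _ f U _ _ _ x _
    have : f = fun _ => f x := by ext y; rw [Subsingleton.elim y x]
    rw [this]
    exact analyticAt_const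
  | n + 1 => by
    intro F _ _ _ f U hU hf hl
    let e : (ℂ × (Fin n → ℂ)) ≃L[ℂ] (Fin (n + 1) → ℂ) := Fin.consEquivL ℂ (fun _ => ℂ)
    have hline : ∀ x ∈ e ⁻¹' U, ∀ y, DifferentiableAt ℂ (fun s : ℂ => f (e (x + s • y))) 0 := by
      intro x hx y
      simpa using hl (e x) hx (e y)
    have h1 : AnalyticOnNhd ℂ (f ∘ e) (e ⁻¹' U) := by
      refine analyticOnNhd_prod (holds_fin n) (hU.preimage e.continuous)
        (hf.comp e.continuous.continuousOn fun x hx => hx) ?_ ?_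
      · intro x hx
        have h2 : DifferentiableAt ℂ (fun z : ℂ => f (e (x + (z - x.1) • (1, 0)))) x.1 := by
          refine DifferentiableAt.comp (g := fun s : ℂ => f (e (x + s • (1, 0))))
            (f := fun z : ℂ => z - x.1) x.1 ?_ (by fun_prop)
          simpa using hline x hx (1, 0)
        convert h2 using 3 with z
        simp only [Function.comp]
        congr 2
        ext <;> simp
      · intro x hx y
        convert hline x hx (0, y) using 3 with s
        simp only [Function.comp]
        congr 2
        ext <;> simp
    intro x hx
    have h3 := (h1 (e.symm x) (by simpa using hx)).comp_of_eq
      (e.symm.toContinuousLinearMap.analyticAt x) rfl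
    refine h3.congr (Eventually.of_forall fun y => ?_)
    simp

end Osgood

/-- **Osgood's lemma** in the form: a continuous function on an open subset of `ℂ × E` that is
holomorphic in `z ∈ ℂ` and along the lines in `E` is analytic. -/
theorem analyticOnNhd_of_separately {E : Type*} [NormedAddCommGroup E] [NormedSpace ℂ E]
    [FiniteDimensional ℂ E] {F : Type*} [NormedAddCommGroup F] [NormedSpace ℂ F] [CompleteSpace F]
    {f : ℂ × E → F} {U : Set (ℂ × E)} (hU : IsOpen U) (hf : ContinuousOn f U)
    (hz : ∀ x ∈ U, DifferentiableAt ℂ (fun z => f (z, x.2)) x.1)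
    (ht : ∀ x ∈ U, ∀ y : E, DifferentiableAt ℂ (fun s : ℂ => f (x.1, x.2 + s • y)) 0) :
    AnalyticOnNhd ℂ f U := by
  refine Osgood.analyticOnNhd_prod ?_ hU hf hz ht
  intro F _ _ _ f U hU hf hl x hx
  let e : E ≃L[ℂ] (Fin (Module.finrank ℂ E) → ℂ) := ContinuousLinearEquiv.ofFinrankEq (by simp)
  have h1 : AnalyticOnNhd ℂ (f ∘ e.symm) (e.symm ⁻¹' U) := by
    refine Osgood.holds_fin _ F _ _ (hU.preimage e.symm.continuous)
      (hf.comp e.symm.continuous.continuousOn fun x hx => hx) ?_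
    intro x hx y
    simpa using hl (e.symm x) hx (e.symm y)
  have h3 := (h1 (e x) (by simpa using hx)).comp_of_eq (e.toContinuousLinearMap.analyticAt x) rfl
  refine h3.congr (Eventually.of_forall fun y => ?_)
  simp

/-! ## Holomorphic dependence of fibrewise holomorphic cochains on parameters -/

section Cochain

open Metric

variable {F : Type*} [NormedAddCommGroup F] [NormedSpace ℂ F]

/-- Lipschitz estimate for bounded holomorphic functions. -/
theorem dist_le_of_bounded_of_differentiableOn {E : Type*} [NormedAddCommGroup E]
    [NormedSpace ℂ E] {f : E → F} {c z : E} {r C : ℝ} (hd : DifferentiableOn ℂ f (ball c r))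
    (hb : ∀ z ∈ ball c r, ‖f z‖ ≤ C) (hz : z ∈ ball c r) :
    dist (f z) (f c) ≤ 2 * C / r * dist z c := by
  have hr : 0 < r := dist_nonneg.trans_lt hz
  refine Complex.dist_le_div_mul_dist_of_mapsTo_ball hd ?_ hz
  intro y hy
  rw [mem_closedBall, dist_eq_norm, two_mul]
  exact (norm_sub_le _ _).trans (add_le_add (hb y hy) (hb c (mem_ball_self hr)))

/-- **Montel's theorem** along an ultrafilter. -/
theorem exists_tendstoUniformlyOn_of_bounded [FiniteDimensional ℂ F] {N : Type*}
    (𝒰 : Ultrafilter N) {U : Set ℂ} (hU : IsOpen U) (f : N → ℂ → F) (C : ℝ)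
    (hd : ∀ n, DifferentiableOn ℂ (f n) U) (hb : ∀ n, ∀ z ∈ U, ‖f n z‖ ≤ C) :
    ∃ k : ℂ → F, DifferentiableOn ℂ k U ∧
      ∀ K ⊆ U, IsCompact K → TendstoUniformlyOn f k 𝒰 K := by
  have : ProperSpace F := FiniteDimensional.proper ℂ F
  -- The values at a point lie in a compact ball, so they converge along the ultrafilter and no
  -- subsequence has to be extracted.
  have hlim : ∀ z, ∃ y, z ∈ U → Tendsto (fun n => f n z) 𝒰 (𝓝 y) := by
    intro z
    by_cases hz : z ∈ U
    · obtain ⟨y, -, hy⟩ := (isCompact_closedBall (0 : F) C).ultrafilter_le_nhds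
        (𝒰.map fun n => f n z) (by
          rw [Ultrafilter.coe_map, le_principal_iff]
          exact Eventually.of_forall (p := fun n => f n z ∈ closedBall (0 : F) C)
            fun n => by simpa using hb n z hz)
      exact ⟨y, fun _ => hy⟩
    · exact ⟨0, fun h => (hz h).elim⟩
  choose k hk using hlim
  have hunif : ∀ K ⊆ U, IsCompact K → TendstoUniformlyOn f k 𝒰 K := by
    intro K hKU hK
    -- The uniform bound gives a uniform Lipschitz estimate by Schwarz's lemma. For an
    -- equicontinuous family, pointwise convergence is uniform on compact sets.
    have heq : ∀ L ∈ ({K} : Set (Set ℂ)), EquicontinuousOn f L := by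
      rintro L rfl z hz
      obtain ⟨r, hr, hrU⟩ := Metric.isOpen_iff.1 hU z (hKU hz)
      refine EquicontinuousAt.equicontinuousWithinAt ?_ _
      rw [Metric.equicontinuousAt_iff]
      intro ε hε
      -- The sign of `C` is known only if the family has a member; otherwise there is nothing to
      -- show.
      have h0 : 0 ≤ C ∨ IsEmpty N := by
        rcases isEmpty_or_nonempty N with h | ⟨⟨n⟩⟩
        · exact Or.inr h
        · exact Or.inl ((norm_nonneg _).trans (hb n z (hKU hz)))
      rcases h0 with h0 | h0
      · refine ⟨min r (ε / (2 * C / r + 1)), by positivity, fun y hy n => ?_⟩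
        have hy1 : y ∈ ball z r := lt_of_lt_of_le hy (min_le_left _ _)
        have hy2 : dist y z < ε / (2 * C / r + 1) := lt_of_lt_of_le hy (min_le_right _ _)
        rw [dist_comm]
        refine (dist_le_of_bounded_of_differentiableOn ((hd n).mono hrU)
          (fun z hz => hb n z (hrU hz)) hy1).trans_lt ?_
        rw [lt_div_iff₀ (by positivity)] at hy2
        nlinarith [dist_nonneg (x := y) (y := z)]
      · exact ⟨1, one_pos, fun y hy n => (h0.false n).elim⟩
    have h1 := (EquicontinuousOn.tendsto_uniformOnFun_iff_pi' (𝔖 := {K})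
      (by rintro L rfl; exact hK) heq 𝒰 k).2 (by
        rw [tendsto_pi_nhds]
        rintro ⟨z, hz⟩
        exact hk z (hKU (by simpa using hz)))
    exact (UniformOnFun.tendsto_iff_tendstoUniformlyOn.1 h1) K rfl
  refine ⟨k, ?_, hunif⟩
  refine TendstoLocallyUniformlyOn.differentiableOn (F := f) (φ := (𝒰 : Filter N)) ?_
    (Eventually.of_forall hd) hU
  rw [tendstoLocallyUniformlyOn_iff_forall_isCompact hU]
  exact hunif

variable {P ι : Type*} {E : Type*} [NormedAddCommGroup E] [NormedSpace ℂ E]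

/-- Discs `s i '' ball 0 1` covering `P`, and transition functions between the larger discs
`s i '' ball 0 2`, depending holomorphically on a parameter in the unit ball of `E`, such that the
only global section of the bundle at the parameter `0` that vanishes at `p₀` is zero. -/
structure DiscCocycle (F : Type*) [NormedAddCommGroup F] [NormedSpace ℂ F] (s : ι → ℂ → P)
    (G : ι → ι → E → P → F →L[ℂ] F) (i₀ : ι) (p₀ : P) (B : ℝ) : Prop where
  cover : ∀ p, ∃ i, p ∈ s i '' ball 0 1
  mem₀ : p₀ ∈ s i₀ '' ball 0 1
  bound : ∀ i j, ∀ u ∈ ball (0 : E) 1, ∀ p ∈ s i '' ball 0 2, p ∈ s j '' ball 0 2 → ‖G i j u p‖ ≤ B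
  diff : ∀ i j, ∀ p ∈ s i '' ball 0 2, p ∈ s j '' ball 0 2 →
    DifferentiableOn ℂ (fun u => G i j u p) (ball 0 1)
  eq_zero : ∀ k : ι → P → F, (∀ i, DifferentiableOn ℂ (fun ζ => k i (s i ζ)) (ball 0 1)) →
    (∀ i j, ∀ p ∈ s i '' ball 0 1, p ∈ s j '' ball 0 1 → k j p = G i j 0 p (k i p)) →
    k i₀ p₀ = 0 → ∀ i, ∀ p ∈ s i '' ball 0 1, k i p = 0

namespace DiscCocycle

variable {s : ι → ℂ → P} {G : ι → ι → E → P → F →L[ℂ] F} {i₀ : ι} {p₀ : P} {B : ℝ}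

theorem mem_two {i : ι} {p : P} (h : p ∈ s i '' ball 0 1) : p ∈ s i '' ball 0 2 :=
  image_mono (ball_subset_ball one_le_two) h

theorem bound_nonneg (hG : DiscCocycle F s G i₀ p₀ B) : 0 ≤ B :=
  (norm_nonneg _).trans (hG.bound i₀ i₀ 0 (mem_ball_self one_pos) p₀ (mem_two hG.mem₀)
    (mem_two hG.mem₀))

/-- Schwarz's lemma in the parameter: two values of a transition function differ by at most `2 * B`,
and the estimate scales with the distance. -/
theorem norm_sub_le (hG : DiscCocycle F s G i₀ p₀ B) {i j : ι} {u u' : E} {r : ℝ}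
    (hr : ball u r ⊆ ball 0 1) (hu' : u' ∈ ball u r) {p : P} (hi : p ∈ s i '' ball 0 2)
    (hj : p ∈ s j '' ball 0 2) : ‖G i j u' p - G i j u p‖ ≤ 2 * B / r * ‖u' - u‖ := by
  have := dist_le_of_bounded_of_differentiableOn ((hG.diff i j p hi hj).mono hr)
    (fun v hv => hG.bound i j v (hr hv) p hi hj) hu'
  rwa [dist_eq_norm, dist_eq_norm] at this

/-- Near the parameter `0`, a holomorphic cochain is bounded by its coboundary and its value at
`p₀`. -/
theorem exists_bound [Finite ι] [FiniteDimensional ℂ F] (hG : DiscCocycle F s G i₀ p₀ B) :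
    ∃ C > 0, ∃ ε > 0, ε ≤ 1 ∧ ∀ u ∈ ball (0 : E) ε, ∀ (k : ι → P → F) (δ : ℝ),
      (∀ i, DifferentiableOn ℂ (fun ζ => k i (s i ζ)) (ball 0 2)) →
      (∃ b, ∀ i, ∀ p ∈ s i '' ball 0 2, ‖k i p‖ ≤ b) →
      (∀ i j, ∀ p ∈ s i '' ball 0 2, p ∈ s j '' ball 0 2 → ‖k j p - G i j u p (k i p)‖ ≤ δ) →
      ‖k i₀ p₀‖ ≤ δ → ∀ i, ∀ p ∈ s i '' ball 0 2, ‖k i p‖ ≤ C * δ := by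
  -- Otherwise there are parameters tending to `0` and cochains whose coboundaries and values at
  -- `p₀` tend to `0`. They can be normalized to have norm `1` at some point and at most `2`
  -- everywhere.
  by_contra hcon
  have hcon : ∀ n : ℕ, ∃ u ∈ ball (0 : E) (1 / ((n : ℝ) + 1)), ∃ (κ : ι → P → F) (i : ι),
      ∃ p ∈ s i '' ball 0 2,
      (∀ i, DifferentiableOn ℂ (fun ζ => κ i (s i ζ)) (ball 0 2)) ∧
      (∀ i, ∀ p ∈ s i '' ball 0 2, ‖κ i p‖ ≤ 2) ∧
      (∀ i j, ∀ p ∈ s i '' ball 0 2, p ∈ s j '' ball 0 2 →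
        ‖κ j p - G i j u p (κ i p)‖ ≤ 2 * (1 / ((n : ℝ) + 1))) ∧
      ‖κ i₀ p₀‖ ≤ 2 * (1 / ((n : ℝ) + 1)) ∧ ‖κ i p‖ = 1 := by
    intro n
    have hn : (0 : ℝ) < (n : ℝ) + 1 := by positivity
    by_contra h
    refine hcon ⟨n + 1, hn, 1 / ((n : ℝ) + 1), by positivity, ?_, ?_⟩
    · rw [div_le_one hn]; linarith [(Nat.cast_nonneg n : (0 : ℝ) ≤ n)]
    intro u hu k δ hd ⟨b, hb⟩ hc h0
    by_contra hlt
    push Not at hlt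
    obtain ⟨i₁, p₁, hp₁, hlt⟩ := hlt
    have hδ : 0 ≤ δ := (norm_nonneg _).trans h0
    let A : Set ℝ := {x | ∃ i, ∃ p ∈ s i '' ball 0 2, x = ‖k i p‖}
    have hA : BddAbove A := ⟨b, by rintro x ⟨i, p, hp, rfl⟩; exact hb i p hp⟩
    have hle : ∀ i, ∀ p ∈ s i '' ball 0 2, ‖k i p‖ ≤ sSup A :=
      fun i p hp => le_csSup hA ⟨i, p, hp, rfl⟩
    have hpos : 0 < sSup A := ((mul_nonneg hn.le hδ).trans_lt hlt).trans_le (hle _ _ hp₁)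
    have hne : A.Nonempty := ⟨_, i₁, p₁, hp₁, rfl⟩
    -- The supremum need not be attained. Dividing by a value above half of it costs the factor 2 in
    -- all the bounds.
    obtain ⟨x, ⟨i, p, hp, rfl⟩, hx⟩ := exists_lt_of_lt_csSup hne (half_lt_self hpos)
    set m := ‖k i p‖ with hm
    have hm0 : 0 < m := (half_pos hpos).trans hx
    have hδm : δ / m ≤ 2 * (1 / ((n : ℝ) + 1)) := by
      rw [div_le_iff₀ hm0, mul_one_div, div_mul_eq_mul_div, le_div_iff₀ hn]
      have := hle _ _ hp₁
      nlinarith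
    have hnm : ∀ y : F, ‖((m : ℂ)⁻¹ • y)‖ = ‖y‖ / m := by
      intro y
      rw [norm_smul, norm_inv, Complex.norm_real, Real.norm_of_nonneg hm0.le, div_eq_inv_mul]
    refine h ⟨u, hu, fun i p => (m : ℂ)⁻¹ • k i p, i, p, hp, ?_, ?_, ?_, ?_, ?_⟩
    · exact fun i => (hd i).const_smul _
    · intro j q hq
      rw [hnm, div_le_iff₀ hm0]
      have := hle j q hq
      linarith
    · intro i j q hi hj
      rw [map_smul, ← smul_sub, hnm]
      exact (div_le_div_of_nonneg_right (hc i j q hi hj) hm0.le).trans hδm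
    · rw [hnm]
      exact (div_le_div_of_nonneg_right h0 hm0.le).trans hδm
    · rw [hnm, ← hm, div_self hm0.ne']
  choose u hu κ i₁ p₁ hp₁ hd hb hc h0 h1 using hcon
  have hlim0 : Tendsto (fun n : ℕ => 2 * (1 / ((n : ℝ) + 1))) (hyperfilter ℕ) (𝓝 0) := by
    have := (tendsto_one_div_add_atTop_nhds_zero_nat (𝕜 := ℝ)).const_mul 2
    rw [mul_zero] at this
    exact this.mono_left Nat.hyperfilter_le_atTop
  have hu0 : Tendsto u (hyperfilter ℕ) (𝓝 0) := by
    refine squeeze_zero_norm (fun n => (mem_ball_zero_iff.1 (hu n)).le) ?_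
    exact tendsto_one_div_add_atTop_nhds_zero_nat.mono_left Nat.hyperfilter_le_atTop
  have hM := fun i => exists_tendstoUniformlyOn_of_bounded (hyperfilter ℕ)
    (isOpen_ball (x := (0 : ℂ)) (ε := 2)) (fun n ζ => κ n i (s i ζ)) 2 (fun n => hd n i)
    (fun n ζ hζ => hb n i _ (mem_image_of_mem _ hζ))
  choose l hl hunif using hM
  have hpt : ∀ i, ∀ ζ ∈ ball (0 : ℂ) 2, Tendsto (fun n => κ n i (s i ζ)) (hyperfilter ℕ)
      (𝓝 (l i ζ)) := fun i ζ hζ =>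
    (hunif i {ζ} (by simpa using hζ) isCompact_singleton).tendsto_at rfl
  let k : ι → P → F := fun i p => limUnder (hyperfilter ℕ : Filter ℕ) fun n => κ n i p
  have hk : ∀ i, ∀ ζ ∈ ball (0 : ℂ) 2, k i (s i ζ) = l i ζ :=
    fun i ζ hζ => (hpt i ζ hζ).limUnder_eq
  have hkt : ∀ i, ∀ p ∈ s i '' ball 0 2, Tendsto (fun n => κ n i p) (hyperfilter ℕ)
      (𝓝 (k i p)) := by
    rintro i _ ⟨ζ, hζ, rfl⟩
    rw [hk i ζ hζ]
    exact hpt i ζ hζ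
  -- The limit cochain is a section for the parameter `0` that vanishes at `p₀`.
  have hzero : ∀ i, ∀ p ∈ s i '' ball 0 1, k i p = 0 := by
    refine hG.eq_zero k ?_ ?_ ?_
    · intro i
      refine ((hl i).mono (ball_subset_ball one_le_two)).congr ?_
      exact fun ζ hζ => hk i ζ (ball_subset_ball one_le_two hζ)
    · intro i j p hi hj
      have hi' := mem_two hi
      have hj' := mem_two hj
      have hGt : Tendsto (fun n => G i j (u n) p) (hyperfilter ℕ) (𝓝 (G i j 0 p)) :=
        (((hG.diff i j p hi' hj').continuousOn.continuousAt
          (ball_mem_nhds _ one_pos)).tendsto).comp hu0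
      have h2 : Tendsto (fun n => κ n j p - G i j (u n) p (κ n i p)) (hyperfilter ℕ)
          (𝓝 (k j p - G i j 0 p (k i p))) :=
        (hkt j p hj').sub ((isBoundedBilinearMap_apply (𝕜 := ℂ) (E := F) (F :=
            F)).continuous.tendsto
          (G i j 0 p, k i p) |>.comp (Tendsto.prodMk_nhds hGt (hkt i p hi')))
      have h3 := squeeze_zero_norm (fun n => hc n i j p hi' hj') hlim0
      exact sub_eq_zero.1 (tendsto_nhds_unique h2 h3)
    · exact tendsto_nhds_unique (hkt i₀ p₀ (mem_two hG.mem₀))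
        (squeeze_zero_norm (fun n => h0 n) hlim0)
  -- Here the two radii matter: the closed unit discs are compact in the discs of radius 2, so the
  -- convergence to `0` is uniform on them.
  have hsmall : ∀ ε > 0, ∀ᶠ n in (hyperfilter ℕ : Filter ℕ), ∀ i, ∀ p ∈ s i '' ball 0 1,
      ‖κ n i p‖ < ε := by
    intro ε hε
    refine eventually_all.2 fun i => ?_
    have h2 := Metric.tendstoUniformlyOn_iff.1 (hunif i (closedBall 0 1)
      (closedBall_subset_ball one_lt_two) (isCompact_closedBall _ _)) ε hε
    filter_upwards [h2] with n hn
    rintro _ ⟨ζ, hζ, rfl⟩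
    have h3 := hn ζ (ball_subset_closedBall hζ)
    rw [← hk i ζ (ball_subset_ball one_le_two hζ), hzero i _ (mem_image_of_mem _ hζ),
      dist_zero_left] at h3
    exact h3
  have hB := hG.bound_nonneg
  -- The thresholds make the transported value and the coboundary each less than `1/2`.
  have hev := (hsmall (1 / (2 * (B + 1))) (by positivity)).and
    (hlim0.eventually (gt_mem_nhds (show (0 : ℝ) < 1 / 2 by norm_num)))
  obtain ⟨n, hn1, hn2⟩ := hev.exists
  -- The point of norm `1` lies in the larger disc `i₁ n`, where smallness is not known near the
  -- boundary. But it also lies in some unit disc, where the cochain is small. The transition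
  -- function carries this over to `i₁ n`, a contradiction.
  obtain ⟨i, hi⟩ := hG.cover (p₁ n)
  have h2 := hc n i (i₁ n) (p₁ n) (mem_two hi) (hp₁ n)
  have hun : u n ∈ ball (0 : E) 1 := by
    refine ball_subset_ball ?_ (hu n)
    rw [div_le_one (by positivity)]
    linarith [(Nat.cast_nonneg n : (0 : ℝ) ≤ n)]
  have h3 : ‖G i (i₁ n) (u n) (p₁ n) (κ n i (p₁ n))‖ ≤ B * (1 / (2 * (B + 1))) :=
    (ContinuousLinearMap.le_opNorm _ _).trans (mul_le_mul
        (hG.bound _ _ _ hun _ (mem_two hi) (hp₁ n))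
      (hn1 i _ hi).le (norm_nonneg _) hB)
  have h4 : B * (1 / (2 * (B + 1))) < 1 / 2 := by
    rw [mul_one_div, div_lt_div_iff₀ (by positivity) (by norm_num)]
    linarith
  have h5 := norm_sub_norm_le (κ n (i₁ n) (p₁ n)) (G i (i₁ n) (u n) (p₁ n) (κ n i (p₁ n)))
  rw [h1 n] at h5
  linarith

/-- Continuity in the parameter, uniform on the discs. The difference `h u - h u₁` is not a cocycle
for `u`, but its coboundary is `(G u - G u₁) (h u₁)`. This is small because the transition functions
are Lipschitz in the parameter, and the a priori bound applies. -/
theorem eventually_norm_sub_le (hG : DiscCocycle F s G i₀ p₀ B) {h : ι → E → P → F} {C ε : ℝ}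
    (hC : 0 < C) (hε : ε ≤ 1)
    (hCε : ∀ u ∈ ball (0 : E) ε, ∀ (k : ι → P → F) (δ : ℝ),
      (∀ i, DifferentiableOn ℂ (fun ζ => k i (s i ζ)) (ball 0 2)) →
      (∃ b, ∀ i, ∀ p ∈ s i '' ball 0 2, ‖k i p‖ ≤ b) →
      (∀ i j, ∀ p ∈ s i '' ball 0 2, p ∈ s j '' ball 0 2 → ‖k j p - G i j u p (k i p)‖ ≤ δ) →
      ‖k i₀ p₀‖ ≤ δ → ∀ i, ∀ p ∈ s i '' ball 0 2, ‖k i p‖ ≤ C * δ)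
    (hd : ∀ u ∈ ball (0 : E) 1, ∀ i, DifferentiableOn ℂ (fun ζ => h i u (s i ζ)) (ball 0 2))
    (hb : ∀ u ∈ ball (0 : E) 1, ∃ b, ∀ i, ∀ p ∈ s i '' ball 0 2, ‖h i u p‖ ≤ b)
    (hc : ∀ u ∈ ball (0 : E) 1, ∀ i j, ∀ p ∈ s i '' ball 0 2, p ∈ s j '' ball 0 2 →
      h j u p = G i j u p (h i u p))
    (hη : DifferentiableOn ℂ (fun u => h i₀ u p₀) (ball 0 1)) {u₁ : E} (hu₁ : u₁ ∈ ball (0 : E) ε)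
    {δ : ℝ} (hδ : 0 < δ) :
    ∀ᶠ u in 𝓝 u₁, ∀ i, ∀ p ∈ s i '' ball 0 2, ‖h i u p - h i u₁ p‖ ≤ δ := by
  have hsub : ball (0 : E) ε ⊆ ball 0 1 := ball_subset_ball hε
  obtain ⟨r, hr, hrε⟩ := Metric.isOpen_iff.1 isOpen_ball u₁ hu₁
  obtain ⟨b, hb₁⟩ := hb u₁ (hsub hu₁)
  have hB := hG.bound_nonneg
  have hδ' : 0 < δ / C := div_pos hδ hC
  have hηc : ContinuousAt (fun u => h i₀ u p₀) u₁ :=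
    hη.continuousOn.continuousAt (isOpen_ball.mem_nhds (hsub hu₁))
  have he1 : ∀ᶠ u in 𝓝 u₁, ‖h i₀ u p₀ - h i₀ u₁ p₀‖ < δ / C := by
    have := Metric.continuousAt_iff'.1 hηc (δ / C) hδ'
    simpa [dist_eq_norm] using this
  have he2 : ∀ᶠ u in 𝓝 u₁, 2 * B / r * ‖u - u₁‖ * |b| < δ / C := by
    have hcont : Continuous fun u : E => 2 * B / r * ‖u - u₁‖ * |b| := by fun_prop
    refine (hcont.tendsto u₁).eventually (gt_mem_nhds ?_)
    simpa using hδ'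
  filter_upwards [he1, he2, ball_mem_nhds u₁ hr] with u hu1 hu2 hur
  have huε := hrε hur
  obtain ⟨b', hb'⟩ := hb u (hsub huε)
  have hmain := hCε u huε (fun i p => h i u p - h i u₁ p) (δ / C)
    (fun i => (hd u (hsub huε) i).sub (hd u₁ (hsub hu₁) i))
    ⟨b' + b, fun i p hp => (_root_.norm_sub_le _ _).trans (add_le_add (hb' i p hp) (hb₁ i p hp))⟩ ?_
    hu1.le
  · intro i p hp
    have := hmain i p hp
    rwa [mul_div_cancel₀ _ hC.ne'] at this
  · intro i j p hi hj
    have heq : h j u p - h j u₁ p - G i j u p (h i u p - h i u₁ p)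
        = (G i j u p - G i j u₁ p) (h i u₁ p) := by
      rw [hc u (hsub huε) i j p hi hj, hc u₁ (hsub hu₁) i j p hi hj, map_sub,
        sub_apply]
      abel
    rw [heq]
    refine (ContinuousLinearMap.le_opNorm _ _).trans (le_trans ?_ hu2.le)
    exact mul_le_mul (hG.norm_sub_le (hrε.trans hsub) hur hi hj)
      ((hb₁ i p hi).trans (le_abs_self b)) (norm_nonneg _) (by positivity)

/-- A family of cocycles in the fibres that is holomorphic in the disc variables, with value at `p₀`
holomorphic in the parameter, is jointly holomorphic. -/
theorem analyticAt [Finite ι] [FiniteDimensional ℂ F] [FiniteDimensional ℂ E]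
    (hG : DiscCocycle F s G i₀ p₀ B) {h : ι → E → P → F}
    (hd : ∀ u ∈ ball (0 : E) 1, ∀ i, DifferentiableOn ℂ (fun ζ => h i u (s i ζ)) (ball 0 2))
    (hb : ∀ u ∈ ball (0 : E) 1, ∃ b, ∀ i, ∀ p ∈ s i '' ball 0 2, ‖h i u p‖ ≤ b)
    (hc : ∀ u ∈ ball (0 : E) 1, ∀ i j, ∀ p ∈ s i '' ball 0 2, p ∈ s j '' ball 0 2 →
      h j u p = G i j u p (h i u p))
    (hη : DifferentiableOn ℂ (fun u => h i₀ u p₀) (ball 0 1)) (i : ι) {ζ : ℂ}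
    (hζ : ζ ∈ ball (0 : ℂ) 2) : AnalyticAt ℂ (fun x : ℂ × E => h i x.2 (s i x.1)) (ζ, 0) := by
  have : CompleteSpace F := FiniteDimensional.complete ℂ F
  obtain ⟨C, hC, ε, hε0, hε, hCε⟩ := hG.exists_bound
  have hsub : ball (0 : E) ε ⊆ ball 0 1 := ball_subset_ball hε
  have hB := hG.bound_nonneg
  have hcont : ∀ u₁ ∈ ball (0 : E) ε, ∀ δ > 0,
      ∀ᶠ u in 𝓝 u₁, ∀ i, ∀ p ∈ s i '' ball 0 2, ‖h i u p - h i u₁ p‖ ≤ δ :=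
    fun u₁ hu₁ δ hδ => hG.eventually_norm_sub_le hC hε hCε hd hb hc hη hu₁ hδ
  refine analyticOnNhd_of_separately (U := ball 0 2 ×ˢ ball 0 ε) (isOpen_ball.prod isOpen_ball)
    ?_ ?_ ?_ (ζ, 0) ⟨hζ, mem_ball_self hε0⟩
  · rintro ⟨z, u₁⟩ ⟨hz, hu₁⟩
    refine ContinuousAt.continuousWithinAt ?_
    rw [Metric.continuousAt_iff']
    intro δ hδ
    have h1 := (hd u₁ (hsub hu₁) i).continuousOn.continuousAt (isOpen_ball.mem_nhds hz)
    have h2 := Metric.continuousAt_iff'.1 h1 (δ / 2) (half_pos hδ)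
    have h3 := hcont u₁ hu₁ (δ / 3) (by positivity)
    rw [nhds_prod_eq]
    have h7 : ∀ᶠ y in 𝓝 z, y ∈ ball (0 : ℂ) 2 := isOpen_ball.mem_nhds hz
    filter_upwards [(h7.and h2).prod_mk h3] with x ⟨⟨hx', hx1⟩, hx2⟩
    have h4 := hx2 i _ (mem_image_of_mem (s i) hx')
    rw [← dist_eq_norm] at h4
    have h5 := dist_triangle (h i x.2 (s i x.1)) (h i u₁ (s i x.1)) (h i u₁ (s i z))
    linarith
  · rintro ⟨z, u₁⟩ ⟨hz, hu₁⟩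
    exact (hd u₁ (hsub hu₁) i).differentiableAt (isOpen_ball.mem_nhds hz)
  · rintro ⟨z, u₁⟩ ⟨hz, hu₁⟩ v
    obtain ⟨b, hb₁⟩ := hb u₁ (hsub hu₁)
    let L : ℂ → E := fun σ => u₁ + σ • v
    have hL : Continuous L := by fun_prop
    have hL0 : L 0 = u₁ := by simp [L]
    obtain ⟨ρ, hρ, hρε⟩ := Metric.isOpen_iff.1 (isOpen_ball.preimage hL) 0
      (show L 0 ∈ ball (0 : E) ε by rwa [hL0])
    -- The first summand bounds the difference quotients `Q` of the transition functions, the second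
    -- bounds their Lipschitz constant at `0`. Both come from Schwarz's lemma, the latter applied to
    -- `dslope`.
    let K : ℝ := 2 * B / ρ + 2 * (2 * B / ρ) / ρ
    have hK : 0 ≤ K := by positivity
    let Q : ι → ι → P → ℂ → F →L[ℂ] F := fun i j p σ => σ⁻¹ • (G i j (L σ) p - G i j u₁ p)
    have hQ : ∀ i j, ∀ p ∈ s i '' ball 0 2, p ∈ s j '' ball 0 2 →
        (∀ σ ∈ ball (0 : ℂ) ρ, σ ≠ 0 → ‖Q i j p σ‖ ≤ K) ∧
        ∀ σ ∈ ball (0 : ℂ) ρ, ∀ σ' ∈ ball (0 : ℂ) ρ, σ ≠ 0 → σ' ≠ 0 →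
          ‖Q i j p σ - Q i j p σ'‖ ≤ K * (‖σ‖ + ‖σ'‖) := by
      intro i j p hi hj
      let φ : ℂ → F →L[ℂ] F := fun σ => G i j (L σ) p
      have hφd : DifferentiableOn ℂ φ (ball 0 ρ) := by
        refine (hG.diff i j p hi hj).comp (f := L) (by fun_prop) ?_
        exact fun σ hσ => hsub (hρε hσ)
      have hφb : ∀ σ ∈ ball (0 : ℂ) ρ, ‖φ σ‖ ≤ B :=
        fun σ hσ => hG.bound i j _ (hsub (hρε hσ)) p hi hj
      have hφQ : ∀ σ, σ ≠ 0 → dslope φ 0 σ = Q i j p σ := by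
        intro σ hσ
        rw [dslope_of_ne _ hσ, slope_def_module, sub_zero]
        simp [φ, Q, hL0]
      have hψd : DifferentiableOn ℂ (dslope φ 0) (ball 0 ρ) :=
        (Complex.differentiableOn_dslope (ball_mem_nhds _ hρ)).2 hφd
      have hψb : ∀ σ ∈ ball (0 : ℂ) ρ, ‖dslope φ 0 σ‖ ≤ 2 * B / ρ := by
        intro σ hσ
        refine Complex.norm_dslope_le_div_of_mapsTo_ball hφd ?_ hσ
        intro y hy
        rw [mem_closedBall, dist_eq_norm, two_mul]
        exact (_root_.norm_sub_le _ _).trans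
          (add_le_add (hφb y hy) (hφb 0 (mem_ball_self hρ)))
      have hψl : ∀ σ ∈ ball (0 : ℂ) ρ, dist (dslope φ 0 σ) (dslope φ 0 0) ≤ K * ‖σ‖ := by
        intro σ hσ
        refine (dist_le_of_bounded_of_differentiableOn hψd hψb hσ).trans ?_
        rw [dist_zero_right]
        refine mul_le_mul_of_nonneg_right ?_ (norm_nonneg _)
        exact le_add_of_nonneg_left (by positivity)
      refine ⟨fun σ hσ hσ0 => ?_, fun σ hσ σ' hσ' hσ0 hσ0' => ?_⟩
      · rw [← hφQ σ hσ0]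
        exact (hψb σ hσ).trans (le_add_of_nonneg_right (by positivity))
      · rw [← hφQ σ hσ0, ← hφQ σ' hσ0', ← dist_eq_norm, mul_add]
        exact (dist_triangle_right _ _ (dslope φ 0 0)).trans (add_le_add (hψl σ hσ) (hψl σ' hσ'))
    let q : ℂ → ι → P → F := fun σ i p => σ⁻¹ • (h i (L σ) p - h i u₁ p)
    -- The coboundary of the difference quotients of `h` is expressed by those of the transition
    -- functions.
    have hqG : ∀ σ ∈ ball (0 : ℂ) ρ, ∀ i j, ∀ p ∈ s i '' ball 0 2, p ∈ s j '' ball 0 2 →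
        q σ j p - G i j u₁ p (q σ i p) = Q i j p σ (h i (L σ) p) := by
      intro σ hσ i j p hi hj
      simp only [q, Q, hc _ (hsub (hρε hσ)) i j p hi hj, hc u₁ (hsub hu₁) i j p hi hj, map_smul,
        map_sub, smul_apply, sub_apply, ← smul_sub]
      congr 1
      abel
    have hηL : DifferentiableAt ℂ (fun σ => h i₀ (L σ) p₀) 0 := by
      refine DifferentiableAt.comp (g := fun u => h i₀ u p₀) (f := L) 0 ?_ (by fun_prop)
      rw [hL0]
      exact hη.differentiableAt (isOpen_ball.mem_nhds (hsub hu₁))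
    have hη' := hasDerivAt_iff_tendsto_slope_zero.1 hηL.hasDerivAt
    simp only [zero_add, hL0] at hη'
    -- The derivative along `v` is obtained without a candidate for its value. The coboundary of `q
    -- σ - q σ'` is `(Q σ - Q σ') (h (L σ)) + Q σ' (h (L σ) - h (L σ'))`, which tends to `0`, and
    -- the values at `p₀` converge by `hη`. The a priori bound makes the quotients Cauchy, and `F`
    -- is complete.
    have hcauchy : Cauchy (map (fun σ => q σ i (s i z)) (𝓝[≠] 0)) := by
      refine Metric.cauchy_iff.2 ⟨inferInstance, fun δ hδ => ?_⟩
      have hδ' : 0 < δ / (2 * C) := by positivity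
      set δ' := δ / (2 * C) with hδ'def
      have e1 : ∀ᶠ σ in 𝓝[≠] (0 : ℂ), σ ∈ ball (0 : ℂ) ρ ∧ σ ≠ 0 :=
        (Eventually.filter_mono nhdsWithin_le_nhds (ball_mem_nhds (0 : ℂ) hρ)).and
          self_mem_nhdsWithin
      have e2 : ∀ᶠ σ in 𝓝[≠] (0 : ℂ), K * ‖σ‖ * (|b| + 1) < δ' / 4 := by
        have hc : Continuous fun σ : ℂ => K * ‖σ‖ * (|b| + 1) := by fun_prop
        refine ((hc.tendsto 0).eventually (gt_mem_nhds ?_)).filter_mono nhdsWithin_le_nhds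
        simpa using hδ'
      -- The bound `1` keeps `‖h i (L σ) p‖` below `|b| + 1`; the other bound controls the term with
      -- `Q σ'`.
      have e3 : ∀ᶠ σ in 𝓝[≠] (0 : ℂ), ∀ i, ∀ p ∈ s i '' ball 0 2,
          ‖h i (L σ) p - h i u₁ p‖ ≤ min 1 (δ' / (4 * (K + 1))) := by
        have h1 := hcont u₁ hu₁ (min 1 (δ' / (4 * (K + 1)))) (by positivity)
        rw [← hL0] at h1
        have h2 := (hL.tendsto 0).eventually h1
        rw [hL0] at h2
        exact h2.filter_mono nhdsWithin_le_nhds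
      have e4 := Metric.tendsto_nhds.1 hη' (δ' / 2) (half_pos hδ')
      refine ⟨_, image_mem_map (e1.and (e2.and (e3.and e4))), ?_⟩
      rintro _ ⟨σ, ⟨⟨hσ, hσ0⟩, hσ2, hσ3, hσ4⟩, rfl⟩ _ ⟨σ', ⟨⟨hσ', hσ0'⟩, hσ2', hσ3', hσ4'⟩, rfl⟩
      have hdq : ∀ σ ∈ ball (0 : ℂ) ρ, ∀ i, DifferentiableOn ℂ (fun ζ => q σ i (s i ζ))
          (ball 0 2) :=
        fun σ hσ i => ((hd _ (hsub (hρε hσ)) i).sub (hd u₁ (hsub hu₁) i)).const_smul _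
      have hbq : ∀ σ ∈ ball (0 : ℂ) ρ, ∃ b, ∀ i, ∀ p ∈ s i '' ball 0 2, ‖q σ i p‖ ≤ b := by
        intro σ hσ
        obtain ⟨b', hb'⟩ := hb _ (hsub (hρε hσ))
        refine ⟨‖σ⁻¹‖ * (b' + b), fun i p hp => ?_⟩
        simp only [q, norm_smul]
        gcongr
        exact (_root_.norm_sub_le _ _).trans (add_le_add (hb' i p hp) (hb₁ i p hp))
      have hfinal := hCε u₁ hu₁ (fun i p => q σ i p - q σ' i p) δ'
        (fun i => (hdq σ hσ i).sub (hdq σ' hσ' i)) ?_ ?_ ?_ i (s i z) (mem_image_of_mem _ hz)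
      · rw [dist_eq_norm]
        refine hfinal.trans_lt ?_
        rw [hδ'def, mul_div_assoc', mul_comm C, mul_comm 2 C, ← div_div, mul_div_cancel_right₀ _
            hC.ne']
        exact half_lt_self hδ
      · obtain ⟨b₁, h₁⟩ := hbq σ hσ
        obtain ⟨b₂, h₂⟩ := hbq σ' hσ'
        exact ⟨b₁ + b₂, fun i p hp => (_root_.norm_sub_le _ _).trans
          (add_le_add (h₁ i p hp) (h₂ i p hp))⟩
      · intro i j p hi hj
        have heq : q σ j p - q σ' j p - G i j u₁ p (q σ i p - q σ' i p)
            = (Q i j p σ - Q i j p σ') (h i (L σ) p)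
              + Q i j p σ' ((h i (L σ) p - h i u₁ p) - (h i (L σ') p - h i u₁ p)) := by
          have h1 := hqG σ hσ i j p hi hj
          have h2 := hqG σ' hσ' i j p hi hj
          have h3 : q σ j p - q σ' j p - G i j u₁ p (q σ i p - q σ' i p)
            = (q σ j p - G i j u₁ p (q σ i p)) - (q σ' j p - G i j u₁ p (q σ' i p)) := by
            rw [map_sub]; abel
          rw [h3, h1, h2]
          simp only [map_sub, sub_apply]
          abel
        rw [heq]
        obtain ⟨hQ1, hQ2⟩ := hQ i j p hi hj
        have hm := hσ3 i p hi
        have hm' := hσ3' i p hi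
        have n1 : ‖h i (L σ) p‖ ≤ |b| + 1 := by
          have := norm_sub_norm_le (h i (L σ) p) (h i u₁ p)
          have := (hb₁ i p hi).trans (le_abs_self b)
          have := hm.trans (min_le_left _ _)
          linarith
        have n2 : ‖(Q i j p σ - Q i j p σ') (h i (L σ) p)‖ ≤ K * (‖σ‖ + ‖σ'‖) * (|b| + 1) :=
          (ContinuousLinearMap.le_opNorm _ _).trans
            (mul_le_mul (hQ2 σ hσ σ' hσ' hσ0 hσ0') n1 (norm_nonneg _) (by positivity))
        have n3 : ‖Q i j p σ' ((h i (L σ) p - h i u₁ p) - (h i (L σ') p - h i u₁ p))‖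
            ≤ K * (δ' / (4 * (K + 1)) + δ' / (4 * (K + 1))) :=
          (ContinuousLinearMap.le_opNorm _ _).trans (mul_le_mul (hQ1 σ' hσ' hσ0')
            ((_root_.norm_sub_le _ _).trans (add_le_add (hm.trans (min_le_right _ _))
              (hm'.trans (min_le_right _ _)))) (norm_nonneg _) hK)
        have n4 : K * (δ' / (4 * (K + 1)) + δ' / (4 * (K + 1))) ≤ δ' / 2 := by
          rw [← two_mul, mul_div_assoc', mul_div_assoc', div_le_div_iff₀ (by positivity) two_pos]
          nlinarith
        have n5 := norm_add_le ((Q i j p σ - Q i j p σ') (h i (L σ) p))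
          (Q i j p σ' ((h i (L σ) p - h i u₁ p) - (h i (L σ') p - h i u₁ p)))
        have n6 : K * (‖σ‖ + ‖σ'‖) * (|b| + 1)
          = K * ‖σ‖ * (|b| + 1) + K * ‖σ'‖ * (|b| + 1) := by ring
        linarith
      · rw [← dist_eq_norm]
        have := dist_triangle_right (q σ i₀ p₀) (q σ' i₀ p₀)
          (deriv (fun σ => h i₀ (L σ) p₀) 0)
        exact this.trans (by linarith [hσ4, hσ4'])
    obtain ⟨d, hd'⟩ := cauchy_map_iff_exists_tendsto.1 hcauchy
    refine HasDerivAt.differentiableAt (f' := d) ?_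
    rw [hasDerivAt_iff_tendsto_slope_zero]
    simpa [q, L] using hd'

end DiscCocycle

end Cochain

namespace HolBundle

/-! ### Germs of holomorphic sections and holomorphic frames -/

section Basics

variable {EB : Type*} [NormedAddCommGroup EB] [NormedSpace ℂ EB]
  {HB : Type*} [TopologicalSpace HB] {I : ModelWithCorners ℂ EB HB}
  {B : Type*} [TopologicalSpace B] [ChartedSpace HB B]
  {F : Type*} [NormedAddCommGroup F] [NormedSpace ℂ F]
  {V : B → Type*} [TopologicalSpace (TotalSpace F V)] [∀ x, AddCommGroup (V x)]
  [∀ x, Module ℂ (V x)] [∀ x, TopologicalSpace (V x)] [FiberBundle F V]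

variable (I F) in
/-- The section `σ` is complex differentiable at `x`. -/
def DiffSecAt (σ : Π x, V x) (x : B) : Prop :=
  MDifferentiableAt I (I.prod 𝓘(ℂ, F)) (fun y => TotalSpace.mk' F y (σ y)) x

theorem HolSecAt.diffSecAt {σ : Π x, V x} {x : B} (h : HolSecAt I F σ x) : DiffSecAt I F σ x :=
  ContMDiffAt.mdifferentiableAt h (by simp)

theorem HolSecAt.congr {σ τ : Π x, V x} {x : B} (h : HolSecAt I F σ x)
    (hστ : ∀ᶠ y in 𝓝 x, τ y = σ y) : HolSecAt I F τ x :=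
  ContMDiffAt.congr_of_eventuallyEq h (hστ.mono fun y hy => by simp only [hy])

theorem DiffSecAt.congr {σ τ : Π x, V x} {x : B} (h : DiffSecAt I F σ x)
    (hστ : ∀ᶠ y in 𝓝 x, τ y = σ y) : DiffSecAt I F τ x :=
  MDifferentiableAt.congr_of_eventuallyEq h (hστ.mono fun y hy => by simp only [hy])

theorem HolFunAt.congr {f g : B → ℂ} {x : B} (h : HolFunAt I f x)
    (hfg : ∀ᶠ y in 𝓝 x, g y = f y) : HolFunAt I g x :=
  ContMDiffAt.congr_of_eventuallyEq h hfg

theorem HolFunAt.mdifferentiableAt {f : B → ℂ} {x : B} (h : HolFunAt I f x) :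
    MDifferentiableAt I 𝓘(ℂ, ℂ) f x :=
  ContMDiffAt.mdifferentiableAt h (by simp)

theorem HolFunAt.const (c : ℂ) (x : B) : HolFunAt I (fun _ => c) x := contMDiffAt_const

theorem HolFunAt.mul {f g : B → ℂ} {x : B} (hf : HolFunAt I f x) (hg : HolFunAt I g x) :
    HolFunAt I (fun y => f y * g y) x :=
  ContMDiffAt.smul hf hg

theorem HolFunAt.sum {ι : Type*} {s : Finset ι} {f : ι → B → ℂ} {x : B}
    (hf : ∀ i ∈ s, HolFunAt I (f i) x) : HolFunAt I (fun y => ∑ i ∈ s, f i y) x :=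
  contMDiffAt_finsetSum hf

theorem HolFunAt.prod {ι : Type*} {s : Finset ι} {f : ι → B → ℂ} {x : B}
    (hf : ∀ i ∈ s, HolFunAt I (f i) x) : HolFunAt I (fun y => ∏ i ∈ s, f i y) x := by
  classical
  induction s using Finset.induction_on with
  | empty => simpa using HolFunAt.const 1 x
  | insert a s ha ih =>
    simp only [Finset.prod_insert ha]
    exact (hf a (by simp)).mul (ih fun i hi => hf i (by simp [hi]))

theorem HolFunAt.comp_analyticAt {f : B → ℂ} {x : B} {g : ℂ → ℂ} (hg : ContDiffAt ℂ ω g (f x))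
    (hf : HolFunAt I f x) : HolFunAt I (fun y => g (f y)) x :=
  ContMDiffAt.comp x (g := g) hg.contMDiffAt hf

theorem HolFunAt.inv {f : B → ℂ} {x : B} (hf : HolFunAt I f x) (h0 : f x ≠ 0) :
    HolFunAt I (fun y => (f y)⁻¹) x :=
  hf.comp_analyticAt (contDiffAt_inv ℂ h0)

theorem HolFunAt.continuousAt {f : B → ℂ} {x : B} (h : HolFunAt I f x) : ContinuousAt f x :=
  ContMDiffAt.continuousAt h

theorem HolFunAt.eventually [IsManifold I ω B] {f : B → ℂ} {x : B} (h : HolFunAt I f x) :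
    ∀ᶠ y in 𝓝 x, HolFunAt I f y :=
  (contMDiffAt_iff_contMDiffAt_nhds (by simp)).1 h

variable [VectorBundle ℂ F V]

theorem HolSecAt.eventually [IsManifold I ω B] [ContMDiffVectorBundle ω F V I] {σ : Π x, V x}
    {x : B} (h : HolSecAt I F σ x) :
    ∀ᶠ y in 𝓝 x, HolSecAt I F σ y :=
  (contMDiffAt_iff_contMDiffAt_nhds (by simp)).1 h

theorem HolSecAt.add {σ τ : Π x, V x} {x : B} (hσ : HolSecAt I F σ x) (hτ : HolSecAt I F τ x) :
    HolSecAt I F (fun y => σ y + τ y) x :=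
  ContMDiffAt.add_section hσ hτ

theorem HolSecAt.sub {σ τ : Π x, V x} {x : B} (hσ : HolSecAt I F σ x) (hτ : HolSecAt I F τ x) :
    HolSecAt I F (fun y => σ y - τ y) x :=
  ContMDiffAt.sub_section hσ hτ

theorem HolSecAt.neg {σ : Π x, V x} {x : B} (hσ : HolSecAt I F σ x) :
    HolSecAt I F (fun y => - σ y) x :=
  ContMDiffAt.neg_section hσ

theorem HolSecAt.smul {f : B → ℂ} {σ : Π x, V x} {x : B} (hf : HolFunAt I f x)
    (hσ : HolSecAt I F σ x) : HolSecAt I F (fun y => f y • σ y) x :=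
  ContMDiffAt.smul_section hf hσ

theorem HolSecAt.const_smul (c : ℂ) {σ : Π x, V x} {x : B}
    (hσ : HolSecAt I F σ x) : HolSecAt I F (fun y => c • σ y) x :=
  HolSecAt.smul (HolFunAt.const c x) hσ

theorem HolSecAt.sum {ι : Type*} {s : Finset ι} {σ : ι → Π x, V x} {x : B}
    (hσ : ∀ i ∈ s, HolSecAt I F (σ i) x) : HolSecAt I F (fun y => ∑ i ∈ s, σ i y) x :=
  ContMDiffAt.sum_section hσ

theorem DiffSecAt.add {σ τ : Π x, V x} {x : B} (hσ : DiffSecAt I F σ x) (hτ : DiffSecAt I F τ x) :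
    DiffSecAt I F (fun y => σ y + τ y) x :=
  mdifferentiableAt_add_section hσ hτ

theorem DiffSecAt.smul {f : B → ℂ} {σ : Π x, V x} {x : B} (hf : MDifferentiableAt I 𝓘(ℂ, ℂ) f x)
    (hσ : DiffSecAt I F σ x) : DiffSecAt I F (fun y => f y • σ y) x :=
  MDifferentiableAt.smul_section hf hσ

theorem DiffSecAt.sum {ι : Type*} {s : Finset ι} {σ : ι → Π x, V x} {x : B}
    (hσ : ∀ i, DiffSecAt I F (σ i) x) : DiffSecAt I F (fun y => ∑ i ∈ s, σ i y) x :=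
  MDifferentiableAt.sum_section fun i _ => hσ i

theorem holSecAt_zero [ContMDiffVectorBundle ω F V I] (x : B) : HolSecAt I F (fun y => (0 : V y))
    x :=
  contMDiff_zeroSection ℂ V x

theorem exists_holSecAt_eq [IsManifold I ω B] [ContMDiffVectorBundle ω F V I] (x : B) (a : V x) :
    ∃ σ : Π x, V x, HolSecAt I F σ x ∧ σ x = a :=
  ⟨FiberBundle.extend F a, FiberBundle.contMDiffAt_extend I F a, FiberBundle.extend_apply_self F a⟩

variable (I F) in
/-- The sections `e i` form a holomorphic frame near `x`. -/
structure IsHolFrameAt {ι : Type*} [Fintype ι] (e : ι → Π x, V x) (x : B) : Prop where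
  hol : ∀ i, HolSecAt I F (e i) x
  linearIndependent : LinearIndependent ℂ fun i => e i x
  exists_coeff : ∀ σ : Π x, V x, ∃ c : ι → B → ℂ, (∀ᶠ y in 𝓝 x, σ y = ∑ i, c i y • e i y) ∧
    (HolSecAt I F σ x → ∀ i, HolFunAt I (c i) x) ∧
    (DiffSecAt I F σ x → ∀ i, MDifferentiableAt I 𝓘(ℂ, ℂ) (c i) x)

theorem IsHolFrameAt.congr {ι : Type*} [Fintype ι] {e e' : ι → Π x, V x} {x : B}
    (h : IsHolFrameAt I F e x) (hee' : ∀ᶠ y in 𝓝 x, ∀ i, e' i y = e i y) :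
    IsHolFrameAt I F e' x := by
  refine ⟨fun i => (h.hol i).congr (hee'.mono fun y hy => hy i), ?_, fun σ => ?_⟩
  · have : (fun i => e' i x) = fun i => e i x := funext hee'.self_of_nhds
    rw [this]
    exact h.linearIndependent
  · obtain ⟨c, h1, h2⟩ := h.exists_coeff σ
    refine ⟨c, ?_, h2⟩
    filter_upwards [h1, hee'] with y hy hy'
    simp only [hy, hy']

/-- The coefficients of a section are the coordinates of its local expression in the trivialization,
so they inherit its regularity. -/
theorem isHolFrameAt_trivialization [FiniteDimensional ℂ F] [IsManifold I ω B]
    [ContMDiffVectorBundle ω F V I] (e : Trivialization F (π F V)) [MemTrivializationAtlas e]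
    {x : B} (hx : x ∈ e.baseSet) {ι : Type*} [Fintype ι] (b : Module.Basis ι ℂ F) :
    IsHolFrameAt I F (fun i y => e.symm y (b i)) x := by
  have hev : ∀ᶠ y in 𝓝 x, y ∈ e.baseSet := e.open_baseSet.mem_nhds hx
  refine ⟨fun i => ?_, ?_, fun σ => ⟨fun i y => b.repr (e ⟨y, σ y⟩).2 i, ?_, fun h i => ?_, fun h
      i => ?_⟩⟩
  · unfold HolSecAt
    rw [e.contMDiffAt_section_iff hx]
    refine contMDiffAt_const (c := b i) |>.congr_of_eventuallyEq ?_
    filter_upwards [hev] with y hy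
    rw [e.apply_mk_symm hy]
  · have : (fun i => e.symm x (b i)) = (e.linearEquivAt ℂ x hx).symm.toLinearMap ∘ b := by
      ext i; simp
    rw [this]
    exact b.linearIndependent.map' _ (LinearEquiv.ker _)
  · filter_upwards [hev] with y hy
    have h1 : (e.linearEquivAt ℂ y hy).symm (∑ i, b.repr (e ⟨y, σ y⟩).2 i • b i) = σ y := by
      rw [b.sum_repr, LinearEquiv.symm_apply_eq]; rfl
    refine h1.symm.trans ?_
    rw [map_sum]
    simp
  · have h' := (e.contMDiffAt_section_iff hx).1 h
    exact ContMDiffAt.comp (g := LinearMap.toContinuousLinearMap (b.coord i)) x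
        (ContinuousLinearMap.contMDiffAt _) h'
  · have h' := (e.mdifferentiableAt_section_iff I _ hx).1 h
    exact MDifferentiableAt.comp (g := LinearMap.toContinuousLinearMap (b.coord i)) x
        ((ContinuousLinearMap.differentiableAt _).mdifferentiableAt) h'

variable (I F V) in
theorem exists_isHolFrameAt [FiniteDimensional ℂ F] [IsManifold I ω B]
    [ContMDiffVectorBundle ω F V I] (x : B) :
    ∃ e : Fin (Module.finrank ℂ F) → Π x, V x, IsHolFrameAt I F e x :=
  ⟨_, isHolFrameAt_trivialization (trivializationAt F V x) (mem_baseSet_trivializationAt F V x)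
    (Module.finBasis ℂ F)⟩

variable {F' : Type*} [NormedAddCommGroup F'] [NormedSpace ℂ F']
  {W : B → Type*} [TopologicalSpace (TotalSpace F' W)] [∀ x, AddCommGroup (W x)]
  [∀ x, Module ℂ (W x)] [∀ x, TopologicalSpace (W x)] [FiberBundle F' W] [VectorBundle ℂ F' W]

/-- Expansion in the frame. It allows holomorphy of fibrewise linear maps to be expressed through
sections, without a bundle of homomorphisms. -/
theorem IsHolFrameAt.holSecAt_map {ι : Type*} [Fintype ι] {e : ι → Π x, V x} {x : B}
    (he : IsHolFrameAt I F e x) {A : Π x, V x →ₗ[ℂ] W x}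
    (hA : ∀ i, HolSecAt I F' (fun y => A y (e i y)) x) {σ : Π x, V x} (hσ : HolSecAt I F σ x) :
    HolSecAt I F' (fun y => A y (σ y)) x := by
  obtain ⟨c, h1, h2, -⟩ := he.exists_coeff σ
  refine (HolSecAt.sum (s := Finset.univ) fun i _ => (hA i).smul (h2 hσ i)).congr ?_
  filter_upwards [h1] with y hy
  rw [hy]
  simp

theorem IsHolFrameAt.diffSecAt_map {ι : Type*} [Fintype ι] {e : ι → Π x, V x} {x : B}
    (he : IsHolFrameAt I F e x) {A : Π x, V x →ₗ[ℂ] W x}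
    (hA : ∀ i, HolSecAt I F' (fun y => A y (e i y)) x) {σ : Π x, V x} (hσ : DiffSecAt I F σ x) :
    DiffSecAt I F' (fun y => A y (σ y)) x := by
  obtain ⟨c, h1, -, h2⟩ := he.exists_coeff σ
  refine (DiffSecAt.sum (s := Finset.univ) fun i => (hA i).diffSecAt.smul (h2 hσ i)).congr ?_
  filter_upwards [h1] with y hy
  rw [hy]
  simp

theorem HolFunAt.matrix_det {n : ℕ} {a : B → Matrix (Fin n) (Fin n) ℂ} {x : B}
    (ha : ∀ i j, HolFunAt I (fun y => a y i j) x) : HolFunAt I (fun y => (a y).det) x := by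
  simp only [Matrix.det_apply']
  exact HolFunAt.sum fun σ _ => (HolFunAt.const _ x).mul (HolFunAt.prod fun i _ => ha _ _)

/-- Cramer's rule: the adjugate and the determinant are polynomials in the entries. -/
theorem HolFunAt.matrix_inv {n : ℕ} {a : B → Matrix (Fin n) (Fin n) ℂ} {x : B}
    (ha : ∀ i j, HolFunAt I (fun y => a y i j) x) (hx : (a x).det ≠ 0) (i j : Fin n) :
    HolFunAt I (fun y => (a y)⁻¹ i j) x := by
  simp only [Matrix.inv_def, Matrix.smul_apply, Ring.inverse_eq_inv', Matrix.adjugate_apply,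
    smul_eq_mul]
  refine ((HolFunAt.matrix_det ha).inv hx).mul (HolFunAt.matrix_det fun k l => ?_)
  by_cases hk : k = j
  · subst hk
    simpa [Matrix.updateRow_self] using HolFunAt.const _ x
  · simpa [Matrix.updateRow_ne hk] using ha k l

/-- Fibrewise isomorphisms preserving holomorphic sections reflect them as well. -/
theorem holSecAt_of_map [FiniteDimensional ℂ F] [IsManifold I ω B]
    [ContMDiffVectorBundle ω F V I] {V' : B → Type*} [TopologicalSpace (TotalSpace F V')]
    [∀ x, AddCommGroup (V' x)] [∀ x, Module ℂ (V' x)] [∀ x, TopologicalSpace (V' x)]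
    [FiberBundle F V'] [VectorBundle ℂ F V'] [ContMDiffVectorBundle ω F V' I]
    (A : Π x, V x ≃ₗ[ℂ] V' x) {x : B}
    (hA : ∀ σ, HolSecAt I F σ x → HolSecAt I F (fun y => A y (σ y)) x) {σ : Π x, V x}
    (hσ : HolSecAt I F (fun y => A y (σ y)) x) : HolSecAt I F σ x := by
  obtain ⟨e, he⟩ := exists_isHolFrameAt I F V x
  obtain ⟨e', he'⟩ := exists_isHolFrameAt I F V' x
  choose c hc hc' _ using fun i => he'.exists_coeff fun y => A y (e i y)
  obtain ⟨d, hd, hd', _⟩ := he'.exists_coeff fun y => A y (σ y)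
  -- The matrix of `A` in the two frames. It is invertible at `x` because `A x` is injective and the
  -- frame is independent, hence invertible near `x`. Its inverse has holomorphic entries and
  -- expresses `σ` through the coefficients of `A σ`.
  set a : B → Matrix (Fin (Module.finrank ℂ F)) (Fin (Module.finrank ℂ F)) ℂ :=
    fun y => Matrix.of fun j i => c i j y with ha
  have ha' : ∀ i j, HolFunAt I (fun y => a y i j) x := fun i j => hc' j (hA _ (he.hol j)) i
  have hcx : ∀ᶠ y in 𝓝 x, ∀ i, A y (e i y) = ∑ j, c i j y • e' j y := eventually_all.2 hc
  have hdet : (a x).det ≠ 0 := by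
    intro h0
    obtain ⟨u, hu0, hu⟩ := Matrix.exists_mulVec_eq_zero_iff.2 h0
    refine hu0 (funext fun i => Fintype.linearIndependent_iff.1 he.linearIndependent u ?_ i)
    apply (A x).injective
    have hcx' := hcx.self_of_nhds
    rw [map_sum, map_zero]
    simp_rw [map_smul, hcx', Finset.smul_sum, smul_smul]
    rw [Finset.sum_comm]
    refine Finset.sum_eq_zero fun j _ => ?_
    rw [← Finset.sum_smul]
    have h2 := congrFun hu j
    simp only [Matrix.mulVec, dotProduct, ha, Matrix.of_apply, Pi.zero_apply] at h2
    rw [Finset.sum_congr rfl fun i _ => mul_comm (u i) (c i j x), h2, zero_smul]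
  have hdet' : ∀ᶠ y in 𝓝 x, (a y).det ≠ 0 :=
    (HolFunAt.matrix_det ha').continuousAt.eventually_ne hdet
  refine (HolSecAt.sum (s := Finset.univ) fun i _ => (he.hol i).smul
    (HolFunAt.sum (s := Finset.univ) fun j _ =>
      (HolFunAt.matrix_inv ha' hdet i j).mul (hd' hσ j))).congr ?_
  filter_upwards [hdet', hcx, hd] with y hy hcy hdy
  apply (A y).injective
  rw [hdy, map_sum]
  simp_rw [map_smul, hcy, Finset.smul_sum, smul_smul]
  rw [Finset.sum_comm]
  refine Finset.sum_congr rfl fun j _ => ?_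
  rw [← Finset.sum_smul]
  congr 1
  have h1 : (a y).mulVec ((a y)⁻¹.mulVec fun j => d j y) = fun j => d j y := by
    rw [Matrix.mulVec_mulVec, Matrix.mul_nonsing_inv _ (isUnit_iff_ne_zero.2 hy), Matrix.one_mulVec]
  have h2 := congrFun h1 j
  rw [← h2]
  simp only [Matrix.mulVec, dotProduct, ha, Matrix.of_apply]
  exact Finset.sum_congr rfl fun i _ => mul_comm _ _

end Basics

/-! ### Pullback of sections and frames along holomorphic maps -/

section Pullback

variable {EB : Type*} [NormedAddCommGroup EB] [NormedSpace ℂ EB]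
  {HB : Type*} [TopologicalSpace HB] {I : ModelWithCorners ℂ EB HB}
  {B : Type*} [TopologicalSpace B] [ChartedSpace HB B]
  {EB' : Type*} [NormedAddCommGroup EB'] [NormedSpace ℂ EB']
  {HB' : Type*} [TopologicalSpace HB'] {I' : ModelWithCorners ℂ EB' HB'}
  {B' : Type*} [TopologicalSpace B'] [ChartedSpace HB' B']
  {F : Type*} [NormedAddCommGroup F] [NormedSpace ℂ F]
  {V : B → Type*} [TopologicalSpace (TotalSpace F V)] [∀ x, AddCommGroup (V x)]
  [∀ x, Module ℂ (V x)] [∀ x, TopologicalSpace (V x)] [FiberBundle F V] [VectorBundle ℂ F V]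
  (f : C^ω⟮I', B'; I, B⟯)

/-- The pullback carries the pulled back trivializations, so both sides have the same fibre
component in local coordinates, and the base component `f` is holomorphic anyway. -/
theorem holSecAt_pullback_iff [IsManifold I ω B] [ContMDiffVectorBundle ω F V I]
    {σ : Π y, (f *ᵖ V) y} {y : B'} :
    HolSecAt I' F σ y ↔ ContMDiffAt I' (I.prod 𝓘(ℂ, F)) ω
        (fun y => TotalSpace.mk' F (f y) (σ y : V (f y))) y := by
  rw [HolSecAt, contMDiffAt_section, contMDiffAt_totalSpace]
  exact ⟨fun h => ⟨f.contMDiff y, h⟩, fun h => h.2⟩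

theorem HolSecAt.pullback [IsManifold I ω B] [ContMDiffVectorBundle ω F V I] {s : Π x, V x} {y : B'}
    (h : HolSecAt I F s (f y)) :
    HolSecAt (V := f *ᵖ V) I' F (fun y => s (f y)) y :=
  (holSecAt_pullback_iff f).2 (ContMDiffAt.comp y (g :=
      fun x => TotalSpace.mk' F x (s x)) h (f.contMDiff y))

theorem DiffSecAt.pullback [IsManifold I ω B] [ContMDiffVectorBundle ω F V I] {s : Π x, V x}
    {y : B'} (h : DiffSecAt I F s (f y)) :
    DiffSecAt (V := f *ᵖ V) I' F (fun y => s (f y)) y := by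
  have h2 := (mdifferentiableAt_section _ _).1 h
  refine (mdifferentiableAt_section _ _).2 ?_
  exact MDifferentiableAt.comp (g := fun b => ((trivializationAt F V (f y))
      (TotalSpace.mk' F b (s b))).2) y h2 ((f.contMDiff y).mdifferentiableAt (by simp))

/-- The vector with constant coordinates in the trivialization of `V` also has these coordinates in
the trivialization of the pullback. -/
theorem isHolFrameAt_pullback_trivialization [FiniteDimensional ℂ F] [IsManifold I ω B]
    [IsManifold I' ω B']
    [ContMDiffVectorBundle ω F V I] (y : B')
    {ι : Type*} [Fintype ι] (b : Module.Basis ι ℂ F) :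
    IsHolFrameAt (V := f *ᵖ V) I' F (fun i y' => (trivializationAt F V (f y)).symm (f y') (b i))
        y :=
  by
  refine (isHolFrameAt_trivialization (I := I') (trivializationAt F (f *ᵖ V) y)
    (mem_baseSet_trivializationAt F (f *ᵖ V) y) b).congr ?_
  filter_upwards [(trivializationAt F (f *ᵖ V) y).open_baseSet.mem_nhds
    (mem_baseSet_trivializationAt F (f *ᵖ V) y)] with y' hy' i
  refine ((trivializationAt F (f *ᵖ V) y).linearEquivAt ℂ y' hy').injective ?_
  have h1 : (trivializationAt F (f *ᵖ V) y ⟨y', (trivializationAt F (f *ᵖ V) y).symm y' (b i)⟩).2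
      = b i := by
    rw [Trivialization.apply_mk_symm _ hy']
  have h2 : (trivializationAt F V (f y) ⟨f y', (trivializationAt F V (f y)).symm (f y') (b i)⟩).2
      = b i := by
    rw [Trivialization.apply_mk_symm (trivializationAt F V (f y)) hy']
  exact h2.trans h1.symm

/-- The reduction used throughout for pulled back bundles: an arbitrary section has holomorphic
coefficients with respect to sections that come from the base. -/
theorem exists_isHolFrameAt_pullback [FiniteDimensional ℂ F] [IsManifold I ω B]
    [IsManifold I' ω B'] [ContMDiffVectorBundle ω F V I] (y : B') :
    ∃ e : Fin (Module.finrank ℂ F) → Π x, V x, IsHolFrameAt I F e (f y) ∧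
      IsHolFrameAt (V := f *ᵖ V) I' F (fun i y' => e i (f y')) y :=
  ⟨_, isHolFrameAt_trivialization (trivializationAt F V (f y))
    (mem_baseSet_trivializationAt F V (f y)) (Module.finBasis ℂ F),
    isHolFrameAt_pullback_trivialization f y (Module.finBasis ℂ F)⟩

theorem HolSecAt.pullback_map [FiniteDimensional ℂ F] [IsManifold I ω B]
    [IsManifold I' ω B'] [ContMDiffVectorBundle ω F V I]
    {F' : Type*} [NormedAddCommGroup F'] [NormedSpace ℂ F']
    {W : B → Type*} [TopologicalSpace (TotalSpace F' W)] [∀ x, AddCommGroup (W x)]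
    [∀ x, Module ℂ (W x)] [∀ x, TopologicalSpace (W x)] [FiberBundle F' W] [VectorBundle ℂ F' W]
    [ContMDiffVectorBundle ω F' W I]
    (A : Π x, V x →ₗ[ℂ] W x) {y : B'}
    (hA : ∀ s, HolSecAt I F s (f y) → HolSecAt I F' (fun x => A x (s x)) (f y))
    {σ : Π y, (f *ᵖ V) y} (hσ : HolSecAt I' F σ y) :
    HolSecAt (V := f *ᵖ W) I' F' (fun y => A (f y) (σ y)) y := by
  obtain ⟨e, he, he'⟩ := exists_isHolFrameAt_pullback (I := I) (F := F) (V := V) f y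
  exact he'.holSecAt_map (I := I') (W := f *ᵖ W) (A := fun y => A (f y))
    (fun i => HolSecAt.pullback (I := I) (V := W) f (hA _ (he.hol i))) hσ

end Pullback

/-! ### Isomorphisms of holomorphic bundles -/

section HolIso

variable {EB : Type*} [NormedAddCommGroup EB] [NormedSpace ℂ EB]
  {HB : Type*} [TopologicalSpace HB] {I : ModelWithCorners ℂ EB HB}
  {B : Type*} [TopologicalSpace B] [ChartedSpace HB B] [IsManifold I ω B]
  {F : Type*} [NormedAddCommGroup F] [NormedSpace ℂ F] [FiniteDimensional ℂ F]
  {V : B → Type*} [TopologicalSpace (TotalSpace F V)] [∀ x, AddCommGroup (V x)]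
  [∀ x, Module ℂ (V x)] [∀ x, TopologicalSpace (V x)] [FiberBundle F V] [VectorBundle ℂ F V]
  [ContMDiffVectorBundle ω F V I]
  {V' : B → Type*} [TopologicalSpace (TotalSpace F V')] [∀ x, AddCommGroup (V' x)]
  [∀ x, Module ℂ (V' x)] [∀ x, TopologicalSpace (V' x)] [FiberBundle F V'] [VectorBundle ℂ F V']
  [ContMDiffVectorBundle ω F V' I]

variable (I F) in
/-- Fibrewise isomorphisms preserving holomorphic sections. -/
noncomputable def HolIso.ofMap (A : Π x, V x ≃ₗ[ℂ] V' x)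
    (hA : ∀ x σ, HolSecAt I F σ x → HolSecAt I F (fun y => A y (σ y)) x) : HolIso I F V V' where
  toEquiv := A
  holSec_iff σ x := ⟨hA x σ, holSecAt_of_map A (hA x)⟩

/-- The inverse isomorphism. -/
def HolIso.symm (φ : HolIso I F V V') : HolIso I F V' V where
  toEquiv x := (φ.toEquiv x).symm
  holSec_iff σ x := by
    rw [φ.holSec_iff]
    simp

theorem HolIso.diffSecAt (φ : HolIso I F V V') {σ : Π x, V x} {x : B} (h : DiffSecAt I F σ x) :
    DiffSecAt I F (fun y => φ.toEquiv y (σ y)) x := by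
  obtain ⟨e, he⟩ := exists_isHolFrameAt I F V x
  exact he.diffSecAt_map (A := fun y => (φ.toEquiv y).toLinearMap)
    (fun i => (φ.holSec_iff _ _).1 (he.hol i)) h

/-- The pullback of an isomorphism along a holomorphic map. -/
noncomputable def HolIso.pullback {EB' : Type*} [NormedAddCommGroup EB'] [NormedSpace ℂ EB']
    {HB' : Type*} [TopologicalSpace HB'] {I' : ModelWithCorners ℂ EB' HB'}
    {B' : Type*} [TopologicalSpace B'] [ChartedSpace HB' B'] [IsManifold I' ω B']
    (φ : HolIso I F V V') (f : C^ω⟮I', B'; I, B⟯) : HolIso I' F (f *ᵖ V) (f *ᵖ V') :=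
  HolIso.ofMap I' F (V := f *ᵖ V) (V' := f *ᵖ V') (fun y => φ.toEquiv (f y)) fun y _ hσ =>
    HolSecAt.pullback_map f (fun x => (φ.toEquiv x).toLinearMap)
      (fun s hs => (φ.holSec_iff s (f y)).1 hs) hσ

end HolIso

end HolBundle

/-! ### Coordinates, involutions and holomorphic functions on the projective line -/

namespace RiemannSphere

@[simp] theorem zCoord_coe (z : ℂ) : zCoord (z : P1) = z := rfl

@[simp] theorem zCoord_infty : zCoord OnePoint.infty = 0 := rfl

@[simp] theorem neg_coe (z : ℂ) : neg (z : P1) = ((-z : ℂ) : P1) := rfl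

@[simp] theorem neg_infty : neg OnePoint.infty = OnePoint.infty := rfl

theorem neg_neg (p : P1) : neg (neg p) = p := by
  induction p using OnePoint.rec with
  | infty => rfl
  | coe z => simp

theorem coe_zCoord {p : P1} (hp : p ≠ OnePoint.infty) : (zCoord p : P1) = p := by
  obtain ⟨z, rfl⟩ := OnePoint.ne_infty_iff_exists.1 hp
  rfl

theorem zCoord_ne_zero {p : P1} (hp : p ∈ Cstar) : zCoord p ≠ 0 := by
  obtain ⟨z, rfl⟩ := OnePoint.ne_infty_iff_exists.1 hp.2
  rintro h
  exact hp.1 (by rw [← h]; rfl)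

theorem zCoord_neg (p : P1) : zCoord (neg p) = - zCoord p := by
  induction p using OnePoint.rec with
  | infty => simp
  | coe z => simp

@[simp] theorem coe_mem_Cstar {z : ℂ} : (z : P1) ∈ Cstar ↔ z ≠ 0 := by
  simp [Cstar]

theorem neg_mem_Cstar {p : P1} (hp : p ∈ Cstar) : neg p ∈ Cstar := by
  obtain ⟨z, rfl⟩ := OnePoint.ne_infty_iff_exists.1 hp.2
  simpa using hp

theorem isOpen_Cstar : IsOpen Cstar := by
  have : Cstar = {((0 : ℂ) : P1)}ᶜ ∩ {OnePoint.infty}ᶜ := by ext p; simp [Cstar]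
  rw [this]
  exact isClosed_singleton.isOpen_compl.inter isClosed_singleton.isOpen_compl

theorem eventually_ne_infty {p : P1} (hp : p ≠ OnePoint.infty) :
    ∀ᶠ q in 𝓝 p, q ≠ OnePoint.infty := eventually_ne_nhds hp

theorem mem_chartZero_source {p : P1} : p ∈ chartZero.source ↔ p ≠ OnePoint.infty := by
  rw [chartZero_source]
  exact OnePoint.ne_infty_iff_exists.symm

theorem chartZero_mem_maximalAtlas : chartZero ∈ IsManifold.maximalAtlas 𝓘(ℂ, ℂ) ω P1 :=
  IsManifold.subset_maximalAtlas (by simp [atlas, ChartedSpace.atlas])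

theorem chartInfty_mem_maximalAtlas : chartInfty ∈ IsManifold.maximalAtlas 𝓘(ℂ, ℂ) ω P1 :=
  IsManifold.subset_maximalAtlas (by simp [atlas, ChartedSpace.atlas])

theorem contMDiff_coe : ContMDiff 𝓘(ℂ, ℂ) 𝓘(ℂ, ℂ) ω ((↑) : ℂ → P1) := by
  have h := contMDiffOn_symm_of_mem_maximalAtlas chartZero_mem_maximalAtlas
  rw [chartZero_target] at h
  exact (contMDiffOn_univ.1 h).congr fun z => (chartZero_symm_apply z).symm

theorem contMDiffAt_zCoord {p : P1} (hp : p ≠ OnePoint.infty) :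
    ContMDiffAt 𝓘(ℂ, ℂ) 𝓘(ℂ, ℂ) ω zCoord p := by
  have h := contMDiffAt_of_mem_maximalAtlas chartZero_mem_maximalAtlas (mem_chartZero_source.2 hp)
  refine h.congr_of_eventuallyEq ?_
  filter_upwards [eventually_ne_infty hp] with q hq
  obtain ⟨z, rfl⟩ := OnePoint.ne_infty_iff_exists.1 hq
  rw [chartZero_coe, zCoord_coe]

theorem zCoord_invFun (p : P1) : zCoord (invFun p) = (zCoord p)⁻¹ := by
  induction p using OnePoint.rec with
  | infty => simp [invFun_infty]
  | coe z =>
    by_cases hz : z = 0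
    · subst hz; simp [invFun_zero]
    · simp [invFun_coe hz]

theorem invFun_ne_infty {p : P1} (hp : p ≠ ((0 : ℂ) : P1)) : invFun p ≠ OnePoint.infty := by
  intro h
  apply hp
  rw [← invFun_invFun p, h, invFun_infty]

/-- Near `0` the inversion is the coordinate `z` followed by the inverse of the chart at `∞`;
elsewhere it is the chart at `∞` followed by the inclusion of `ℂ`. -/
theorem contMDiff_invFun : ContMDiff 𝓘(ℂ, ℂ) 𝓘(ℂ, ℂ) ω invFun := by
  intro p
  by_cases hp : p = ((0 : ℂ) : P1)
  · have h1 := contMDiffOn_symm_of_mem_maximalAtlas chartInfty_mem_maximalAtlas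
    have htgt : chartInfty.target = univ := by simp [chartInfty, chartZero_target]
    rw [htgt, contMDiffOn_univ] at h1
    have h2 : ContMDiffAt 𝓘(ℂ, ℂ) 𝓘(ℂ, ℂ) ω zCoord p :=
      contMDiffAt_zCoord (by rw [hp]; exact OnePoint.coe_ne_infty 0)
    refine (h1.contMDiffAt.comp p h2).congr_of_eventuallyEq ?_
    filter_upwards [eventually_ne_infty (p := p) (by rw [hp]; exact OnePoint.coe_ne_infty 0)]
      with q hq
    obtain ⟨z, rfl⟩ := OnePoint.ne_infty_iff_exists.1 hq
    simp [chartInfty, invHomeo, chartZero_symm_apply]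
  · have hp' : p ∈ chartInfty.source := by
      simp only [chartInfty, OpenPartialHomeomorph.trans_source,
        Homeomorph.toOpenPartialHomeomorph_source,
        mem_inter_iff, mem_univ, true_and, mem_preimage]
      exact mem_chartZero_source.2 (invFun_ne_infty hp)
    have h1 := contMDiffAt_of_mem_maximalAtlas chartInfty_mem_maximalAtlas hp'
    refine (contMDiff_coe.contMDiffAt.comp p h1).congr_of_eventuallyEq ?_
    filter_upwards [chartInfty.open_source.mem_nhds hp'] with q hq
    have hq' : invFun q ≠ OnePoint.infty := by
      simp only [chartInfty, OpenPartialHomeomorph.trans_source,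
        Homeomorph.toOpenPartialHomeomorph_source,
        mem_inter_iff, mem_univ, true_and, mem_preimage] at hq
      exact mem_chartZero_source.1 hq
    obtain ⟨z, hz⟩ := OnePoint.ne_infty_iff_exists.1 hq'
    have : chartInfty q = z := by
      change chartZero (invFun q) = z
      rw [← hz, chartZero_coe]
    simp [this, hz]

theorem contMDiffAt_inv_zCoord {p : P1} (hp : p ≠ ((0 : ℂ) : P1)) :
    ContMDiffAt 𝓘(ℂ, ℂ) 𝓘(ℂ, ℂ) ω (fun q => (zCoord q)⁻¹) p := by
  have h := (contMDiffAt_zCoord (invFun_ne_infty hp)).comp p contMDiff_invFun.contMDiffAt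
  exact h.congr_of_eventuallyEq (Eventually.of_forall fun q => (zCoord_invFun q).symm)

theorem neg_eq_invFun_neg_invFun (p : P1) : neg p = invFun (neg (invFun p)) := by
  induction p using OnePoint.rec with
  | infty => simp [invFun_infty, invFun_zero]
  | coe z =>
    by_cases hz : z = 0
    · subst hz; simp [invFun_zero, invFun_infty]
    · rw [invFun_coe hz, neg_coe, neg_coe, invFun_coe (by simpa using hz)]
      congr 1; rw [inv_neg, inv_inv]

/-- Negation is its own conjugate under the inversion, which reduces the point `∞` to the point `0`.
-/
theorem contMDiff_neg : ContMDiff 𝓘(ℂ, ℂ) 𝓘(ℂ, ℂ) ω neg := by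
  have key : ∀ p : P1, p ≠ OnePoint.infty → ContMDiffAt 𝓘(ℂ, ℂ) 𝓘(ℂ, ℂ) ω neg p := by
    intro p hp
    have h1 : ContMDiff 𝓘(ℂ, ℂ) 𝓘(ℂ, ℂ) ω (fun z : ℂ => ((-z : ℂ) : P1)) :=
      contMDiff_coe.comp contDiff_neg.contMDiff
    refine (h1.contMDiffAt.comp p (contMDiffAt_zCoord hp)).congr_of_eventuallyEq ?_
    filter_upwards [eventually_ne_infty hp] with q hq
    obtain ⟨z, rfl⟩ := OnePoint.ne_infty_iff_exists.1 hq
    simp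
  intro p
  by_cases hp : p = OnePoint.infty
  · have h1 := key (invFun p) (by rw [hp, invFun_infty]; exact OnePoint.coe_ne_infty 0)
    have h2 := contMDiff_invFun.contMDiffAt.comp p (h1.comp p contMDiff_invFun.contMDiffAt)
    exact h2.congr_of_eventuallyEq (Eventually.of_forall neg_eq_invFun_neg_invFun)
  · exact key p hp

/-- Holomorphic functions on the projective line are constant. -/
theorem apply_eq_of_contMDiff {G : Type*} [NormedAddCommGroup G] [NormedSpace ℂ G] {f : P1 → G}
    (hf : ContMDiff 𝓘(ℂ, ℂ) 𝓘(ℂ, G) ω f) (p q : P1) : f p = f q :=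
  MDifferentiable.apply_eq_of_compactSpace (hf.mdifferentiable (by simp)) p q

theorem tendsto_coe_cocompact : Tendsto ((↑) : ℂ → P1) (cocompact ℂ) (𝓝 OnePoint.infty) := by
  have h := OnePoint.tendsto_coe_infty (X := ℂ)
  rwa [coclosedCompact_eq_cocompact] at h

/-- A function on `ℂ^*` with at most a simple pole at `0` and a limit at `∞` is of the form
`A + z⁻¹ B`. -/
theorem eq_add_inv_smul {G : Type*} [NormedAddCommGroup G] [NormedSpace ℂ G] [CompleteSpace G]
    {f k : ℂ → G} {A : G} (hf : ∀ z ≠ 0, DifferentiableAt ℂ f z) (hk : DifferentiableAt ℂ k 0)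
    (hfk : ∀ᶠ z in 𝓝 0, z ≠ 0 → k z = z • f z) (hA : Tendsto f (cocompact ℂ) (𝓝 A))
    {z : ℂ} (hz : z ≠ 0) : f z = A + z⁻¹ • k 0 := by
  -- The function `z f(z)` with its singularity at `0` removed is entire. So is its slope at `0`,
  -- which is `f(z) - z⁻¹ k(0)` away from `0` and tends to `A` at infinity. Liouville's theorem
  -- makes it constant.
  set g : ℂ → G := fun z => if z = 0 then k 0 else z • f z with hg
  have hg0 : g 0 = k 0 := by simp [hg]
  have hgd : Differentiable ℂ g := by
    intro z
    by_cases hz : z = 0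
    · subst hz
      refine hk.congr_of_eventuallyEq ?_
      filter_upwards [hfk] with z hz
      by_cases h : z = 0
      · simp [hg, h]
      · simp [hg, h, hz h]
    · refine (differentiableAt_id.smul (hf z hz)).congr_of_eventuallyEq ?_
      filter_upwards [isOpen_ne.mem_nhds hz] with y hy
      simp [hg, show y ≠ 0 from hy]
  have hds : Differentiable ℂ (dslope g 0) := by
    rw [← differentiableOn_univ, Complex.differentiableOn_dslope univ_mem]
    exact hgd.differentiableOn
  have hval : ∀ y : ℂ, y ≠ 0 → dslope g 0 y = f y - y⁻¹ • k 0 := by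
    intro y hy
    rw [dslope_of_ne _ hy, slope_def_module, hg0]
    simp [hg, hy, smul_sub, smul_smul]
  have hne : ∀ᶠ y in cocompact ℂ, y ≠ (0 : ℂ) := by
    rw [← Metric.cobounded_eq_cocompact]
    exact Bornology.eventually_ne_cobounded 0
  have hlim : Tendsto (dslope g 0) (cocompact ℂ) (𝓝 A) := by
    have h1 : Tendsto (fun y : ℂ => f y - y⁻¹ • k 0) (cocompact ℂ) (𝓝 (A - (0 : ℂ) • k 0)) := by
      refine hA.sub (Tendsto.smul_const ?_ _)
      rw [← Metric.cobounded_eq_cocompact]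
      exact tendsto_inv₀_cobounded
    rw [zero_smul, sub_zero] at h1
    exact h1.congr' (hne.mono fun y hy => (hval y hy).symm)
  have h := hds.apply_eq_of_tendsto_cocompact z hlim
  rw [hval z hz] at h
  rw [← h]
  abel

end RiemannSphere

namespace HolBundle

open RiemannSphere

/-! ### Vector fields and derivatives on `P1 × M` -/

section Derivative

variable {EB : Type*} [NormedAddCommGroup EB] [NormedSpace ℂ EB]
  {HB : Type*} [TopologicalSpace HB] {I : ModelWithCorners ℂ EB HB}
  {B : Type*} [TopologicalSpace B] [ChartedSpace HB B] [IsManifold I ω B]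

/-- Differentiation loses no regularity in the class `ω`. -/
theorem HolFunAt.mvfderiv {f : B → ℂ} {X : Π x : B, TangentSpace I x} {x : B}
    (hf : HolFunAt I f x) (hX : HolVFAt I X x) :
    HolFunAt I (fun y => mvfderiv I f y (X y)) x := by
  have h1 := ContMDiffAt.mfderiv_const (m := ω) hf (by simp)
  have h2 : ContMDiffAt I 𝓘(ℂ, ℂ).tangent ω
      (fun y => TotalSpace.mk' ℂ (E := TangentSpace 𝓘(ℂ, ℂ)) (f y) (mfderiv I 𝓘(ℂ, ℂ) f y (X y)))
          x :=
    ContMDiffAt.clm_apply_of_inCoordinates (b₁ := id) (b₂ := f) h1 hX hf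
  exact (contMDiff_snd_tangentBundle_modelSpace ℂ 𝓘(ℂ, ℂ)).contMDiffAt.comp x h2

end Derivative

section Product

variable {E : Type*} [NormedAddCommGroup E] [NormedSpace ℂ E]
  {M : Type*} [TopologicalSpace M] [ChartedSpace E M] [IsManifold 𝓘(ℂ, E) ω M]

theorem holVFAt_prod_iff {X : Π x : P1 × M, TangentSpace (𝓘(ℂ, ℂ).prod 𝓘(ℂ, E)) x} {x : P1 × M} :
    HolVFAt (𝓘(ℂ, ℂ).prod 𝓘(ℂ, E)) X x ↔
      ContMDiffAt (𝓘(ℂ, ℂ).prod 𝓘(ℂ, E)) 𝓘(ℂ, ℂ).tangent ω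
        (fun y => TotalSpace.mk' ℂ (E := TangentSpace 𝓘(ℂ, ℂ)) y.1 (X y).1) x ∧
      ContMDiffAt (𝓘(ℂ, ℂ).prod 𝓘(ℂ, E)) 𝓘(ℂ, E).tangent ω
        (fun y => TotalSpace.mk' E (E := TangentSpace 𝓘(ℂ, E)) y.2 (X y).2) x := by
  constructor
  · intro h
    have h1 := (contMDiff_equivTangentBundleProd (n := ω) (I := 𝓘(ℂ, ℂ)) (M := P1) (I' := 𝓘(ℂ, E))
      (M' := M)).contMDiffAt.comp x h
    exact ⟨contMDiffAt_fst.comp x h1, contMDiffAt_snd.comp x h1⟩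
  · rintro ⟨h1, h2⟩
    exact (contMDiff_equivTangentBundleProd_symm (n := ω) (I := 𝓘(ℂ, ℂ)) (M := P1) (I' := 𝓘(ℂ, E))
      (M' := M)).contMDiffAt.comp x (h1.prodMk h2)

/-- All finite points have the same preferred chart. -/
theorem trivializationAt_tangentSpace_coe (z z' ζ : ℂ) :
    (trivializationAt ℂ (TangentSpace 𝓘(ℂ, ℂ)) (z : P1) ⟨(z' : P1), ζ⟩).2 = ζ := by
  rw [TangentBundle.trivializationAt_apply]
  simp only [chartAt_coe]
  have : (chartZero.extend 𝓘(ℂ, ℂ) ∘ (chartZero.extend 𝓘(ℂ, ℂ)).symm : ℂ → ℂ) = id := by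
    ext w
    simp [chartZero_symm_apply, chartZero_coe]
  rw [this]
  simp

theorem trivializationAt_tangentSpace_infty {z : ℂ} (hz : z ≠ 0) (ζ : ℂ) :
    (trivializationAt ℂ (TangentSpace 𝓘(ℂ, ℂ)) (OnePoint.infty : P1) ⟨(z : P1), ζ⟩).2
      = - (z ^ 2)⁻¹ * ζ := by
  rw [TangentBundle.trivializationAt_apply]
  simp only [chartAt_coe, chartAt_infty]
  have : (chartInfty.extend 𝓘(ℂ, ℂ) ∘ (chartZero.extend 𝓘(ℂ, ℂ)).symm : ℂ → ℂ) =ᶠ[𝓝 z]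
      fun w => w⁻¹ := by
    filter_upwards [isOpen_ne.mem_nhds hz] with w hw
    simp [chartZero_symm_apply, chartInfty, invHomeo, invFun_coe hw, chartZero_coe]
  simp only [modelWithCornersSelf_coe, range_id, fderivWithin_univ,
    OpenPartialHomeomorph.extend_coe,
    CompTriple.comp_eq, chartZero_coe] at this ⊢
  rw [this.fderiv_eq, (hasDerivAt_inv hz).hasFDerivAt.fderiv]
  exact mul_comm _ _

theorem contMDiffAt_tangent_P1_iff {EB : Type*} [NormedAddCommGroup EB] [NormedSpace ℂ EB]
    {HB : Type*} [TopologicalSpace HB] {I : ModelWithCorners ℂ EB HB}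
    {B : Type*} [TopologicalSpace B] [ChartedSpace HB B] {g : B → P1} {ζ : B → ℂ} {x : B}
    (hg : ContMDiffAt I 𝓘(ℂ, ℂ) ω g x) (hx : g x ≠ OnePoint.infty) :
    ContMDiffAt I 𝓘(ℂ, ℂ).tangent ω
      (fun y => TotalSpace.mk' ℂ (E := TangentSpace 𝓘(ℂ, ℂ)) (g y) (ζ y)) x ↔ HolFunAt I ζ x := by
  rw [contMDiffAt_totalSpace]
  have : (fun y => (trivializationAt ℂ (TangentSpace 𝓘(ℂ, ℂ)) (g x)
      (TotalSpace.mk' ℂ (E := TangentSpace 𝓘(ℂ, ℂ)) (g y) (ζ y))).2) =ᶠ[𝓝 x] ζ := by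
    filter_upwards [hg.continuousAt.eventually (eventually_ne_infty hx)] with y hy
    rw [← coe_zCoord hx, ← coe_zCoord hy]
    exact trivializationAt_tangentSpace_coe _ _ _
  exact ⟨fun h => h.2.congr_of_eventuallyEq this.symm, fun h => ⟨hg, h.congr_of_eventuallyEq this⟩⟩

theorem holVFAt_iff_of_ne_infty {ζ : P1 × M → ℂ} {v : Π x : P1 × M, TangentSpace 𝓘(ℂ, E) x.2}
    {x : P1 × M} (hx : x.1 ≠ OnePoint.infty) :
    HolVFAt (𝓘(ℂ, ℂ).prod 𝓘(ℂ, E)) (fun y => tvec y (ζ y) (v y)) x ↔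
      HolFunAt (𝓘(ℂ, ℂ).prod 𝓘(ℂ, E)) ζ x ∧
      HolSecAt (V := projM E M *ᵖ (TangentSpace 𝓘(ℂ, E))) (𝓘(ℂ, ℂ).prod 𝓘(ℂ, E)) E v x := by
  exact holVFAt_prod_iff.trans (and_congr (contMDiffAt_tangent_P1_iff contMDiffAt_fst hx)
    (holSecAt_pullback_iff (V := TangentSpace 𝓘(ℂ, E)) (projM E M)).symm)

/-- In the coordinate `u = 1/z` the field `z ∂_z` is `-u ∂_u`. It is holomorphic at `∞` and vanishes
there, in accordance with the value `0` of `zCoord`. -/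
theorem holVFAt_euler (x : P1 × M) :
    HolVFAt (𝓘(ℂ, ℂ).prod 𝓘(ℂ, E)) (fun y => tvec y (zCoord y.1) 0) x := by
  rw [holVFAt_prod_iff]
  refine ⟨?_, ?_⟩
  swap
  · exact (contMDiff_zeroSection ℂ (TangentSpace 𝓘(ℂ, E))).contMDiffAt.comp x contMDiffAt_snd
  by_cases hx : x.1 = OnePoint.infty
  · rw [contMDiffAt_totalSpace]
    refine ⟨contMDiffAt_fst, ?_⟩
    have h1 : ContMDiffAt (𝓘(ℂ, ℂ).prod 𝓘(ℂ, E)) 𝓘(ℂ, ℂ) ω (fun y : P1 × M => -(zCoord y.1)⁻¹) x :=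
      ((contMDiffAt_inv_zCoord (by rw [hx]; exact OnePoint.infty_ne_coe 0)).comp x
          contMDiffAt_fst).neg
    refine h1.congr_of_eventuallyEq ?_
    have h0 : ∀ᶠ y : P1 × M in 𝓝 x, y.1 ≠ ((0 : ℂ) : P1) :=
      continuousAt_fst.eventually (eventually_ne_nhds (by rw [hx]; exact OnePoint.infty_ne_coe 0))
    filter_upwards [h0] with y hy
    simp only [hx]
    by_cases hy' : y.1 = OnePoint.infty
    · rw [hy']
      change (trivializationAt ℂ (TangentSpace 𝓘(ℂ, ℂ)) (OnePoint.infty : P1)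
        ⟨OnePoint.infty, (0 : ℂ)⟩).2 = _
      have := ((trivializationAt ℂ (TangentSpace 𝓘(ℂ, ℂ)) (OnePoint.infty : P1)).linearMapAt ℂ
          OnePoint.infty).map_zero
      rw [Trivialization.linearMapAt_apply, if_pos (mem_baseSet_trivializationAt _ _ _)] at this
      exact this.trans (by simp)
    · have hz : zCoord y.1 ≠ 0 := zCoord_ne_zero ⟨hy, hy'⟩
      rw [← coe_zCoord hy']
      refine (trivializationAt_tangentSpace_infty hz _).trans ?_
      change -(zCoord y.1 ^ 2)⁻¹ * zCoord y.1 = _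
      simp only [zCoord_coe]
      field_simp
  · exact (contMDiffAt_tangent_P1_iff contMDiffAt_fst hx).2
        ((contMDiffAt_zCoord hx).comp x contMDiffAt_fst)

theorem HolVFAt.tvec {X : Π t : M, TangentSpace 𝓘(ℂ, E) t} {x : P1 × M} (hX : HolVFAt 𝓘(ℂ, E) X x.2)
    :
    HolVFAt (𝓘(ℂ, ℂ).prod 𝓘(ℂ, E)) (fun y => tvec y 0 (X y.2)) x := by
  rw [holVFAt_prod_iff]
  exact ⟨(contMDiff_zeroSection ℂ (TangentSpace 𝓘(ℂ, ℂ))).contMDiffAt.comp x contMDiffAt_fst,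
    ContMDiffAt.comp (g := fun t => TotalSpace.mk' E t (X t)) x hX contMDiffAt_snd⟩

/-- Tangent vectors at finite points are written in the chart `z`, in which the inclusion of `ℂ` is
the identity. -/
theorem mfderiv_coe (z ζ : ℂ) :
    mfderiv 𝓘(ℂ, ℂ) 𝓘(ℂ, ℂ) ((↑) : ℂ → P1) z ζ = ζ := by
  have h : writtenInExtChartAt 𝓘(ℂ, ℂ) 𝓘(ℂ, ℂ) z ((↑) : ℂ → P1) = id := by
    ext w
    simp [writtenInExtChartAt, extChartAt, chartAt_coe, chartZero_coe, chartAt_self_eq]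
  have h2 : HasMFDerivAt 𝓘(ℂ, ℂ) 𝓘(ℂ, ℂ) ((↑) : ℂ → P1) z (ContinuousLinearMap.id ℂ ℂ) := by
    refine ⟨contMDiff_coe.continuous.continuousAt, ?_⟩
    rw [h]
    exact hasFDerivWithinAt_id _ _
  exact congrArg (fun L : ℂ →L[ℂ] ℂ => L ζ) h2.mfderiv

theorem mvfderiv_tvec {f : P1 × M → ℂ} {z : ℂ} {t : M} {ζ : ℂ} {v : TangentSpace 𝓘(ℂ, E) t}
    (hf : MDifferentiableAt (𝓘(ℂ, ℂ).prod 𝓘(ℂ, E)) 𝓘(ℂ, ℂ) f ((z : P1), t)) :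
    mvfderiv (𝓘(ℂ, ℂ).prod 𝓘(ℂ, E)) f ((z : P1), t) (tvec ((z : P1), t) ζ v)
      = ζ * deriv (fun w : ℂ => f ((w : P1), t)) z
        + mvfderiv 𝓘(ℂ, E) (fun t' => f ((z : P1), t')) t v := by
  have h1 := mfderiv_prod_eq_add_apply (v := tvec ((z : P1), t) ζ v) hf
  have hs : MDifferentiableAt 𝓘(ℂ, ℂ) 𝓘(ℂ, ℂ) (fun p => f (p, t)) (z : P1) :=
    hf.comp (z : P1) (mdifferentiableAt_id.prodMk mdifferentiableAt_const)
  have h2 : mfderiv 𝓘(ℂ, ℂ) 𝓘(ℂ, ℂ) (fun w : ℂ => f ((w : P1), t)) z ζ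
      = mfderiv 𝓘(ℂ, ℂ) 𝓘(ℂ, ℂ) (fun p => f (p, t)) (z : P1) ζ := by
    have := mfderiv_comp_apply z hs (contMDiff_coe.contMDiffAt.mdifferentiableAt (by simp)) ζ
    rw [mfderiv_coe] at this
    exact this
  have h3 : mfderiv 𝓘(ℂ, ℂ) 𝓘(ℂ, ℂ) (fun w : ℂ => f ((w : P1), t)) z ζ
      = ζ * deriv (fun w : ℂ => f ((w : P1), t)) z := by
    have h4 : fderiv ℂ (fun w : ℂ => f ((w : P1), t)) z ζ
        = ζ * deriv (fun w : ℂ => f ((w : P1), t)) z := fderiv_eq_smul_deriv _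
    exact (congrArg (fun L : ℂ →L[ℂ] ℂ => L ζ) mfderiv_eq_fderiv).trans h4
  refine h1.trans ?_
  rw [← h3, h2]
  rfl

end Product

end HolBundle

/-! ### Coordinate discs of the projective line -/

namespace RiemannSphere

open Metric

/-- Both charts are onto `ℂ`, so discs of every radius are available. -/
theorem chartAt_target (q : P1) : (chartAt ℂ q).target = univ := by
  induction q using OnePoint.rec with
  | infty => rw [chartAt_infty]; simp [chartInfty, chartZero_target]
  | coe z => rw [chartAt_coe, chartZero_target]

/-- The point with coordinate `r ζ` in the preferred chart, centred at `q`. -/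
noncomputable def disc (q : P1) (r : ℝ) (ζ : ℂ) : P1 :=
  (chartAt ℂ q).symm (chartAt ℂ q q + r * ζ)

/-- The inverse of `disc`. -/
noncomputable def discCoord (q : P1) (r : ℝ) (p : P1) : ℂ :=
  (chartAt ℂ q p - chartAt ℂ q q) / r

variable {q p : P1} {r : ℝ}

theorem disc_mem_source (ζ : ℂ) : disc q r ζ ∈ (chartAt ℂ q).source :=
  (chartAt ℂ q).map_target (by rw [chartAt_target]; trivial)

theorem discCoord_disc (hr : 0 < r) (ζ : ℂ) : discCoord q r (disc q r ζ) = ζ := by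
  have : (r : ℂ) ≠ 0 := by exact_mod_cast hr.ne'
  rw [discCoord, disc, (chartAt ℂ q).right_inv (by rw [chartAt_target]; trivial)]
  field_simp
  ring

theorem disc_discCoord (hr : 0 < r) (hp : p ∈ (chartAt ℂ q).source) :
    disc q r (discCoord q r p) = p := by
  have : (r : ℂ) ≠ 0 := by exact_mod_cast hr.ne'
  rw [discCoord, disc, mul_div_cancel₀ _ this, add_sub_cancel, (chartAt ℂ q).left_inv hp]

theorem contMDiff_disc : ContMDiff 𝓘(ℂ, ℂ) 𝓘(ℂ, ℂ) ω (disc q r) := by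
  have h1 : ContMDiff 𝓘(ℂ, ℂ) 𝓘(ℂ, ℂ) ω (chartAt ℂ q).symm := by
    have := contMDiffOn_chart_symm (I := 𝓘(ℂ, ℂ)) (n := ω) (x := q)
    rwa [chartAt_target, contMDiffOn_univ] at this
  have h2 : ContDiff ℂ ω (fun ζ : ℂ => chartAt ℂ q q + r * ζ) :=
    contDiff_const.add (contDiff_const.mul contDiff_id)
  exact h1.comp h2.contMDiff

theorem contMDiffAt_discCoord (hp : p ∈ (chartAt ℂ q).source) :
    ContMDiffAt 𝓘(ℂ, ℂ) 𝓘(ℂ, ℂ) ω (discCoord q r) p := by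
  have h1 : ContMDiffAt 𝓘(ℂ, ℂ) 𝓘(ℂ, ℂ) ω (chartAt ℂ q) p :=
    contMDiffAt_of_mem_maximalAtlas (IsManifold.chart_mem_maximalAtlas q) hp
  have h2 : ContDiff ℂ ω (fun w : ℂ => (w - chartAt ℂ q q) / r) :=
    (contDiff_id.sub contDiff_const).div_const _
  exact h2.contMDiff.contMDiffAt.comp p h1

theorem isOpen_image_disc (hr : 0 < r) {s : Set ℂ} (hs : IsOpen s) : IsOpen (disc q r '' s) := by
  have h : disc q r '' s = (chartAt ℂ q).source ∩ discCoord q r ⁻¹' s := by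
    ext p
    constructor
    · rintro ⟨ζ, hζ, rfl⟩
      exact ⟨disc_mem_source ζ, by rwa [mem_preimage, discCoord_disc hr]⟩
    · rintro ⟨h1, h2⟩
      exact ⟨_, h2, disc_discCoord hr h1⟩
  rw [h]
  exact ContinuousOn.isOpen_inter_preimage
    (fun p hp => (contMDiffAt_discCoord hp).continuousAt.continuousWithinAt)
    (chartAt ℂ q).open_source hs

theorem disc_zero : disc q r 0 = q := by
  rw [disc, mul_zero, add_zero, (chartAt ℂ q).left_inv (mem_chart_source ℂ q)]

theorem exists_disc_subset {A : Set P1} (hA : A ∈ 𝓝 q) :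
    ∃ r : ℝ, 0 < r ∧ ∀ ζ ∈ closedBall (0 : ℂ) 2, disc q r ζ ∈ A := by
  have hc : ContinuousAt (disc q 1) 0 := contMDiff_disc.continuous.continuousAt
  obtain ⟨ε, hε, h⟩ := Metric.mem_nhds_iff.1 (hc (by rwa [disc_zero]))
  refine ⟨ε / 3, by positivity, fun ζ hζ => ?_⟩
  have h1 : disc q (ε / 3) ζ = disc q 1 (((ε / 3 : ℝ) : ℂ) * ζ) := by simp [disc]
  rw [h1]
  apply h
  rw [mem_ball_zero_iff, norm_mul, Complex.norm_real, Real.norm_of_nonneg (by positivity)]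
  rw [mem_closedBall_zero_iff] at hζ
  nlinarith

end RiemannSphere

namespace HolBundle

open RiemannSphere Metric

/-! ### Coordinate balls of `M` and adapted covers -/

section Param

variable {E : Type*} [NormedAddCommGroup E] [NormedSpace ℂ E]
  {M : Type*} [TopologicalSpace M] [ChartedSpace E M]

/-- The point with coordinate `ρ u` in the preferred chart, centred at `t₀`. -/
noncomputable def param (t₀ : M) (ρ : ℝ) (u : E) : M :=
  (chartAt E t₀).symm (chartAt E t₀ t₀ + (ρ : ℂ) • u)

/-- The inverse of `param`. -/
noncomputable def paramCoord (t₀ : M) (ρ : ℝ) (t : M) : E :=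
  (ρ : ℂ)⁻¹ • (chartAt E t₀ t - chartAt E t₀ t₀)

variable {t₀ : M} {ρ : ℝ}

theorem param_zero : param t₀ ρ (0 : E) = t₀ := by
  rw [param, smul_zero, add_zero, (chartAt E t₀).left_inv (mem_chart_source E t₀)]

theorem paramCoord_self : paramCoord t₀ ρ t₀ = (0 : E) := by
  rw [paramCoord, sub_self, smul_zero]

theorem param_paramCoord (hρ : 0 < ρ) {t : M} (ht : t ∈ (chartAt E t₀).source) :
    param t₀ ρ (paramCoord t₀ ρ t : E) = t := by
  have : (ρ : ℂ) ≠ 0 := by exact_mod_cast hρ.ne'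
  rw [param, paramCoord, smul_inv_smul₀ this, add_sub_cancel, (chartAt E t₀).left_inv ht]

variable [IsManifold 𝓘(ℂ, E) ω M]

theorem add_smul_mem_target (hρ : 0 < ρ) (h : closedBall (chartAt E t₀ t₀) ρ ⊆
    (chartAt E t₀).target)
    {u : E} (hu : u ∈ closedBall (0 : E) 1) :
    chartAt E t₀ t₀ + (ρ : ℂ) • u ∈ (chartAt E t₀).target := by
  apply h
  rw [mem_closedBall_zero_iff] at hu
  rw [mem_closedBall, dist_eq_norm, add_sub_cancel_left, norm_smul, Complex.norm_real,
    Real.norm_of_nonneg hρ.le]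
  nlinarith

theorem contMDiffAt_param (hρ : 0 < ρ) (h : closedBall (chartAt E t₀ t₀) ρ ⊆ (chartAt E t₀).target)
    {u : E} (hu : u ∈ closedBall (0 : E) 1) :
    ContMDiffAt 𝓘(ℂ, E) 𝓘(ℂ, E) ω (param t₀ ρ) u := by
  have h1 : ContMDiffAt 𝓘(ℂ, E) 𝓘(ℂ, E) ω (chartAt E t₀).symm (chartAt E t₀ t₀ + (ρ : ℂ) • u) :=
    (contMDiffOn_chart_symm (I := 𝓘(ℂ, E)) (n := ω) (x := t₀)).contMDiffAt
      ((chartAt E t₀).open_target.mem_nhds (add_smul_mem_target hρ h hu))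
  have h2 : ContDiff ℂ ω (fun u : E => chartAt E t₀ t₀ + (ρ : ℂ) • u) :=
    contDiff_const.add (contDiff_const.smul contDiff_id)
  exact h1.comp u h2.contMDiff.contMDiffAt

theorem contMDiffAt_paramCoord :
    ContMDiffAt 𝓘(ℂ, E) 𝓘(ℂ, E) ω (paramCoord t₀ ρ : M → E) t₀ := by
  have h1 : ContMDiffAt 𝓘(ℂ, E) 𝓘(ℂ, E) ω (chartAt E t₀) t₀ :=
    contMDiffAt_of_mem_maximalAtlas (IsManifold.chart_mem_maximalAtlas t₀) (mem_chart_source E t₀)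
  have h2 : ContDiff ℂ ω (fun w : E => (ρ : ℂ)⁻¹ • (w - chartAt E t₀ t₀)) :=
    contDiff_const.smul (contDiff_id.sub contDiff_const)
  exact h2.contMDiff.contMDiffAt.comp t₀ h1

/-- A tube lemma from the compactness of `P1`. The unit discs already cover, while the closed discs
of radius 2 still fit into the given neighbourhoods. This margin is what the normal family argument
consumes. -/
theorem exists_disc_cover [FiniteDimensional ℂ E] (t₀ : M) {N : Set M} (hN : N ∈ 𝓝 t₀)
    (U : P1 → Set (P1 × M)) (hU : ∀ q, U q ∈ 𝓝 (q, t₀)) :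
    ∃ (S : Finset P1) (r : P1 → ℝ) (ρ : ℝ), 0 < ρ ∧ (∀ q, 0 < r q) ∧
      (∀ p, ∃ q ∈ S, p ∈ disc q (r q) '' ball 0 1) ∧
      closedBall (chartAt E t₀ t₀) ρ ⊆ (chartAt E t₀).target ∧
      (∀ u ∈ closedBall (0 : E) 1, param t₀ ρ u ∈ N) ∧
      ∀ q ∈ S, ∀ ζ ∈ closedBall (0 : ℂ) 2, ∀ u ∈ closedBall (0 : E) 1,
        (disc q (r q) ζ, param t₀ ρ u) ∈ U q := by
  have h1 : ∀ q, ∃ r : ℝ, ∃ B ∈ 𝓝 t₀, 0 < r ∧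
      ∀ ζ ∈ closedBall (0 : ℂ) 2, ∀ t ∈ B, (disc q r ζ, t) ∈ U q := by
    intro q
    obtain ⟨A, hA, B, hB, hAB⟩ := mem_nhds_prod_iff.1 (hU q)
    obtain ⟨r, hr, h⟩ := exists_disc_subset hA
    exact ⟨r, B, hB, hr, fun ζ hζ t ht => hAB ⟨h ζ hζ, ht⟩⟩
  choose r B hB hr hrB using h1
  obtain ⟨S, hS⟩ := isCompact_univ.elim_finite_subcover (fun q => disc q (r q) '' ball 0 1)
    (fun q => isOpen_image_disc (hr q) isOpen_ball)
    (fun q _ => mem_iUnion.2 ⟨q, 0, mem_ball_self one_pos, disc_zero⟩)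
  have hN' : N ∩ ⋂ q ∈ S, B q ∈ 𝓝 t₀ :=
    inter_mem hN ((biInter_finset_mem S).2 fun q _ => hB q)
  have h2 : (chartAt E t₀).target ∩ (chartAt E t₀).symm ⁻¹' (N ∩ ⋂ q ∈ S, B q) ∈
      𝓝 (chartAt E t₀ t₀) := by
    refine inter_mem ((chartAt E t₀).open_target.mem_nhds (mem_chart_target E t₀)) ?_
    refine (chartAt E t₀).continuousAt_symm (mem_chart_target E t₀) ?_
    rwa [(chartAt E t₀).left_inv (mem_chart_source E t₀)]
  obtain ⟨ρ, hρ, h3⟩ := Metric.nhds_basis_closedBall.mem_iff.1 h2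
  have h4 : ∀ u ∈ closedBall (0 : E) 1, param t₀ ρ u ∈ N ∩ ⋂ q ∈ S, B q := by
    intro u hu
    refine (h3 ?_).2
    rw [mem_closedBall_zero_iff] at hu
    rw [mem_closedBall, dist_eq_norm, add_sub_cancel_left, norm_smul, Complex.norm_real,
      Real.norm_of_nonneg hρ.le]
    nlinarith
  refine ⟨S, r, ρ, hρ, hr, fun p => ?_, fun x hx => (h3 hx).1, fun u hu => (h4 u hu).1,
    fun q hq ζ hζ u hu => hrB q ζ hζ _ (mem_iInter₂.1 (h4 u hu).2 q hq)⟩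
  simpa using hS (mem_univ p)

end Param

theorem holSecAt_trivial_iff {EB : Type*} [NormedAddCommGroup EB] [NormedSpace ℂ EB]
    {HB : Type*} [TopologicalSpace HB] {I : ModelWithCorners ℂ EB HB}
    {B : Type*} [TopologicalSpace B] [ChartedSpace HB B]
    {F : Type*} [NormedAddCommGroup F] [NormedSpace ℂ F] {σ : B → F} {x : B} :
    HolSecAt (V := Bundle.Trivial B F) I F σ x ↔ ContMDiffAt I 𝓘(ℂ, F) ω σ x :=
  contMDiffAt_section x

/-! ### Holomorphic dependence of `ψ` on the parameter -/

section FiberIso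

variable {E : Type*} [NormedAddCommGroup E] [NormedSpace ℂ E]
  {M : Type*} [TopologicalSpace M] [ChartedSpace E M] [IsManifold 𝓘(ℂ, E) ω M]
  {F : Type*} [NormedAddCommGroup F] [NormedSpace ℂ F] [FiniteDimensional ℂ F]
  {H : P1 × M → Type*}
  [TopologicalSpace (TotalSpace F H)] [∀ x, AddCommGroup (H x)] [∀ x, Module ℂ (H x)]
  [∀ x, TopologicalSpace (H x)] [FiberBundle F H] [VectorBundle ℂ F H]
  [ContMDiffVectorBundle ω F H (𝓘(ℂ, ℂ).prod 𝓘(ℂ, E))]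

/-- The identification of the fibres over `(p, t)` and `(0, t)` by means of a trivialization over
`P1 × {t}`. -/
noncomputable def fiberIso
    (triv : ∀ t : M, Nonempty (HolIso 𝓘(ℂ, ℂ) F (inclP1 E t *ᵖ H) (Bundle.Trivial P1 F)))
    (x : P1 × M) : H x ≃ₗ[ℂ] H (((0 : ℂ) : P1), x.2) :=
  ((triv x.2).some.toEquiv x.1).trans ((triv x.2).some.toEquiv ((0 : ℂ) : P1)).symm

variable (triv : ∀ t : M, Nonempty (HolIso 𝓘(ℂ, ℂ) F (inclP1 E t *ᵖ H) (Bundle.Trivial P1 F)))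

theorem fiberIso_zero (t : M) (a : H (((0 : ℂ) : P1), t)) :
    fiberIso triv (((0 : ℂ) : P1), t) a = a :=
  LinearEquiv.symm_apply_apply _ a

/-- The section is constant in the trivialization over `P1 × {t}`. This is regularity along `P1`
only, since the trivializations for different `t` are unrelated. -/
theorem contMDiffAt_fiberIso_symm (p : P1) (t : M) (a : H (((0 : ℂ) : P1), t)) :
    ContMDiffAt 𝓘(ℂ, ℂ) ((𝓘(ℂ, ℂ).prod 𝓘(ℂ, E)).prod 𝓘(ℂ, F)) ω
      (fun p => TotalSpace.mk' F (p, t) ((fiberIso triv (p, t)).symm a)) p := by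
  have h1 : HolSecAt (V := Bundle.Trivial P1 F) 𝓘(ℂ, ℂ) F
      (fun _ => (triv t).some.toEquiv ((0 : ℂ) : P1) a) p :=
          holSecAt_trivial_iff.2 contMDiffAt_const
  have h2 := ((triv t).some.symm.holSec_iff _ p).1 h1
  exact (holSecAt_pullback_iff (inclP1 E t)).1 h2

end FiberIso

end HolBundle

namespace HolBundle

open RiemannSphere Metric

section FiberIso

variable {E : Type*} [NormedAddCommGroup E] [NormedSpace ℂ E] [FiniteDimensional ℂ E]
  {M : Type*} [TopologicalSpace M] [ChartedSpace E M] [IsManifold 𝓘(ℂ, E) ω M]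
  {F : Type*} [NormedAddCommGroup F] [NormedSpace ℂ F] [FiniteDimensional ℂ F]
  {H : P1 × M → Type*}
  [TopologicalSpace (TotalSpace F H)] [∀ x, AddCommGroup (H x)] [∀ x, Module ℂ (H x)]
  [∀ x, TopologicalSpace (H x)] [FiberBundle F H] [VectorBundle ℂ F H]
  [ContMDiffVectorBundle ω F H (𝓘(ℂ, ℂ).prod 𝓘(ℂ, E))]
  (triv : ∀ t : M, Nonempty (HolIso 𝓘(ℂ, ℂ) F (inclP1 E t *ᵖ H) (Bundle.Trivial P1 F)))

/-- A section of `H` over `P1 × {t}` vanishing at one point vanishes. -/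
theorem eq_zero_of_holSecAt_fiber
    (triv : ∀ t : M, Nonempty (HolIso 𝓘(ℂ, ℂ) F (inclP1 E t *ᵖ H) (Bundle.Trivial P1 F))) (t : M)
        {κ : Π p : P1, (inclP1 E t *ᵖ H) p}
    (hκ : ∀ p, HolSecAt 𝓘(ℂ, ℂ) F κ p) {p₀ : P1} (h0 : κ p₀ = 0) (p : P1) : κ p = 0 := by
  obtain ⟨χ⟩ := triv t
  have h1 : ContMDiff 𝓘(ℂ, ℂ) 𝓘(ℂ, F) ω (fun p => χ.toEquiv p (κ p)) := fun p =>
    holSecAt_trivial_iff.1 ((χ.holSec_iff κ p).1 (hκ p))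
  have h2 := apply_eq_of_contMDiff h1 p p₀
  simp only [h0, map_zero] at h2
  exact (χ.toEquiv p).map_eq_zero_iff.1 h2

/-- The bound on the transition functions comes from compactness of the closed discs and of the
closed parameter ball. The vanishing condition holds because compatible functions glue to a section
of `H` over `P1 × {t₀}`, and `H` is trivial there. -/
theorem discCocycle_of_cover
    (triv : ∀ t : M, Nonempty (HolIso 𝓘(ℂ, ℂ) F (inclP1 E t *ᵖ H) (Bundle.Trivial P1 F))) {t₀ : M}
        {S : Finset P1} {r : P1 → ℝ} {ρ : ℝ} (hρ : 0 < ρ)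
    (hr : ∀ q, 0 < r q) (hS : ∀ p, ∃ q ∈ S, p ∈ disc q (r q) '' ball 0 1)
    (htgt : closedBall (chartAt E t₀ t₀) ρ ⊆ (chartAt E t₀).target)
    (hbase : ∀ q ∈ S, ∀ ζ ∈ closedBall (0 : ℂ) 2, ∀ u ∈ closedBall (0 : E) 1,
      (disc q (r q) ζ, param t₀ ρ u) ∈ (trivializationAt F H (q, t₀)).baseSet)
    (i₀ : S) (hi₀ : ((0 : ℂ) : P1) ∈ disc (i₀ : P1) (r i₀) '' ball 0 1) :
    ∃ B, DiscCocycle F (fun i : S => disc (i : P1) (r i))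
      (fun i j (u : E) p => ((trivializationAt F H ((i : P1), t₀)).coordChangeL ℂ
        (trivializationAt F H ((j : P1), t₀)) (p, param t₀ ρ u) : F →L[ℂ] F))
      i₀ ((0 : ℂ) : P1) B := by
  have hb : ∀ i : S, ∀ p ∈ disc (i : P1) (r i) '' closedBall 0 2, ∀ u ∈ closedBall (0 : E) 1,
      (p, param t₀ ρ u) ∈ (trivializationAt F H ((i : P1), t₀)).baseSet := by
    rintro i _ ⟨ζ, hζ, rfl⟩ u hu
    exact hbase i i.2 ζ hζ u hu
  have hpar : ∀ p : P1, ∀ u ∈ closedBall (0 : E) 1, ContMDiffAt (𝓘(ℂ, ℂ).prod 𝓘(ℂ, E))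
      (𝓘(ℂ, ℂ).prod 𝓘(ℂ, E)) ω (fun x : P1 × E => (x.1, param t₀ ρ x.2)) (p, u) := fun p u hu =>
    contMDiffAt_fst.prodMk (ContMDiffAt.comp (g := param t₀ ρ) (f := Prod.snd) (I' :=
        𝓘(ℂ, E)) (p, u)
      (contMDiffAt_param hρ htgt hu) contMDiffAt_snd)
  have hG : ∀ i j : S, ∀ p ∈ disc (i : P1) (r i) '' closedBall 0 2,
      p ∈ disc (j : P1) (r j) '' closedBall 0 2 → ∀ u ∈ closedBall (0 : E) 1,
      ContMDiffAt (𝓘(ℂ, ℂ).prod 𝓘(ℂ, E)) 𝓘(ℂ, F →L[ℂ] F) ω (fun x : P1 × E =>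
        ((trivializationAt F H ((i : P1), t₀)).coordChangeL ℂ
        (trivializationAt F H ((j : P1), t₀)) (x.1, param t₀ ρ x.2) : F →L[ℂ] F)) (p, u) := by
    intro i j p hp hp' u hu
    have h1 := contMDiffAt_coordChangeL (IB := 𝓘(ℂ, ℂ).prod 𝓘(ℂ, E)) (n := ω) (hb i p hp u hu)
      (hb j p hp' u hu)
    exact ContMDiffAt.comp (p, u) h1 (hpar p u hu)
  have hmem : ∀ i : S, ∀ p ∈ disc (i : P1) (r i) '' ball 0 2, p ∈ disc (i : P1) (r i) '' closedBall
      0 2 :=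
    fun i p hp => image_mono ball_subset_closedBall hp
  have hbd : ∀ x : S × S, ∃ B : ℝ, ∀ y ∈ (disc (x.1 : P1) (r x.1) '' closedBall 0 2 ∩
      disc (x.2 : P1) (r x.2) '' closedBall 0 2) ×ˢ closedBall (0 : E) 1,
      ‖((trivializationAt F H ((x.1 : P1), t₀)).coordChangeL ℂ
        (trivializationAt F H ((x.2 : P1), t₀)) (y.1, param t₀ ρ y.2) : F →L[ℂ] F)‖ ≤ B := by
    intro x
    have hK : ∀ i : S, IsCompact (disc (i : P1) (r i) '' closedBall 0 2) := fun i =>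
      (isCompact_closedBall 0 2).image contMDiff_disc.continuous
    refine IsCompact.exists_bound_of_continuousOn
      (((hK x.1).inter (hK x.2)).prod (isCompact_closedBall 0 1)) ?_
    rintro ⟨p, u⟩ ⟨⟨hp, hp'⟩, hu⟩
    exact (hG x.1 x.2 p hp hp' u hu).continuousAt.continuousWithinAt
  choose B hB using hbd
  obtain ⟨B', hB'⟩ := Finite.exists_le B
  refine ⟨B', fun p => ?_, hi₀, fun i j u hu p hp hp' => ?_, fun i j p hp hp' u hu => ?_, ?_⟩
  · obtain ⟨q, hq, h⟩ := hS p
    exact ⟨⟨q, hq⟩, h⟩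
  · exact (hB (i, j) (p, u) ⟨⟨hmem i p hp, hmem j p hp'⟩, ball_subset_closedBall hu⟩).trans
      (hB' (i, j))
  · have h1 := hG i j p (hmem i p hp) (hmem j p hp') u (ball_subset_closedBall hu)
    have h2 : ContMDiffAt 𝓘(ℂ, E) 𝓘(ℂ, F →L[ℂ] F) ω (fun u : E =>
        ((trivializationAt F H ((i : P1), t₀)).coordChangeL ℂ
        (trivializationAt F H ((j : P1), t₀)) (p, param t₀ ρ u) : F →L[ℂ] F)) u :=
      h1.comp u (contMDiffAt_const.prodMk contMDiffAt_id)
    exact (h2.contDiffAt.differentiableAt (by simp)).differentiableWithinAt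
  · intro k hk hkc hk0 i p hp
    have hb0 : ∀ i : S, ∀ p ∈ disc (i : P1) (r i) '' ball 0 1,
        (p, t₀) ∈ (trivializationAt F H ((i : P1), t₀)).baseSet := by
      intro i p hp
      have := hb i p (image_mono (ball_subset_closedBall.trans
        (closedBall_subset_closedBall one_le_two)) hp) 0 (mem_closedBall_self zero_le_one)
      rwa [param_zero] at this
    choose q hqS hq using hS
    -- Any disc containing `p` may be used to define the glued section; the cocycle condition makes
    -- the choice irrelevant.
    set κ : Π p : P1, H (p, t₀) := fun p =>
      (trivializationAt F H (q p, t₀)).symm (p, t₀) (k ⟨q p, hqS p⟩ p) with hκ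
    have hκi : ∀ i : S, ∀ p ∈ disc (i : P1) (r i) '' ball 0 1,
        (trivializationAt F H ((i : P1), t₀) ⟨(p, t₀), κ p⟩).2 = k i p := by
      intro i p hp
      rw [hkc ⟨q p, hqS p⟩ i p (hq p) hp]
      simp only [param_zero]
      exact (Trivialization.coordChangeL_apply _ _
        ⟨hb0 ⟨q p, hqS p⟩ p (hq p), hb0 i p hp⟩ _).symm
    have hκhol : ∀ p, HolSecAt (V := inclP1 E t₀ *ᵖ H) 𝓘(ℂ, ℂ) F κ p := by
      intro p
      refine (holSecAt_pullback_iff (inclP1 E t₀)).2 ?_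
      obtain ⟨i, hp⟩ : ∃ i : S, p ∈ disc (i : P1) (r i) '' ball 0 1 := ⟨⟨q p, hqS p⟩, hq p⟩
      refine ((trivializationAt F H ((i : P1), t₀)).contMDiffAt_iff (IB := 𝓘(ℂ, ℂ).prod 𝓘(ℂ, E))
        (Trivialization.mem_source _ |>.2 (hb0 i p hp))).2
        ⟨contMDiffAt_id.prodMk contMDiffAt_const, ?_⟩
      have hps : p ∈ (chartAt ℂ (i : P1)).source := by
        obtain ⟨ζ, -, rfl⟩ := hp
        exact disc_mem_source ζ
      obtain ⟨ζ, hζ, hζp⟩ := hp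
      have h1 : ContDiffAt ℂ ω (fun ζ => k i (disc (i : P1) (r i) ζ))
          (discCoord (i : P1) (r i) p) := by
        rw [← hζp, discCoord_disc (hr i)]
        exact ((hk i).analyticAt (isOpen_ball.mem_nhds hζ)).contDiffAt
      refine (h1.contMDiffAt.comp p (contMDiffAt_discCoord hps)).congr_of_eventuallyEq ?_
      filter_upwards [(isOpen_image_disc (hr i) isOpen_ball).mem_nhds ⟨ζ, hζ, hζp⟩,
        (chartAt ℂ (i : P1)).open_source.mem_nhds hps] with p' hp' hps'
      rw [Function.comp_apply, disc_discCoord (hr i) hps']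
      exact hκi i p' hp'
    have hκ0 : κ ((0 : ℂ) : P1) = 0 := by
      have h1 := hκi i₀ _ hi₀
      rw [hk0] at h1
      refine ((trivializationAt F H ((i₀ : P1), t₀)).linearEquivAt ℂ _ (hb0 i₀ _ hi₀)).injective ?_
      exact h1.trans (map_zero _).symm
    have h2 := eq_zero_of_holSecAt_fiber triv t₀ hκhol hκ0 p
    rw [← hκi i p hp, h2]
    exact ((trivializationAt F H ((i : P1), t₀)).linearEquivAt ℂ _ (hb0 i _ hp)).map_zero

/-- The analytic core. Over discs that trivialize `H`, the sections extending the values `η t` along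
the lines `P1 × {t}` are cocycles for holomorphically varying transition functions. They are
normalized holomorphically at `0`, so `DiscCocycle.analyticAt` applies. -/
theorem holSecAt_fiberIso_symm {t₀ : M} {η : Π t, (inclM E M ((0 : ℂ) : P1) *ᵖ H) t}
    (hη : HolSecAt 𝓘(ℂ, E) F η t₀) (p : P1) :
    HolSecAt (𝓘(ℂ, ℂ).prod 𝓘(ℂ, E)) F (fun y => (fiberIso triv y).symm (η y.2)) (p, t₀) := by
  obtain ⟨S, r, ρ, hρ, hr, hS, htgt, hN, hbase⟩ := exists_disc_cover (E := E) t₀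
    (N := {t | HolSecAt 𝓘(ℂ, E) F η t}) hη.eventually
    (fun q => (trivializationAt F H (q, t₀)).baseSet)
    (fun q => (trivializationAt F H (q, t₀)).open_baseSet.mem_nhds
      (mem_baseSet_trivializationAt F H _))
  obtain ⟨q₀, hq₀, hi₀⟩ := hS ((0 : ℂ) : P1)
  obtain ⟨B, hG⟩ := discCocycle_of_cover triv hρ hr hS htgt hbase ⟨q₀, hq₀⟩ hi₀
  set sec : Π y : P1 × M, H y := fun y => (fiberIso triv y).symm (η y.2) with hsec
  -- Local expressions of the section. For each `u` they are holomorphic on the discs; in `u`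
  -- nothing is known yet except over the point `0`.
  set h : S → E → P1 → F := fun i u p =>
    (trivializationAt F H ((i : P1), t₀) ⟨(p, param t₀ ρ u), sec (p, param t₀ ρ u)⟩).2 with hh
  have hdiff : ∀ i : S, ∀ u ∈ closedBall (0 : E) 1, ∀ ζ ∈ closedBall (0 : ℂ) 2,
      DifferentiableAt ℂ (fun ζ => h i u (disc (i : P1) (r i) ζ)) ζ := by
    intro i u hu ζ hζ
    have h1 := contMDiffAt_fiberIso_symm triv (disc (i : P1) (r i) ζ) (param t₀ ρ u)
        (η (param t₀ ρ u))
    have h2 := (((trivializationAt F H ((i : P1), t₀)).contMDiffAt_iff (IB := 𝓘(ℂ, ℂ).prod 𝓘(ℂ, E))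
        (Trivialization.mem_source _ |>.2 (hbase i i.2 ζ hζ u hu))).1 h1).2
    have h3 := h2.comp ζ (contMDiff_disc.contMDiffAt)
    exact h3.contDiffAt.differentiableAt (by simp)
  obtain ⟨q, hq, ζ, hζ, hζp⟩ := hS p
  set i : S := ⟨q, hq⟩
  have han := hG.analyticAt (h := h) ?_ ?_ ?_ ?_ i (ball_subset_ball one_le_two hζ)
  · have hps : p ∈ (chartAt ℂ q).source := by
      rw [← hζp]; exact disc_mem_source ζ
    have hbp : (p, t₀) ∈ (trivializationAt F H (q, t₀)).baseSet := by
      have := hbase q hq ζ (ball_subset_closedBall (ball_subset_ball one_le_two hζ)) 0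
        (mem_closedBall_self zero_le_one)
      rwa [param_zero, hζp] at this
    unfold HolSecAt
    rw [Trivialization.contMDiffAt_section_iff (trivializationAt F H (q, t₀)) hbp]
    have h1 : ContMDiffAt (𝓘(ℂ, ℂ).prod 𝓘(ℂ, E)) 𝓘(ℂ, ℂ × E) ω
        (fun y : P1 × M => (discCoord q (r q) y.1, (paramCoord t₀ ρ y.2 : E))) (p, t₀) :=
      ((contMDiffAt_discCoord hps).comp (p, t₀) contMDiffAt_fst).prodMk_space
        (contMDiffAt_paramCoord.comp (p, t₀) contMDiffAt_snd)
    have h2 : ContDiffAt ℂ ω (fun x : ℂ × E => h i x.2 (disc q (r q) x.1))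
        (discCoord q (r q) p, (paramCoord t₀ ρ t₀ : E)) := by
      rw [paramCoord_self, ← hζp, discCoord_disc (hr q)]
      exact han.contDiffAt
    refine (h2.contMDiffAt.comp (p, t₀) h1).congr_of_eventuallyEq ?_
    have e1 : ∀ᶠ y : P1 × M in 𝓝 (p, t₀), y.1 ∈ (chartAt ℂ q).source :=
      continuousAt_fst.eventually ((chartAt ℂ q).open_source.mem_nhds hps)
    have e2 : ∀ᶠ y : P1 × M in 𝓝 (p, t₀), y.2 ∈ (chartAt E t₀).source :=
      continuousAt_snd.eventually ((chartAt E t₀).open_source.mem_nhds (mem_chart_source E t₀))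
    filter_upwards [e1, e2] with y hy1 hy2
    have hy : (disc q (r q) (discCoord q (r q) y.1), param t₀ ρ (paramCoord t₀ ρ y.2 : E)) = y :=
      Prod.ext (disc_discCoord (hr q) hy1) (param_paramCoord hρ hy2)
    exact (congrArg (fun y' => (trivializationAt F H (q, t₀) ⟨y', sec y'⟩).2) hy).symm
  · intro u hu i ζ hζ
    exact (hdiff i u (ball_subset_closedBall hu) ζ
        (ball_subset_closedBall hζ)).differentiableWithinAt
  · intro u hu
    have h1 : ∀ i : S, ∃ b, ∀ ζ ∈ closedBall (0 : ℂ) 2, ‖h i u (disc (i : P1) (r i) ζ)‖ ≤ b :=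
        fun i =>
      (isCompact_closedBall 0 2).exists_bound_of_continuousOn fun ζ hζ =>
        (hdiff i u (ball_subset_closedBall hu) ζ hζ).continuousAt.continuousWithinAt
    choose b hb using h1
    obtain ⟨b', hb'⟩ := Finite.exists_le b
    refine ⟨b', ?_⟩
    rintro i _ ⟨ζ, hζ, rfl⟩
    exact (hb i ζ (ball_subset_closedBall hζ)).trans (hb' i)
  · rintro u hu i j p ⟨ζ, hζ, rfl⟩ ⟨ζ', hζ', hp⟩
    have hb1 := hbase i i.2 ζ (ball_subset_closedBall hζ) u (ball_subset_closedBall hu)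
    have hb2 := hbase j j.2 ζ' (ball_subset_closedBall hζ') u (ball_subset_closedBall hu)
    rw [hp] at hb2
    refine Eq.trans ?_ (Trivialization.coordChangeL_apply _ _ ⟨hb1, hb2⟩ _).symm
    simp only [hh]
    rw [Trivialization.symm_apply_apply_mk _ hb1]
  -- Over `0` the section is `η` itself, and `η` is holomorphic by assumption.
  · intro u hu
    have hu' := ball_subset_closedBall hu
    have hb0 : (((0 : ℂ) : P1), param t₀ ρ u) ∈ (trivializationAt F H (q₀, t₀)).baseSet := by
      obtain ⟨ζ, hζ, h0⟩ := hi₀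
      rw [← h0]
      exact hbase q₀ hq₀ ζ (ball_subset_closedBall (ball_subset_ball one_le_two hζ)) u hu'
    have h1 := (holSecAt_pullback_iff (inclM E M ((0 : ℂ) : P1))).1 (hN u hu')
    have h2 := (((trivializationAt F H (q₀, t₀)).contMDiffAt_iff (IB := 𝓘(ℂ, ℂ).prod 𝓘(ℂ, E))
        (Trivialization.mem_source _ |>.2 hb0)).1 h1).2
    have h3 := h2.comp u (contMDiffAt_param hρ htgt hu')
    refine ((h3.contDiffAt.differentiableAt (by simp)).congr_of_eventuallyEq
      (Eventually.of_forall fun u' => ?_)).differentiableWithinAt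
    simp only [hh, hsec, Function.comp_apply]
    have h4 : ∀ t, (fiberIso triv (((0 : ℂ) : P1), t)).symm (η t) = η t := fun t =>
      (LinearEquiv.symm_apply_eq _).2 (fiberIso_zero triv t _).symm
    exact congrArg (fun a => (trivializationAt F H (q₀, t₀)
      ⟨(((0 : ℂ) : P1), param t₀ ρ u'), a⟩).2) (h4 _)

/-- `fiberIso` is an isomorphism of holomorphic vector bundles. -/
noncomputable def fiberHolIso : HolIso (𝓘(ℂ, ℂ).prod 𝓘(ℂ, E)) F H
    (projM E M *ᵖ (inclM E M ((0 : ℂ) : P1) *ᵖ H)) :=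
  (HolIso.ofMap (𝓘(ℂ, ℂ).prod 𝓘(ℂ, E)) F
    (V := projM E M *ᵖ (inclM E M ((0 : ℂ) : P1) *ᵖ H)) (V' := H)
    (fun y => (fiberIso triv y).symm) (fun x σ hσ => by
      obtain ⟨e, he, he'⟩ := exists_isHolFrameAt_pullback (I := 𝓘(ℂ, E))
        (I' := 𝓘(ℂ, ℂ).prod 𝓘(ℂ, E)) (F := F)
        (V := inclM E M ((0 : ℂ) : P1) *ᵖ H) (projM E M) x
      exact he'.holSecAt_map (A := fun y => (fiberIso triv y).symm.toLinearMap)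
        (fun i => holSecAt_fiberIso_symm triv (he.hol i) x.1) hσ)).symm

end FiberIso

end HolBundle

namespace HolBundle

open RiemannSphere VectorField

/-! ### Lie brackets as commutators of derivations -/

section Bracket

variable {EB : Type*} [NormedAddCommGroup EB] [NormedSpace ℂ EB] [CompleteSpace EB]
  {HB : Type*} [TopologicalSpace HB] {I : ModelWithCorners ℂ EB HB}
  {B : Type*} [TopologicalSpace B] [ChartedSpace HB B] [IsManifold I ω B]

theorem HolVFAt.mdifferentiableAt {X : Π x : B, TangentSpace I x} {x : B} (hX : HolVFAt I X x) :
    MDifferentiableAt I I.tangent (fun x => (X x : TangentBundle I B)) x :=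
  ContMDiffAt.mdifferentiableAt hX (by simp)

theorem HolVFAt.mdifferentiableAt_mlieBracket {X Y : Π x : B, TangentSpace I x} {x : B}
    (hX : HolVFAt I X x) (hY : HolVFAt I Y x) :
    MDifferentiableAt I I.tangent (fun x => (mlieBracket I X Y x : TangentBundle I B)) x := by
  have : IsManifold I ((2 : ℕ∞) + 1) B := IsManifold.of_le (n := ω) le_top
  have h1 : ContMDiffAt I I.tangent ((2 : ℕ∞) : WithTop ℕ∞) (fun x => (X x : TangentBundle I B))
      x :=
    ContMDiffAt.of_le hX le_top
  have h2 : ContMDiffAt I I.tangent ((2 : ℕ∞) : WithTop ℕ∞) (fun x => (Y x : TangentBundle I B))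
      x :=
    ContMDiffAt.of_le hY le_top
  have h3 := h1.mlieBracket_vectorField (m := 1) h2 (by
    rw [minSmoothness_of_isRCLikeNormedField]; norm_num)
  exact h3.mdifferentiableAt (by simp)

/-- The Lie bracket acts on functions as the commutator of derivations. -/
theorem mvfderiv_mlieBracket {f : B → ℂ} {X Y : Π x : B, TangentSpace I x} {x : B}
    (hf : HolFunAt I f x) (hX : HolVFAt I X x) (hY : HolVFAt I Y x) :
    mvfderiv I f x (mlieBracket I X Y x) = mvfderiv I (fun y => mvfderiv I f y (Y y)) x (X x)
      - mvfderiv I (fun y => mvfderiv I f y (X y)) x (Y x) := by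
  have : IsManifold I (minSmoothness ℂ 3) B := IsManifold.of_le (n := ω) le_top
  have : IsManifold I (minSmoothness ℂ 2) B := IsManifold.of_le (n := ω) le_top
  -- A nonvanishing auxiliary field is needed below, so the case of a trivial model space is
  -- separated.
  rcases subsingleton_or_nontrivial EB with hE | hE
  · have h0 : ∀ (h : B → ℂ) (v : TangentSpace I x), mvfderiv I h x v = 0 := fun h v => by
      rw [show v = 0 from Subsingleton.elim (α := EB) v 0, map_zero]
    simp [h0]
  obtain ⟨w, hw⟩ := exists_ne (0 : EB)
  obtain ⟨W, hW, hWx⟩ := exists_holSecAt_eq (I := I) (F := EB) (V := TangentSpace I) x w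
  have hXf := hf.mvfderiv hX
  have hYf := hf.mvfderiv hY
  have hfW : HolVFAt I (f • W) x := HolSecAt.smul hf hW
  -- The Jacobi identity for `X, Y, f • W` is compared with `f` times the one for `X, Y, W`. What
  -- remains is the difference of the two sides of the claim, multiplied by `W x ≠ 0`.
  have L := leibniz_identity_mlieBracket_apply (U := X) (V := Y) (W := f • W)
    (ContMDiffAt.of_le hX le_top) (ContMDiffAt.of_le hY le_top) (ContMDiffAt.of_le hfW le_top)
  have L' := leibniz_identity_mlieBracket_apply (U := X) (V := Y) (W := W)
    (ContMDiffAt.of_le hX le_top) (ContMDiffAt.of_le hY le_top) (ContMDiffAt.of_le hW le_top)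
  have key : ∀ Z : Π x : B, TangentSpace I x, mlieBracket I Z (f • W) =ᶠ[𝓝 x]
      (fun y => mvfderiv I f y (Z y)) • W + f • mlieBracket I Z W := by
    intro Z
    filter_upwards [hf.eventually, HolSecAt.eventually hW] with y hy hWy
    exact mlieBracket_smul_right hy.mdifferentiableAt (HolVFAt.mdifferentiableAt hWy)
  have e1 : ∀ Z Z' : Π x : B, TangentSpace I x, HolVFAt I Z x → HolVFAt I Z' x →
      mlieBracket I Z (mlieBracket I Z' (f • W)) x =
        mvfderiv I (fun y => mvfderiv I f y (Z' y)) x (Z x) • W x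
        + mvfderiv I f x (Z' x) • mlieBracket I Z W x
        + (mvfderiv I f x (Z x) • mlieBracket I Z' W x + f x • mlieBracket I Z (mlieBracket I Z' W)
            x) := by
    intro Z Z' hZ hZ'
    have hZ'f := hf.mvfderiv hZ'
    have hb := HolVFAt.mdifferentiableAt_mlieBracket hZ' hW
    rw [(EventuallyEq.refl (𝓝 x) Z).mlieBracket_vectorField_eq (key Z'), mlieBracket_add_right,
      mlieBracket_smul_right hZ'f.mdifferentiableAt (HolVFAt.mdifferentiableAt hW),
      mlieBracket_smul_right hf.mdifferentiableAt hb]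
    · exact HolVFAt.mdifferentiableAt (HolSecAt.smul hZ'f hW)
    · exact MDifferentiableAt.smul_section hf.mdifferentiableAt hb
  have e2 : mlieBracket I (mlieBracket I X Y) (f • W) x =
      mvfderiv I f x (mlieBracket I X Y x) • W x + f x • mlieBracket I (mlieBracket I X Y) W x :=
    mlieBracket_smul_right hf.mdifferentiableAt (HolVFAt.mdifferentiableAt hW)
  rw [e1 X Y hX hY, e1 Y X hY hX, e2, L', smul_add] at L
  have h3 : (mvfderiv I f x (mlieBracket I X Y x) - (mvfderiv I (fun y => mvfderiv I f y (Y y)) x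
      (X x)
      - mvfderiv I (fun y => mvfderiv I f y (X y)) x (Y x))) • W x = 0 := by
    rw [sub_smul, sub_smul]
    have h4 := neg_eq_zero.2 (sub_eq_zero.2 L)
    rw [← h4]
    abel
  rw [hWx] at h3
  exact sub_eq_zero.1 ((smul_eq_zero.1 h3).resolve_right hw)

/-- A tangent vector is determined by the derivatives of holomorphic functions along it. -/
theorem eq_of_mvfderiv_eq {x : B} {v w : TangentSpace I x}
    (h : ∀ f : B → ℂ, HolFunAt I f x → mvfderiv I f x v = mvfderiv I f x w) : v = w := by
  have key : ∀ (φ : EB →L[ℂ] ℂ), HasMFDerivAt I 𝓘(ℂ, ℂ) (fun y => φ (extChartAt I x y)) x φ := by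
    intro φ
    refine ⟨φ.continuous.continuousAt.comp (continuousAt_extChartAt x), ?_⟩
    refine φ.hasFDerivWithinAt.congr_of_eventuallyEq ?_ ?_
    · filter_upwards [extChartAt_target_mem_nhdsWithin (I := I) x] with y hy
      exact congrArg φ ((extChartAt I x).right_inv hy)
    · exact congrArg φ ((extChartAt I x).right_inv (mem_extChartAt_target x))
  refine (SeparatingDual.eq_iff_forall_dual_eq (R := ℂ) (V := EB)).2 fun φ => ?_
  have h1 := h (fun y => φ (extChartAt I x y))
    (φ.contMDiff.contMDiffAt.comp x contMDiffAt_extChartAt)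
  have h2 : ∀ u : TangentSpace I x, mvfderiv I (fun y => φ (extChartAt I x y)) x u = φ u := fun u =>
    congrArg (fun L : EB →L[ℂ] ℂ => L u) (key φ).mfderiv
  rwa [h2, h2] at h1

theorem mvfderiv_congr {f g : B → ℂ} {x : B} (h : ∀ᶠ y in 𝓝 x, f y = g y) :
    mvfderiv I f x = mvfderiv I g x := by
  have h1 : f =ᶠ[𝓝 x] g := h
  ext v
  exact congrArg (fun L : EB →L[ℂ] ℂ => L v) h1.mfderiv_eq

end Bracket

section Product

variable {E : Type*} [NormedAddCommGroup E] [NormedSpace ℂ E] [FiniteDimensional ℂ E]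
  {M : Type*} [TopologicalSpace M] [ChartedSpace E M] [IsManifold 𝓘(ℂ, E) ω M]

/-- The vector field on `P1 × M` given by a vector field on `M`. -/
def liftVF (X : Π t : M, TangentSpace 𝓘(ℂ, E) t) (y : P1 × M) :
    TangentSpace (𝓘(ℂ, ℂ).prod 𝓘(ℂ, E)) y := tvec y 0 (X y.2)

variable (E) in
/-- The vector field `z ∂_z`. -/
noncomputable def eulerVF (y : P1 × M) :
    TangentSpace (𝓘(ℂ, ℂ).prod 𝓘(ℂ, E)) y := tvec y (zCoord y.1) 0

theorem HolVFAt.liftVF {X : Π t : M, TangentSpace 𝓘(ℂ, E) t} {x : P1 × M}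
    (hX : HolVFAt 𝓘(ℂ, E) X x.2) : HolVFAt (𝓘(ℂ, ℂ).prod 𝓘(ℂ, E)) (liftVF X) x :=
  hX.tvec

variable (E) in
theorem holVFAt_eulerVF (x : P1 × M) : HolVFAt (𝓘(ℂ, ℂ).prod 𝓘(ℂ, E)) (eulerVF E) x :=
  holVFAt_euler x

theorem sum_smul_liftVF {ι : Type*} [Fintype ι] (c : ι → ℂ)
    (X : ι → Π t : M, TangentSpace 𝓘(ℂ, E) t) (y : P1 × M) :
    ∑ i, c i • liftVF (X i) y = tvec y 0 (∑ i, c i • X i y.2) := by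
  let L : TangentSpace 𝓘(ℂ, E) y.2 →ₗ[ℂ] TangentSpace (𝓘(ℂ, ℂ).prod 𝓘(ℂ, E)) y :=
    LinearMap.inr ℂ ℂ E
  have h := map_sum L (fun i => c i • X i y.2) Finset.univ
  simp only [map_smul] at h
  exact h.symm

theorem HolFunAt.comp_snd {f : M → ℂ} {x : P1 × M} (hf : HolFunAt 𝓘(ℂ, E) f x.2) :
    HolFunAt (𝓘(ℂ, ℂ).prod 𝓘(ℂ, E)) (fun y : P1 × M => f y.2) x :=
  ContMDiffAt.comp x hf contMDiffAt_snd

theorem holFunAt_zCoord {x : P1 × M} (hx : x.1 ≠ OnePoint.infty) :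
    HolFunAt (𝓘(ℂ, ℂ).prod 𝓘(ℂ, E)) (fun y : P1 × M => zCoord y.1) x :=
  (contMDiffAt_zCoord hx).comp x contMDiffAt_fst

theorem mvfderiv_comp_snd {f : M → ℂ} {x : P1 × M} (hf : MDifferentiableAt 𝓘(ℂ, E) 𝓘(ℂ, ℂ) f x.2)
    (ζ : ℂ) (v : TangentSpace 𝓘(ℂ, E) x.2) :
    mvfderiv (𝓘(ℂ, ℂ).prod 𝓘(ℂ, E)) (fun y : P1 × M => f y.2) x (tvec x ζ v)
      = mvfderiv 𝓘(ℂ, E) f x.2 v := by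
  have h1 := mfderiv_comp_apply (I := 𝓘(ℂ, ℂ).prod 𝓘(ℂ, E)) (I' := 𝓘(ℂ, E)) (I'' := 𝓘(ℂ, ℂ))
    (f := (Prod.snd : P1 × M → M)) (g := f) x hf mdifferentiableAt_snd (tvec x ζ v)
  rw [mfderiv_snd] at h1
  exact h1

theorem mvfderiv_zCoord {x : P1 × M} (hx : x.1 ≠ OnePoint.infty) (ζ : ℂ)
    (v : TangentSpace 𝓘(ℂ, E) x.2) :
    mvfderiv (𝓘(ℂ, ℂ).prod 𝓘(ℂ, E)) (fun y : P1 × M => zCoord y.1) x (tvec x ζ v) = ζ := by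
  obtain ⟨p, t⟩ := x
  obtain ⟨z, rfl⟩ := OnePoint.ne_infty_iff_exists.1 hx
  rw [mvfderiv_tvec (holFunAt_zCoord hx).mdifferentiableAt]
  simp [mvfderiv_const]

/-- The function `z` detects the component along `P1`, and functions pulled back from `M` detect the
component along `M`. With the commutator formula this computes brackets on `P1 × M` without charts.
-/
theorem eq_tvec_of_mvfderiv {x : P1 × M} (hx : x.1 ≠ OnePoint.infty)
    {u : TangentSpace (𝓘(ℂ, ℂ).prod 𝓘(ℂ, E)) x} {ζ : ℂ} {v : TangentSpace 𝓘(ℂ, E) x.2}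
    (h1 : mvfderiv (𝓘(ℂ, ℂ).prod 𝓘(ℂ, E)) (fun y : P1 × M => zCoord y.1) x u = ζ)
    (h2 : ∀ f : M → ℂ, HolFunAt 𝓘(ℂ, E) f x.2 →
      mvfderiv (𝓘(ℂ, ℂ).prod 𝓘(ℂ, E)) (fun y : P1 × M => f y.2) x u = mvfderiv 𝓘(ℂ, E) f x.2 v) :
    u = tvec x ζ v := by
  have h1' : (u : ℂ × E).1 = ζ := (mvfderiv_zCoord hx _ (u : ℂ × E).2).symm.trans h1
  have h3 : ((u : ℂ × E).2 : TangentSpace 𝓘(ℂ, E) x.2) = v :=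
    eq_of_mvfderiv_eq fun f hf =>
      (mvfderiv_comp_snd hf.mdifferentiableAt (u : ℂ × E).1 _).symm.trans (h2 f hf)
  exact Prod.ext (x := (u : ℂ × E)) h1' h3

theorem mvfderiv_eq_zero_of_eventually {f : P1 × M → ℂ} {c : ℂ} {x : P1 × M}
    (h : ∀ᶠ y in 𝓝 x, f y = c)
    (v : TangentSpace (𝓘(ℂ, ℂ).prod 𝓘(ℂ, E)) x) :
    mvfderiv (𝓘(ℂ, ℂ).prod 𝓘(ℂ, E)) f x v = 0 := by
  rw [mvfderiv_congr (g := fun _ => c) h, mvfderiv_const]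
  rfl

theorem eventually_fst_ne_infty {x : P1 × M} (hx : x.1 ≠ OnePoint.infty) :
    ∀ᶠ y in 𝓝 x, y.1 ≠ OnePoint.infty :=
  continuousAt_fst.eventually (eventually_ne_infty hx)

theorem HolFunAt.eventually_mdifferentiableAt_snd {f : M → ℂ} {x : P1 × M}
    (hf : HolFunAt 𝓘(ℂ, E) f x.2) :
    ∀ᶠ y in 𝓝 x, MDifferentiableAt 𝓘(ℂ, E) 𝓘(ℂ, ℂ) f y.2 :=
  (continuousAt_snd.eventually hf.eventually).mono fun _ hy => HolFunAt.mdifferentiableAt hy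

theorem mlieBracket_liftVF {X Y : Π t : M, TangentSpace 𝓘(ℂ, E) t} {x : P1 × M}
    (hx : x.1 ≠ OnePoint.infty) (hX : HolVFAt 𝓘(ℂ, E) X x.2) (hY : HolVFAt 𝓘(ℂ, E) Y x.2) :
    mlieBracket (𝓘(ℂ, ℂ).prod 𝓘(ℂ, E)) (liftVF X) (liftVF Y) x
      = tvec x 0 (mlieBracket 𝓘(ℂ, E) X Y x.2) := by
  refine eq_tvec_of_mvfderiv hx ?_ fun f hf => ?_
  · rw [mvfderiv_mlieBracket (holFunAt_zCoord hx) hX.liftVF hY.liftVF,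
      mvfderiv_eq_zero_of_eventually (c := 0), mvfderiv_eq_zero_of_eventually (c := 0), sub_zero]
    · exact (eventually_fst_ne_infty hx).mono fun y hy => mvfderiv_zCoord hy _ _
    · exact (eventually_fst_ne_infty hx).mono fun y hy => mvfderiv_zCoord hy _ _
  · have key : ∀ Z : Π t : M, TangentSpace 𝓘(ℂ, E) t,
        ∀ᶠ y in 𝓝 x, mvfderiv (𝓘(ℂ, ℂ).prod 𝓘(ℂ, E)) (fun y : P1 × M => f y.2) y (liftVF Z y)
          = (fun t => mvfderiv 𝓘(ℂ, E) f t (Z t)) y.2 := fun Z =>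
      hf.eventually_mdifferentiableAt_snd.mono fun y hy => mvfderiv_comp_snd hy _ _
    rw [mvfderiv_mlieBracket hf.comp_snd hX.liftVF hY.liftVF, mvfderiv_congr (key X),
      mvfderiv_congr (key Y), mvfderiv_mlieBracket hf hX hY]
    congr 1
    · exact mvfderiv_comp_snd (hf.mvfderiv hY).mdifferentiableAt _ _
    · exact mvfderiv_comp_snd (hf.mvfderiv hX).mdifferentiableAt _ _

theorem mlieBracket_eulerVF_liftVF {X : Π t : M, TangentSpace 𝓘(ℂ, E) t} {x : P1 × M}
    (hx : x.1 ≠ OnePoint.infty) (hX : HolVFAt 𝓘(ℂ, E) X x.2) :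
    mlieBracket (𝓘(ℂ, ℂ).prod 𝓘(ℂ, E)) (eulerVF E) (liftVF X) x = 0 := by
  have h0 : (0 : TangentSpace (𝓘(ℂ, ℂ).prod 𝓘(ℂ, E)) x) = tvec x 0 0 := rfl
  rw [h0]
  refine eq_tvec_of_mvfderiv hx ?_ fun f hf => ?_
  · have e1 : ∀ᶠ y in 𝓝 x, mvfderiv (𝓘(ℂ, ℂ).prod 𝓘(ℂ, E)) (fun y : P1 × M => zCoord y.1) y
        (eulerVF E y) = zCoord y.1 :=
      (eventually_fst_ne_infty hx).mono fun y hy => mvfderiv_zCoord hy _ _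
    rw [mvfderiv_mlieBracket (holFunAt_zCoord hx) (holVFAt_eulerVF E x) hX.liftVF,
      mvfderiv_eq_zero_of_eventually (c := 0), mvfderiv_congr e1, zero_sub, neg_eq_zero]
    · exact mvfderiv_zCoord hx _ _
    · exact (eventually_fst_ne_infty hx).mono fun y hy => mvfderiv_zCoord hy _ _
  · have e1 : ∀ᶠ y in 𝓝 x, mvfderiv (𝓘(ℂ, ℂ).prod 𝓘(ℂ, E)) (fun y : P1 × M => f y.2) y
        (eulerVF E y) = 0 :=
      hf.eventually_mdifferentiableAt_snd.mono fun y hy =>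
        (mvfderiv_comp_snd hy _ _).trans (map_zero _)
    have e2 : ∀ᶠ y in 𝓝 x, mvfderiv (𝓘(ℂ, ℂ).prod 𝓘(ℂ, E)) (fun y : P1 × M => f y.2) y (liftVF X y)
          = (fun t => mvfderiv 𝓘(ℂ, E) f t (X t)) y.2 :=
      hf.eventually_mdifferentiableAt_snd.mono fun y hy => mvfderiv_comp_snd hy _ _
    rw [mvfderiv_mlieBracket hf.comp_snd (holVFAt_eulerVF E x) hX.liftVF, map_zero,
      mvfderiv_eq_zero_of_eventually e1, mvfderiv_congr e2, sub_zero]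
    exact (mvfderiv_comp_snd (hf.mvfderiv hX).mdifferentiableAt _ _).trans (map_zero _)

/-- Near a point of `ℂ^* × M` the vector field `z ∂_z` and the lifts of a frame of `M` span. -/
theorem exists_vectorField_coeff {x : P1 × M} (hx : x.1 ∈ Cstar) :
    ∃ Z : Fin (Module.finrank ℂ E) → Π t : M, TangentSpace 𝓘(ℂ, E) t,
      (∀ i, HolVFAt 𝓘(ℂ, E) (Z i) x.2) ∧
      ∀ X : Π y : P1 × M, TangentSpace (𝓘(ℂ, ℂ).prod 𝓘(ℂ, E)) y,
        HolVFAt (𝓘(ℂ, ℂ).prod 𝓘(ℂ, E)) X x →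
        ∃ (c₀ : P1 × M → ℂ) (c : Fin (Module.finrank ℂ E) → P1 × M → ℂ),
          HolFunAt (𝓘(ℂ, ℂ).prod 𝓘(ℂ, E)) c₀ x ∧
          (∀ i, HolFunAt (𝓘(ℂ, ℂ).prod 𝓘(ℂ, E)) (c i) x) ∧
          ∀ᶠ y in 𝓝 x, X y = c₀ y • eulerVF E y + ∑ i, c i y • liftVF (Z i) y := by
  obtain ⟨Z, hZ, hZ'⟩ := exists_isHolFrameAt_pullback (I := 𝓘(ℂ, E))
    (I' := 𝓘(ℂ, ℂ).prod 𝓘(ℂ, E)) (F := E) (V := TangentSpace 𝓘(ℂ, E)) (projM E M) x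
  refine ⟨Z, hZ.hol, fun X hX => ?_⟩
  have hX' : HolVFAt (𝓘(ℂ, ℂ).prod 𝓘(ℂ, E))
      (fun y => tvec y (X y : ℂ × E).1 (X y : ℂ × E).2) x := hX
  obtain ⟨h1, h2⟩ := (holVFAt_iff_of_ne_infty hx.2).1 hX'
  obtain ⟨c, hc, hc', -⟩ := hZ'.exists_coeff _
  have hz := holFunAt_zCoord (E := E) hx.2
  refine ⟨fun y => (X y : ℂ × E).1 * (zCoord y.1)⁻¹, c, h1.mul (hz.inv (zCoord_ne_zero hx)),
    hc' h2, ?_⟩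
  filter_upwards [hc, hz.continuousAt.eventually_ne (zCoord_ne_zero hx)] with y hy hy'
  rw [sum_smul_liftVF]
  refine Prod.ext (x := (X y : ℂ × E)) ?_ ?_
  · change (X y : ℂ × E).1 = ((X y : ℂ × E).1 * (zCoord y.1)⁻¹) * zCoord y.1 + 0
    field_simp
    ring
  · change (X y : ℂ × E).2 = ((X y : ℂ × E).1 * (zCoord y.1)⁻¹) • (0 : E) + _
    rw [smul_zero, zero_add]
    exact hy

end Product

end HolBundle

namespace HolBundle

open VectorField

/-! ### Calculus of covariant derivatives -/

section Calculus

variable {EB : Type*} [NormedAddCommGroup EB] [NormedSpace ℂ EB]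
  {HB : Type*} [TopologicalSpace HB] {I : ModelWithCorners ℂ EB HB}
  {B : Type*} [TopologicalSpace B] [ChartedSpace HB B]
  {F : Type*} [NormedAddCommGroup F] [NormedSpace ℂ F]
  {V : B → Type*} [TopologicalSpace (TotalSpace F V)] [∀ x, AddCommGroup (V x)]
  [∀ x, Module ℂ (V x)] [∀ x, TopologicalSpace (V x)] [∀ x, IsTopologicalAddGroup (V x)]
  [∀ x, ContinuousSMul ℂ (V x)] [FiberBundle F V]

section Raw

variable {cov : (Π x, V x) → Π x, TangentSpace I x →L[ℂ] V x} {S : Set B}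

theorem isCov_add (hcov : IsCovariantDerivativeOn F cov S) {σ τ : Π x, V x} {x : B}
    (hσ : DiffSecAt I F σ x) (hτ : DiffSecAt I F τ x) (hx : x ∈ S) (v : TangentSpace I x) :
    cov (fun y => σ y + τ y) x v = cov σ x v + cov τ x v :=
  congrArg (fun L : TangentSpace I x →L[ℂ] V x => L v) (hcov.add hσ hτ hx)

theorem isCov_smul (hcov : IsCovariantDerivativeOn F cov S) {f : B → ℂ} {σ : Π x, V x} {x : B}
    (hf : MDifferentiableAt I 𝓘(ℂ, ℂ) f x) (hσ : DiffSecAt I F σ x) (hx : x ∈ S)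
    (v : TangentSpace I x) :
    cov (fun y => f y • σ y) x v = f x • cov σ x v + mvfderiv I f x v • σ x :=
  congrArg (fun L : TangentSpace I x →L[ℂ] V x => L v) (hcov.leibniz hσ hf hx)

theorem isCov_zero [VectorBundle ℂ F V] (hcov : IsCovariantDerivativeOn F cov S) {x : B}
    (hx : x ∈ S) (v : TangentSpace I x) : cov (fun _ => 0) x v = 0 :=
  congrArg (fun L : TangentSpace I x →L[ℂ] V x => L v) (hcov.zero hx)

theorem isCov_sum_smul [VectorBundle ℂ F V] (hcov : IsCovariantDerivativeOn F cov S) {ι : Type*}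
    (s : Finset ι) {c : ι → B → ℂ} {e : ι → Π x, V x} {x : B}
    (hc : ∀ i, MDifferentiableAt I 𝓘(ℂ, ℂ) (c i) x) (he : ∀ i, DiffSecAt I F (e i) x) (hx : x ∈ S)
    (v : TangentSpace I x) :
    cov (fun y => ∑ i ∈ s, c i y • e i y) x v
      = ∑ i ∈ s, (c i x • cov (e i) x v + mvfderiv I (c i) x v • e i x) := by
  classical
  induction s using Finset.induction_on with
  | empty => simpa using isCov_zero hcov hx v
  | insert a s ha ih =>
    simp only [Finset.sum_insert ha]
    rw [isCov_add hcov ((he a).smul (hc a)) (DiffSecAt.sum fun i => (he i).smul (hc i)) hx,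
      isCov_smul hcov (hc a) (he a) hx, ih]

theorem isCov_congr (hcov : IsCovariantDerivativeOn F cov S) (hS : IsOpen S) {σ τ : Π x, V x}
    {x : B} (hx : x ∈ S) (hσ : DiffSecAt I F σ x) (h : ∀ᶠ y in 𝓝 x, τ y = σ y) :
    cov τ x = cov σ x :=
  hcov.congr_of_eventuallyEq (hσ.congr h) hσ (hS.mem_nhds hx) h

theorem isCov_eq_sum [VectorBundle ℂ F V] (hcov : IsCovariantDerivativeOn F cov S) (hS : IsOpen S)
    {ι : Type*} [Fintype ι] {c : ι → B → ℂ} {e : ι → Π x, V x} {σ : Π x, V x} {x : B}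
    (hx : x ∈ S) (hc : ∀ i, MDifferentiableAt I 𝓘(ℂ, ℂ) (c i) x) (he : ∀ i, DiffSecAt I F (e i) x)
    (hσ : ∀ᶠ y in 𝓝 x, σ y = ∑ i, c i y • e i y) (v : TangentSpace I x) :
    cov σ x v = ∑ i, (c i x • cov (e i) x v + mvfderiv I (c i) x v • e i x) := by
  rw [isCov_congr hcov hS hx (DiffSecAt.sum fun i => (he i).smul (hc i)) hσ]
  exact isCov_sum_smul hcov Finset.univ hc he hx v

end Raw

namespace HolConnection

variable [IsManifold I 1 B] {S : Set B}

theorem ext' {D D' : HolConnection I F V S} (h : D.toFun = D'.toFun) : D = D' := by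
  cases D
  cases D'
  congr

/-- Where locality of covariant derivatives is not available, both values are `0` by the
normalization `eq_zero`; hence no regularity is assumed. -/
theorem congr (D : HolConnection I F V S) (hS : IsOpen S) {σ τ : Π x, V x} {x : B}
    (h : ∀ᶠ y in 𝓝 x, τ y = σ y) : D.toFun τ x = D.toFun σ x := by
  by_cases hx : x ∈ S ∧ DiffSecAt I F σ x
  · exact isCov_congr D.isCov hS hx.1 hx.2 h
  · rw [D.eq_zero σ x hx, D.eq_zero τ x fun hx' => hx ⟨hx'.1, DiffSecAt.congr hx'.2
      (h.mono fun _ h => h.symm)⟩]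

variable [VectorBundle ℂ F V]

/-- A connection is determined by its values on holomorphic frames. -/
theorem ext_of_frame [IsManifold I ω B] [ContMDiffVectorBundle ω F V I]
    {D D' : HolConnection I F V S} (hS : IsOpen S)
    (h : ∀ x ∈ S, ∃ (n : ℕ) (e : Fin n → Π x, V x), IsHolFrameAt I F e x ∧
      ∀ i, D.toFun (e i) x = D'.toFun (e i) x) : D = D' := by
  refine ext' (funext fun σ => funext fun x => ?_)
  by_cases hx : x ∈ S ∧ DiffSecAt I F σ x
  · obtain ⟨n, e, he, hDe⟩ := h x hx.1
    obtain ⟨c, hσ, -, hc⟩ := he.exists_coeff σ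
    ext v
    rw [isCov_eq_sum D.isCov hS hx.1 (hc hx.2) (fun i => (he.hol i).diffSecAt) hσ,
      isCov_eq_sum D'.isCov hS hx.1 (hc hx.2) (fun i => (he.hol i).diffSecAt) hσ]
    simp only [hDe]
  · rw [D.eq_zero σ x hx, D'.eq_zero σ x hx]

theorem ext_of_holSecAt [IsManifold I ω B] [ContMDiffVectorBundle ω F V I] [FiniteDimensional ℂ F]
    {D D' : HolConnection I F V S} (hS : IsOpen S)
    (h : ∀ x ∈ S, ∀ σ, HolSecAt I F σ x → D.toFun σ x = D'.toFun σ x) : D = D' := by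
  refine ext_of_frame hS fun x hx => ?_
  obtain ⟨e, he⟩ := exists_isHolFrameAt I F V x
  exact ⟨_, e, he, fun i => h x hx _ (he.hol i)⟩

end HolConnection

end Calculus

/-! ### Maps linear over germs of holomorphic functions -/

section Tensorial

variable {EB : Type*} [NormedAddCommGroup EB] [NormedSpace ℂ EB]
  {HB : Type*} [TopologicalSpace HB] {I : ModelWithCorners ℂ EB HB}
  {B : Type*} [TopologicalSpace B] [ChartedSpace HB B]
  {F : Type*} [NormedAddCommGroup F] [NormedSpace ℂ F]
  {V : B → Type*} [TopologicalSpace (TotalSpace F V)] [∀ x, AddCommGroup (V x)]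
  [∀ x, Module ℂ (V x)] [∀ x, TopologicalSpace (V x)] [FiberBundle F V] [VectorBundle ℂ F V]
  {W : Type*} [AddCommGroup W] [Module ℂ W]

variable (I F) in
/-- The map `Ψ` from germs at `x` of holomorphic sections to a vector space is linear over the
germs of holomorphic functions. -/
structure IsTensorialAt (Ψ : (Π x, V x) → W) (x : B) : Prop where
  congr : ∀ σ τ : Π x, V x, HolSecAt I F σ x → (∀ᶠ y in 𝓝 x, τ y = σ y) → Ψ τ = Ψ σ
  add : ∀ σ τ : Π x, V x, HolSecAt I F σ x → HolSecAt I F τ x →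
    Ψ (fun y => σ y + τ y) = Ψ σ + Ψ τ
  smul : ∀ (f : B → ℂ) (σ : Π x, V x), HolFunAt I f x → HolSecAt I F σ x →
    Ψ (fun y => f y • σ y) = f x • Ψ σ

theorem IsTensorialAt.sum [ContMDiffVectorBundle ω F V I] {Ψ : (Π x, V x) → W} {x : B}
    (hΨ : IsTensorialAt I F Ψ x)
    {ι : Type*} (s : Finset ι) {c : ι → B → ℂ} {e : ι → Π x, V x}
    (hc : ∀ i, HolFunAt I (c i) x) (he : ∀ i, HolSecAt I F (e i) x) :
    Ψ (fun y => ∑ i ∈ s, c i y • e i y) = ∑ i ∈ s, c i x • Ψ (e i) := by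
  classical
  induction s using Finset.induction_on with
  | empty =>
    have h := hΨ.smul (fun _ => 0) (fun _ => 0) (HolFunAt.const 0 x) (holSecAt_zero x)
    simpa using h
  | insert a s ha ih =>
    simp only [Finset.sum_insert ha]
    rw [hΨ.add _ _ (HolSecAt.smul (hc a) (he a)) (HolSecAt.sum fun i _ => HolSecAt.smul (hc i)
        (he i)),
      hΨ.smul _ _ (hc a) (he a), ih]

theorem IsTensorialAt.eq_sum [ContMDiffVectorBundle ω F V I] {Ψ : (Π x, V x) → W} {x : B}
    (hΨ : IsTensorialAt I F Ψ x)
    {ι : Type*} [Fintype ι] {c : ι → B → ℂ} {e : ι → Π x, V x}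
    (hc : ∀ i, HolFunAt I (c i) x) (he : ∀ i, HolSecAt I F (e i) x) {σ : Π x, V x}
    (hσ : ∀ᶠ y in 𝓝 x, σ y = ∑ i, c i y • e i y) :
    Ψ σ = ∑ i, c i x • Ψ (e i) := by
  rw [hΨ.congr _ σ (HolSecAt.sum fun i _ => HolSecAt.smul (hc i) (he i)) hσ,
    hΨ.sum Finset.univ hc he]

theorem IsTensorialAt.eq_zero [ContMDiffVectorBundle ω F V I] {Ψ : (Π x, V x) → W} {x : B}
    (hΨ : IsTensorialAt I F Ψ x)
    {ι : Type*} [Fintype ι] {e : ι → Π x, V x} (he : IsHolFrameAt I F e x)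
    (h : ∀ i, Ψ (e i) = 0) {σ : Π x, V x} (hσ : HolSecAt I F σ x) : Ψ σ = 0 := by
  obtain ⟨c, h1, h2, -⟩ := he.exists_coeff σ
  rw [hΨ.eq_sum (h2 hσ) he.hol h1]
  simp [h]

/-- A tensorial map is induced by a linear map on the fibre. -/
theorem IsTensorialAt.exists_linearMap [IsManifold I ω B] [ContMDiffVectorBundle ω F V I]
    [FiniteDimensional ℂ F] {Ψ : (Π x, V x) → W} {x : B} (hΨ : IsTensorialAt I F Ψ x) :
    ∃ L : V x →ₗ[ℂ] W, ∀ σ : Π x, V x, HolSecAt I F σ x → Ψ σ = L (σ x) := by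
  obtain ⟨e, he⟩ := exists_isHolFrameAt I F V x
  have hspan : ⊤ ≤ Submodule.span ℂ (Set.range fun i => e i x) := by
    intro a _
    obtain ⟨σ, -, rfl⟩ := exists_holSecAt_eq (I := I) (F := F) x a
    obtain ⟨c, h1, -⟩ := he.exists_coeff σ
    rw [h1.self_of_nhds]
    exact Submodule.sum_mem _ fun i _ => Submodule.smul_mem _ _ (Submodule.subset_span ⟨i, rfl⟩)
  let b := Module.Basis.mk he.linearIndependent hspan
  refine ⟨b.constr ℂ fun i => Ψ (e i), fun σ hσ => ?_⟩
  obtain ⟨c, h1, h2, -⟩ := he.exists_coeff σ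
  rw [hΨ.eq_sum (h2 hσ) he.hol h1, h1.self_of_nhds, map_sum]
  refine Finset.sum_congr rfl fun i _ => ?_
  rw [map_smul]
  congr 1
  have hb : e i x = b i := by simp [b]
  rw [hb, b.constr_basis]

end Tensorial

/-! ### Tensoriality of the curvature -/

section Curvature

variable {EB : Type*} [NormedAddCommGroup EB] [NormedSpace ℂ EB] [CompleteSpace EB]
  {HB : Type*} [TopologicalSpace HB] {I : ModelWithCorners ℂ EB HB}
  {B : Type*} [TopologicalSpace B] [ChartedSpace HB B] [IsManifold I ω B]
  {F : Type*} [NormedAddCommGroup F] [NormedSpace ℂ F]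
  {V : B → Type*} [TopologicalSpace (TotalSpace F V)] [∀ x, AddCommGroup (V x)]
  [∀ x, Module ℂ (V x)] [∀ x, TopologicalSpace (V x)] [∀ x, IsTopologicalAddGroup (V x)]
  [∀ x, ContinuousSMul ℂ (V x)] [FiberBundle F V] [VectorBundle ℂ F V]
  [ContMDiffVectorBundle ω F V I] {S : Set B}

namespace HolConnection

/-- The curvature `[∇_X, ∇_Y] σ - ∇_{[X,Y]} σ`. -/
noncomputable def curv (D : HolConnection I F V S) (X Y : Π x : B, TangentSpace I x) (σ : Π x, V x)
    (x : B) : V x :=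
  D.toFun (fun y => D.toFun σ y (Y y)) x (X x) - D.toFun (fun y => D.toFun σ y (X y)) x (Y x)
    - D.toFun σ x (mlieBracket I X Y x)

variable (D : HolConnection I F V S)

theorem eventually_apply_eq {D : HolConnection I F V S} (hS : IsOpen S) {σ τ : Π x, V x}
    {X Y : Π x : B, TangentSpace I x} {x : B}
    (h : ∀ᶠ y in 𝓝 x, τ y = σ y) (h' : ∀ᶠ y in 𝓝 x, Y y = X y) :
    ∀ᶠ y in 𝓝 x, D.toFun τ y (Y y) = D.toFun σ y (X y) := by
  filter_upwards [h.eventually_nhds, h'] with y hy hy'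
  rw [D.congr hS hy, hy']

theorem curv_congr (hS : IsOpen S) {σ τ : Π x, V x} {X X' Y Y' : Π x : B, TangentSpace I x} {x : B}
    (h : ∀ᶠ y in 𝓝 x, τ y = σ y) (hX : ∀ᶠ y in 𝓝 x, X' y = X y) (hY : ∀ᶠ y in 𝓝 x, Y' y = Y y) :
    D.curv X' Y' τ x = D.curv X Y σ x := by
  have hb : mlieBracket I X' Y' x = mlieBracket I X Y x :=
    EventuallyEq.mlieBracket_vectorField_eq hX hY
  rw [curv, curv, D.congr hS (eventually_apply_eq hS h hX), D.congr hS
      (eventually_apply_eq hS h hY),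
    D.congr hS h, hX.self_of_nhds, hY.self_of_nhds, hb]

theorem curv_swap (X Y : Π x : B, TangentSpace I x) (σ : Π x, V x) (x : B) :
    D.curv Y X σ x = - D.curv X Y σ x := by
  rw [curv, curv, mlieBracket_swap_apply, map_neg]
  abel

variable {D}

/-- First derivatives of the factor cancel by symmetry in `X` and `Y`. The second derivatives
combine to the commutator `[X, Y] f`, which cancels against `∇_{[X,Y]}`. -/
theorem isTensorialAt_curv_section (hS : IsOpen S) {X Y : Π x : B, TangentSpace I x} {x : B}
    (hx : x ∈ S) (hX : HolVFAt I X x) (hY : HolVFAt I Y x) :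
    IsTensorialAt I F (fun σ => D.curv X Y σ x) x where
  congr σ τ _ h := D.curv_congr hS h (Eventually.of_forall fun _ => rfl)
    (Eventually.of_forall fun _ => rfl)
  add σ τ hσ hτ := by
    have key : ∀ Z : Π x : B, TangentSpace I x, HolVFAt I Z x → ∀ v,
        D.toFun (fun y => D.toFun (fun y => σ y + τ y) y (Z y)) x v
          = D.toFun (fun y => D.toFun σ y (Z y)) x v + D.toFun (fun y => D.toFun τ y (Z y)) x v :=
              by
      intro Z hZ v
      rw [← isCov_add D.isCov (D.hol x hx σ Z hσ hZ).diffSecAt (D.hol x hx τ Z hτ hZ).diffSecAt hx,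
        D.congr hS]
      filter_upwards [hσ.eventually, hτ.eventually, hS.mem_nhds hx] with y h1 h2 hy
      exact isCov_add D.isCov h1.diffSecAt h2.diffSecAt hy _
    simp only [curv]
    rw [key Y hY, key X hX, isCov_add D.isCov hσ.diffSecAt hτ.diffSecAt hx]
    abel
  smul f σ hf hσ := by
    have key : ∀ Z : Π x : B, TangentSpace I x, HolVFAt I Z x → ∀ v,
        D.toFun (fun y => D.toFun (fun y => f y • σ y) y (Z y)) x v
          = (f x • D.toFun (fun y => D.toFun σ y (Z y)) x v + mvfderiv I f x v • D.toFun σ x (Z x))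
            + (mvfderiv I f x (Z x) • D.toFun σ x v
              + mvfderiv I (fun y => mvfderiv I f y (Z y)) x v • σ x) := by
      intro Z hZ v
      have h1 := D.hol x hx σ Z hσ hZ
      rw [← isCov_smul D.isCov hf.mdifferentiableAt h1.diffSecAt hx,
        ← isCov_smul D.isCov (hf.mvfderiv hZ).mdifferentiableAt hσ.diffSecAt hx,
        ← isCov_add D.isCov (HolSecAt.smul hf h1).diffSecAt
          (HolSecAt.smul (hf.mvfderiv hZ) hσ).diffSecAt hx, D.congr hS]
      filter_upwards [hσ.eventually, hf.eventually, hS.mem_nhds hx] with y h1 h2 hy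
      exact isCov_smul D.isCov h2.mdifferentiableAt h1.diffSecAt hy _
    simp only [curv]
    rw [key Y hY, key X hX, isCov_smul D.isCov hf.mdifferentiableAt hσ.diffSecAt hx,
      mvfderiv_mlieBracket hf hX hY]
    module

/-- The derivative of the factor appears once in `∇_X ∇_{fY}` and once in `∇_{[X, fY]}`, and the two
cancel. -/
theorem isTensorialAt_curv_right (hS : IsOpen S) {X : Π x : B, TangentSpace I x} {σ : Π x, V x}
    {x : B}
    (hx : x ∈ S) (hσ : HolSecAt I F σ x) :
    IsTensorialAt I EB (V := (TangentSpace I : B → Type _)) (fun Y => D.curv X Y σ x) x where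
  congr Y Z _ h := D.curv_congr hS (Eventually.of_forall fun _ => rfl)
    (Eventually.of_forall fun _ => rfl) h
  add Y Z hY hZ := by
    simp only [curv, map_add]
    have h1 := D.hol x hx σ Y hσ hY
    have h2 := D.hol x hx σ Z hσ hZ
    have hb : mlieBracket I X (fun y => Y y + Z y) x = mlieBracket I X Y x + mlieBracket I X Z x :=
      mlieBracket_add_right (HolVFAt.mdifferentiableAt hY) (HolVFAt.mdifferentiableAt hZ)
    rw [isCov_add D.isCov h1.diffSecAt h2.diffSecAt hx, hb, map_add]
    abel
  smul f Y hf hY := by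
    simp only [curv, map_smul]
    have h1 := D.hol x hx σ Y hσ hY
    have hb : mlieBracket I X (fun y => f y • Y y) x
        = mvfderiv I f x (X x) • Y x + f x • mlieBracket I X Y x :=
      mlieBracket_smul_right hf.mdifferentiableAt (HolVFAt.mdifferentiableAt hY)
    rw [isCov_smul D.isCov hf.mdifferentiableAt h1.diffSecAt hx, hb, map_add, map_smul, map_smul]
    module

end HolConnection

end Curvature

end HolBundle

namespace HolBundle

open RiemannSphere VectorField

/-! ### Sections of `π^*K` pulled back from `M` -/

section PullSec

variable {E : Type*} [NormedAddCommGroup E] [NormedSpace ℂ E]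
  {M : Type*} [TopologicalSpace M] [ChartedSpace E M]
  {F : Type*} [NormedAddCommGroup F] [NormedSpace ℂ F]
  {K : M → Type*}

variable (E) in
/-- The section of `π^*K` given by a section of `K`. -/
def pullSec (s : Π t, K t) (y : P1 × M) : (projM E M *ᵖ K) y := s y.2

variable [TopologicalSpace (TotalSpace F K)]
  [∀ t, AddCommGroup (K t)] [∀ t, Module ℂ (K t)] [∀ t, TopologicalSpace (K t)]
  [FiberBundle F K] [VectorBundle ℂ F K]
  [IsManifold 𝓘(ℂ, E) ω M] [ContMDiffVectorBundle ω F K 𝓘(ℂ, E)]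

theorem HolSecAt.pullSec {s : Π t, K t} {x : P1 × M} (hs : HolSecAt 𝓘(ℂ, E) F s x.2) :
    HolSecAt (𝓘(ℂ, ℂ).prod 𝓘(ℂ, E)) F (pullSec E s) x :=
  HolSecAt.pullback (projM E M) hs

theorem DiffSecAt.pullSec {s : Π t, K t} {x : P1 × M} (hs : DiffSecAt 𝓘(ℂ, E) F s x.2) :
    DiffSecAt (𝓘(ℂ, ℂ).prod 𝓘(ℂ, E)) F (pullSec E s) x :=
  DiffSecAt.pullback (projM E M) hs

theorem eventually_holSecAt_snd {s : Π t, K t} {x : P1 × M} (hs : HolSecAt 𝓘(ℂ, E) F s x.2) :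
    ∀ᶠ y in 𝓝 x, HolSecAt 𝓘(ℂ, E) F s y.2 :=
  continuousAt_snd.eventually hs.eventually

theorem exists_isHolFrameAt_pullSec [FiniteDimensional ℂ F] (x : P1 × M) :
    ∃ e : Fin (Module.finrank ℂ F) → Π t, K t, IsHolFrameAt 𝓘(ℂ, E) F e x.2 ∧
      IsHolFrameAt (𝓘(ℂ, ℂ).prod 𝓘(ℂ, E)) F (fun i => pullSec E (e i)) x :=
  exists_isHolFrameAt_pullback (I := 𝓘(ℂ, E)) (I' := 𝓘(ℂ, ℂ).prod 𝓘(ℂ, E)) (F := F) (V := K)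
    (projM E M) x

theorem eventually_fst_mem_Cstar {x : P1 × M} (hx : x.1 ∈ Cstar) : ∀ᶠ y in 𝓝 x, y.1 ∈ Cstar :=
  continuousAt_fst.eventually (isOpen_Cstar.mem_nhds hx)

variable (M) in
theorem isOpen_Cstar_prod : IsOpen {x : P1 × M | x.1 ∈ Cstar} :=
  isOpen_Cstar.preimage continuous_fst

end PullSec

section Inv

variable {E : Type*} [NormedAddCommGroup E] [NormedSpace ℂ E] [FiniteDimensional ℂ E]
  {M : Type*} [TopologicalSpace M] [ChartedSpace E M] [IsManifold 𝓘(ℂ, E) ω M]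

theorem holFunAt_inv_zCoord {x : P1 × M} (hx : x.1 ≠ ((0 : ℂ) : P1)) :
    HolFunAt (𝓘(ℂ, ℂ).prod 𝓘(ℂ, E)) (fun y : P1 × M => (zCoord y.1)⁻¹) x :=
  (contMDiffAt_inv_zCoord hx).comp x contMDiffAt_fst

theorem mvfderiv_inv_zCoord {z : ℂ} (hz : z ≠ 0) (t : M) (ζ : ℂ) (v : TangentSpace 𝓘(ℂ, E) t) :
    mvfderiv (𝓘(ℂ, ℂ).prod 𝓘(ℂ, E)) (fun y : P1 × M => (zCoord y.1)⁻¹) ((z : P1), t)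
      (tvec ((z : P1), t) ζ v) = - (ζ / z ^ 2) := by
  rw [mvfderiv_tvec (holFunAt_inv_zCoord (by simpa using hz)).mdifferentiableAt]
  simp [mvfderiv_const, div_eq_mul_inv]

end Inv

/-! ### Connections of the form `∇ + C/z + (U/z + R) dz/z` and their curvature -/

section Twist

variable {E : Type*} [NormedAddCommGroup E] [NormedSpace ℂ E] [FiniteDimensional ℂ E]
  {M : Type*} [TopologicalSpace M] [ChartedSpace E M] [IsManifold 𝓘(ℂ, E) ω M]
  {F : Type*} [NormedAddCommGroup F] [NormedSpace ℂ F]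
  {K : M → Type*} [TopologicalSpace (TotalSpace F K)]
  [∀ t, AddCommGroup (K t)] [∀ t, Module ℂ (K t)] [∀ t, TopologicalSpace (K t)]
  [∀ t, IsTopologicalAddGroup (K t)] [∀ t, ContinuousSMul ℂ (K t)]
  [FiberBundle F K] [VectorBundle ℂ F K] [ContMDiffVectorBundle ω F K 𝓘(ℂ, E)]

/-- The value at `(z, t)` of the derivative of `π^*s` along `ζ ∂_z + v`. -/
noncomputable def pullDeriv
    (D : HolConnection (𝓘(ℂ, ℂ).prod 𝓘(ℂ, E)) F (projM E M *ᵖ K) {x | x.1 ∈ Cstar})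
    (s : Π t, K t) (p : P1) (t : M) (ζ : ℂ) (v : TangentSpace 𝓘(ℂ, E) t) : K t :=
  D.toFun (pullSec E s) (p, t) (tvec (p, t) ζ v)

/-- The connection `D` is `∇ + C/z + (U/z + N) dz/z` on the sections `π^*s`. -/
structure IsTwist (D : HolConnection (𝓘(ℂ, ℂ).prod 𝓘(ℂ, E)) F (projM E M *ᵖ K) {x | x.1 ∈ Cstar})
    (N : HolConnection 𝓘(ℂ, E) F K univ) (C : Π t : M, TangentSpace 𝓘(ℂ, E) t →ₗ[ℂ] K t →ₗ[ℂ] K t)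
    (U R : Π t : M, K t →ₗ[ℂ] K t) : Prop where
  C_hol : ∀ (t : M) (s : Π t, K t) (X : Π t : M, TangentSpace 𝓘(ℂ, E) t),
    HolSecAt 𝓘(ℂ, E) F s t → HolVFAt 𝓘(ℂ, E) X t → HolSecAt 𝓘(ℂ, E) F (fun y => C y (X y) (s y)) t
  U_hol : ∀ (t : M) (s : Π t, K t), HolSecAt 𝓘(ℂ, E) F s t →
    HolSecAt 𝓘(ℂ, E) F (fun y => U y (s y)) t
  R_hol : ∀ (t : M) (s : Π t, K t), HolSecAt 𝓘(ℂ, E) F s t →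
    HolSecAt 𝓘(ℂ, E) F (fun y => R y (s y)) t
  eq : ∀ (z : ℂ) (t : M) (s : Π t, K t) (ζ : ℂ) (v : TangentSpace 𝓘(ℂ, E) t), z ≠ 0 →
    HolSecAt 𝓘(ℂ, E) F s t →
      pullDeriv D s z t ζ v = N.toFun s t v + z⁻¹ • C t v (s t)
        + (ζ / z) • (z⁻¹ • U t (s t) + R t (s t))

variable {D : HolConnection (𝓘(ℂ, ℂ).prod 𝓘(ℂ, E)) F (projM E M *ᵖ K) {x | x.1 ∈ Cstar}}
  {N : HolConnection 𝓘(ℂ, E) F K univ} {C : Π t : M, TangentSpace 𝓘(ℂ, E) t →ₗ[ℂ] K t →ₗ[ℂ] K t}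
  {U R : Π t : M, K t →ₗ[ℂ] K t}

/-- First derivatives of pulled back sections are again of the form `π^*s₁ + z⁻¹ π^*s₂`, so this
computes second derivatives. The last term, the derivative of `z⁻¹`, is the origin of the summand `+
C` in `∇^r(U) - [C, V] + C = 0`. -/
theorem deriv_pullSec_add_inv_smul {s₁ s₂ : Π t, K t} {z : ℂ} {t : M} (hz : z ≠ 0)
    (h₁ : HolSecAt 𝓘(ℂ, E) F s₁ t) (h₂ : HolSecAt 𝓘(ℂ, E) F s₂ t)
    {σ : Π y : P1 × M, (projM E M *ᵖ K) y}
    (hσ : ∀ᶠ y in 𝓝 ((z : P1), t), σ y = pullSec E s₁ y + (zCoord y.1)⁻¹ • pullSec E s₂ y) (ζ : ℂ)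
    (v : TangentSpace 𝓘(ℂ, E) t) :
    D.toFun σ ((z : P1), t) (tvec ((z : P1), t) ζ v)
      = (pullDeriv D s₁ z t ζ v + z⁻¹ • pullDeriv D s₂ z t ζ v - (ζ / z ^ 2) • s₂ t : K t) := by
  have hx : ((z : P1), t) ∈ {x : P1 × M | x.1 ∈ Cstar} := by simpa using hz
  have h1 := h₁.pullSec (x := ((z : P1), t))
  have h2 := h₂.pullSec (x := ((z : P1), t))
  have hi := holFunAt_inv_zCoord (E := E) (x := ((z : P1), t)) (by simpa using hz)
  rw [D.congr (isOpen_Cstar_prod M) hσ]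
  refine (isCov_add D.isCov h1.diffSecAt (HolSecAt.smul hi h2).diffSecAt hx _).trans ?_
  rw [isCov_smul D.isCov hi.mdifferentiableAt h2.diffSecAt hx, mvfderiv_inv_zCoord hz, neg_smul,
    ← sub_eq_add_neg, ← add_sub_assoc]
  rfl

namespace IsTwist

theorem eventually_lift (h : IsTwist D N C U R) {s : Π t, K t} {x : P1 × M} (hx : x.1 ∈ Cstar)
    (hs : HolSecAt 𝓘(ℂ, E) F s x.2) (X : Π t : M, TangentSpace 𝓘(ℂ, E) t) :
    ∀ᶠ y in 𝓝 x, D.toFun (pullSec E s) y (liftVF X y)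
      = pullSec E (fun t => N.toFun s t (X t)) y
        + (zCoord y.1)⁻¹ • pullSec E (fun t => C t (X t) (s t)) y := by
  filter_upwards [eventually_fst_mem_Cstar hx, eventually_holSecAt_snd hs] with y hy hsy
  obtain ⟨p, t⟩ := y
  obtain ⟨z, rfl⟩ := OnePoint.ne_infty_iff_exists.1 hy.2
  have := h.eq z t s 0 (X t) (by simpa using hy) hsy
  rw [zero_div, zero_smul, add_zero] at this
  exact this

theorem eventually_euler (h : IsTwist D N C U R) {s : Π t, K t} {x : P1 × M} (hx : x.1 ∈ Cstar)
    (hs : HolSecAt 𝓘(ℂ, E) F s x.2) :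
    ∀ᶠ y in 𝓝 x, D.toFun (pullSec E s) y (eulerVF E y)
      = pullSec E (fun t => R t (s t)) y + (zCoord y.1)⁻¹ • pullSec E (fun t => U t (s t)) y := by
  filter_upwards [eventually_fst_mem_Cstar hx, eventually_holSecAt_snd hs] with y hy hsy
  obtain ⟨p, t⟩ := y
  obtain ⟨z, rfl⟩ := OnePoint.ne_infty_iff_exists.1 hy.2
  have hz : z ≠ 0 := by simpa using hy
  have := h.eq z t s z 0 hz hsy
  rw [div_self hz, one_smul, map_zero, map_zero, LinearMap.zero_apply, smul_zero, add_zero,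
      zero_add,
    add_comm] at this
  exact this

/-- The coefficients of `1`, `z⁻¹`, `z⁻²` are the defects of flatness of `∇^r`, of `∇^r(C) = 0` and
of commutativity of the Higgs field. The expansion serves both directions of the correspondence. -/
theorem curv_lift_lift (h : IsTwist D N C U R) {s : Π t, K t} {z : ℂ} {t : M} (hz : z ≠ 0)
    (hs : HolSecAt 𝓘(ℂ, E) F s t) {X Y : Π t : M, TangentSpace 𝓘(ℂ, E) t}
    (hX : HolVFAt 𝓘(ℂ, E) X t) (hY : HolVFAt 𝓘(ℂ, E) Y t) :
    D.curv (liftVF X) (liftVF Y) (pullSec E s) ((z : P1), t)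
      = (N.curv X Y s t
        + z⁻¹ • ((N.toFun (fun y => C y (Y y) (s y)) t (X t) - C t (Y t) (N.toFun s t (X t)))
          - (N.toFun (fun y => C y (X y) (s y)) t (Y t) - C t (X t) (N.toFun s t (Y t)))
          - C t (mlieBracket 𝓘(ℂ, E) X Y t) (s t))
        + z⁻¹ ^ 2 • (C t (X t) (C t (Y t) (s t)) - C t (Y t) (C t (X t) (s t))) : K t) := by
  have hx : ((z : P1), t).1 ∈ Cstar := by simpa using hz
  have key : ∀ Y Z : Π t : M, TangentSpace 𝓘(ℂ, E) t, HolVFAt 𝓘(ℂ, E) Y t →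
      D.toFun (fun y => D.toFun (pullSec E s) y (liftVF Y y)) ((z : P1), t) (liftVF Z ((z : P1), t))
      = (N.toFun (fun y => N.toFun s y (Y y)) t (Z t) + z⁻¹ • C t (Z t) (N.toFun s t (Y t))
        + z⁻¹ • (N.toFun (fun y => C y (Y y) (s y)) t (Z t)
          + z⁻¹ • C t (Z t) (C t (Y t) (s t))) : K t) := by
    intro Y Z hY
    have h1 := N.hol t (mem_univ _) s Y hs hY
    have h2 := h.C_hol t s Y hs hY
    refine (deriv_pullSec_add_inv_smul hz h1 h2 (h.eventually_lift hx hs Y) 0 (Z t)).trans ?_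
    rw [h.eq z t _ 0 _ hz h1, h.eq z t _ 0 _ hz h2]
    simp only [zero_div, zero_smul, add_zero, sub_zero]
    rfl
  have hb := mlieBracket_liftVF (x := ((z : P1), t)) hx.2 hX hY
  have h3 : D.toFun (pullSec E s) ((z : P1), t)
      (mlieBracket (𝓘(ℂ, ℂ).prod 𝓘(ℂ, E)) (liftVF X) (liftVF Y) ((z : P1), t))
      = (N.toFun s t (mlieBracket 𝓘(ℂ, E) X Y t) + z⁻¹ • C t (mlieBracket 𝓘(ℂ, E) X Y t) (s t) : K
          t) := by
    rw [hb]
    refine (h.eq z t s 0 _ hz hs).trans ?_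
    simp only [zero_div, zero_smul, add_zero]
  have h4 := congrArg₂ (fun a b : K t => a - b) (congrArg₂ (fun a b : K t => a - b) (key Y X hY)
      (key X Y hX)) h3
  refine Eq.trans h4 ?_
  change @Eq (K t) _ _
  simp only [HolConnection.curv]
  module

/-- With `R = w/2 - V` the three coefficients are, up to sign, the defects of `∇^r(V) = 0`, of
`∇^r(U) - [C, V] + C = 0` and of `[C, U] = 0`. The constant scalar `w/2` drops out of all of them.
The bracket of `z ∂_z` with a lift is zero. -/
theorem curv_euler_lift (h : IsTwist D N C U R) {s : Π t, K t} {z : ℂ} {t : M} (hz : z ≠ 0)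
    (hs : HolSecAt 𝓘(ℂ, E) F s t) {X : Π t : M, TangentSpace 𝓘(ℂ, E) t}
    (hX : HolVFAt 𝓘(ℂ, E) X t) :
    D.curv (eulerVF E) (liftVF X) (pullSec E s) ((z : P1), t)
      = (R t (N.toFun s t (X t)) - N.toFun (fun y => R y (s y)) t (X t)
        + z⁻¹ • (U t (N.toFun s t (X t)) - N.toFun (fun y => U y (s y)) t (X t)
          + R t (C t (X t) (s t)) - C t (X t) (R t (s t)) - C t (X t) (s t))
        + z⁻¹ ^ 2 • (U t (C t (X t) (s t)) - C t (X t) (U t (s t))) : K t) := by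
  have hx : ((z : P1), t).1 ∈ Cstar := by simpa using hz
  have k1 : D.toFun (fun y => D.toFun (pullSec E s) y (liftVF X y)) ((z : P1), t)
        (eulerVF E ((z : P1), t))
      = (z⁻¹ • U t (N.toFun s t (X t)) + R t (N.toFun s t (X t))
        + z⁻¹ • (z⁻¹ • U t (C t (X t) (s t)) + R t (C t (X t) (s t)))
        - z⁻¹ • C t (X t) (s t) : K t) := by
    have h1 := N.hol t (mem_univ _) s X hs hX
    have h2 := h.C_hol t s X hs hX
    refine (deriv_pullSec_add_inv_smul hz h1 h2 (h.eventually_lift hx hs X) z 0).trans ?_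
    rw [h.eq z t _ z _ hz h1, h.eq z t _ z _ hz h2, div_self hz, show z / z ^ 2 = z⁻¹ by field_simp]
    simp only [map_zero, LinearMap.zero_apply, smul_zero, one_smul, zero_add]
    rfl
  have k2 : D.toFun (fun y => D.toFun (pullSec E s) y (eulerVF E y)) ((z : P1), t)
        (liftVF X ((z : P1), t))
      = (N.toFun (fun y => R y (s y)) t (X t) + z⁻¹ • C t (X t) (R t (s t))
        + z⁻¹ • (N.toFun (fun y => U y (s y)) t (X t) + z⁻¹ • C t (X t) (U t (s t))) : K t) := by
    have h1 := h.R_hol t s hs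
    have h2 := h.U_hol t s hs
    refine (deriv_pullSec_add_inv_smul hz h1 h2 (h.eventually_euler hx hs) 0 (X t)).trans ?_
    rw [h.eq z t _ 0 _ hz h1, h.eq z t _ 0 _ hz h2]
    simp only [zero_div, zero_smul, add_zero, sub_zero]
    rfl
  have hb := mlieBracket_eulerVF_liftVF (x := ((z : P1), t)) hx.2 hX
  have h3 : D.toFun (pullSec E s) ((z : P1), t)
      (mlieBracket (𝓘(ℂ, ℂ).prod 𝓘(ℂ, E)) (eulerVF E) (liftVF X) ((z : P1), t)) = (0 : K t) := by
    rw [hb]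
    exact map_zero _
  have h4 := congrArg₂ (fun a b : K t => a - b) (congrArg₂ (fun a b : K t => a - b) k1 k2) h3
  refine Eq.trans h4 ?_
  change @Eq (K t) _ _
  module

end IsTwist

/-- Flatness can be tested on pulled back sections, with `z ∂_z` and lifts of vector fields. -/
theorem isFlat_of_pullSec [FiniteDimensional ℂ F]
    (h1 : ∀ (z : ℂ) (t : M) (s : Π t, K t) (X Y : Π t : M, TangentSpace 𝓘(ℂ, E) t), z ≠ 0 →
      HolSecAt 𝓘(ℂ, E) F s t → HolVFAt 𝓘(ℂ, E) X t → HolVFAt 𝓘(ℂ, E) Y t →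
      D.curv (liftVF X) (liftVF Y) (pullSec E s) ((z : P1), t) = 0)
    (h2 : ∀ (z : ℂ) (t : M) (s : Π t, K t) (X : Π t : M, TangentSpace 𝓘(ℂ, E) t), z ≠ 0 →
      HolSecAt 𝓘(ℂ, E) F s t → HolVFAt 𝓘(ℂ, E) X t →
      D.curv (eulerVF E) (liftVF X) (pullSec E s) ((z : P1), t) = 0) : D.IsFlat := by
  rintro x hx σ X Y hσ hX hY
  change D.curv X Y σ x = 0
  have hS := isOpen_Cstar_prod M
  obtain ⟨e, he, he'⟩ := exists_isHolFrameAt_pullSec (E := E) (F := F) (K := K) x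
  obtain ⟨Z, hZ, hZ'⟩ := exists_vectorField_coeff (E := E) hx
  have hxz : ((zCoord x.1 : P1), x.2) = x := by rw [coe_zCoord hx.2]
  have a1 : ∀ i j, D.curv (liftVF (Z i)) (liftVF (Z j)) σ x = 0 := fun i j =>
    (HolConnection.isTensorialAt_curv_section hS hx (hZ i).liftVF (hZ j).liftVF).eq_zero he'
      (fun k => by
        have := h1 (zCoord x.1) x.2 (e k) (Z i) (Z j) (zCoord_ne_zero hx) (he.hol k) (hZ i) (hZ j)
        rwa [hxz] at this) hσ
  have a2 : ∀ i, D.curv (eulerVF E) (liftVF (Z i)) σ x = 0 := fun i =>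
    (HolConnection.isTensorialAt_curv_section hS hx (holVFAt_eulerVF E x) (hZ i).liftVF).eq_zero he'
      (fun k => by
        have := h2 (zCoord x.1) x.2 (e k) (Z i) (zCoord_ne_zero hx) (he.hol k) (hZ i)
        rwa [hxz] at this) hσ
  have a3 : D.curv (eulerVF E) (eulerVF E) σ x = 0 := by
    simp [HolConnection.curv, mlieBracket_self]
  -- Tensoriality is available in the second vector field only; antisymmetry of the curvature
  -- transfers the conclusion to the first.
  have ext : ∀ X : Π y : P1 × M, TangentSpace (𝓘(ℂ, ℂ).prod 𝓘(ℂ, E)) y,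
      HolVFAt (𝓘(ℂ, ℂ).prod 𝓘(ℂ, E)) X x → D.curv X (eulerVF E) σ x = 0 →
      (∀ i, D.curv X (liftVF (Z i)) σ x = 0) → ∀ Y : Π y : P1 × M, TangentSpace
          (𝓘(ℂ, ℂ).prod 𝓘(ℂ, E)) y,
      HolVFAt (𝓘(ℂ, ℂ).prod 𝓘(ℂ, E)) Y x → D.curv X Y σ x = 0 := by
    intro X hX hXE hXZ Y hY
    obtain ⟨c₀, c, h0, hc, hYc⟩ := hZ' Y hY
    have hΨ := HolConnection.isTensorialAt_curv_right (D := D) (X := X) hS hx hσ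
    have i1 : HolVFAt (𝓘(ℂ, ℂ).prod 𝓘(ℂ, E)) (fun y => c₀ y • eulerVF E y) x :=
      HolSecAt.smul h0 (holVFAt_eulerVF E x)
    have i2 : HolVFAt (𝓘(ℂ, ℂ).prod 𝓘(ℂ, E)) (fun y => ∑ i, c i y • liftVF (Z i) y) x :=
      HolSecAt.sum (V := TangentSpace (𝓘(ℂ, ℂ).prod 𝓘(ℂ, E))) fun i _ =>
        HolSecAt.smul (V := TangentSpace (𝓘(ℂ, ℂ).prod 𝓘(ℂ, E))) (hc i) (hZ i).liftVF
    have e1 := hΨ.congr _ Y (HolSecAt.add i1 i2) hYc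
    have e2 := hΨ.add _ _ i1 i2
    have e3 := hΨ.smul _ _ h0 (holVFAt_eulerVF E x)
    have e4 := hΨ.sum (e := fun i => liftVF (Z i)) Finset.univ hc fun i => (hZ i).liftVF
    simp only [hXE, hXZ, smul_zero, Finset.sum_const_zero] at e3 e4
    rw [e1, e2, e3, e4, add_zero]
  have b1 : D.curv X (eulerVF E) σ x = 0 := by
    rw [D.curv_swap, ext _ (holVFAt_eulerVF E x) a3 a2 X hX, neg_zero]
  have b2 : ∀ i, D.curv X (liftVF (Z i)) σ x = 0 := fun i => by
    rw [D.curv_swap, ext _ (hZ i).liftVF (by rw [D.curv_swap, a2, neg_zero]) (a1 i) X hX, neg_zero]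
  exact ext X hX b1 b2 Y hY

end Twist

end HolBundle

namespace HolBundle

open RiemannSphere VectorField

/-! ### Restriction of sections of `π^*K` to slices and to lines -/

section Slices

variable {E : Type*} [NormedAddCommGroup E] [NormedSpace ℂ E] [FiniteDimensional ℂ E]
  {M : Type*} [TopologicalSpace M] [ChartedSpace E M] [IsManifold 𝓘(ℂ, E) ω M]
  {F : Type*} [NormedAddCommGroup F] [NormedSpace ℂ F] [FiniteDimensional ℂ F]
  {K : M → Type*} [TopologicalSpace (TotalSpace F K)]
  [∀ t, AddCommGroup (K t)] [∀ t, Module ℂ (K t)] [∀ t, TopologicalSpace (K t)]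
  [FiberBundle F K] [VectorBundle ℂ F K] [ContMDiffVectorBundle ω F K 𝓘(ℂ, E)]

theorem HolFunAt.slice {f : P1 × M → ℂ} {p : P1} {t : M}
    (hf : HolFunAt (𝓘(ℂ, ℂ).prod 𝓘(ℂ, E)) f (p, t)) : HolFunAt 𝓘(ℂ, E) (fun t' => f (p, t')) t :=
  ContMDiffAt.comp (g := f) t hf (contMDiffAt_const.prodMk contMDiffAt_id)

theorem mdifferentiableAt_slice {f : P1 × M → ℂ} {p : P1} {t : M}
    (hf : MDifferentiableAt (𝓘(ℂ, ℂ).prod 𝓘(ℂ, E)) 𝓘(ℂ, ℂ) f (p, t)) :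
    MDifferentiableAt 𝓘(ℂ, E) 𝓘(ℂ, ℂ) (fun t' => f (p, t')) t :=
  MDifferentiableAt.comp (g := f) (f := fun t' => (p, t')) (I' := 𝓘(ℂ, ℂ).prod 𝓘(ℂ, E)) t hf
    (mdifferentiableAt_const.prodMk mdifferentiableAt_id)

theorem eventually_slice {p : P1} {t : M} {Q : P1 × M → Prop} (h : ∀ᶠ y in 𝓝 (p, t), Q y) :
    ∀ᶠ t' in 𝓝 t, Q (p, t') :=
  (Continuous.tendsto (by fun_prop : Continuous fun t' : M => (p, t')) t).eventually h

theorem eventually_fiber {p : P1} {t : M} {Q : P1 × M → Prop} (h : ∀ᶠ y in 𝓝 (p, t), Q y) :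
    ∀ᶠ q in 𝓝 p, Q (q, t) :=
  (Continuous.tendsto (by fun_prop : Continuous fun q : P1 => (q, t)) p).eventually h

/-- The coefficients in a pulled back frame restrict to `{p} × M`, and the frame itself does not
depend on `p`. -/
theorem HolSecAt.slice {σ : Π y : P1 × M, K y.2} {p : P1} {t : M}
    (hσ : HolSecAt (V := projM E M *ᵖ K) (𝓘(ℂ, ℂ).prod 𝓘(ℂ, E)) F σ (p, t)) :
    HolSecAt (V := K) 𝓘(ℂ, E) F (fun t' => σ (p, t')) t := by
  obtain ⟨e, he, he'⟩ := exists_isHolFrameAt_pullSec (E := E) (F := F) (K := K) (p, t)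
  obtain ⟨c, h1, h2, -⟩ := he'.exists_coeff σ
  exact (HolSecAt.sum (s := Finset.univ) fun i _ => HolSecAt.smul (h2 hσ i).slice (he.hol i)).congr
    (eventually_slice h1)

theorem DiffSecAt.slice {σ : Π y : P1 × M, K y.2} {p : P1} {t : M}
    (hσ : DiffSecAt (V := projM E M *ᵖ K) (𝓘(ℂ, ℂ).prod 𝓘(ℂ, E)) F σ (p, t)) :
    DiffSecAt (V := K) 𝓘(ℂ, E) F (fun t' => σ (p, t')) t := by
  obtain ⟨e, he, he'⟩ := exists_isHolFrameAt_pullSec (E := E) (F := F) (K := K) (p, t)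
  obtain ⟨c, h1, -, h2⟩ := he'.exists_coeff σ
  exact (DiffSecAt.sum (s := Finset.univ) fun i =>
    (he.hol i).diffSecAt.smul (mdifferentiableAt_slice (h2 hσ i))).congr (eventually_slice h1)

/-- Along `P1 × {t}` a pulled back frame is constant in the fixed space `K t`. This turns sections
into vector valued functions, to which Liouville's theorem applies. -/
theorem HolSecAt.comp_fiber {G : Type*} [NormedAddCommGroup G] [NormedSpace ℂ G]
    {σ : Π y : P1 × M, K y.2} {p : P1} {t : M} (A : K t →ₗ[ℂ] G)
    (hσ : HolSecAt (V := projM E M *ᵖ K) (𝓘(ℂ, ℂ).prod 𝓘(ℂ, E)) F σ (p, t)) :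
    ContMDiffAt 𝓘(ℂ, ℂ) 𝓘(ℂ, G) ω (fun q => A (σ (q, t))) p := by
  obtain ⟨e, he, he'⟩ := exists_isHolFrameAt_pullSec (E := E) (F := F) (K := K) (p, t)
  obtain ⟨c, h1, h2, -⟩ := he'.exists_coeff σ
  have h3 : ContMDiffAt 𝓘(ℂ, ℂ) 𝓘(ℂ, G) ω (fun q => ∑ i, c i (q, t) • A (e i t)) p :=
    contMDiffAt_finsetSum fun i _ => ContMDiffAt.smul (ContMDiffAt.comp (g := c i)
      (f := fun q => (q, t)) p (h2 hσ i) (contMDiffAt_id.prodMk contMDiffAt_const))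
          contMDiffAt_const
  refine h3.congr_of_eventuallyEq ((eventually_fiber h1).mono fun q hq => ?_)
  have := congrArg A hq
  refine this.trans ((map_sum A _ _).trans (Finset.sum_congr rfl fun i _ => map_smul A _ _))

theorem DiffSecAt.comp_fiber {G : Type*} [NormedAddCommGroup G] [NormedSpace ℂ G]
    {σ : Π y : P1 × M, K y.2} {z : ℂ} {t : M} (A : K t →ₗ[ℂ] G)
    (hσ : DiffSecAt (V := projM E M *ᵖ K) (𝓘(ℂ, ℂ).prod 𝓘(ℂ, E)) F σ ((z : P1), t)) :
    DifferentiableAt ℂ (fun w : ℂ => A (σ ((w : P1), t))) z := by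
  obtain ⟨e, he, he'⟩ := exists_isHolFrameAt_pullSec (E := E) (F := F) (K := K) ((z : P1), t)
  obtain ⟨c, h1, -, h2⟩ := he'.exists_coeff σ
  have h3 : DifferentiableAt ℂ (fun w : ℂ => ∑ i, c i ((w : P1), t) • A (e i t)) z :=
    DifferentiableAt.fun_sum fun i _ => by
      have h4 : MDifferentiableAt 𝓘(ℂ, ℂ) 𝓘(ℂ, ℂ) (fun w : ℂ => c i ((w : P1), t)) z :=
        MDifferentiableAt.comp (g := c i) (I' := 𝓘(ℂ, ℂ).prod 𝓘(ℂ, E))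
          (f := fun w : ℂ => ((w : P1), t)) z (h2 hσ i)
          (((contMDiff_coe z).mdifferentiableAt (by simp)).prodMk mdifferentiableAt_const)
      exact h4.differentiableAt.smul_const _
  refine h3.congr_of_eventuallyEq ?_
  filter_upwards [(contMDiff_coe.continuous.tendsto z).eventually (eventually_fiber h1)] with w hw
  have := congrArg A hw
  refine this.trans ((map_sum A _ _).trans (Finset.sum_congr rfl fun i _ => map_smul A _ _))

end Slices

/-! ### Construction of the connection on `π^*K` -/

section Construction

variable {E : Type*} [NormedAddCommGroup E] [NormedSpace ℂ E] [FiniteDimensional ℂ E]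
  {M : Type*} [TopologicalSpace M] [ChartedSpace E M] [IsManifold 𝓘(ℂ, E) ω M]
  {F : Type*} [NormedAddCommGroup F] [NormedSpace ℂ F] [FiniteDimensional ℂ F]
  {K : M → Type*} [TopologicalSpace (TotalSpace F K)]
  [∀ t, AddCommGroup (K t)] [∀ t, Module ℂ (K t)] [∀ t, TopologicalSpace (K t)]
  [∀ t, IsTopologicalAddGroup (K t)] [∀ t, ContinuousSMul ℂ (K t)]
  [FiberBundle F K] [VectorBundle ℂ F K] [ContMDiffVectorBundle ω F K 𝓘(ℂ, E)]

theorem isCov_eventually_eq_sum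
    {cov : (Π x, (projM E M *ᵖ K) x) →
      Π x, TangentSpace (𝓘(ℂ, ℂ).prod 𝓘(ℂ, E)) x →L[ℂ] (projM E M *ᵖ K) x}
    (hcov : IsCovariantDerivativeOn F cov {x : P1 × M | x.1 ∈ Cstar}) {x : P1 × M}
    {ι : Type*} [Fintype ι] {c : ι → P1 × M → ℂ}
    {e : ι → Π t, K t} {σ : Π y, (projM E M *ᵖ K) y}
    (hc : ∀ i, HolFunAt (𝓘(ℂ, ℂ).prod 𝓘(ℂ, E)) (c i) x) (he : ∀ i, HolSecAt 𝓘(ℂ, E) F (e i) x.2)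
    (hσ : ∀ᶠ y in 𝓝 x, σ y = ∑ i, c i y • pullSec E (e i) y)
    (W : Π y : P1 × M, TangentSpace (𝓘(ℂ, ℂ).prod 𝓘(ℂ, E)) y) :
    ∀ᶠ y in 𝓝 x, y.1 ∈ Cstar → cov σ y (W y) = ∑ i, (c i y • cov (pullSec E (e i)) y (W y)
      + mvfderiv (𝓘(ℂ, ℂ).prod 𝓘(ℂ, E)) (c i) y (W y) • pullSec E (e i) y) := by
  filter_upwards [hσ.eventually_nhds, eventually_all.2 fun i => (hc i).eventually,
    eventually_all.2 fun i => eventually_holSecAt_snd (he i)] with y h1 h2 h3 hy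
  exact isCov_eq_sum hcov (isOpen_Cstar_prod M) hy (fun i => (h2 i).mdifferentiableAt)
    (fun i => (h3 i).pullSec.diffSecAt) h1 (W y)

/-- A covariant derivative on `π^*K` preserves holomorphy if it does so on pulled back sections. -/
theorem holSecAt_cov
    {cov : (Π x, (projM E M *ᵖ K) x) →
      Π x, TangentSpace (𝓘(ℂ, ℂ).prod 𝓘(ℂ, E)) x →L[ℂ] (projM E M *ᵖ K) x}
    (hcov : IsCovariantDerivativeOn F cov {x : P1 × M | x.1 ∈ Cstar}) {x : P1 × M}
    (hx : x.1 ∈ Cstar)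
    (h1 : ∀ s : Π t, K t, HolSecAt 𝓘(ℂ, E) F s x.2 → HolSecAt (𝓘(ℂ, ℂ).prod 𝓘(ℂ, E)) F
      (fun y => cov (pullSec E s) y (eulerVF E y)) x)
    (h2 : ∀ (s : Π t, K t) (X : Π t : M, TangentSpace 𝓘(ℂ, E) t), HolSecAt 𝓘(ℂ, E) F s x.2 →
      HolVFAt 𝓘(ℂ, E) X x.2 → HolSecAt (𝓘(ℂ, ℂ).prod 𝓘(ℂ, E)) F
      (fun y => cov (pullSec E s) y (liftVF X y)) x)
    {σ : Π y, (projM E M *ᵖ K) y} {X : Π y : P1 × M, TangentSpace (𝓘(ℂ, ℂ).prod 𝓘(ℂ, E)) y}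
    (hσ : HolSecAt (𝓘(ℂ, ℂ).prod 𝓘(ℂ, E)) F σ x) (hX : HolVFAt (𝓘(ℂ, ℂ).prod 𝓘(ℂ, E)) X x) :
    HolSecAt (𝓘(ℂ, ℂ).prod 𝓘(ℂ, E)) F (fun y => cov σ y (X y)) x := by
  obtain ⟨e, he, he'⟩ := exists_isHolFrameAt_pullSec (E := E) (F := F) (K := K) x
  obtain ⟨Z, hZ, hZ'⟩ := exists_vectorField_coeff (E := E) hx
  obtain ⟨c, c1, c2, -⟩ := he'.exists_coeff σ
  obtain ⟨d₀, d, d1, d2, d3⟩ := hZ' X hX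
  have key : ∀ i, HolSecAt (𝓘(ℂ, ℂ).prod 𝓘(ℂ, E)) F
      (fun y => cov (pullSec E (e i)) y (X y)) x := by
    intro i
    refine (HolSecAt.add (HolSecAt.smul d1 (h1 _ (he.hol i))) (HolSecAt.sum (s := Finset.univ)
      fun j _ => HolSecAt.smul (d2 j) (h2 _ _ (he.hol i) (hZ j)))).congr ?_
    filter_upwards [d3] with y hy
    rw [hy, map_add, map_smul, map_sum]
    simp only [map_smul]
  refine (HolSecAt.sum (s := Finset.univ) fun i _ => HolSecAt.add
    (HolSecAt.smul (c2 hσ i) (key i)) (HolSecAt.smul ((c2 hσ i).mvfderiv hX) (he'.hol i))).congr ?_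
  filter_upwards [isCov_eventually_eq_sum hcov (c2 hσ) he.hol c1 X, eventually_fst_mem_Cstar hx]
    with y hy hy'
  exact hy hy'

variable (F) in
/-- A linear identification of the fibre with the model fibre. -/
noncomputable def fiberCoord (t : M) : K t ≃ₗ[ℂ] F :=
  (trivializationAt F K t).linearEquivAt ℂ t (mem_baseSet_trivializationAt F K t)

variable (F) in
/-- The derivative in direction `∂_z` of a section of `π^*K`. -/
noncomputable def fiberDeriv (σ : Π y : P1 × M, K y.2) (x : P1 × M) : K x.2 :=
  (fiberCoord F x.2).symm (deriv (fun w : ℂ => fiberCoord F x.2 (σ ((w : P1), x.2))) (zCoord x.1))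

theorem fiberDeriv_smul {σ : Π y : P1 × M, K y.2} {g : P1 × M → ℂ} {z : ℂ} {t : M}
    (hg : MDifferentiableAt (𝓘(ℂ, ℂ).prod 𝓘(ℂ, E)) 𝓘(ℂ, ℂ) g ((z : P1), t))
    (hσ : DiffSecAt (V := projM E M *ᵖ K) (𝓘(ℂ, ℂ).prod 𝓘(ℂ, E)) F σ ((z : P1), t)) :
    fiberDeriv F (fun y => g y • σ y) ((z : P1), t)
      = g ((z : P1), t) • fiberDeriv F σ ((z : P1), t)
        + deriv (fun w : ℂ => g ((w : P1), t)) z • σ ((z : P1), t) := by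
  have e1 := hσ.comp_fiber (K := K) (fiberCoord F t).toLinearMap
  have e2 : MDifferentiableAt 𝓘(ℂ, ℂ) 𝓘(ℂ, ℂ) (fun w : ℂ => g ((w : P1), t)) z :=
    MDifferentiableAt.comp (g := g) (I' := 𝓘(ℂ, ℂ).prod 𝓘(ℂ, E))
      (f := fun w : ℂ => ((w : P1), t)) z hg
      (((contMDiff_coe z).mdifferentiableAt (by simp)).prodMk mdifferentiableAt_const)
  have e3 := deriv_smul e2.differentiableAt e1
  refine (fiberCoord F t).injective (Eq.trans ((fiberCoord F t).apply_symm_apply _) ?_)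
  refine Eq.trans ?_ (e3.trans ?_)
  · congr 1
    funext w
    exact map_smul (fiberCoord F t) _ _
  · refine Eq.trans ?_ (map_add (fiberCoord F t) _ _).symm
    refine congrArg₂ (fun a b : F => a + b) (Eq.trans ?_ (map_smul (fiberCoord F t) _ _).symm)
      (map_smul (fiberCoord F t) _ _).symm
    exact congrArg (fun a : F => g ((z : P1), t) • a) ((fiberCoord F t).apply_symm_apply _).symm

section

variable (N : HolConnection 𝓘(ℂ, E) F K univ)
  (C : Π t : M, TangentSpace 𝓘(ℂ, E) t →ₗ[ℂ] K t →ₗ[ℂ] K t)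
  (U R : Π t : M, K t →ₗ[ℂ] K t)

/-- The linear map `(ζ, v) ↦ ζ ∂_z σ + ∇_v σ + z⁻¹ C_v σ + (ζ / z) (z⁻¹ U + R) σ`. -/
noncomputable def twistLin (σ : Π y : P1 × M, K y.2) (x : P1 × M) : ℂ × E →ₗ[ℂ] K x.2 where
  toFun u := u.1 • fiberDeriv F σ x + N.toFun (fun t => σ (x.1, t)) x.2 u.2
    + (zCoord x.1)⁻¹ • C x.2 u.2 (σ x)
    + (u.1 / zCoord x.1) • ((zCoord x.1)⁻¹ • U x.2 (σ x) + R x.2 (σ x))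
  map_add' u u' := by
    have h1 : N.toFun (fun t => σ (x.1, t)) x.2 (u.2 + u'.2)
      = N.toFun (fun t => σ (x.1, t)) x.2 u.2 + N.toFun (fun t => σ (x.1, t)) x.2 u'.2 :=
          map_add _ _ _
    have h2 : C x.2 (u.2 + u'.2) = C x.2 u.2 + C x.2 u'.2 := map_add _ _ _
    simp only [Prod.fst_add, Prod.snd_add, h1, h2, LinearMap.add_apply, add_div]
    module
  map_smul' c u := by
    have h1 : N.toFun (fun t => σ (x.1, t)) x.2 (c • u.2)
      = c • N.toFun (fun t => σ (x.1, t)) x.2 u.2 := map_smul _ _ _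
    have h2 : C x.2 (c • u.2) = c • C x.2 u.2 := map_smul _ _ _
    simp only [Prod.smul_fst, Prod.smul_snd, h1, h2, LinearMap.smul_apply, smul_eq_mul,
      mul_div_assoc,
      RingHom.id_apply]
    module

open scoped Classical in
/-- The covariant derivative `∇ + C/z + (U/z + R) dz/z` on `π^*K`. -/
noncomputable def twistCov (σ : Π y : P1 × M, (projM E M *ᵖ K) y) (x : P1 × M) :
    TangentSpace (𝓘(ℂ, ℂ).prod 𝓘(ℂ, E)) x →L[ℂ] (projM E M *ᵖ K) x :=
  if x.1 ∈ Cstar ∧ DiffSecAt (𝓘(ℂ, ℂ).prod 𝓘(ℂ, E)) F σ x then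
    (LinearMap.toContinuousLinearMap (twistLin N C U R σ x) : ℂ × E →L[ℂ] K x.2)
  else 0

theorem twistCov_apply {σ : Π y : P1 × M, K y.2} {z : ℂ} {t : M} (hz : z ≠ 0)
    (hσ : DiffSecAt (V := projM E M *ᵖ K) (𝓘(ℂ, ℂ).prod 𝓘(ℂ, E)) F σ ((z : P1), t)) (ζ : ℂ)
    (v : TangentSpace 𝓘(ℂ, E) t) :
    twistCov N C U R σ ((z : P1), t) (tvec ((z : P1), t) ζ v)
      = (ζ • fiberDeriv F σ ((z : P1), t) + N.toFun (fun t => σ ((z : P1), t)) t v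
        + z⁻¹ • C t v (σ ((z : P1), t))
        + (ζ / z) • (z⁻¹ • U t (σ ((z : P1), t)) + R t (σ ((z : P1), t))) : K t) := by
  have h : ((z : P1), t).1 ∈ Cstar ∧ DiffSecAt (V := projM E M *ᵖ K) (𝓘(ℂ, ℂ).prod 𝓘(ℂ, E)) F σ
    ((z : P1), t) := ⟨by simpa using hz, hσ⟩
  exact congrArg (fun L : ℂ × E →L[ℂ] K t => L (ζ, v)) (if_pos h)

/-- The derivative of a function splits into a part along `P1` and a part along `M`. These are the
Leibniz terms of `fiberDeriv` and of `N` on the slice. The remaining summands are linear over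
functions. -/
theorem isCovariantDerivativeOn_twistCov :
    IsCovariantDerivativeOn (I := 𝓘(ℂ, ℂ).prod 𝓘(ℂ, E)) (V := projM E M *ᵖ K) F
      (twistCov N C U R) {x : P1 × M | x.1 ∈ Cstar} where
  add {σ τ x} hσ hτ hx := by
    obtain ⟨p, t⟩ := x
    obtain ⟨z, rfl⟩ := OnePoint.ne_infty_iff_exists.1 hx.2
    have hz : z ≠ 0 := by simpa using hx
    have hσ' : DiffSecAt (V := projM E M *ᵖ K) (𝓘(ℂ, ℂ).prod 𝓘(ℂ, E)) F σ ((z : P1), t) := hσ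
    have hτ' : DiffSecAt (V := projM E M *ᵖ K) (𝓘(ℂ, ℂ).prod 𝓘(ℂ, E)) F τ ((z : P1), t) := hτ
    ext u
    obtain ⟨ζ, v⟩ : ℂ × E := u
    have h1 := twistCov_apply N C U R hz (hσ'.add hτ') ζ v
    have h2 := twistCov_apply N C U R hz hσ' ζ v
    have h3 := twistCov_apply N C U R hz hτ' ζ v
    have hd : fiberDeriv F (fun y => (σ y + τ y : K y.2)) ((z : P1), t)
        = fiberDeriv F (K := K) σ ((z : P1), t) + fiberDeriv F (K := K) τ ((z : P1), t) := by
      have e1 := hσ'.comp_fiber (K := K) (fiberCoord F t).toLinearMap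
      have e2 := hτ'.comp_fiber (K := K) (fiberCoord F t).toLinearMap
      refine (congrArg (fiberCoord F t).symm ?_).trans (map_add (fiberCoord F t).symm _ _)
      refine Eq.trans ?_ (deriv_add e1 e2)
      congr 1
      funext w
      exact map_add (fiberCoord F t) _ _
    have hN := isCov_add N.isCov hσ'.slice hτ'.slice (mem_univ t) v
    refine h1.trans (Eq.trans ?_ (congrArg₂ (fun a b : K t => a + b) h2 h3).symm)
    have hadd : ∀ A : K t →ₗ[ℂ] K t, A (σ ((z : P1), t) + τ ((z : P1), t) : K t)
        = A (σ ((z : P1), t)) + A (τ ((z : P1), t)) := fun A => map_add A _ _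
    refine (congrArg₂ (fun a b : K t => a + b) (congrArg₂ (fun a b : K t => a + b)
      (congrArg₂ (fun a b : K t => a + b)
      (congrArg (fun a : K t => ζ • a) hd) hN) (congrArg (fun a : K t => z⁻¹ • a) (hadd _)))
      (congrArg (fun a : K t => (ζ / z) • a) (congrArg₂ (fun a b : K t => a + b)
        (congrArg (fun a : K t => z⁻¹ • a) (hadd _)) (hadd _)))).trans ?_
    module
  leibniz {σ g x} hσ hg hx := by
    obtain ⟨p, t⟩ := x
    obtain ⟨z, rfl⟩ := OnePoint.ne_infty_iff_exists.1 hx.2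
    have hz : z ≠ 0 := by simpa using hx
    have hσ' : DiffSecAt (V := projM E M *ᵖ K) (𝓘(ℂ, ℂ).prod 𝓘(ℂ, E)) F σ ((z : P1), t) := hσ
    ext u
    obtain ⟨ζ, v⟩ : ℂ × E := u
    have h1 := twistCov_apply N C U R hz (hσ'.smul hg) ζ v
    have h2 := twistCov_apply N C U R hz hσ' ζ v
    have hd := fiberDeriv_smul hg hσ'
    have hN := isCov_smul N.isCov (mdifferentiableAt_slice hg) hσ'.slice (mem_univ t) v
    have hm : mvfderiv (𝓘(ℂ, ℂ).prod 𝓘(ℂ, E)) g ((z : P1), t) (tvec ((z : P1), t) ζ v)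
      = ζ * deriv (fun w : ℂ => g ((w : P1), t)) z
        + mvfderiv 𝓘(ℂ, E) (fun t' => g ((z : P1), t')) t v := mvfderiv_tvec hg
    refine h1.trans (Eq.trans ?_ (congrArg₂ (fun a b : K t => a + b)
      (congrArg (fun a : K t => g ((z : P1), t) • a) h2)
      (congrArg (fun a : ℂ => a • (σ ((z : P1), t) : K t)) hm)).symm)
    have hsm : ∀ A : K t →ₗ[ℂ] K t, A (g ((z : P1), t) • σ ((z : P1), t) : K t)
        = g ((z : P1), t) • A (σ ((z : P1), t)) := fun A => map_smul A _ _
    refine (congrArg₂ (fun a b : K t => a + b) (congrArg₂ (fun a b : K t => a + b)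
      (congrArg₂ (fun a b : K t => a + b)
      (congrArg (fun a : K t => ζ • a) hd) hN) (congrArg (fun a : K t => z⁻¹ • a) (hsm _)))
      (congrArg (fun a : K t => (ζ / z) • a) (congrArg₂ (fun a b : K t => a + b)
        (congrArg (fun a : K t => z⁻¹ • a) (hsm _)) (hsm _)))).trans ?_
    have alg : ∀ (c d m : ℂ) (f n h u r a : K t),
        ζ • (c • f + d • a) + (c • n + m • a) + z⁻¹ • (c • h) + (ζ / z) • (z⁻¹ • (c • u) + c • r)
          = c • (ζ • f + n + z⁻¹ • h + (ζ / z) • (z⁻¹ • u + r)) + (ζ * d + m) • a := by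
      intros
      module
    exact alg _ _ _ _ _ _ _ _ _

/-- A pulled back section is constant in `z`, so the term with `∂_z` vanishes. -/
theorem twistCov_pullSec {s : Π t, K t} {z : ℂ} {t : M} (hz : z ≠ 0)
    (hs : DiffSecAt 𝓘(ℂ, E) F s t) (ζ : ℂ) (v : TangentSpace 𝓘(ℂ, E) t) :
    twistCov N C U R (pullSec E s) ((z : P1), t) (tvec ((z : P1), t) ζ v)
      = (N.toFun s t v + z⁻¹ • C t v (s t) + (ζ / z) • (z⁻¹ • U t (s t) + R t (s t)) : K t) := by
  refine (twistCov_apply N C U R hz (DiffSecAt.pullSec (x := ((z : P1), t)) hs) ζ v).trans ?_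
  have hd : fiberDeriv F (fun y : P1 × M => s y.2) ((z : P1), t) = 0 := by
    simp [fiberDeriv]
  refine (congrArg (fun a : K t => ζ • a + N.toFun s t v + z⁻¹ • C t v (s t)
    + (ζ / z) • (z⁻¹ • U t (s t) + R t (s t))) hd).trans ?_
  simp only [smul_zero, zero_add]

variable {N C U R}

/-- The connection `∇ + C/z + (U/z + R) dz/z` on `π^*K`. -/
theorem exists_isTwist
    (hC : ∀ (t : M) (s : Π t, K t) (X : Π t : M, TangentSpace 𝓘(ℂ, E) t),
      HolSecAt 𝓘(ℂ, E) F s t → HolVFAt 𝓘(ℂ, E) X t →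
      HolSecAt 𝓘(ℂ, E) F (fun y => C y (X y) (s y)) t)
    (hU : ∀ (t : M) (s : Π t, K t), HolSecAt 𝓘(ℂ, E) F s t →
      HolSecAt 𝓘(ℂ, E) F (fun y => U y (s y)) t)
    (hR : ∀ (t : M) (s : Π t, K t), HolSecAt 𝓘(ℂ, E) F s t →
      HolSecAt 𝓘(ℂ, E) F (fun y => R y (s y)) t) :
    ∃ D : HolConnection (𝓘(ℂ, ℂ).prod 𝓘(ℂ, E)) F (projM E M *ᵖ K) {x | x.1 ∈ Cstar},
      IsTwist D N C U R := by
  refine ⟨⟨twistCov N C U R, isCovariantDerivativeOn_twistCov N C U R, fun x hx σ X hσ hX => ?_,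
    fun σ x hx => if_neg hx⟩, ⟨hC, hU, hR, fun z t s ζ v hz hs =>
      twistCov_pullSec N C U R hz hs.diffSecAt ζ v⟩⟩
  refine holSecAt_cov (isCovariantDerivativeOn_twistCov N C U R) hx ?_ ?_ hσ hX
  · intro s hs
    refine (HolSecAt.add (hR _ s hs).pullSec (HolSecAt.smul (holFunAt_inv_zCoord hx.1)
      (hU _ s hs).pullSec)).congr ?_
    filter_upwards [eventually_fst_mem_Cstar hx, eventually_holSecAt_snd hs] with y hy hsy
    obtain ⟨p, t⟩ := y
    obtain ⟨z, rfl⟩ := OnePoint.ne_infty_iff_exists.1 hy.2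
    have hz : z ≠ 0 := by simpa using hy
    have := twistCov_pullSec N C U R hz hsy.diffSecAt z 0
    rw [div_self hz, one_smul, map_zero, map_zero, LinearMap.zero_apply, smul_zero, add_zero,
      zero_add, add_comm] at this
    exact this
  · intro s X hs hX
    refine (HolSecAt.add (N.hol _ (mem_univ _) s X hs hX).pullSec
      (HolSecAt.smul (holFunAt_inv_zCoord hx.1) (hC _ s X hs hX).pullSec)).congr ?_
    filter_upwards [eventually_fst_mem_Cstar hx, eventually_holSecAt_snd hs] with y hy hsy
    obtain ⟨p, t⟩ := y
    obtain ⟨z, rfl⟩ := OnePoint.ne_infty_iff_exists.1 hy.2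
    have hz : z ≠ 0 := by simpa using hy
    have := twistCov_pullSec N C U R hz hsy.diffSecAt 0 (X t)
    rw [zero_div, zero_smul, add_zero] at this
    exact this

end

end Construction

end HolBundle

namespace HolBundle

open RiemannSphere VectorField

/-! ### Pole orders and residual data along `{0} × M` and `{∞} × M` -/

section Extension

variable {E : Type*} [NormedAddCommGroup E] [NormedSpace ℂ E] [FiniteDimensional ℂ E]
  {M : Type*} [TopologicalSpace M] [ChartedSpace E M] [IsManifold 𝓘(ℂ, E) ω M]
  {F : Type*} [NormedAddCommGroup F] [NormedSpace ℂ F] [FiniteDimensional ℂ F]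
  {K : M → Type*} [TopologicalSpace (TotalSpace F K)]
  [∀ t, AddCommGroup (K t)] [∀ t, Module ℂ (K t)] [∀ t, TopologicalSpace (K t)]
  [∀ t, IsTopologicalAddGroup (K t)] [∀ t, ContinuousSMul ℂ (K t)]
  [FiberBundle F K] [VectorBundle ℂ F K] [ContMDiffVectorBundle ω F K 𝓘(ℂ, E)]
  {D : HolConnection (𝓘(ℂ, ℂ).prod 𝓘(ℂ, E)) F (projM E M *ᵖ K) {x | x.1 ∈ Cstar}}
  {N : HolConnection 𝓘(ℂ, E) F K univ} {C : Π t : M, TangentSpace 𝓘(ℂ, E) t →ₗ[ℂ] K t →ₗ[ℂ] K t}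
  {U R : Π t : M, K t →ₗ[ℂ] K t}

/-- A derivative `f ∇_W σ` extends holomorphically if it does so for pulled back frames. -/
theorem extendsTo_of_frame {x : P1 × M} {ι : Type*} [Fintype ι] {e : ι → Π t, K t}
    (he : ∀ i, HolSecAt 𝓘(ℂ, E) F (e i) x.2) {c : ι → P1 × M → ℂ}
    (hc : ∀ i, HolFunAt (𝓘(ℂ, ℂ).prod 𝓘(ℂ, E)) (c i) x) {σ : Π y, (projM E M *ᵖ K) y}
    (hσ : ∀ᶠ y in 𝓝 x, σ y = ∑ i, c i y • pullSec E (e i) y) {f : P1 × M → ℂ}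
    (hf : HolFunAt (𝓘(ℂ, ℂ).prod 𝓘(ℂ, E)) f x)
    {W : Π y : P1 × M, TangentSpace (𝓘(ℂ, ℂ).prod 𝓘(ℂ, E)) y}
    (hW : HolVFAt (𝓘(ℂ, ℂ).prod 𝓘(ℂ, E)) W x) {τ : ι → Π y, (projM E M *ᵖ K) y}
    (hτ : ∀ i, HolSecAt (𝓘(ℂ, ℂ).prod 𝓘(ℂ, E)) F (τ i) x)
    (hτ' : ∀ i, ∀ᶠ y in 𝓝 x, y.1 ∈ Cstar → τ i y = f y • D.toFun (pullSec E (e i)) y (W y)) :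
    ExtendsTo E F (fun y => f y • D.toFun σ y (W y)) x
      (∑ i, (c i x • τ i x + (f x * mvfderiv (𝓘(ℂ, ℂ).prod 𝓘(ℂ, E)) (c i) x (W x)) •
        pullSec E (e i) x)) := by
  refine ⟨fun y => ∑ i, (c i y • τ i y + (f y * mvfderiv (𝓘(ℂ, ℂ).prod 𝓘(ℂ, E)) (c i) y (W y)) •
        pullSec E (e i) y), HolSecAt.sum fun i _ => HolSecAt.add (HolSecAt.smul (hc i) (hτ i))
        (HolSecAt.smul (hf.mul ((hc i).mvfderiv hW)) (he i).pullSec), ?_, rfl⟩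
  filter_upwards [isCov_eventually_eq_sum D.isCov hc he hσ W, eventually_all.2 hτ'] with y h1 h2 hy
  rw [h1 hy, Finset.smul_sum]
  refine Finset.sum_congr rfl fun i _ => ?_
  rw [h2 i hy, smul_add, smul_smul, smul_smul, smul_smul, mul_comm]

theorem map_eq_sum_smul {V W ι : Type*} [AddCommGroup V] [Module ℂ V] [AddCommGroup W] [Module ℂ W]
    [Fintype ι] (A : V →ₗ[ℂ] W) {a : V} {c : ι → ℂ} {e : ι → V} (h : a = ∑ i, c i • e i) :
    A a = ∑ i, c i • A (e i) := by
  rw [h, map_sum]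
  simp only [map_smul]

namespace IsTwist

theorem eq_liftVF (h : IsTwist D N C U R) {s : Π t, K t} {y : P1 × M} (hy : y.1 ∈ Cstar)
    (hs : HolSecAt 𝓘(ℂ, E) F s y.2) (X : Π t : M, TangentSpace 𝓘(ℂ, E) t) :
    D.toFun (pullSec E s) y (liftVF X y) = pullSec E (fun t => N.toFun s t (X t)) y
      + (zCoord y.1)⁻¹ • pullSec E (fun t => C t (X t) (s t)) y :=
  (h.eventually_lift hy hs X).self_of_nhds

theorem eq_eulerVF (h : IsTwist D N C U R) {s : Π t, K t} {y : P1 × M} (hy : y.1 ∈ Cstar)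
    (hs : HolSecAt 𝓘(ℂ, E) F s y.2) :
    D.toFun (pullSec E s) y (eulerVF E y)
      = pullSec E (fun t => R t (s t)) y + (zCoord y.1)⁻¹ • pullSec E (fun t => U t (s t)) y :=
  (h.eventually_euler hy hs).self_of_nhds

variable {σ : Π y : P1 × M, K y.2} {t : M}

/-- On the frame, `z ∇_X` is `z ∇^r_X + C_X`. The Leibniz terms with derivatives of the coefficients
carry the factor `z` and vanish at `z = 0`. -/
theorem extendsTo_zero_lift (h : IsTwist D N C U R)
    (hσ : HolSecAt (V := projM E M *ᵖ K) (𝓘(ℂ, ℂ).prod 𝓘(ℂ, E)) F σ (((0 : ℂ) : P1), t))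
    {X : Π t : M, TangentSpace 𝓘(ℂ, E) t} (hX : HolVFAt 𝓘(ℂ, E) X t) :
    ExtendsTo (H := projM E M *ᵖ K) E F
      (fun y => zCoord y.1 • D.toFun σ y (tvec y 0 (X y.2))) (((0 : ℂ) : P1), t)
      (C t (X t) (σ (((0 : ℂ) : P1), t))) := by
  obtain ⟨e, he, he'⟩ := exists_isHolFrameAt_pullSec (E := E) (F := F) (K := K) (((0 : ℂ) : P1), t)
  obtain ⟨c, c1, c2, -⟩ := he'.exists_coeff σ
  have hz := holFunAt_zCoord (E := E) (x := (((0 : ℂ) : P1), t)) (OnePoint.coe_ne_infty _)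
  have hτ : ∀ i, HolSecAt (𝓘(ℂ, ℂ).prod 𝓘(ℂ, E)) F (fun y => zCoord y.1 •
      pullSec E (fun t => N.toFun (e i) t (X t)) y + pullSec E (fun t => C t (X t) (e i t)) y)
      (((0 : ℂ) : P1), t) := fun i =>
    HolSecAt.add (HolSecAt.smul hz (N.hol t (mem_univ t) _ _ (he.hol i) hX).pullSec)
      (h.C_hol t _ X (he.hol i) hX).pullSec
  have hext := extendsTo_of_frame (D := D) he.hol (c2 hσ) c1 hz (HolVFAt.liftVF (x :=
      (((0 : ℂ) : P1), t)) hX) hτ fun i => by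
    filter_upwards [eventually_holSecAt_snd (he.hol i)] with y hs hy
    rw [h.eq_liftVF hy hs, smul_add, smul_smul, mul_inv_cancel₀ (zCoord_ne_zero hy), one_smul]
  have hval : C t (X t) (σ (((0 : ℂ) : P1), t)) = ∑ i, c i (((0 : ℂ) : P1), t) • C t (X t)
      (e i t) :=
    map_eq_sum_smul (C t (X t)) c1.self_of_nhds
  simp only [zCoord_coe, zero_smul, zero_mul, zero_add, add_zero] at hext
  rw [hval]
  exact hext

/-- Here `z ∇_{z∂_z}` is `z R + U` on the frame, and again the Leibniz terms vanish at `z = 0`. -/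
theorem extendsTo_zero_euler (h : IsTwist D N C U R)
    (hσ : HolSecAt (V := projM E M *ᵖ K) (𝓘(ℂ, ℂ).prod 𝓘(ℂ, E)) F σ (((0 : ℂ) : P1), t)) :
    ExtendsTo (H := projM E M *ᵖ K) E F
      (fun y => zCoord y.1 • D.toFun σ y (tvec y (zCoord y.1) 0)) (((0 : ℂ) : P1), t)
      (U t (σ (((0 : ℂ) : P1), t))) := by
  obtain ⟨e, he, he'⟩ := exists_isHolFrameAt_pullSec (E := E) (F := F) (K := K) (((0 : ℂ) : P1), t)
  obtain ⟨c, c1, c2, -⟩ := he'.exists_coeff σ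
  have hz := holFunAt_zCoord (E := E) (x := (((0 : ℂ) : P1), t)) (OnePoint.coe_ne_infty _)
  have hτ : ∀ i, HolSecAt (𝓘(ℂ, ℂ).prod 𝓘(ℂ, E)) F (fun y => zCoord y.1 •
      pullSec E (fun t => R t (e i t)) y + pullSec E (fun t => U t (e i t)) y)
      (((0 : ℂ) : P1), t) := fun i =>
    HolSecAt.add (HolSecAt.smul hz (h.R_hol t _ (he.hol i)).pullSec)
      (h.U_hol t _ (he.hol i)).pullSec
  have hext := extendsTo_of_frame (D := D) he.hol (c2 hσ) c1 hz (holVFAt_eulerVF E _) hτ fun i => by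
    filter_upwards [eventually_holSecAt_snd (he.hol i)] with y hs hy
    rw [h.eq_eulerVF hy hs, smul_add, smul_smul, mul_inv_cancel₀ (zCoord_ne_zero hy), one_smul]
  have hval : U t (σ (((0 : ℂ) : P1), t)) = ∑ i, c i (((0 : ℂ) : P1), t) • U t (e i t) :=
    map_eq_sum_smul (U t) c1.self_of_nhds
  simp only [zCoord_coe, zero_smul, zero_mul, zero_add, add_zero] at hext
  rw [hval]
  exact hext

/-- The term `C/z` disappears at `∞`, but the Leibniz terms survive. They are those of `∇^r` on the
restriction to `{∞} × M`, so the value depends on the slice of `σ` and not only on its value at one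
point. -/
theorem extendsTo_infty_lift (h : IsTwist D N C U R)
    (hσ : HolSecAt (V := projM E M *ᵖ K) (𝓘(ℂ, ℂ).prod 𝓘(ℂ, E)) F σ ((OnePoint.infty : P1), t))
    {X : Π t : M, TangentSpace 𝓘(ℂ, E) t} (hX : HolVFAt 𝓘(ℂ, E) X t) :
    ExtendsTo (H := projM E M *ᵖ K) E F
      (fun y => D.toFun σ y (tvec y 0 (X y.2))) ((OnePoint.infty : P1), t)
      (N.toFun (fun t' => σ ((OnePoint.infty : P1), t')) t (X t)) := by
  obtain ⟨e, he, he'⟩ := exists_isHolFrameAt_pullSec (E := E) (F := F) (K := K)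
    ((OnePoint.infty : P1), t)
  obtain ⟨c, c1, c2, -⟩ := he'.exists_coeff σ
  have hz := holFunAt_inv_zCoord (E := E) (x :=
      ((OnePoint.infty : P1), t)) (OnePoint.infty_ne_coe _)
  have hτ : ∀ i, HolSecAt (𝓘(ℂ, ℂ).prod 𝓘(ℂ, E)) F (fun y =>
      pullSec E (fun t => N.toFun (e i) t (X t)) y
        + (zCoord y.1)⁻¹ • pullSec E (fun t => C t (X t) (e i t)) y)
      ((OnePoint.infty : P1), t) := fun i =>
    HolSecAt.add (N.hol t (mem_univ t) _ _ (he.hol i) hX).pullSec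
      (HolSecAt.smul hz (h.C_hol t _ X (he.hol i) hX).pullSec)
  have hext := extendsTo_of_frame (D := D) he.hol (c2 hσ) c1 (HolFunAt.const 1 _)
    (HolVFAt.liftVF (x := ((OnePoint.infty : P1), t)) hX) hτ fun i => by
      filter_upwards [eventually_holSecAt_snd (he.hol i)] with y hs hy
      rw [h.eq_liftVF hy hs, one_smul]
  simp only [one_smul, one_mul, zCoord_infty, inv_zero, zero_smul, add_zero] at hext
  refine Eq.mp (congrArg (ExtendsTo (H := projM E M *ᵖ K) E F _ ((OnePoint.infty : P1), t)) ?_) hext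
  refine Eq.symm ?_
  refine (isCov_eq_sum N.isCov isOpen_univ (mem_univ t) (fun i => (c2 hσ i).slice.mdifferentiableAt)
    (fun i => (he.hol i).diffSecAt) (eventually_slice c1) (X t)).trans ?_
  refine Finset.sum_congr rfl fun i _ =>
    congrArg₂ (fun a b : K t => a + b) rfl ?_
  refine congrArg (fun a : ℂ => a • e i t) ?_
  have h1 := mfderiv_prod_eq_add_apply (v := liftVF X ((OnePoint.infty : P1), t))
    (c2 hσ i).mdifferentiableAt
  refine Eq.trans ?_ h1.symm
  refine (zero_add _).symm.trans ?_
  congr 1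
  exact (map_zero _).symm

/-- The field `z ∂_z` vanishes at `∞`, so the Leibniz terms disappear and the residue `R` is left.
-/
theorem extendsTo_infty_euler (h : IsTwist D N C U R)
    (hσ : HolSecAt (V := projM E M *ᵖ K) (𝓘(ℂ, ℂ).prod 𝓘(ℂ, E)) F σ ((OnePoint.infty : P1), t)) :
    ExtendsTo (H := projM E M *ᵖ K) E F
      (fun y => D.toFun σ y (tvec y (zCoord y.1) 0)) ((OnePoint.infty : P1), t)
      (R t (σ ((OnePoint.infty : P1), t))) := by
  obtain ⟨e, he, he'⟩ := exists_isHolFrameAt_pullSec (E := E) (F := F) (K := K)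
    ((OnePoint.infty : P1), t)
  obtain ⟨c, c1, c2, -⟩ := he'.exists_coeff σ
  have hz := holFunAt_inv_zCoord (E := E) (x :=
      ((OnePoint.infty : P1), t)) (OnePoint.infty_ne_coe _)
  have hτ : ∀ i, HolSecAt (𝓘(ℂ, ℂ).prod 𝓘(ℂ, E)) F (fun y =>
      pullSec E (fun t => R t (e i t)) y + (zCoord y.1)⁻¹ • pullSec E (fun t => U t (e i t)) y)
      ((OnePoint.infty : P1), t) := fun i =>
    HolSecAt.add (h.R_hol t _ (he.hol i)).pullSec
      (HolSecAt.smul hz (h.U_hol t _ (he.hol i)).pullSec)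
  have hext := extendsTo_of_frame (D := D) he.hol (c2 hσ) c1 (HolFunAt.const 1 _)
    (holVFAt_eulerVF E _) hτ fun i => by
      filter_upwards [eventually_holSecAt_snd (he.hol i)] with y hs hy
      rw [h.eq_eulerVF hy hs, one_smul]
  have h0 : eulerVF E ((OnePoint.infty : P1), t) = 0 := rfl
  simp only [one_smul, one_mul, zCoord_infty, inv_zero, zero_smul, add_zero, h0, map_zero] at hext
  have hval : R t (σ ((OnePoint.infty : P1), t))
      = ∑ i, c i ((OnePoint.infty : P1), t) • R t (e i t) :=
    map_eq_sum_smul (R t) c1.self_of_nhds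
  rw [hval]
  exact hext

end IsTwist

end Extension

/-! ### The defect of flatness of a pairing -/

section Defect

variable {E : Type*} [NormedAddCommGroup E] [NormedSpace ℂ E] [FiniteDimensional ℂ E]
  {M : Type*} [TopologicalSpace M] [ChartedSpace E M] [IsManifold 𝓘(ℂ, E) ω M]
  {F : Type*} [NormedAddCommGroup F] [NormedSpace ℂ F] [FiniteDimensional ℂ F]
  {H : P1 × M → Type*} [TopologicalSpace (TotalSpace F H)]
  [∀ x, AddCommGroup (H x)] [∀ x, Module ℂ (H x)] [∀ x, TopologicalSpace (H x)]
  [∀ x, IsTopologicalAddGroup (H x)] [∀ x, ContinuousSMul ℂ (H x)]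
  [FiberBundle F H] [VectorBundle ℂ F H] [ContMDiffVectorBundle ω F H (𝓘(ℂ, ℂ).prod 𝓘(ℂ, E))]

theorem tendsto_neg_prod (p : P1) (t : M) :
    Tendsto (fun y : P1 × M => (neg y.1, y.2)) (𝓝 (p, t)) (𝓝 (neg p, t)) :=
  Continuous.tendsto ((contMDiff_neg.continuous.comp continuous_fst).prodMk continuous_snd) (p, t)

theorem HolFunAt.comp_neg {f : P1 × M → ℂ} {p : P1} {t : M}
    (hf : HolFunAt (𝓘(ℂ, ℂ).prod 𝓘(ℂ, E)) f (neg p, t)) :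
    HolFunAt (𝓘(ℂ, ℂ).prod 𝓘(ℂ, E)) (fun y => f (neg y.1, y.2)) (p, t) :=
  ContMDiffAt.comp (g := f) (f := fun y : P1 × M => (neg y.1, y.2))
    (I' := 𝓘(ℂ, ℂ).prod 𝓘(ℂ, E)) (p, t) hf
    ((ContMDiffAt.comp (p, t) contMDiff_neg.contMDiffAt contMDiffAt_fst).prodMk contMDiffAt_snd)

/-- Chain rule: the involution reverses the component along `∂_z`. This explains the sign of `ζ` in
the second argument of `flatDefect`. -/
theorem mvfderiv_comp_neg {f : P1 × M → ℂ} {z : ℂ} {t : M}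
    (hf : HolFunAt (𝓘(ℂ, ℂ).prod 𝓘(ℂ, E)) f (neg z, t)) (ζ : ℂ) (v : TangentSpace 𝓘(ℂ, E) t) :
    mvfderiv (𝓘(ℂ, ℂ).prod 𝓘(ℂ, E)) (fun y => f (neg y.1, y.2)) ((z : P1), t)
        (tvec ((z : P1), t) ζ v)
      = mvfderiv (𝓘(ℂ, ℂ).prod 𝓘(ℂ, E)) f (neg z, t) (tvec (neg z, t) (-ζ) v) := by
  have h1 := mvfderiv_tvec (ζ := ζ) (v := v) hf.comp_neg.mdifferentiableAt
  have h2 := mvfderiv_tvec (z := -z) (ζ := -ζ) (v := v) hf.mdifferentiableAt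
  refine h1.trans (Eq.trans ?_ h2.symm)
  have h3 : deriv (fun w : ℂ => f (neg w, t)) z = - deriv (fun w : ℂ => f ((w : P1), t)) (-z) :=
    deriv_comp_neg (fun w : ℂ => f ((w : P1), t)) z
  refine congrArg₂ (fun a b : ℂ => a + b) ?_ rfl
  refine (congrArg (fun a : ℂ => ζ * a) h3).trans ?_
  ring

theorem mvfderiv_mul_apply {f g : P1 × M → ℂ} {x : P1 × M}
    (hf : HolFunAt (𝓘(ℂ, ℂ).prod 𝓘(ℂ, E)) f x) (hg : HolFunAt (𝓘(ℂ, ℂ).prod 𝓘(ℂ, E)) g x)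
    (u : TangentSpace (𝓘(ℂ, ℂ).prod 𝓘(ℂ, E)) x) :
    mvfderiv (𝓘(ℂ, ℂ).prod 𝓘(ℂ, E)) (fun y => f y * g y) x u
      = f x * mvfderiv (𝓘(ℂ, ℂ).prod 𝓘(ℂ, E)) g x u
        + g x * mvfderiv (𝓘(ℂ, ℂ).prod 𝓘(ℂ, E)) f x u := by
  have h := hf.mdifferentiableAt.hasMFDerivAt.mul hg.mdifferentiableAt.hasMFDerivAt
  exact congrArg (fun L : ℂ × E →L[ℂ] ℂ => L u) h.mfderiv

theorem mvfderiv_add_apply {f g : P1 × M → ℂ} {x : P1 × M}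
    (hf : HolFunAt (𝓘(ℂ, ℂ).prod 𝓘(ℂ, E)) f x) (hg : HolFunAt (𝓘(ℂ, ℂ).prod 𝓘(ℂ, E)) g x)
    (u : TangentSpace (𝓘(ℂ, ℂ).prod 𝓘(ℂ, E)) x) :
    mvfderiv (𝓘(ℂ, ℂ).prod 𝓘(ℂ, E)) (fun y => f y + g y) x u
      = mvfderiv (𝓘(ℂ, ℂ).prod 𝓘(ℂ, E)) f x u
        + mvfderiv (𝓘(ℂ, ℂ).prod 𝓘(ℂ, E)) g x u := by
  have h := hf.mdifferentiableAt.hasMFDerivAt.add hg.mdifferentiableAt.hasMFDerivAt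
  exact congrArg (fun L : ℂ × E →L[ℂ] ℂ => L u) h.mfderiv

/-- The defect of flatness of a pairing. -/
noncomputable def flatDefect (D : HolConnection (𝓘(ℂ, ℂ).prod 𝓘(ℂ, E)) F H {x | x.1 ∈ Cstar})
    (P : Π (p : P1) (t : M), H (p, t) →ₗ[ℂ] H (neg p, t) →ₗ[ℂ] ℂ) (p : P1) (t : M) (ζ : ℂ)
    (v : TangentSpace 𝓘(ℂ, E) t) (a b : Π x, H x) : ℂ :=
  mvfderiv (𝓘(ℂ, ℂ).prod 𝓘(ℂ, E)) (pairFun P a b) (p, t) (tvec (p, t) ζ v)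
    - P p t (D.toFun a (p, t) (tvec (p, t) ζ v)) (b (neg p, t))
    - P p t (a (p, t)) (D.toFun b (neg p, t) (tvec (neg p, t) (-ζ) v))

variable {D : HolConnection (𝓘(ℂ, ℂ).prod 𝓘(ℂ, E)) F H {x | x.1 ∈ Cstar}}
  {P : Π (p : P1) (t : M), H (p, t) →ₗ[ℂ] H (neg p, t) →ₗ[ℂ] ℂ} {p : P1} {t : M}

/-- The derivative of the factor occurs in the derivative of the pairing and in the connection term,
with opposite signs. -/
theorem isTensorialAt_flatDefect_left (hp : p ∈ Cstar)
    (hP : ∀ a b, HolSecAt (𝓘(ℂ, ℂ).prod 𝓘(ℂ, E)) F a (p, t) →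
      HolSecAt (𝓘(ℂ, ℂ).prod 𝓘(ℂ, E)) F b (neg p, t) →
      HolFunAt (𝓘(ℂ, ℂ).prod 𝓘(ℂ, E)) (pairFun P a b) (p, t)) (ζ : ℂ)
    (v : TangentSpace 𝓘(ℂ, E) t) {b : Π x, H x}
    (hb : HolSecAt (𝓘(ℂ, ℂ).prod 𝓘(ℂ, E)) F b (neg p, t)) :
    IsTensorialAt (𝓘(ℂ, ℂ).prod 𝓘(ℂ, E)) F (fun a => flatDefect D P p t ζ v a b) (p, t) where
  congr σ τ _ h := by
    simp only [flatDefect]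
    rw [D.congr (isOpen_Cstar_prod M) h, h.self_of_nhds,
      mvfderiv_congr (g := pairFun P σ b) (h.mono fun y hy => by simp only [pairFun, hy])]
  add σ τ hσ hτ := by
    have h1 : pairFun P (fun y => σ y + τ y) b = fun y => pairFun P σ b y + pairFun P τ b y := by
      funext y
      simp [pairFun]
    simp only [flatDefect]
    rw [h1, mvfderiv_add_apply (hP σ b hσ hb) (hP τ b hτ hb),
      isCov_add D.isCov hσ.diffSecAt hτ.diffSecAt hp]
    simp only [map_add, LinearMap.add_apply]
    ring
  smul f σ hf hσ := by
    have h1 : pairFun P (fun y => f y • σ y) b = fun y => f y * pairFun P σ b y := by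
      funext y
      simp [pairFun]
    simp only [flatDefect]
    rw [h1, mvfderiv_mul_apply hf (hP σ b hσ hb),
      isCov_smul D.isCov hf.mdifferentiableAt hσ.diffSecAt hp]
    simp only [map_add, LinearMap.add_apply, map_smul, LinearMap.smul_apply, smul_eq_mul, pairFun]
    ring

/-- Here the factor is evaluated at `-z`. Its derivative there is taken in direction `-ζ`, which
matches the direction of the connection term at `-z`. -/
theorem isTensorialAt_flatDefect_right (hp : p ∈ Cstar)
    (hP : ∀ a b, HolSecAt (𝓘(ℂ, ℂ).prod 𝓘(ℂ, E)) F a (p, t) →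
      HolSecAt (𝓘(ℂ, ℂ).prod 𝓘(ℂ, E)) F b (neg p, t) →
      HolFunAt (𝓘(ℂ, ℂ).prod 𝓘(ℂ, E)) (pairFun P a b) (p, t)) (ζ : ℂ)
    (v : TangentSpace 𝓘(ℂ, E) t) {a : Π x, H x}
    (ha : HolSecAt (𝓘(ℂ, ℂ).prod 𝓘(ℂ, E)) F a (p, t)) :
    IsTensorialAt (𝓘(ℂ, ℂ).prod 𝓘(ℂ, E)) F (fun b => flatDefect D P p t ζ v a b) (neg p, t) where
  congr σ τ _ h := by
    simp only [flatDefect]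
    rw [D.congr (isOpen_Cstar_prod M) h, h.self_of_nhds, mvfderiv_congr (g := pairFun P a σ)
      (((tendsto_neg_prod p t).eventually h).mono fun y hy => by simp only [pairFun, hy])]
  add σ τ hσ hτ := by
    have h1 : pairFun P a (fun y => σ y + τ y) = fun y => pairFun P a σ y + pairFun P a τ y := by
      funext y
      simp [pairFun]
    simp only [flatDefect]
    rw [h1, mvfderiv_add_apply (hP a σ ha hσ) (hP a τ ha hτ),
      isCov_add D.isCov hσ.diffSecAt hτ.diffSecAt (neg_mem_Cstar hp)]
    simp only [map_add]
    ring
  smul f σ hf hσ := by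
    have h1 : pairFun P a (fun y => f y • σ y)
        = fun y => f (neg y.1, y.2) * pairFun P a σ y := by
      funext y
      simp [pairFun]
    obtain ⟨z, rfl⟩ := OnePoint.ne_infty_iff_exists.1 hp.2
    simp only [flatDefect]
    rw [h1, mvfderiv_mul_apply hf.comp_neg (hP a σ ha hσ), mvfderiv_comp_neg hf,
      isCov_smul D.isCov hf.mdifferentiableAt hσ.diffSecAt (neg_mem_Cstar hp)]
    simp only [map_add, map_smul, smul_eq_mul, pairFun]
    ring

end Defect

end HolBundle

namespace HolBundle

open RiemannSphere VectorField

/-! ### Pairings on `π^*K` of the form `z^w g` -/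

section PullPair

variable {E : Type*} [NormedAddCommGroup E] [NormedSpace ℂ E] [FiniteDimensional ℂ E]
  {M : Type*} [TopologicalSpace M] [ChartedSpace E M] [IsManifold 𝓘(ℂ, E) ω M]
  {F : Type*} [NormedAddCommGroup F] [NormedSpace ℂ F] [FiniteDimensional ℂ F]
  {K : M → Type*} [TopologicalSpace (TotalSpace F K)]
  [∀ t, AddCommGroup (K t)] [∀ t, Module ℂ (K t)] [∀ t, TopologicalSpace (K t)]
  [∀ t, IsTopologicalAddGroup (K t)] [∀ t, ContinuousSMul ℂ (K t)]
  [FiberBundle F K] [VectorBundle ℂ F K] [ContMDiffVectorBundle ω F K 𝓘(ℂ, E)]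

variable (E) in
/-- The pairing on `π^*K` induced by a pairing on `K`. -/
def pullPair (g : Π t : M, K t →ₗ[ℂ] K t →ₗ[ℂ] ℂ) (p : P1) (t : M) :
    (projM E M *ᵖ K) (p, t) →ₗ[ℂ] (projM E M *ᵖ K) (neg p, t) →ₗ[ℂ] ℂ := g t

/-- The two arguments are expanded in pulled back frames near `p` and near `-p`; the pairings of the
frame vectors depend on `t` only. -/
theorem holFunAt_pairFun_pullPair {g : Π t : M, K t →ₗ[ℂ] K t →ₗ[ℂ] ℂ}
    (hg : ∀ (t : M) (a b : Π t, K t), HolSecAt 𝓘(ℂ, E) F a t → HolSecAt 𝓘(ℂ, E) F b t →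
      HolFunAt 𝓘(ℂ, E) (fun y => g y (a y) (b y)) t) {p : P1} {t : M}
    {a b : Π y, (projM E M *ᵖ K) y}
    (ha : HolSecAt (𝓘(ℂ, ℂ).prod 𝓘(ℂ, E)) F a (p, t))
    (hb : HolSecAt (𝓘(ℂ, ℂ).prod 𝓘(ℂ, E)) F b (neg p, t)) :
    HolFunAt (𝓘(ℂ, ℂ).prod 𝓘(ℂ, E)) (pairFun (pullPair E g) a b) (p, t) := by
  obtain ⟨e, he, he'⟩ := exists_isHolFrameAt_pullSec (E := E) (F := F) (K := K) (p, t)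
  obtain ⟨e₂, he₂, he₂'⟩ := exists_isHolFrameAt_pullSec (E := E) (F := F) (K := K) (neg p, t)
  obtain ⟨c, c1, c2, -⟩ := he'.exists_coeff a
  obtain ⟨d, d1, d2, -⟩ := he₂'.exists_coeff b
  refine (HolFunAt.sum (s := Finset.univ) fun i _ => HolFunAt.sum (s := Finset.univ) fun j _ =>
    ((c2 ha i).mul (d2 hb j).comp_neg).mul (HolFunAt.comp_snd (x := (p, t))
      (hg t _ _ (he.hol i) (he₂.hol j)))).congr ?_
  filter_upwards [c1, (tendsto_neg_prod p t).eventually d1] with y h1 h2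
  have e1 : ∀ b' : K y.2, g y.2 (a y) b' = ∑ i, c i y * g y.2 (e i y.2) b' := fun b' =>
    map_eq_sum_smul ((g y.2).flip b') h1
  have e2 : ∀ a' : K y.2, g y.2 a' (b (neg y.1, y.2))
      = ∑ j, d j (neg y.1, y.2) * g y.2 a' (e₂ j y.2) := fun a' => map_eq_sum_smul (g y.2 a') h2
  refine (e1 _).trans (Finset.sum_congr rfl fun i _ => ?_)
  rw [e2, Finset.mul_sum]
  exact Finset.sum_congr rfl fun j _ => (mul_assoc _ _ _).symm

theorem holFunAt_zCoord_zpow {x : P1 × M} (hx : x.1 ∈ Cstar) (w : ℤ) :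
    HolFunAt (𝓘(ℂ, ℂ).prod 𝓘(ℂ, E)) (fun y : P1 × M => zCoord y.1 ^ w) x :=
  HolFunAt.comp_analyticAt (g := fun z : ℂ => z ^ w)
    (AnalyticAt.contDiffAt (AnalyticAt.zpow analyticAt_id (zCoord_ne_zero hx)))
    (holFunAt_zCoord hx.2)

theorem mvfderiv_zCoord_zpow {z : ℂ} (hz : z ≠ 0) (t : M) (w : ℤ) (ζ : ℂ)
    (v : TangentSpace 𝓘(ℂ, E) t) :
    mvfderiv (𝓘(ℂ, ℂ).prod 𝓘(ℂ, E)) (fun y : P1 × M => zCoord y.1 ^ w) ((z : P1), t)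
      (tvec ((z : P1), t) ζ v) = z ^ w * (ζ / z * w) := by
  have hx : ((z : P1), t).1 ∈ Cstar := by simpa using hz
  rw [mvfderiv_tvec (holFunAt_zCoord_zpow hx w).mdifferentiableAt]
  simp only [zCoord_coe, mvfderiv_const, deriv_zpow, zpow_sub_one₀ hz]
  simp
  ring

variable {D : HolConnection (𝓘(ℂ, ℂ).prod 𝓘(ℂ, E)) F (projM E M *ᵖ K) {x | x.1 ∈ Cstar}}
  {N : HolConnection 𝓘(ℂ, E) F K univ} {C : Π t : M, TangentSpace 𝓘(ℂ, E) t →ₗ[ℂ] K t →ₗ[ℂ] K t}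
  {U R : Π t : M, K t →ₗ[ℂ] K t}
  {P : Π (p : P1) (t : M), (projM E M *ᵖ K) (p, t) →ₗ[ℂ] (projM E M *ᵖ K) (neg p, t) →ₗ[ℂ] ℂ}
  {g : Π t : M, K t →ₗ[ℂ] K t →ₗ[ℂ] ℂ} {w : ℤ}

theorem pairFun_eq_zpow_mul (hP : ∀ (z : ℂ) (t : M) (a b : K t), z ≠ 0 → P z t a b = z ^ w * g t a
    b)
    (a b : Π y, (projM E M *ᵖ K) y) {y : P1 × M} (hy : y.1 ∈ Cstar) :
    pairFun P a b y = zCoord y.1 ^ w * pairFun (pullPair E g) a b y := by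
  obtain ⟨p, t⟩ := y
  obtain ⟨z, rfl⟩ := OnePoint.ne_infty_iff_exists.1 hy.2
  exact hP z t _ _ (by simpa using hy)

/-- The second argument lives at `-z`. There `C/z` and `U/z` change sign, so that symmetry of `C`
and `U` is what is required, while `dz/z` does not. The derivative of `z^w` contributes `w`, so `R`
and its adjoint must add up to `w`, which is antisymmetry of `V = w/2 - R`. -/
theorem IsTwist.flatDefect_pullSec (h : IsTwist D N C U R)
    (hP : ∀ (z : ℂ) (t : M) (a b : K t), z ≠ 0 → P z t a b = z ^ w * g t a b)
    (hg : ∀ (t : M) (a b : Π t, K t), HolSecAt 𝓘(ℂ, E) F a t → HolSecAt 𝓘(ℂ, E) F b t →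
      HolFunAt 𝓘(ℂ, E) (fun y => g y (a y) (b y)) t)
    {z : ℂ} (hz : z ≠ 0) {t : M} {a b : Π t, K t} (ha : HolSecAt 𝓘(ℂ, E) F a t)
    (hb : HolSecAt 𝓘(ℂ, E) F b t) (ζ : ℂ) (v : TangentSpace 𝓘(ℂ, E) t) :
    flatDefect D P z t ζ v (pullSec E a) (pullSec E b)
      = z ^ w * ((mvfderiv 𝓘(ℂ, E) (fun y => g y (a y) (b y)) t v - g t (N.toFun a t v) (b t)
          - g t (a t) (N.toFun b t v))
        - z⁻¹ * (g t (C t v (a t)) (b t) - g t (a t) (C t v (b t)))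
        + ζ / z * (w * g t (a t) (b t) - g t (R t (a t)) (b t) - g t (a t) (R t (b t)))
        - ζ / z * z⁻¹ * (g t (U t (a t)) (b t) - g t (a t) (U t (b t)))) := by
  have hx : ((z : P1), t).1 ∈ Cstar := by simpa using hz
  have e1 : mvfderiv (𝓘(ℂ, ℂ).prod 𝓘(ℂ, E)) (pairFun P (pullSec E a) (pullSec E b)) ((z : P1), t)
      (tvec ((z : P1), t) ζ v) = z ^ w * mvfderiv 𝓘(ℂ, E) (fun y => g y (a y) (b y)) t v
        + g t (a t) (b t) * (z ^ w * (ζ / z * w)) := by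
    rw [mvfderiv_congr (g := fun y : P1 × M => zCoord y.1 ^ w * g y.2 (a y.2) (b y.2))
      ((eventually_fst_mem_Cstar hx).mono fun y hy => pairFun_eq_zpow_mul hP _ _ hy),
      mvfderiv_mul_apply (holFunAt_zCoord_zpow hx w)
        (HolFunAt.comp_snd (x := ((z : P1), t)) (hg t a b ha hb)), mvfderiv_zCoord_zpow hz]
    congr 2
    exact mvfderiv_comp_snd (x := ((z : P1), t)) (hg t a b ha hb).mdifferentiableAt ζ v
  have e2 : P z t (D.toFun (pullSec E a) ((z : P1), t) (tvec ((z : P1), t) ζ v)) (b t)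
      = z ^ w * g t (N.toFun a t v + z⁻¹ • C t v (a t)
        + (ζ / z) • (z⁻¹ • U t (a t) + R t (a t))) (b t) :=
    (hP z t _ _ hz).trans (congrArg (fun x : K t => z ^ w * g t x (b t)) (h.eq z t a ζ v hz ha))
  have e3 : P z t (a t) (D.toFun (pullSec E b) (neg z, t) (tvec (neg z, t) (-ζ) v))
      = z ^ w * g t (a t) (N.toFun b t v + (-z)⁻¹ • C t v (b t)
        + (-ζ / -z) • ((-z)⁻¹ • U t (b t) + R t (b t))) :=
    (hP z t _ _ hz).trans (congrArg (fun x : K t => z ^ w * g t (a t) x)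
      (h.eq (-z) t b (-ζ) v (neg_ne_zero.2 hz) hb))
  rw [flatDefect, e1]
  refine (congrArg₂ (fun x y : ℂ => _ - x - y) e2 e3).trans ?_
  simp only [map_add, map_smul, LinearMap.add_apply, LinearMap.smul_apply, smul_eq_mul, inv_neg,
    neg_div_neg_eq]
  ring

theorem flatDefect_eq_zero_of_pullSec {p : P1} {t : M} (hp : p ∈ Cstar)
    (hP : ∀ a b, HolSecAt (𝓘(ℂ, ℂ).prod 𝓘(ℂ, E)) F a (p, t) →
      HolSecAt (𝓘(ℂ, ℂ).prod 𝓘(ℂ, E)) F b (neg p, t) →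
      HolFunAt (𝓘(ℂ, ℂ).prod 𝓘(ℂ, E)) (pairFun P a b) (p, t)) {ζ : ℂ}
    {v : TangentSpace 𝓘(ℂ, E) t}
    (h : ∀ a b : Π t, K t, HolSecAt 𝓘(ℂ, E) F a t → HolSecAt 𝓘(ℂ, E) F b t →
      flatDefect D P p t ζ v (pullSec E a) (pullSec E b) = 0) {a b : Π y, (projM E M *ᵖ K) y}
    (ha : HolSecAt (𝓘(ℂ, ℂ).prod 𝓘(ℂ, E)) F a (p, t))
    (hb : HolSecAt (𝓘(ℂ, ℂ).prod 𝓘(ℂ, E)) F b (neg p, t)) : flatDefect D P p t ζ v a b = 0 := by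
  obtain ⟨e, he, he'⟩ := exists_isHolFrameAt_pullSec (E := E) (F := F) (K := K) (p, t)
  obtain ⟨e₂, he₂, he₂'⟩ := exists_isHolFrameAt_pullSec (E := E) (F := F) (K := K) (neg p, t)
  refine (isTensorialAt_flatDefect_right (D := D) hp hP ζ v ha).eq_zero he₂' (fun j => ?_) hb
  refine (isTensorialAt_flatDefect_left (D := D) hp hP ζ v (he₂'.hol j)).eq_zero he' (fun i => ?_)
      ha
  exact h _ _ (he.hol i) (he₂.hol j)

theorem contMDiffAt_of_holSecAt_inclP1 {G : Type*} [NormedAddCommGroup G] [NormedSpace ℂ G] {t : M}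
    {σ : P1 → K t} {p : P1} (A : K t →ₗ[ℂ] G)
    (hσ : HolSecAt (V := inclP1 E t *ᵖ (projM E M *ᵖ K)) 𝓘(ℂ, ℂ) F σ p) :
    ContMDiffAt 𝓘(ℂ, ℂ) 𝓘(ℂ, G) ω (fun q => A (σ q)) p := by
  obtain ⟨e, he, he'⟩ := exists_isHolFrameAt_pullback (I := 𝓘(ℂ, ℂ).prod 𝓘(ℂ, E)) (I' := 𝓘(ℂ, ℂ))
    (F := F) (V := projM E M *ᵖ K) (inclP1 E t) p
  obtain ⟨c, c1, c2, -⟩ := he'.exists_coeff σ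
  have h3 : ContMDiffAt 𝓘(ℂ, ℂ) 𝓘(ℂ, G) ω (fun q => ∑ i, c i q • A (e i (q, t))) p :=
    contMDiffAt_finsetSum fun i _ => ContMDiffAt.smul (c2 hσ i)
      (HolSecAt.comp_fiber (K := K) A (he.hol i))
  exact h3.congr_of_eventuallyEq (c1.mono fun q hq => map_eq_sum_smul A hq)

variable (E F K) in
/-- The bundle `π^*K` is trivial on `P1 × {t}`. -/
theorem trivial_fibers_projM (t : M) :
    Nonempty (HolIso 𝓘(ℂ, ℂ) F (inclP1 E t *ᵖ (projM E M *ᵖ K)) (Bundle.Trivial P1 F)) :=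
  ⟨HolIso.ofMap 𝓘(ℂ, ℂ) F (V := inclP1 E t *ᵖ (projM E M *ᵖ K)) (fun _ => fiberCoord F t)
    fun _ _ hσ => holSecAt_trivial_iff.2
      (contMDiffAt_of_holSecAt_inclP1 (fiberCoord F t).toLinearMap hσ)⟩

end PullPair

/-! ### From Frobenius type structures to `(trTLEP(w))`-structures -/

section PartA

variable {E : Type*} [NormedAddCommGroup E] [NormedSpace ℂ E] [FiniteDimensional ℂ E]
  {M : Type*} [TopologicalSpace M] [ChartedSpace E M] [IsManifold 𝓘(ℂ, E) ω M]
  {F : Type*} [NormedAddCommGroup F] [NormedSpace ℂ F] [FiniteDimensional ℂ F]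
  {K : M → Type*} [TopologicalSpace (TotalSpace F K)]
  [∀ t, AddCommGroup (K t)] [∀ t, Module ℂ (K t)] [∀ t, TopologicalSpace (K t)]
  [∀ t, IsTopologicalAddGroup (K t)] [∀ t, ContinuousSMul ℂ (K t)]
  [FiberBundle F K] [VectorBundle ℂ F K] [ContMDiffVectorBundle ω F K 𝓘(ℂ, E)]

/-- The coefficient `w/2 - V` of `dz/z`. -/
noncomputable def FrobeniusTypeStructure.residue (Φ : FrobeniusTypeStructure 𝓘(ℂ, E) F K) (w : ℤ)
    (t : M) : K t →ₗ[ℂ] K t := ((w : ℂ) / 2) • LinearMap.id - Φ.V t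

theorem FrobeniusTypeStructure.residue_apply (Φ : FrobeniusTypeStructure 𝓘(ℂ, E) F K) (w : ℤ)
    (t : M) (a : K t) : Φ.residue w t a = ((w : ℂ) / 2) • a - Φ.V t a := rfl

theorem isTwistedPullback_iff {w : ℤ} {Φ : FrobeniusTypeStructure 𝓘(ℂ, E) F K}
    {T : TrTLEPStructure E F w (projM E M *ᵖ K)} :
    IsTwistedPullback Φ T ↔ IsTwist T.conn Φ.conn Φ.C Φ.U (Φ.residue w) ∧
      ∀ (z : ℂ) (t : M) (a b : K t), z ≠ 0 → T.P (z : P1) t a b = z ^ w * Φ.g t a b := by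
  refine ⟨fun h => ⟨⟨Φ.C_hol, Φ.U_hol, fun t s hs => HolSecAt.sub (HolSecAt.const_smul _ hs)
    (Φ.V_hol t s hs), fun z t s ζ v hz hs => (h.conn z t s ζ v hz hs).trans ?_⟩, h.P⟩,
    fun h => ⟨fun z t s ζ v hz hs => (h.1.eq z t s ζ v hz hs).trans ?_, h.2⟩⟩
  · rw [FrobeniusTypeStructure.residue_apply, sub_add_eq_add_sub, add_sub_assoc]
  · rw [FrobeniusTypeStructure.residue_apply, sub_add_eq_add_sub, add_sub_assoc]

theorem TrTLEPStructure.ext' {w : ℤ} {H : P1 × M → Type*}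
    [TopologicalSpace (TotalSpace F H)] [∀ x, AddCommGroup (H x)] [∀ x, Module ℂ (H x)]
    [∀ x, TopologicalSpace (H x)] [∀ x, IsTopologicalAddGroup (H x)]
    [∀ x, ContinuousSMul ℂ (H x)] [FiberBundle F H] {T T' : TrTLEPStructure E F w H}
    (h : T.conn = T'.conn) (h' : ∀ p ∈ Cstar, ∀ t, T.P p t = T'.P p t) : T = T' := by
  have hP : T.P = T'.P := by
    funext p t
    by_cases hp : p ∈ Cstar
    · exact h' p hp t
    · rw [T.P_eq_zero p hp, T'.P_eq_zero p hp]
  cases T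
  cases T'
  congr

/-- Pulled back sections contain a frame near each point, so the formula determines the connection.
The values of the pairing off `ℂ^*` are fixed by normalization. -/
theorem IsTwistedPullback.unique {w : ℤ} {Φ : FrobeniusTypeStructure 𝓘(ℂ, E) F K}
    {T T' : TrTLEPStructure E F w (projM E M *ᵖ K)} (h : IsTwistedPullback Φ T)
    (h' : IsTwistedPullback Φ T') : T = T' := by
  refine TrTLEPStructure.ext' (HolConnection.ext_of_frame (isOpen_Cstar_prod M) ?_) ?_
  · rintro ⟨p, t⟩ hx
    obtain ⟨z, rfl⟩ := OnePoint.ne_infty_iff_exists.1 hx.2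
    obtain ⟨e, he, he'⟩ := exists_isHolFrameAt_pullSec (E := E) (F := F) (K := K) ((z : P1), t)
    refine ⟨_, _, he', fun i => ?_⟩
    ext u
    obtain ⟨ζ, v⟩ : ℂ × E := u
    have hz : z ≠ 0 := by simpa using hx
    exact (h.conn z t (e i) ζ v hz (he.hol i)).trans (h'.conn z t (e i) ζ v hz (he.hol i)).symm
  · intro p hp t
    obtain ⟨z, rfl⟩ := OnePoint.ne_infty_iff_exists.1 hp.2
    have hz : z ≠ 0 := by simpa using hp
    ext a b
    exact (h.P z t a b hz).trans (h'.P z t a b hz).symm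

theorem isFlat_of_isTwist {w : ℤ} {Φ : FrobeniusTypeStructure 𝓘(ℂ, E) F K}
    {D : HolConnection (𝓘(ℂ, ℂ).prod 𝓘(ℂ, E)) F (projM E M *ᵖ K) {x | x.1 ∈ Cstar}}
    (h : IsTwist D Φ.conn Φ.C Φ.U (Φ.residue w)) : D.IsFlat := by
  refine isFlat_of_pullSec (fun z t s X Y hz hs hX hY => ?_) (fun z t s X hz hs hX => ?_)
  · refine (h.curv_lift_lift hz hs hX hY).trans ?_
    rw [show Φ.conn.curv X Y s t = 0 from Φ.conn_flat t (mem_univ t) s X Y hs hX hY,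
      Φ.conn_C t s X Y hs hX hY, Φ.C_comm, sub_self]
    simp
    rfl
  · refine (h.curv_euler_lift hz hs hX).trans ?_
    -- The residue is flat because `V` is and because `w/2` is constant.
    have h1 : Φ.conn.toFun (fun y => Φ.residue w y (s y)) t (X t)
        = Φ.residue w t (Φ.conn.toFun s t (X t)) := by
      have e1 := isCov_add Φ.conn.isCov (HolSecAt.const_smul ((w : ℂ) / 2) hs).diffSecAt
        (HolSecAt.const_smul (-1) (Φ.V_hol t s hs)).diffSecAt (mem_univ t) (X t)
      have e2 := isCov_smul Φ.conn.isCov (f := fun _ => (w : ℂ) / 2) mdifferentiableAt_const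
        hs.diffSecAt (mem_univ t) (X t)
      have e3 := isCov_smul Φ.conn.isCov (f := fun _ => (-1 : ℂ)) mdifferentiableAt_const
        (Φ.V_hol t s hs).diffSecAt (mem_univ t) (X t)
      rw [e2, e3, Φ.V_flat t s _ hs] at e1
      simp only [mvfderiv_const, neg_smul, one_smul, ← sub_eq_add_neg] at e1
      simpa [Φ.residue_apply, sub_eq_add_neg] using e1
    have h2 := Φ.conn_U t s (X t) hs
    rw [h1, sub_self, Φ.C_U, sub_self, smul_zero, add_zero, zero_add]
    have h3 : Φ.U t (Φ.conn.toFun s t (X t)) - Φ.conn.toFun (fun y => Φ.U y (s y)) t (X t)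
        + Φ.residue w t (Φ.C t (X t) (s t)) - Φ.C t (X t) (Φ.residue w t (s t))
        - Φ.C t (X t) (s t) = 0 := by
      simp only [Φ.residue_apply, map_sub, map_smul]
      rw [← neg_eq_zero, ← h2]
      abel
    rw [h3, smul_zero]
    rfl

/-- A Frobenius type structure on `K` gives a `(trTLEP(w))`-structure on `π^*K`. -/
theorem exists_isTwistedPullback (Φ : FrobeniusTypeStructure 𝓘(ℂ, E) F K) (w : ℤ) :
    ∃ T : TrTLEPStructure E F w (projM E M *ᵖ K), IsTwistedPullback Φ T := by
  classical
  obtain ⟨D, hD⟩ := exists_isTwist (N := Φ.conn) (R := Φ.residue w) Φ.C_hol Φ.U_hol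
    fun t s hs => HolSecAt.sub (HolSecAt.const_smul _ hs) (Φ.V_hol t s hs)
  let P : Π (p : P1) (t : M), (projM E M *ᵖ K) (p, t) →ₗ[ℂ] (projM E M *ᵖ K) (neg p, t) →ₗ[ℂ] ℂ :=
    fun p t => if p ∈ Cstar then zCoord p ^ w • pullPair E Φ.g p t else 0
  have hPC : ∀ p ∈ Cstar, ∀ t, P p t = zCoord p ^ w • pullPair E Φ.g p t := fun p hp t => if_pos hp
  have hP : ∀ (z : ℂ) (t : M) (a b : K t), z ≠ 0 → P z t a b = z ^ w * Φ.g t a b := by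
    intro z t a b hz
    rw [hPC z (by simpa using hz) t]
    rfl
  have hPhol : ∀ p ∈ Cstar, ∀ t a b, HolSecAt (𝓘(ℂ, ℂ).prod 𝓘(ℂ, E)) F a (p, t) →
      HolSecAt (𝓘(ℂ, ℂ).prod 𝓘(ℂ, E)) F b (neg p, t) →
      HolFunAt (𝓘(ℂ, ℂ).prod 𝓘(ℂ, E)) (pairFun P a b) (p, t) := by
    intro p hp t a b ha hb
    exact ((holFunAt_zCoord_zpow (x := (p, t)) hp w).mul
      (holFunAt_pairFun_pullPair Φ.g_hol ha hb)).congr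
      ((eventually_fst_mem_Cstar (x := (p, t)) hp).mono fun y hy => pairFun_eq_zpow_mul hP a b hy)
  have hflat : ∀ p ∈ Cstar, ∀ t (ζ : ℂ) (v : TangentSpace 𝓘(ℂ, E) t) a b,
      HolSecAt (𝓘(ℂ, ℂ).prod 𝓘(ℂ, E)) F a (p, t) →
      HolSecAt (𝓘(ℂ, ℂ).prod 𝓘(ℂ, E)) F b (neg p, t) → flatDefect D P p t ζ v a b = 0 := by
    intro p hp t ζ v a b ha hb
    refine flatDefect_eq_zero_of_pullSec hp (hPhol p hp t) (fun s₁ s₂ h₁ h₂ => ?_) ha hb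
    obtain ⟨z, rfl⟩ := OnePoint.ne_infty_iff_exists.1 hp.2
    rw [hD.flatDefect_pullSec hP Φ.g_hol (by simpa using hp) h₁ h₂, Φ.g_flat t s₁ s₂ v h₁ h₂, Φ.g_C,
      Φ.g_U]
    simp only [Φ.residue_apply, map_sub, map_smul, LinearMap.sub_apply, LinearMap.smul_apply, Φ.g_V,
      smul_eq_mul]
    ring
  -- The same extension, the pullback of `g`, serves at `0` and at `∞`, since `(z⁻¹)^(-w) = z^w`.
  have hext : ∀ (D : Set P1) (f : P1 → ℂ) (k : ℤ), (∀ p ∈ Cstar, f p ^ k = zCoord p ^ w) →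
      PairingExtends E F P D f k := fun D f k hf =>
    ⟨pullPair E Φ.g, fun p _ hp t => by rw [hPC p hp, hf p hp], fun p _ t => Φ.g_nondeg t,
      fun p _ t a b ha hb => holFunAt_pairFun_pullPair Φ.g_hol ha hb⟩
  refine ⟨⟨trivial_fibers_projM E F K, D, isFlat_of_isTwist hD,
    fun t σ X hσ hX => ⟨_, hD.extendsTo_zero_lift hσ hX⟩,
    fun t σ hσ => ⟨_, hD.extendsTo_zero_euler hσ⟩,
    fun t σ X hσ hX => ⟨_, hD.extendsTo_infty_lift hσ hX⟩,
    fun t σ hσ => ⟨_, hD.extendsTo_infty_euler hσ⟩, P, fun p hp t => if_neg hp, ?_, ?_, ?_,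
    hext _ _ _ fun _ _ => rfl, hext _ _ _ fun p hp => by simp⟩, isTwistedPullback_iff.2 ⟨hD, hP⟩⟩
  · intro p hp t a b
    rw [pairFun_eq_zpow_mul hP a b (y := (p, t)) hp,
      pairFun_eq_zpow_mul hP b a (y := (neg p, t)) (neg_mem_Cstar hp)]
    have h1 : pairFun (pullPair E Φ.g) b a (neg p, t) = pairFun (pullPair E Φ.g) a b (p, t) := by
      refine Eq.trans ?_ (Φ.g_symm t _ _)
      exact congrArg (fun q => Φ.g t (b (neg p, t)) (a (q, t))) (neg_neg p)
    -- The sign `(-1)^w` is the quotient of `z^w` and `(-z)^w`.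
    rw [h1, ← mul_assoc, zCoord_neg, ← mul_zpow, neg_one_mul, _root_.neg_neg]
  · intro p hp t a b v ha hb
    have := hflat p hp t 0 v a b ha hb
    rw [flatDefect, neg_zero, sub_sub] at this
    exact sub_eq_zero.1 this
  · intro p hp t a b ha hb
    have := hflat p hp t (zCoord p) 0 a b ha hb
    rw [flatDefect, ← zCoord_neg, sub_sub] at this
    exact sub_eq_zero.1 this

end PartA

end HolBundle

namespace HolBundle

open RiemannSphere VectorField

/-! ### Comparison of coefficients in `z⁻¹` -/

section Coefficients

/-- A polynomial of degree 2 is determined by three values; `z = 1, -1, 1/2` are convenient. -/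
theorem eq_zero_of_forall_inv_smul {W : Type*} [AddCommGroup W] [Module ℂ W] {a b c : W}
    (h : ∀ z : ℂ, z ≠ 0 → a + z⁻¹ • b + z⁻¹ ^ 2 • c = 0) : a = 0 ∧ b = 0 ∧ c = 0 := by
  have h1 := h 1 one_ne_zero
  have h2 := h (-1) (neg_ne_zero.2 one_ne_zero)
  have h3 := h (2⁻¹) (by norm_num)
  norm_num at h1 h2 h3
  have hb : b = 0 := by
    have : (2 : ℂ) • b = 0 := by
      calc (2 : ℂ) • b = (a + b + c) - (a + -b + c) := by module
        _ = 0 := by rw [h1, h2, sub_zero]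
    simpa using this
  subst hb
  simp only [smul_zero, add_zero] at h1 h3
  have hc : c = 0 := by
    have : (3 : ℂ) • c = 0 := by
      calc (3 : ℂ) • c = (a + (4 : ℂ) • c) - (a + c) := by module
        _ = 0 := by rw [h1, h3, sub_zero]
    simpa using this
  subst hc
  simpa using h1

theorem eq_of_forall_inv_smul {W : Type*} [AddCommGroup W] [Module ℂ W] {a b a' b' : W}
    (h : ∀ z : ℂ, z ≠ 0 → a + z⁻¹ • b = a' + z⁻¹ • b') : a = a' ∧ b = b' := by
  have := eq_zero_of_forall_inv_smul (a := a - a') (b := b - b') (c := 0) fun z hz => by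
    rw [smul_zero, add_zero, smul_sub, ← sub_eq_zero.2 (h z hz)]
    abel
  exact ⟨sub_eq_zero.1 this.1, sub_eq_zero.1 this.2.1⟩

variable {E : Type*} [NormedAddCommGroup E] [NormedSpace ℂ E] [FiniteDimensional ℂ E]
  {M : Type*} [TopologicalSpace M] [ChartedSpace E M] [IsManifold 𝓘(ℂ, E) ω M]
  {F : Type*} [NormedAddCommGroup F] [NormedSpace ℂ F] [FiniteDimensional ℂ F]
  {K : M → Type*} [TopologicalSpace (TotalSpace F K)]
  [∀ t, AddCommGroup (K t)] [∀ t, Module ℂ (K t)] [∀ t, TopologicalSpace (K t)]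
  [∀ t, IsTopologicalAddGroup (K t)] [∀ t, ContinuousSMul ℂ (K t)]
  [FiberBundle F K] [VectorBundle ℂ F K] [ContMDiffVectorBundle ω F K 𝓘(ℂ, E)]

/-- A section over `ℂ^* × {t}` with at most a simple pole at `0` and regular at `∞` is of the form
`a + z⁻¹ b`. -/
theorem eq_add_inv_smul_of_extendsTo {σ : Π y : P1 × M, K y.2} {t : M} {a b : K t}
    (hσ : ∀ z : ℂ, z ≠ 0 →
      DiffSecAt (V := projM E M *ᵖ K) (𝓘(ℂ, ℂ).prod 𝓘(ℂ, E)) F σ ((z : P1), t))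
    (h0 : ExtendsTo (H := projM E M *ᵖ K) E F (fun y => zCoord y.1 • σ y) (((0 : ℂ) : P1), t) b)
    (hi : ExtendsTo (H := projM E M *ᵖ K) E F σ ((OnePoint.infty : P1), t) a) {z : ℂ}
    (hz : z ≠ 0) : σ ((z : P1), t) = a + z⁻¹ • b := by
  obtain ⟨τ, h1, h2, h3⟩ := h0
  obtain ⟨τ', h1', h2', h3'⟩ := hi
  let L := (fiberCoord F t : K t ≃ₗ[ℂ] F)
  have c1 : Tendsto (fun q => L (τ' (q, t))) (𝓝 OnePoint.infty) (𝓝 (L a)) := by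
    have := (HolSecAt.comp_fiber (K := K) L.toLinearMap h1').continuousAt.tendsto
    have h4 : L (τ' ((OnePoint.infty : P1), t)) = L a := congrArg L h3'
    rw [← h4]
    exact this
  have hA : Tendsto (fun z : ℂ => L (σ ((z : P1), t))) (cocompact ℂ) (𝓝 (L a)) := by
    refine (c1.comp tendsto_coe_cocompact).congr' ?_
    have hne : ∀ᶠ z in cocompact ℂ, z ≠ (0 : ℂ) :=
      (isCompact_singleton (x := (0 : ℂ))).compl_mem_cocompact
    filter_upwards [tendsto_coe_cocompact.eventually (eventually_fiber h2'), hne] with w hw hw0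
    exact congrArg L (hw (by simpa using hw0))
  have hfk : ∀ᶠ w : ℂ in 𝓝 0, w ≠ 0 → L (τ ((w : P1), t)) = w • L (σ ((w : P1), t)) := by
    filter_upwards [(contMDiff_coe.continuous.tendsto (0 : ℂ)).eventually (eventually_fiber h2)]
      with w hw hw0
    exact (congrArg L (hw (by simpa using hw0))).trans (map_smul L _ _)
  have key := eq_add_inv_smul (fun z hz => (hσ z hz).comp_fiber (K := K) L.toLinearMap)
    (h1.diffSecAt.comp_fiber (K := K) L.toLinearMap) hfk hA hz
  refine L.injective (key.trans ?_)
  rw [map_add, map_smul]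
  exact congrArg (fun u : K t => L a + z⁻¹ • L u) h3

end Coefficients

/-! ### The shape of a connection on `π^*K` with the prescribed poles -/

section Descent

variable {E : Type*} [NormedAddCommGroup E] [NormedSpace ℂ E] [FiniteDimensional ℂ E]
  {M : Type*} [TopologicalSpace M] [ChartedSpace E M] [IsManifold 𝓘(ℂ, E) ω M]
  {F : Type*} [NormedAddCommGroup F] [NormedSpace ℂ F] [FiniteDimensional ℂ F]
  {K : M → Type*} [TopologicalSpace (TotalSpace F K)]
  [∀ t, AddCommGroup (K t)] [∀ t, Module ℂ (K t)] [∀ t, TopologicalSpace (K t)]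
  [∀ t, IsTopologicalAddGroup (K t)] [∀ t, ContinuousSMul ℂ (K t)]
  [FiberBundle F K] [VectorBundle ℂ F K] [ContMDiffVectorBundle ω F K 𝓘(ℂ, E)]
  {D : HolConnection (𝓘(ℂ, ℂ).prod 𝓘(ℂ, E)) F (projM E M *ᵖ K) {x | x.1 ∈ Cstar}}

theorem clm_apply_eq_add {G : Type*} [AddCommGroup G] [Module ℂ G] [TopologicalSpace G]
    (L : ℂ × E →L[ℂ] G) {z : ℂ} (hz : z ≠ 0) (ζ : ℂ) (u : E) :
    L (ζ, u) = L (0, u) + (ζ / z) • L (z, 0) := by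
  rw [← map_smul, ← map_add]
  simp [hz]

/-- The restriction of a connection on `π^*K` to `{p} × M`. -/
noncomputable def sliceDeriv
    (D : HolConnection (𝓘(ℂ, ℂ).prod 𝓘(ℂ, E)) F (projM E M *ᵖ K) {x | x.1 ∈ Cstar})
    (p : P1) (s : Π t, K t) (t : M) : TangentSpace 𝓘(ℂ, E) t →L[ℂ] K t :=
  (D.toFun (pullSec E s) (p, t) : ℂ × E →L[ℂ] K t).comp (ContinuousLinearMap.inr ℂ ℂ E)

theorem sliceDeriv_apply (p : P1) (s : Π t, K t) (t : M) (v : TangentSpace 𝓘(ℂ, E) t) :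
    sliceDeriv D p s t v = pullDeriv D s p t 0 v := rfl

theorem pullDeriv_congr {s s' : Π t, K t} {t : M} (h : ∀ᶠ y in 𝓝 t, s' y = s y) (p : P1) (ζ : ℂ)
    (v : TangentSpace 𝓘(ℂ, E) t) : pullDeriv D s' p t ζ v = pullDeriv D s p t ζ v := by
  have h1 : D.toFun (pullSec E s') (p, t) = D.toFun (pullSec E s) (p, t) :=
    D.congr (isOpen_Cstar_prod M) ((continuousAt_snd (p := (p, t))).eventually h)
  exact congrArg (fun L : ℂ × E →L[ℂ] K t => L (ζ, v)) h1

theorem pullDeriv_add {s s' : Π t, K t} {t : M} {p : P1} (hp : p ∈ Cstar)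
    (hs : DiffSecAt 𝓘(ℂ, E) F s t) (hs' : DiffSecAt 𝓘(ℂ, E) F s' t) (ζ : ℂ)
    (v : TangentSpace 𝓘(ℂ, E) t) : pullDeriv D (fun y => s y + s' y) p t ζ v
      = pullDeriv D s p t ζ v + pullDeriv D s' p t ζ v :=
  isCov_add D.isCov (hs.pullSec (x := (p, t))) (hs'.pullSec (x := (p, t))) hp _

theorem mdifferentiableAt_comp_snd {f : M → ℂ} {x : P1 × M}
    (hf : MDifferentiableAt 𝓘(ℂ, E) 𝓘(ℂ, ℂ) f x.2) :
    MDifferentiableAt (𝓘(ℂ, ℂ).prod 𝓘(ℂ, E)) 𝓘(ℂ, ℂ) (fun y : P1 × M => f y.2) x :=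
  MDifferentiableAt.comp (g := f) (f := Prod.snd) (I' := 𝓘(ℂ, E)) x hf mdifferentiableAt_snd

theorem pullDeriv_smul {f : M → ℂ} {s : Π t, K t} {t : M} {p : P1} (hp : p ∈ Cstar)
    (hf : MDifferentiableAt 𝓘(ℂ, E) 𝓘(ℂ, ℂ) f t)
    (hs : DiffSecAt 𝓘(ℂ, E) F s t) (ζ : ℂ)
    (v : TangentSpace 𝓘(ℂ, E) t) : pullDeriv D (fun y => f y • s y) p t ζ v
      = f t • pullDeriv D s p t ζ v + mvfderiv 𝓘(ℂ, E) f t v • s t := by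
  refine (isCov_smul D.isCov (mdifferentiableAt_comp_snd (x := (p, t)) hf)
    (hs.pullSec (x := (p, t))) hp _).trans ?_
  rw [mvfderiv_comp_snd (x := (p, t)) hf]
  rfl

theorem isCovariantDerivativeOn_sliceDeriv {p : P1} (hp : p ∈ Cstar) :
    IsCovariantDerivativeOn (I := 𝓘(ℂ, E)) F (sliceDeriv D p) univ where
  add {σ τ t} hσ hτ _ := by
    ext v
    exact pullDeriv_add hp hσ hτ 0 v
  leibniz {σ f t} hσ hf _ := by
    ext v
    exact pullDeriv_smul hp hf hσ 0 v

theorem holSecAt_sliceDeriv {p : P1} (hp : p ∈ Cstar) {s : Π t, K t} {t : M}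
    {X : Π t : M, TangentSpace 𝓘(ℂ, E) t} (hs : HolSecAt 𝓘(ℂ, E) F s t) (hX : HolVFAt 𝓘(ℂ, E) X t) :
    HolSecAt 𝓘(ℂ, E) F (fun y => pullDeriv D s p y 0 (X y)) t :=
  HolSecAt.slice (σ := fun y => D.toFun (pullSec E s) y (liftVF X y))
    (D.hol (p, t) hp _ _ (hs.pullSec (x := (p, t))) (hX.liftVF (x := (p, t))))

theorem holSecAt_eulerDeriv {p : P1} (hp : p ∈ Cstar) {s : Π t, K t} {t : M}
    (hs : HolSecAt 𝓘(ℂ, E) F s t) :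
    HolSecAt 𝓘(ℂ, E) F (fun y => pullDeriv D s p y (zCoord p) 0) t :=
  HolSecAt.slice (σ := fun y => D.toFun (pullSec E s) y (eulerVF E y))
    (D.hol (p, t) hp _ _ (hs.pullSec (x := (p, t))) (holVFAt_eulerVF E (p, t)))

theorem one_mem_Cstar : ((1 : ℂ) : P1) ∈ Cstar := by simp

theorem two_mem_Cstar : ((2 : ℂ) : P1) ∈ Cstar := by simp

/-- The connection `2 ∇|_{z = 2} - ∇|_{z = 1}` on `K`. -/
noncomputable def constConn
    (D : HolConnection (𝓘(ℂ, ℂ).prod 𝓘(ℂ, E)) F (projM E M *ᵖ K) {x | x.1 ∈ Cstar}) :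
    HolConnection 𝓘(ℂ, E) F K univ where
  -- If `∇` restricts to `N + z⁻¹ C` on the slices, this combination is `N`. The weights add up to
  -- `1`, so it is a connection without any passage to the limit at `∞`.
  toFun s := ((fun _ => (2 : ℂ)) • sliceDeriv D ((2 : ℂ) : P1) s)
    + (1 - fun _ => (2 : ℂ)) • sliceDeriv D ((1 : ℂ) : P1) s
  isCov := (isCovariantDerivativeOn_sliceDeriv two_mem_Cstar).affine_combination
    (isCovariantDerivativeOn_sliceDeriv one_mem_Cstar) _
  hol t _ s X hs hX := HolSecAt.add (HolSecAt.const_smul 2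
      (holSecAt_sliceDeriv two_mem_Cstar hs hX))
    (HolSecAt.const_smul (1 - 2) (holSecAt_sliceDeriv one_mem_Cstar hs hX))
  eq_zero s t h := by
    have key : ∀ p : P1, sliceDeriv D p s t = 0 := by
      intro p
      have : D.toFun (pullSec E s) (p, t) = 0 := by
        refine D.eq_zero _ _ fun h' => h ⟨mem_univ t, ?_⟩
        exact DiffSecAt.slice (K := K) h'.2
      ext v
      exact congrArg (fun L : ℂ × E →L[ℂ] K t => L (0, v)) this
    simp [key]

theorem constConn_apply (s : Π t, K t) (t : M) (v : TangentSpace 𝓘(ℂ, E) t) :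
    (constConn D).toFun s t v = (2 : ℂ) • pullDeriv D s ((2 : ℂ) : P1) t 0 v
      + (1 - 2 : ℂ) • pullDeriv D s ((1 : ℂ) : P1) t 0 v := rfl

/-- A connection on `π^*K` with poles of the prescribed type is `∇ + C/z + (U/z + R) dz/z`. -/
theorem exists_isTwist_of_poles
    (h0 : ∀ (t : M) (σ : Π x, (projM E M *ᵖ K) x) (X : Π t : M, TangentSpace 𝓘(ℂ, E) t),
      HolSecAt (𝓘(ℂ, ℂ).prod 𝓘(ℂ, E)) F σ (((0 : ℂ) : P1), t) → HolVFAt 𝓘(ℂ, E) X t →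
      ∃ a, ExtendsTo E F (fun y => zCoord y.1 • D.toFun σ y (tvec y 0 (X y.2)))
        (((0 : ℂ) : P1), t) a)
    (h0' : ∀ (t : M) (σ : Π x, (projM E M *ᵖ K) x),
      HolSecAt (𝓘(ℂ, ℂ).prod 𝓘(ℂ, E)) F σ (((0 : ℂ) : P1), t) →
      ∃ a, ExtendsTo E F (fun y => zCoord y.1 • D.toFun σ y (tvec y (zCoord y.1) 0))
        (((0 : ℂ) : P1), t) a)
    (hi : ∀ (t : M) (σ : Π x, (projM E M *ᵖ K) x) (X : Π t : M, TangentSpace 𝓘(ℂ, E) t),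
      HolSecAt (𝓘(ℂ, ℂ).prod 𝓘(ℂ, E)) F σ ((OnePoint.infty : P1), t) → HolVFAt 𝓘(ℂ, E) X t →
      ∃ a, ExtendsTo E F (fun y => D.toFun σ y (tvec y 0 (X y.2)))
        ((OnePoint.infty : P1), t) a)
    (hi' : ∀ (t : M) (σ : Π x, (projM E M *ᵖ K) x),
      HolSecAt (𝓘(ℂ, ℂ).prod 𝓘(ℂ, E)) F σ ((OnePoint.infty : P1), t) →
      ∃ a, ExtendsTo E F (fun y => D.toFun σ y (tvec y (zCoord y.1) 0))
        ((OnePoint.infty : P1), t) a) :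
    ∃ (C : Π t : M, TangentSpace 𝓘(ℂ, E) t →ₗ[ℂ] K t →ₗ[ℂ] K t) (U R : Π t : M, K t →ₗ[ℂ] K t),
      IsTwist D (constConn D) C U R := by
  -- Liouville's theorem gives the dependence on `z` for each `t`. The coefficients are then
  -- recovered from the values at `z = 1` and `z = 2`, where holomorphy in `t` is known.
  have lin : ∀ (t : M) (s : Π t, K t) (X : Π t : M, TangentSpace 𝓘(ℂ, E) t),
      HolSecAt 𝓘(ℂ, E) F s t → HolVFAt 𝓘(ℂ, E) X t → ∃ a b : K t, ∀ z : ℂ, z ≠ 0 →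
        pullDeriv D s z t 0 (X t) = a + z⁻¹ • b := by
    intro t s X hs hX
    obtain ⟨b, hb⟩ := h0 t _ X (hs.pullSec (x := (((0 : ℂ) : P1), t))) hX
    obtain ⟨a, ha⟩ := hi t _ X (hs.pullSec (x := ((OnePoint.infty : P1), t))) hX
    refine ⟨a, b, fun z hz => ?_⟩
    refine eq_add_inv_smul_of_extendsTo (fun z hz => ?_) hb ha hz
    exact (D.hol ((z : P1), t) (by simpa using hz) _ _ (hs.pullSec (x := ((z : P1), t)))
      (hX.liftVF (x := ((z : P1), t)))).diffSecAt
  have lin' : ∀ (t : M) (s : Π t, K t), HolSecAt 𝓘(ℂ, E) F s t → ∃ a b : K t, ∀ z : ℂ, z ≠ 0 →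
        pullDeriv D s z t z 0 = a + z⁻¹ • b := by
    intro t s hs
    obtain ⟨b, hb⟩ := h0' t _ (hs.pullSec (x := (((0 : ℂ) : P1), t)))
    obtain ⟨a, ha⟩ := hi' t _ (hs.pullSec (x := ((OnePoint.infty : P1), t)))
    refine ⟨a, b, fun z hz => ?_⟩
    refine eq_add_inv_smul_of_extendsTo (fun z hz => ?_) hb ha hz
    exact (D.hol ((z : P1), t) (by simpa using hz) _ _ (hs.pullSec (x := ((z : P1), t)))
      (holVFAt_eulerVF E ((z : P1), t))).diffSecAt
  -- A difference of two connections is linear over functions; this one will be `C/2`.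
  have tens : ∀ t : M, IsTensorialAt 𝓘(ℂ, E) F (fun s : Π t, K t =>
      ((sliceDeriv D ((1 : ℂ) : P1) s t : TangentSpace 𝓘(ℂ, E) t →ₗ[ℂ] K t)
        - (sliceDeriv D ((2 : ℂ) : P1) s t : TangentSpace 𝓘(ℂ, E) t →ₗ[ℂ] K t))) t := by
    refine fun t => ⟨fun s s' hs h => ?_, fun s s' hs hs' => ?_, fun f s hf hs => ?_⟩ <;> ext v
    · exact congrArg₂ (fun a b : K t => a - b) (pullDeriv_congr h _ 0 v) (pullDeriv_congr h _ 0 v)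
    · refine (congrArg₂ (fun a b : K t => a - b)
        (pullDeriv_add one_mem_Cstar hs.diffSecAt hs'.diffSecAt 0 v)
        (pullDeriv_add two_mem_Cstar hs.diffSecAt hs'.diffSecAt 0 v)).trans ?_
      simp only [LinearMap.add_apply, LinearMap.sub_apply, ContinuousLinearMap.coe_coe,
        sliceDeriv_apply]
      abel
    · refine (congrArg₂ (fun a b : K t => a - b)
        (pullDeriv_smul one_mem_Cstar hf.mdifferentiableAt hs.diffSecAt 0 v)
        (pullDeriv_smul two_mem_Cstar hf.mdifferentiableAt hs.diffSecAt 0 v)).trans ?_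
      simp only [LinearMap.smul_apply, LinearMap.sub_apply, ContinuousLinearMap.coe_coe,
        sliceDeriv_apply]
      module
  -- The field `z ∂_z` annihilates functions pulled back from `M`.
  have tens' : ∀ (t : M) (p : P1), p ∈ Cstar → IsTensorialAt 𝓘(ℂ, E) F (fun s : Π t, K t =>
      pullDeriv D s p t (zCoord p) 0) t := by
    refine fun t p hp => ⟨fun s s' hs h => pullDeriv_congr h _ _ _, fun s s' hs hs' =>
      pullDeriv_add hp hs.diffSecAt hs'.diffSecAt _ _, fun f s hf hs => ?_⟩
    rw [pullDeriv_smul hp hf.mdifferentiableAt hs.diffSecAt, map_zero, zero_smul, add_zero]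
  choose C hC using fun t => (tens t).exists_linearMap
  choose G₁ hG₁ using fun t => (tens' t _ one_mem_Cstar).exists_linearMap
  choose G₂ hG₂ using fun t => (tens' t _ two_mem_Cstar).exists_linearMap
  have hC' : ∀ t s, HolSecAt 𝓘(ℂ, E) F s t → ∀ v : TangentSpace 𝓘(ℂ, E) t,
      ((2 : ℂ) • C t).flip v (s t) = (2 : ℂ) • (pullDeriv D s ((1 : ℂ) : P1) t 0 v
        - pullDeriv D s ((2 : ℂ) : P1) t 0 v) := by
    intro t s hs v
    have := congrArg (fun L : TangentSpace 𝓘(ℂ, E) t →ₗ[ℂ] K t => L v) (hC t s hs)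
    rw [LinearMap.flip_apply, LinearMap.smul_apply, LinearMap.smul_apply]
    exact congrArg (fun a : K t => (2 : ℂ) • a) this.symm
  have hU' : ∀ t s, HolSecAt 𝓘(ℂ, E) F s t → ((2 : ℂ) • (G₁ t - G₂ t)) (s t)
      = (2 : ℂ) • (pullDeriv D s ((1 : ℂ) : P1) t 1 0 - pullDeriv D s ((2 : ℂ) : P1) t 2 0) := by
    intro t s hs
    rw [LinearMap.smul_apply, LinearMap.sub_apply, ← hG₁ t s hs, ← hG₂ t s hs]
    rfl
  have hR' : ∀ t s, HolSecAt 𝓘(ℂ, E) F s t → ((2 : ℂ) • G₂ t - G₁ t) (s t)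
      = (2 : ℂ) • pullDeriv D s ((2 : ℂ) : P1) t 2 0 - pullDeriv D s ((1 : ℂ) : P1) t 1 0 := by
    intro t s hs
    rw [LinearMap.sub_apply, LinearMap.smul_apply, ← hG₁ t s hs, ← hG₂ t s hs]
    rfl
  have hd : ∀ (p : P1) (hp : p ∈ Cstar) t s, HolSecAt 𝓘(ℂ, E) F s t →
      HolSecAt 𝓘(ℂ, E) F (fun y => pullDeriv D s p y (zCoord p) 0) t := fun p hp t s hs =>
    holSecAt_eulerDeriv hp hs
  -- The coefficients of `a + z⁻¹ b`, solved from its values at `1` and `2`: `b` is twice the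
  -- difference, and `a` is twice the second value minus the first.
  refine ⟨fun t => ((2 : ℂ) • C t).flip, fun t => (2 : ℂ) • (G₁ t - G₂ t),
    fun t => (2 : ℂ) • G₂ t - G₁ t, fun t s X hs hX => ?_, fun t s hs => ?_, fun t s hs => ?_,
    fun z t s ζ v hz hs => ?_⟩
  · exact (HolSecAt.const_smul 2 ((holSecAt_sliceDeriv (D := D) one_mem_Cstar hs hX).sub
      (holSecAt_sliceDeriv (D := D) two_mem_Cstar hs hX))).congr
      (hs.eventually.mono fun y hy => hC' y s hy (X y))
  · exact (HolSecAt.const_smul 2 ((hd _ one_mem_Cstar t s hs).sub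
      (hd _ two_mem_Cstar t s hs))).congr (hs.eventually.mono fun y hy => hU' y s hy)
  · exact ((HolSecAt.const_smul 2 (hd _ two_mem_Cstar t s hs)).sub
      (hd _ one_mem_Cstar t s hs)).congr (hs.eventually.mono fun y hy => hR' y s hy)
  · obtain ⟨X, hX, rfl⟩ := exists_holSecAt_eq (I := 𝓘(ℂ, E)) (F := E) (V :=
        TangentSpace 𝓘(ℂ, E)) t v
    obtain ⟨a, b, hab⟩ := lin t s X hs hX
    obtain ⟨a', b', hab'⟩ := lin' t s hs
    have hsplit : pullDeriv D s z t ζ (X t) = pullDeriv D s z t 0 (X t)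
        + (ζ / z) • pullDeriv D s z t z 0 :=
      clm_apply_eq_add (D.toFun (pullSec E s) ((z : P1), t) : ℂ × E →L[ℂ] K t) hz ζ (X t)
    rw [hsplit, hab z hz, hab' z hz, constConn_apply, hC' t s hs, hU' t s hs, hR' t s hs,
      hab 1 one_ne_zero, hab 2 two_ne_zero, hab' 1 one_ne_zero, hab' 2 two_ne_zero]
    simp only [inv_one]
    module

end Descent

end HolBundle

namespace HolBundle

open RiemannSphere VectorField

/-! ### From `(trTLEP(w))`-structures on `π^*K` to Frobenius type structures -/

section Untwist

variable {E : Type*} [NormedAddCommGroup E] [NormedSpace ℂ E] [FiniteDimensional ℂ E]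
  {M : Type*} [TopologicalSpace M] [ChartedSpace E M] [IsManifold 𝓘(ℂ, E) ω M]
  {F : Type*} [NormedAddCommGroup F] [NormedSpace ℂ F] [FiniteDimensional ℂ F]
  {K : M → Type*} [TopologicalSpace (TotalSpace F K)]
  [∀ t, AddCommGroup (K t)] [∀ t, Module ℂ (K t)] [∀ t, TopologicalSpace (K t)]
  [∀ t, IsTopologicalAddGroup (K t)] [∀ t, ContinuousSMul ℂ (K t)]
  [FiberBundle F K] [VectorBundle ℂ F K] [ContMDiffVectorBundle ω F K 𝓘(ℂ, E)]
  {w : ℤ}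

/-- On a pulled back bundle, `z^(-w) P` is constant in `z`. -/
theorem pairing_eq_zpow_mul {P : Π (p : P1) (t : M),
      (projM E M *ᵖ K) (p, t) →ₗ[ℂ] (projM E M *ᵖ K) (neg p, t) →ₗ[ℂ] ℂ}
    (h0 : PairingExtends E F P {p | p ≠ OnePoint.infty} zCoord w)
    (hi : PairingExtends E F P {p | p ≠ ((0 : ℂ) : P1)} (fun p => (zCoord p)⁻¹) (-w)) {z : ℂ}
    (hz : z ≠ 0) (t : M) (a b : K t) :
    P (z : P1) t a b = z ^ w * P ((1 : ℂ) : P1) t a b := by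
  classical
  obtain ⟨Q, hQ, -, hQ'⟩ := h0
  obtain ⟨Q', hQ₁, -, hQ₁'⟩ := hi
  obtain ⟨α, hα, hαt⟩ := exists_holSecAt_eq (I := 𝓘(ℂ, E)) (F := F) (V := K) t a
  obtain ⟨β, hβ, hβt⟩ := exists_holSecAt_eq (I := 𝓘(ℂ, E)) (F := F) (V := K) t b
  let q : P1 → ℂ := fun p => Q p t (α t) (β t)
  let q' : P1 → ℂ := fun p => Q' p t (α t) (β t)
  have e1 : ∀ p ∈ Cstar, P p t (α t) (β t) = zCoord p ^ w * q p := fun p hp =>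
    congrArg (fun L : K t →ₗ[ℂ] K t →ₗ[ℂ] ℂ => L (α t) (β t)) (hQ p hp.2 hp t)
  have e2 : ∀ p ∈ Cstar, P p t (α t) (β t) = zCoord p ^ w * q' p := fun p hp => by
    have := congrArg (fun L : K t →ₗ[ℂ] K t →ₗ[ℂ] ℂ => L (α t) (β t)) (hQ₁ p hp.1 hp t)
    rw [inv_zpow', _root_.neg_neg] at this
    exact this
  have hfib : ∀ {f : P1 × M → ℂ} {p : P1}, HolFunAt (𝓘(ℂ, ℂ).prod 𝓘(ℂ, E)) f (p, t) →
      ContMDiffAt 𝓘(ℂ, ℂ) 𝓘(ℂ, ℂ) ω (fun p => f (p, t)) p := fun {f p} hf =>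
    ContMDiffAt.comp (g := f) (f := fun p => (p, t)) (I' := 𝓘(ℂ, ℂ).prod 𝓘(ℂ, E)) p hf
      (contMDiffAt_id.prodMk contMDiffAt_const)
  have hq : ∀ p : P1, p ≠ OnePoint.infty → ContMDiffAt 𝓘(ℂ, ℂ) 𝓘(ℂ, ℂ) ω q p := fun p hp =>
    hfib (hQ' p hp t _ _ (hα.pullSec (x := (p, t))) (hβ.pullSec (x := (neg p, t))))
  have hq' : ∀ p : P1, p ≠ ((0 : ℂ) : P1) → ContMDiffAt 𝓘(ℂ, ℂ) 𝓘(ℂ, ℂ) ω q' p := fun p hp =>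
    hfib (hQ₁' p hp t _ _ (hα.pullSec (x := (p, t))) (hβ.pullSec (x := (neg p, t))))
  -- The extensions at `0` and at `∞` agree on `ℂ^*`, so they glue to a holomorphic function on
  -- `P1`, which is constant. Its value is read off at `z = 1`.
  let f : P1 → ℂ := fun p => if p = OnePoint.infty then q' p else q p
  have hf : ContMDiff 𝓘(ℂ, ℂ) 𝓘(ℂ, ℂ) ω f := by
    intro p
    by_cases hp : p = OnePoint.infty
    · subst hp
      refine (hq' _ (OnePoint.infty_ne_coe _)).congr_of_eventuallyEq ?_
      filter_upwards [eventually_ne_nhds (OnePoint.infty_ne_coe (0 : ℂ))] with p hp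
      by_cases hp' : p = OnePoint.infty
      · exact if_pos hp'
      · refine (if_neg hp').trans (mul_left_cancel₀ (zpow_ne_zero w (zCoord_ne_zero ⟨hp, hp'⟩)) ?_)
        rw [← e1 p ⟨hp, hp'⟩, e2 p ⟨hp, hp'⟩]
    · refine (hq p hp).congr_of_eventuallyEq ?_
      filter_upwards [eventually_ne_infty hp] with p hp'
      exact if_neg hp'
  have hconst := apply_eq_of_contMDiff hf (z : P1) ((1 : ℂ) : P1)
  have hfz : ∀ z : ℂ, f z = q z := fun z => if_neg (OnePoint.coe_ne_infty z)
  rw [hfz, hfz] at hconst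
  have h1 := e1 (z : P1) (by simpa using hz)
  have h2 := e1 ((1 : ℂ) : P1) one_mem_Cstar
  rw [zCoord_coe, one_zpow, one_mul] at h2
  rw [zCoord_coe, hconst, ← h2, hαt, hβt] at h1
  exact h1

/-- A `(trTLEP(w))`-structure on `π^*K` comes from a Frobenius type structure on `K`. -/
theorem TrTLEPStructure.exists_isTwistedPullback (T : TrTLEPStructure E F w (projM E M *ᵖ K)) :
    ∃ Φ : FrobeniusTypeStructure 𝓘(ℂ, E) F K, IsTwistedPullback Φ T := by
  obtain ⟨C, U, R, h⟩ := exists_isTwist_of_poles T.pole_zero_M T.pole_zero_z T.pole_infty_M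
    T.pole_infty_z
  let N := constConn T.conn
  -- At `z = 1` the factor `z^w` is `1`.
  let g : Π t : M, K t →ₗ[ℂ] K t →ₗ[ℂ] ℂ := fun t => T.P ((1 : ℂ) : P1) t
  have hP : ∀ (z : ℂ) (t : M) (a b : K t), z ≠ 0 → T.P z t a b = z ^ w * g t a b :=
    fun z t a b hz => pairing_eq_zpow_mul T.P_zero T.P_infty hz t a b
  have hg : ∀ (t : M) (a b : Π t, K t), HolSecAt 𝓘(ℂ, E) F a t → HolSecAt 𝓘(ℂ, E) F b t →
      HolFunAt 𝓘(ℂ, E) (fun y => g y (a y) (b y)) t := by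
    intro t a b ha hb
    obtain ⟨Q, hQ, -, hQ'⟩ := T.P_zero
    refine (hQ' ((1 : ℂ) : P1) (OnePoint.coe_ne_infty _) t _ _
      (ha.pullSec (x := (((1 : ℂ) : P1), t))) (hb.pullSec (x :=
          (neg ((1 : ℂ) : P1), t)))).slice.congr
      (Eventually.of_forall fun y => ?_)
    have := congrArg (fun L : K y →ₗ[ℂ] K y →ₗ[ℂ] ℂ => L (a y) (b y))
      (hQ ((1 : ℂ) : P1) (OnePoint.coe_ne_infty _) one_mem_Cstar y)
    rw [zCoord_coe, one_zpow, one_smul] at this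
    exact this
  -- The curvature vanishes for all `z ≠ 0`, hence so does each coefficient of its expansion; these
  -- are the axioms.
  have hfl : ∀ (t : M) (s : Π t, K t) (X Y : Π t : M, TangentSpace 𝓘(ℂ, E) t),
      HolSecAt 𝓘(ℂ, E) F s t → HolVFAt 𝓘(ℂ, E) X t → HolVFAt 𝓘(ℂ, E) Y t → _ :=
    fun t s X Y hs hX hY => eq_zero_of_forall_inv_smul fun z hz =>
      (h.curv_lift_lift hz hs hX hY).symm.trans (T.conn_flat ((z : P1), t) (by simpa using hz) _ _ _
        (hs.pullSec (x := ((z : P1), t))) (hX.liftVF (x := ((z : P1), t)))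
        (hY.liftVF (x := ((z : P1), t))))
  have hfe : ∀ (t : M) (s : Π t, K t) (X : Π t : M, TangentSpace 𝓘(ℂ, E) t),
      HolSecAt 𝓘(ℂ, E) F s t → HolVFAt 𝓘(ℂ, E) X t → _ :=
    fun t s X hs hX => eq_zero_of_forall_inv_smul fun z hz =>
      (h.curv_euler_lift hz hs hX).symm.trans (T.conn_flat ((z : P1), t) (by simpa using hz) _ _ _
        (hs.pullSec (x := ((z : P1), t))) (holVFAt_eulerVF E _)
        (hX.liftVF (x := ((z : P1), t))))
  have hgM : ∀ (t : M) (a b : Π t, K t) (v : TangentSpace 𝓘(ℂ, E) t), HolSecAt 𝓘(ℂ, E) F a t →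
      HolSecAt 𝓘(ℂ, E) F b t →
      (mvfderiv 𝓘(ℂ, E) (fun y => g y (a y) (b y)) t v - g t (N.toFun a t v) (b t)
          - g t (a t) (N.toFun b t v)) = 0 ∧ g t (C t v (a t)) (b t) = g t (a t) (C t v (b t)) := by
    intro t a b v ha hb
    have key := eq_zero_of_forall_inv_smul (W := ℂ)
      (a := mvfderiv 𝓘(ℂ, E) (fun y => g y (a y) (b y)) t v - g t (N.toFun a t v) (b t)
          - g t (a t) (N.toFun b t v)) (b := -(g t (C t v (a t)) (b t) - g t (a t) (C t v (b t))))
      (c := 0) fun z hz => by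
        have h1 := T.P_flat_M z (by simpa using hz) t _ _ v (ha.pullSec (x := ((z : P1), t)))
          (hb.pullSec (x := (neg z, t)))
        have h2 := h.flatDefect_pullSec hP hg hz ha hb 0 v
        rw [flatDefect, neg_zero, sub_sub, sub_eq_zero.2 h1] at h2
        have h3 := (mul_eq_zero.1 h2.symm).resolve_left (zpow_ne_zero w hz)
        refine Eq.trans ?_ h3
        simp only [N, smul_eq_mul, zero_div]
        ring
    exact ⟨key.1, sub_eq_zero.1 (neg_eq_zero.1 key.2.1)⟩
  -- The direction `z ∂_z` yields the conditions on the endomorphisms, after the direction along `M`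
  -- gave those on `N` and `C`.
  have hgE : ∀ (t : M) (a b : K t), w * g t a b - g t (R t a) b - g t a (R t b) = 0 ∧
      g t (U t a) b = g t a (U t b) := by
    intro t a₀ b₀
    obtain ⟨a, ha, rfl⟩ := exists_holSecAt_eq (I := 𝓘(ℂ, E)) (F := F) (V := K) t a₀
    obtain ⟨b, hb, rfl⟩ := exists_holSecAt_eq (I := 𝓘(ℂ, E)) (F := F) (V := K) t b₀
    have key := eq_zero_of_forall_inv_smul (W := ℂ)
      (a := w * g t (a t) (b t) - g t (R t (a t)) (b t) - g t (a t) (R t (b t)))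
      (b := -(g t (U t (a t)) (b t) - g t (a t) (U t (b t))))
      (c := 0) fun z hz => by
        have h1 := T.P_flat_z z (by simpa using hz) t _ _ (ha.pullSec (x := ((z : P1), t)))
          (hb.pullSec (x := (neg z, t)))
        have h2 := h.flatDefect_pullSec hP hg hz ha hb z 0
        rw [zCoord_neg, zCoord_coe] at h1
        rw [flatDefect, sub_sub, sub_eq_zero.2 h1] at h2
        have h3 := (mul_eq_zero.1 h2.symm).resolve_left (zpow_ne_zero w hz)
        rw [div_self hz] at h3
        refine Eq.trans ?_ h3
        simp only [map_zero, LinearMap.zero_apply, smul_eq_mul]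
        ring
    exact ⟨key.1, sub_eq_zero.1 (neg_eq_zero.1 key.2.1)⟩
  have hvf : ∀ (t : M) (v : TangentSpace 𝓘(ℂ, E) t), ∃ X : Π t : M, TangentSpace 𝓘(ℂ, E) t,
      HolVFAt 𝓘(ℂ, E) X t ∧ X t = v := fun t v =>
    exists_holSecAt_eq (I := 𝓘(ℂ, E)) (F := E) (V := TangentSpace 𝓘(ℂ, E)) t v
  have hV : ∀ (t : M) (s : Π t, K t), HolSecAt 𝓘(ℂ, E) F s t →
      HolSecAt 𝓘(ℂ, E) F (fun y => (((w : ℂ) / 2) • LinearMap.id - R y : K y →ₗ[ℂ] K y) (s y)) t :=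
    fun t s hs => (HolSecAt.const_smul _ hs).sub (h.R_hol t s hs)
  let Φ : FrobeniusTypeStructure 𝓘(ℂ, E) F K :=
    { conn := N
      conn_flat := fun t _ s X Y hs hX hY => (hfl t s X Y hs hX hY).1
      C := C
      C_hol := h.C_hol
      C_comm := fun t u v a => by
        obtain ⟨X, hX, rfl⟩ := hvf t u
        obtain ⟨Y, hY, rfl⟩ := hvf t v
        obtain ⟨s, hs, rfl⟩ := exists_holSecAt_eq (I := 𝓘(ℂ, E)) (F := F) (V := K) t a
        exact sub_eq_zero.1 (hfl t s X Y hs hX hY).2.2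
      conn_C := fun t s X Y hs hX hY => (hfl t s X Y hs hX hY).2.1
      U := U
      U_hol := h.U_hol
      C_U := fun t v a => by
        obtain ⟨X, hX, rfl⟩ := hvf t v
        obtain ⟨s, hs, rfl⟩ := exists_holSecAt_eq (I := 𝓘(ℂ, E)) (F := F) (V := K) t a
        exact (sub_eq_zero.1 (hfe t s X hs hX).2.2).symm
      V := fun t => ((w : ℂ) / 2) • LinearMap.id - R t
      V_hol := hV
      V_flat := fun t s v hs => by
        obtain ⟨X, hX, rfl⟩ := hvf t v
        have e0 := sub_eq_zero.1 (hfe t s X hs hX).1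
        have e1 := isCov_add N.isCov (HolSecAt.const_smul (-1) (h.R_hol t s hs)).diffSecAt
          (hV t s hs).diffSecAt (mem_univ t) (X t)
        have e2 := isCov_smul N.isCov (f := fun _ => (w : ℂ) / 2) mdifferentiableAt_const
          hs.diffSecAt (mem_univ t) (X t)
        have e3 := isCov_add N.isCov (h.R_hol t s hs).diffSecAt
          (hV t s hs).diffSecAt (mem_univ t) (X t)
        simp only [LinearMap.sub_apply, LinearMap.smul_apply, LinearMap.id_apply,
          add_sub_cancel] at e3
        rw [e2, mvfderiv_const] at e3
        simp only [LinearMap.sub_apply, LinearMap.smul_apply, LinearMap.id_apply]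
        rw [eq_sub_iff_add_eq, e0, add_comm, ← e3]
        simp
      conn_U := fun t s v hs => by
        obtain ⟨X, hX, rfl⟩ := hvf t v
        have e0 := (hfe t s X hs hX).2.1
        rw [← neg_eq_zero, ← e0]
        simp only [LinearMap.sub_apply, LinearMap.smul_apply, LinearMap.id_apply, map_sub, map_smul]
        abel
      g := g
      g_hol := hg
      g_symm := fun t a b => by
        obtain ⟨α, -, rfl⟩ := exists_holSecAt_eq (I := 𝓘(ℂ, E)) (F := F) (V := K) t a
        obtain ⟨β, -, rfl⟩ := exists_holSecAt_eq (I := 𝓘(ℂ, E)) (F := F) (V := K) t b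
        -- Symmetry of `P` compares `z = 1` with `z = -1`, where the pairing is `(-1)^w g`; the two
        -- signs cancel.
        have h1 := T.P_symm ((1 : ℂ) : P1) one_mem_Cstar t (pullSec E α) (pullSec E β)
        have h2 := hP (-1) t (β t) (α t) (neg_ne_zero.2 one_ne_zero)
        have h3 : g t (α t) (β t) = (-1 : ℂ) ^ w * ((-1) ^ w * g t (β t) (α t)) :=
          h1.trans (congrArg (fun x : ℂ => (-1 : ℂ) ^ w * x) h2)
        rw [h3, ← mul_assoc, ← mul_zpow]
        simp
      g_nondeg := fun t => by
        obtain ⟨Q, hQ, hQ', -⟩ := T.P_zero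
        have h1 := hQ ((1 : ℂ) : P1) (OnePoint.coe_ne_infty _) one_mem_Cstar t
        rw [zCoord_coe, one_zpow, one_smul] at h1
        have h2 := hQ' ((1 : ℂ) : P1) (OnePoint.coe_ne_infty _) t
        rw [← h1] at h2
        exact h2
      g_flat := fun t a b v ha hb => by
        have := (hgM t a b v ha hb).1
        rw [sub_sub] at this
        exact sub_eq_zero.1 this
      g_C := fun t v a b => by
        obtain ⟨α, hα, rfl⟩ := exists_holSecAt_eq (I := 𝓘(ℂ, E)) (F := F) (V := K) t a
        obtain ⟨β, hβ, rfl⟩ := exists_holSecAt_eq (I := 𝓘(ℂ, E)) (F := F) (V := K) t b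
        exact (hgM t α β v hα hβ).2
      g_U := fun t a b => (hgE t a b).2
      g_V := fun t a b => by
        have := (hgE t a b).1
        simp only [LinearMap.sub_apply, LinearMap.smul_apply, LinearMap.id_apply, map_sub, map_smul,
          smul_eq_mul]
        linear_combination this }
  refine ⟨Φ, isTwistedPullback_iff.2 ⟨?_, hP⟩⟩
  have hres : Φ.residue w = R := by
    funext t
    exact sub_sub_cancel _ _
  rw [hres]
  exact h

end Untwist

end HolBundle

namespace HolBundle

open RiemannSphere VectorField

/-! ### Transport of connections along isomorphisms -/

section Transport

variable {EB : Type*} [NormedAddCommGroup EB] [NormedSpace ℂ EB]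
  {HB : Type*} [TopologicalSpace HB] {I : ModelWithCorners ℂ EB HB}
  {B : Type*} [TopologicalSpace B] [ChartedSpace HB B] [IsManifold I ω B]
  {F : Type*} [NormedAddCommGroup F] [NormedSpace ℂ F]
  {V : B → Type*} [TopologicalSpace (TotalSpace F V)] [∀ x, AddCommGroup (V x)]
  [∀ x, Module ℂ (V x)] [∀ x, TopologicalSpace (V x)] [∀ x, IsTopologicalAddGroup (V x)]
  [∀ x, ContinuousSMul ℂ (V x)] [FiberBundle F V]
  {V' : B → Type*} [TopologicalSpace (TotalSpace F V')] [∀ x, AddCommGroup (V' x)]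
  [∀ x, Module ℂ (V' x)] [∀ x, TopologicalSpace (V' x)] [∀ x, IsTopologicalAddGroup (V' x)]
  [∀ x, ContinuousSMul ℂ (V' x)] [FiberBundle F V']
  {V'' : B → Type*} [TopologicalSpace (TotalSpace F V'')] [∀ x, AddCommGroup (V'' x)]
  [∀ x, Module ℂ (V'' x)] [∀ x, TopologicalSpace (V'' x)] [FiberBundle F V'']

/-- The composition of isomorphisms. -/
def HolIso.trans (φ : HolIso I F V V') (ψ : HolIso I F V' V'') : HolIso I F V V'' where
  toEquiv x := (φ.toEquiv x).trans (ψ.toEquiv x)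
  holSec_iff σ x := (φ.holSec_iff σ x).trans (ψ.holSec_iff _ x)

variable [FiniteDimensional ℂ EB] [FiniteDimensional ℂ F] [VectorBundle ℂ F V]
  [ContMDiffVectorBundle ω F V I] [VectorBundle ℂ F V'] [ContMDiffVectorBundle ω F V' I]
  {S : Set B}

/-- The transport of a connection along an isomorphism of bundles. -/
noncomputable def HolConnection.transport (D : HolConnection I F V S) (χ : HolIso I F V V') :
    HolConnection I F V' S where
  toFun σ x :=
    haveI : FiniteDimensional ℂ (TangentSpace I x) := inferInstanceAs (FiniteDimensional ℂ EB)
    haveI : T2Space (TangentSpace I x) := inferInstanceAs (T2Space EB)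
    LinearMap.toContinuousLinearMap ((χ.toEquiv x).toLinearMap ∘ₗ
      (D.toFun (fun y => (χ.toEquiv y).symm (σ y)) x : TangentSpace I x →ₗ[ℂ] V x))
  isCov :=
    { add := fun {σ σ' x} hσ hσ' hx => by
        ext v
        have h := isCov_add D.isCov (χ.symm.diffSecAt hσ) (χ.symm.diffSecAt hσ') hx v
        have h' : (fun y => (χ.toEquiv y).symm ((σ + σ') y))
          = fun y => χ.symm.toEquiv y (σ y) + χ.symm.toEquiv y (σ' y) := by
            funext y; exact map_add (χ.toEquiv y).symm _ _
        change χ.toEquiv x (D.toFun (fun y => (χ.toEquiv y).symm ((σ + σ') y)) x v) = _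
        rw [h', h]
        exact map_add _ _ _
      leibniz := fun {σ f x} hσ hf hx => by
        ext v
        have h := isCov_smul D.isCov hf (χ.symm.diffSecAt hσ) hx v
        have h' : (fun y => (χ.toEquiv y).symm ((f • σ) y))
          = fun y => f y • χ.symm.toEquiv y (σ y) := by
            funext y; exact map_smul (χ.toEquiv y).symm _ _
        change χ.toEquiv x (D.toFun (fun y => (χ.toEquiv y).symm ((f • σ) y)) x v) = _
        rw [h', h, map_add, map_smul, map_smul]
        exact congrArg (fun a => _ + _ • a) ((χ.toEquiv x).apply_symm_apply _) }
  hol x hx σ X hσ hX := (χ.holSec_iff _ x).1 (D.hol x hx _ X ((χ.symm.holSec_iff σ x).1 hσ) hX)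
  eq_zero σ x h := by
    have : D.toFun (fun y => (χ.toEquiv y).symm (σ y)) x = 0 := by
      refine D.eq_zero _ _ fun h' => h ⟨h'.1, ?_⟩
      have := χ.diffSecAt h'.2
      simp only [LinearEquiv.apply_symm_apply] at this
      exact this
    ext v
    change χ.toEquiv x (D.toFun (fun y => (χ.toEquiv y).symm (σ y)) x v) = 0
    rw [this]
    exact map_zero _

theorem HolConnection.transport_apply (D : HolConnection I F V S) (χ : HolIso I F V V')
    (σ : Π x, V' x) (x : B) (v : TangentSpace I x) :
    (D.transport χ).toFun σ x v = χ.toEquiv x (D.toFun (fun y => (χ.toEquiv y).symm (σ y)) x v) :=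
  rfl

theorem HolConnection.IsFlat.transport {D : HolConnection I F V S} (h : D.IsFlat)
    (χ : HolIso I F V V') : (D.transport χ).IsFlat := by
  intro x hx σ X Y hσ hX hY
  have := h x hx _ X Y ((χ.symm.holSec_iff σ x).1 hσ) hX hY
  simp only [transport_apply, LinearEquiv.symm_apply_apply]
  rw [← map_sub, ← map_sub]
  exact (congrArg (χ.toEquiv x) this).trans (map_zero _)

end Transport

/-! ### Transport of `(trTLEP(w))`-structures and uniqueness of extensions -/

section TransportTwistor

variable {E : Type*} [NormedAddCommGroup E] [NormedSpace ℂ E] [FiniteDimensional ℂ E]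
  {M : Type*} [TopologicalSpace M] [ChartedSpace E M] [IsManifold 𝓘(ℂ, E) ω M]
  {F : Type*} [NormedAddCommGroup F] [NormedSpace ℂ F] [FiniteDimensional ℂ F]
  {H : P1 × M → Type*} [TopologicalSpace (TotalSpace F H)] [∀ x, AddCommGroup (H x)]
  [∀ x, Module ℂ (H x)] [∀ x, TopologicalSpace (H x)] [∀ x, IsTopologicalAddGroup (H x)]
  [∀ x, ContinuousSMul ℂ (H x)] [FiberBundle F H] [VectorBundle ℂ F H]
  [ContMDiffVectorBundle ω F H (𝓘(ℂ, ℂ).prod 𝓘(ℂ, E))]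
  {H' : P1 × M → Type*} [TopologicalSpace (TotalSpace F H')] [∀ x, AddCommGroup (H' x)]
  [∀ x, Module ℂ (H' x)] [∀ x, TopologicalSpace (H' x)] [∀ x, IsTopologicalAddGroup (H' x)]
  [∀ x, ContinuousSMul ℂ (H' x)] [FiberBundle F H'] [VectorBundle ℂ F H']
  [ContMDiffVectorBundle ω F H' (𝓘(ℂ, ℂ).prod 𝓘(ℂ, E))]
  {w : ℤ}

theorem ExtendsTo.map (χ : HolIso (𝓘(ℂ, ℂ).prod 𝓘(ℂ, E)) F H H') {σ : Π x, H x} {x : P1 × M}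
    {a : H x} (h : ExtendsTo E F σ x a) :
    ExtendsTo E F (fun y => χ.toEquiv y (σ y)) x (χ.toEquiv x a) := by
  obtain ⟨τ, h1, h2, h3⟩ := h
  exact ⟨fun y => χ.toEquiv y (τ y), (χ.holSec_iff τ x).1 h1,
    h2.mono fun y hy hy' => congrArg (χ.toEquiv y) (hy hy'), congrArg (χ.toEquiv x) h3⟩

theorem ExtendsTo.congr {σ σ' : Π x, H x} {x : P1 × M} {a : H x} (h : ExtendsTo E F σ x a)
    (h' : ∀ y, y.1 ∈ Cstar → σ' y = σ y) : ExtendsTo E F σ' x a := by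
  obtain ⟨τ, h1, h2, h3⟩ := h
  exact ⟨τ, h1, h2.mono fun y hy hy' => (hy hy').trans (h' y hy').symm, h3⟩

/-- Density of `ℂ^* × M`, which makes the residual data at `0` and `∞` unambiguous. -/
theorem frequently_fst_mem_Cstar (x : P1 × M) : ∃ᶠ y in 𝓝 x, y.1 ∈ Cstar := by
  obtain ⟨p, t⟩ := x
  have h : ∃ᶠ q in 𝓝 p, q ∈ Cstar := by
    have h2 : Dense (Cstar : Set P1) := by
      have : Cstar = {((0 : ℂ) : P1)}ᶜ ∩ {OnePoint.infty}ᶜ := by ext p; simp [Cstar]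
      rw [this]
      exact (dense_compl_singleton _).inter_of_isOpen_left (dense_compl_singleton _)
        isOpen_compl_singleton
    exact mem_closure_iff_frequently.1 (h2 p)
  exact (Continuous.tendsto (by fun_prop : Continuous fun q : P1 => (q, t)) p).frequently h

/-- The value of the extension of a section over `ℂ^* × M` is unique. -/
theorem ExtendsTo.unique {σ : Π x, H x} {x : P1 × M} {a b : H x} (ha : ExtendsTo E F σ x a)
    (hb : ExtendsTo E F σ x b) : a = b := by
  obtain ⟨τ, h1, h2, rfl⟩ := ha
  obtain ⟨τ', h1', h2', rfl⟩ := hb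
  have c := ((contMDiffAt_section x).1 h1).continuousAt.tendsto
  have c' := ((contMDiffAt_section x).1 h1').continuousAt.tendsto
  have key := tendsto_nhds_unique_of_frequently_eq c c'
    (((frequently_fst_mem_Cstar x).and_eventually (h2.and h2')).mono fun y hy => by
      rw [hy.2.1 hy.1, hy.2.2 hy.1])
  exact ((trivializationAt F H x).linearEquivAt ℂ x
    (mem_baseSet_trivializationAt F H x)).injective key

theorem nondegenerate_compl₁₂ {W W₁ W' W₁' : Type*} [AddCommGroup W] [Module ℂ W] [AddCommGroup W₁]
    [Module ℂ W₁] [AddCommGroup W'] [Module ℂ W'] [AddCommGroup W₁'] [Module ℂ W₁']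
    {Q : W →ₗ[ℂ] W₁ →ₗ[ℂ] ℂ} (h : Q.Nondegenerate) (e : W' ≃ₗ[ℂ] W) (e₁ : W₁' ≃ₗ[ℂ] W₁) :
    (Q.compl₁₂ e.toLinearMap e₁.toLinearMap).Nondegenerate := by
  refine ⟨fun a ha => ?_, fun b hb => ?_⟩
  · refine e.map_eq_zero_iff.1 (h.1 _ fun b => ?_)
    simpa using ha (e₁.symm b)
  · refine e₁.map_eq_zero_iff.1 (h.2 _ fun a => ?_)
    simpa using hb (e.symm a)

theorem PairingExtends.map {P : Π (p : P1) (t : M), H (p, t) →ₗ[ℂ] H (neg p, t) →ₗ[ℂ] ℂ}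
    {D : Set P1} {f : P1 → ℂ} {k : ℤ} (h : PairingExtends E F P D f k)
    (χ : HolIso (𝓘(ℂ, ℂ).prod 𝓘(ℂ, E)) F H H') :
    PairingExtends E F (fun p t => (P p t).compl₁₂ (χ.toEquiv (p, t)).symm.toLinearMap
      (χ.toEquiv (neg p, t)).symm.toLinearMap) D f k := by
  obtain ⟨Q, h1, h2, h3⟩ := h
  refine ⟨fun p t => (Q p t).compl₁₂ (χ.toEquiv (p, t)).symm.toLinearMap
      (χ.toEquiv (neg p, t)).symm.toLinearMap, fun p hp hp' t => ?_,
    fun p hp t => nondegenerate_compl₁₂ (h2 p hp t) _ _, fun p hp t a b ha hb =>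
      h3 p hp t _ _ ((χ.symm.holSec_iff a _).1 ha) ((χ.symm.holSec_iff b _).1 hb)⟩
  ext a b
  simp [h1 p hp hp' t]

/-- The transport of a `(trTLEP(w))`-structure along an isomorphism of bundles. -/
noncomputable def TrTLEPStructure.transport (T : TrTLEPStructure E F w H)
    (χ : HolIso (𝓘(ℂ, ℂ).prod 𝓘(ℂ, E)) F H H') : TrTLEPStructure E F w H' where
  trivial_fibers t := (T.trivial_fibers t).map fun ι => (χ.symm.pullback (inclP1 E t)).trans ι
  conn := T.conn.transport χ
  conn_flat := T.conn_flat.transport χ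
  pole_zero_M t σ X hσ hX := by
    obtain ⟨a, ha⟩ := T.pole_zero_M t _ X ((χ.symm.holSec_iff σ _).1 hσ) hX
    exact ⟨_, (ha.map χ).congr fun y _ => (map_smul (χ.toEquiv y) _ _).symm⟩
  pole_zero_z t σ hσ := by
    obtain ⟨a, ha⟩ := T.pole_zero_z t _ ((χ.symm.holSec_iff σ _).1 hσ)
    exact ⟨_, (ha.map χ).congr fun y _ => (map_smul (χ.toEquiv y) _ _).symm⟩
  pole_infty_M t σ X hσ hX := by
    obtain ⟨a, ha⟩ := T.pole_infty_M t _ X ((χ.symm.holSec_iff σ _).1 hσ) hX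
    exact ⟨_, ha.map χ⟩
  pole_infty_z t σ hσ := by
    obtain ⟨a, ha⟩ := T.pole_infty_z t _ ((χ.symm.holSec_iff σ _).1 hσ)
    exact ⟨_, ha.map χ⟩
  P p t := (T.P p t).compl₁₂ (χ.toEquiv (p, t)).symm.toLinearMap
    (χ.toEquiv (neg p, t)).symm.toLinearMap
  P_eq_zero p hp t := by
    ext a b
    simp [T.P_eq_zero p hp t]
  P_symm p hp t a b := T.P_symm p hp t (fun y => (χ.toEquiv y).symm (a y))
    (fun y => (χ.toEquiv y).symm (b y))
  P_flat_M p hp t a b v ha hb := by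
    have := T.P_flat_M p hp t _ _ v ((χ.symm.holSec_iff a _).1 ha) ((χ.symm.holSec_iff b _).1 hb)
    simp only [HolConnection.transport_apply, LinearMap.compl₁₂_apply, LinearEquiv.coe_coe,
      LinearEquiv.symm_apply_apply]
    exact this
  P_flat_z p hp t a b ha hb := by
    have := T.P_flat_z p hp t _ _ ((χ.symm.holSec_iff a _).1 ha) ((χ.symm.holSec_iff b _).1 hb)
    simp only [HolConnection.transport_apply, LinearMap.compl₁₂_apply, LinearEquiv.coe_coe,
      LinearEquiv.symm_apply_apply]
    exact this
  P_zero := T.P_zero.map χ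
  P_infty := T.P_infty.map χ

theorem TrTLEPStructure.transport_conn_apply (T : TrTLEPStructure E F w H)
    (χ : HolIso (𝓘(ℂ, ℂ).prod 𝓘(ℂ, E)) F H H') (σ : Π x, H x) (x : P1 × M)
    (v : TangentSpace (𝓘(ℂ, ℂ).prod 𝓘(ℂ, E)) x) :
    (χ.toEquiv x).symm ((T.transport χ).conn.toFun (fun y => χ.toEquiv y (σ y)) x v)
      = T.conn.toFun σ x v := by
  refine (congrArg (χ.toEquiv x).symm (T.conn.transport_apply χ _ x v)).trans ?_
  simp only [LinearEquiv.symm_apply_apply]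

theorem TrTLEPStructure.isIso_transport (T : TrTLEPStructure E F w H)
    (χ : HolIso (𝓘(ℂ, ℂ).prod 𝓘(ℂ, E)) F H H') : T.IsIso (T.transport χ) χ where
  conn x σ v _ _ := by
    exact ((LinearEquiv.symm_apply_eq _).1 (T.transport_conn_apply χ σ x v)).symm
  P p _ t a b := by
    simp [TrTLEPStructure.transport]

end TransportTwistor

end HolBundle

namespace HolBundle

open RiemannSphere VectorField

section Ext

variable {EB : Type*} [NormedAddCommGroup EB] [NormedSpace ℂ EB]
  {HB : Type*} [TopologicalSpace HB] {I : ModelWithCorners ℂ EB HB}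
  {B : Type*} [TopologicalSpace B] [ChartedSpace HB B] [IsManifold I 1 B]
  {F : Type*} [NormedAddCommGroup F] [NormedSpace ℂ F]
  {V : B → Type*} [TopologicalSpace (TotalSpace F V)] [∀ x, AddCommGroup (V x)]
  [∀ x, Module ℂ (V x)] [∀ x, TopologicalSpace (V x)] [∀ x, IsTopologicalAddGroup (V x)]
  [∀ x, ContinuousSMul ℂ (V x)] [FiberBundle F V]

theorem FrobeniusTypeStructure.ext' {Φ Φ' : FrobeniusTypeStructure I F V} (h1 : Φ.conn = Φ'.conn)
    (h2 : Φ.C = Φ'.C) (h3 : Φ.U = Φ'.U) (h4 : Φ.V = Φ'.V) (h5 : Φ.g = Φ'.g) : Φ = Φ' := by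
  cases Φ
  cases Φ'
  cases h1
  cases h2
  cases h3
  cases h4
  cases h5
  rfl

end Ext

/-! ### Residual data: uniqueness and computation -/

section Residues

variable {E : Type*} [NormedAddCommGroup E] [NormedSpace ℂ E] [FiniteDimensional ℂ E]
  {M : Type*} [TopologicalSpace M] [ChartedSpace E M] [IsManifold 𝓘(ℂ, E) ω M]
  {F : Type*} [NormedAddCommGroup F] [NormedSpace ℂ F] [FiniteDimensional ℂ F]
  {H : P1 × M → Type*} [TopologicalSpace (TotalSpace F H)] [∀ x, AddCommGroup (H x)]
  [∀ x, Module ℂ (H x)] [∀ x, TopologicalSpace (H x)] [∀ x, IsTopologicalAddGroup (H x)]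
  [∀ x, ContinuousSMul ℂ (H x)] [FiberBundle F H] [VectorBundle ℂ F H]
  [ContMDiffVectorBundle ω F H (𝓘(ℂ, ℂ).prod 𝓘(ℂ, E))]
  {w : ℤ}

theorem exists_holVFAt_eq (t : M) (v : TangentSpace 𝓘(ℂ, E) t) :
    ∃ X : Π t : M, TangentSpace 𝓘(ℂ, E) t, HolVFAt 𝓘(ℂ, E) X t ∧ X t = v :=
  exists_holSecAt_eq (I := 𝓘(ℂ, E)) (F := E) (V := TangentSpace 𝓘(ℂ, E)) t v

/-- The value at `x` of a holomorphic function given on `ℂ^* × M` is unique. -/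
theorem HolFunAt.eq_of_eventually_Cstar {f g : P1 × M → ℂ} {x : P1 × M}
    (hf : HolFunAt (𝓘(ℂ, ℂ).prod 𝓘(ℂ, E)) f x) (hg : HolFunAt (𝓘(ℂ, ℂ).prod 𝓘(ℂ, E)) g x)
    (h : ∀ᶠ y in 𝓝 x, y.1 ∈ Cstar → f y = g y) : f x = g x :=
  tendsto_nhds_unique_of_frequently_eq (ContMDiffAt.continuousAt hf).tendsto
    (ContMDiffAt.continuousAt hg).tendsto
    (((frequently_fst_mem_Cstar x).and_eventually h).mono fun _ hy => hy.2 hy.1)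

namespace TrTLEPStructure

/-- Every component is the value at `0` or `∞` of a holomorphic extension from `ℂ^* × M`, and such
values are unique. Local holomorphic sections through any vector exist. -/
theorem Induces.unique {T : TrTLEPStructure E F w H}
    {Φ Φ' : FrobeniusTypeStructure 𝓘(ℂ, E) F (inclM E M ((0 : ℂ) : P1) *ᵖ H)}
    (h : T.Induces Φ) (h' : T.Induces Φ') : Φ = Φ' := by
  have lift : ∀ (t : M) (a : H (((0 : ℂ) : P1), t)), ∃ σ : Π x, H x,
      HolSecAt (𝓘(ℂ, ℂ).prod 𝓘(ℂ, E)) F σ (((0 : ℂ) : P1), t) ∧ σ (((0 : ℂ) : P1), t) = a :=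
    fun t a => exists_holSecAt_eq (I := 𝓘(ℂ, ℂ).prod 𝓘(ℂ, E)) (F := F) (V := H) _ a
  refine FrobeniusTypeStructure.ext' ?_ ?_ ?_ ?_ ?_
  · refine HolConnection.ext_of_holSecAt isOpen_univ fun t _ s hs => ?_
    ext v
    obtain ⟨X, hX, rfl⟩ := exists_holVFAt_eq (E := E) t v
    -- For the connection a whole germ of section must be lifted to `H` at `∞`, not just a vector.
    -- This is where holomorphy of `ψ` in the parameter is needed.
    have hσ := holSecAt_fiberIso_symm T.trivial_fibers hs OnePoint.infty
    have key := (h.conn t _ X hσ hX).unique (h'.conn t _ X hσ hX)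
    have hs' : (fun t' : M => T.psi ((OnePoint.infty : P1), t')
        ((fiberIso T.trivial_fibers ((OnePoint.infty : P1), t')).symm (s t'))) = s := by
      funext t'
      exact (T.psi ((OnePoint.infty : P1), t')).apply_symm_apply _
    rw [hs'] at key
    exact (T.psi ((OnePoint.infty : P1), t)).symm.injective key
  · funext t
    ext v a
    obtain ⟨X, hX, rfl⟩ := exists_holVFAt_eq (E := E) t v
    obtain ⟨σ, hσ, rfl⟩ := lift t a
    exact (h.C t σ X hσ hX).unique (h'.C t σ X hσ hX)
  · funext t
    ext a
    obtain ⟨σ, hσ, rfl⟩ := lift t a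
    exact (h.U t σ hσ).unique (h'.U t σ hσ)
  · funext t
    ext a
    obtain ⟨σ, hσ, h1⟩ := exists_holSecAt_eq (I := 𝓘(ℂ, ℂ).prod 𝓘(ℂ, E)) (F := F) (V := H)
      ((OnePoint.infty : P1), t) ((T.psi ((OnePoint.infty : P1), t)).symm a)
    have key := sub_left_injective ((h.V t σ hσ).unique (h'.V t σ hσ))
    have key' := (T.psi ((OnePoint.infty : P1), t)).symm.injective key
    rw [h1] at key'
    have h2 : T.psi ((OnePoint.infty : P1), t) ((T.psi ((OnePoint.infty : P1), t)).symm a) = a :=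
      LinearEquiv.apply_symm_apply _ _
    exact (congrArg (Φ.V t) h2).symm.trans (key'.trans (congrArg (Φ'.V t) h2))
  · funext t
    ext a b
    obtain ⟨σ, hσ, rfl⟩ := lift t a
    obtain ⟨τ, hτ, rfl⟩ := lift t b
    obtain ⟨f, f1, f2, f3⟩ := h.g t σ τ hσ hτ
    obtain ⟨f', f1', f2', f3'⟩ := h'.g t σ τ hσ hτ
    refine f3.symm.trans (Eq.trans ?_ f3')
    refine f1.eq_of_eventually_Cstar f1' ?_
    filter_upwards [f2, f2'] with y h1 h2 hy
    rw [h1 hy, h2 hy]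

end TrTLEPStructure

variable {K : M → Type*} [TopologicalSpace (TotalSpace F K)]
  [∀ t, AddCommGroup (K t)] [∀ t, Module ℂ (K t)] [∀ t, TopologicalSpace (K t)]
  [∀ t, IsTopologicalAddGroup (K t)] [∀ t, ContinuousSMul ℂ (K t)]
  [FiberBundle F K] [VectorBundle ℂ F K] [ContMDiffVectorBundle ω F K 𝓘(ℂ, E)]
  {T : TrTLEPStructure E F w H} {Φ : FrobeniusTypeStructure 𝓘(ℂ, E) F K}
  {χ : HolIso (𝓘(ℂ, ℂ).prod 𝓘(ℂ, E)) F H (projM E M *ᵖ K)}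

namespace IsTwistedPullback

/-- The residual data are known on `π^*K` and are carried back by the inverse of `χ`; the same holds
for the four statements that follow. -/
theorem extendsTo_C (h : IsTwistedPullback Φ (T.transport χ)) {t : M} {σ : Π x, H x}
    {X : Π t : M, TangentSpace 𝓘(ℂ, E) t}
    (hσ : HolSecAt (𝓘(ℂ, ℂ).prod 𝓘(ℂ, E)) F σ (((0 : ℂ) : P1), t)) (hX : HolVFAt 𝓘(ℂ, E) X t) :
    ExtendsTo E F (fun y => zCoord y.1 • T.conn.toFun σ y (tvec y 0 (X y.2))) (((0 : ℂ) : P1), t)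
      ((χ.toEquiv (((0 : ℂ) : P1), t)).symm
        (Φ.C t (X t) (χ.toEquiv (((0 : ℂ) : P1), t) (σ (((0 : ℂ) : P1), t))))) := by
  have key := ((isTwistedPullback_iff.1 h).1.extendsTo_zero_lift ((χ.holSec_iff σ _).1 hσ) hX).map
    χ.symm
  exact key.congr fun y _ => Eq.symm (((χ.toEquiv y).symm.map_smul _ _).trans
    (congrArg (fun a : H y => zCoord y.1 • a) (T.transport_conn_apply χ σ y _)))

theorem extendsTo_U (h : IsTwistedPullback Φ (T.transport χ)) {t : M} {σ : Π x, H x}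
    (hσ : HolSecAt (𝓘(ℂ, ℂ).prod 𝓘(ℂ, E)) F σ (((0 : ℂ) : P1), t)) :
    ExtendsTo E F (fun y => zCoord y.1 ^ 2 • T.conn.toFun σ y (tvec y 1 0)) (((0 : ℂ) : P1), t)
      ((χ.toEquiv (((0 : ℂ) : P1), t)).symm
        (Φ.U t (χ.toEquiv (((0 : ℂ) : P1), t) (σ (((0 : ℂ) : P1), t))))) := by
  have key := ((isTwistedPullback_iff.1 h).1.extendsTo_zero_euler ((χ.holSec_iff σ _).1 hσ)).map
    χ.symm
  refine key.congr fun y _ => Eq.symm (((χ.toEquiv y).symm.map_smul _ _).trans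
    ((congrArg (fun a : H y => zCoord y.1 • a) (T.transport_conn_apply χ σ y _)).trans ?_))
  -- The formula for `U` uses `z² ∂_z`, while the pole condition uses `z · z ∂_z`.
  have h1 : tvec y (zCoord y.1) 0 = zCoord y.1 • tvec y 1 0 :=
    Prod.ext (x := ((zCoord y.1, 0) : ℂ × E)) (y := zCoord y.1 • ((1, 0) : ℂ × E))
      (mul_one _).symm (smul_zero _).symm
  rw [h1, map_smul, smul_smul, pow_two]

theorem extendsTo_conn (h : IsTwistedPullback Φ (T.transport χ)) {t : M} {σ : Π x, H x}
    {X : Π t : M, TangentSpace 𝓘(ℂ, E) t}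
    (hσ : HolSecAt (𝓘(ℂ, ℂ).prod 𝓘(ℂ, E)) F σ ((OnePoint.infty : P1), t))
    (hX : HolVFAt 𝓘(ℂ, E) X t) :
    ExtendsTo E F (fun y => T.conn.toFun σ y (tvec y 0 (X y.2))) ((OnePoint.infty : P1), t)
      ((χ.toEquiv ((OnePoint.infty : P1), t)).symm
        (Φ.conn.toFun (fun t' => χ.toEquiv ((OnePoint.infty : P1), t')
          (σ ((OnePoint.infty : P1), t'))) t (X t))) :=
  (((isTwistedPullback_iff.1 h).1.extendsTo_infty_lift ((χ.holSec_iff σ _).1 hσ) hX).map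
    χ.symm).congr fun y _ => (T.transport_conn_apply χ σ y _).symm

theorem extendsTo_V (h : IsTwistedPullback Φ (T.transport χ)) {t : M} {σ : Π x, H x}
    (hσ : HolSecAt (𝓘(ℂ, ℂ).prod 𝓘(ℂ, E)) F σ ((OnePoint.infty : P1), t)) :
    ExtendsTo E F (fun y => - T.conn.toFun σ y (tvec y (zCoord y.1) 0))
      ((OnePoint.infty : P1), t) ((χ.toEquiv ((OnePoint.infty : P1), t)).symm
        (Φ.V t (χ.toEquiv ((OnePoint.infty : P1), t) (σ ((OnePoint.infty : P1), t))))
          - ((w : ℂ) / 2) • σ ((OnePoint.infty : P1), t)) := by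
  obtain ⟨τ, h1, h2, h3⟩ :=
    ((isTwistedPullback_iff.1 h).1.extendsTo_infty_euler ((χ.holSec_iff σ _).1 hσ)).map χ.symm
  refine ⟨fun y => - τ y, h1.neg, h2.mono fun y hy hy' => ?_, ?_⟩
  · exact congrArg (fun a : H y => -a) ((hy hy').trans (T.transport_conn_apply χ σ y _))
  · refine (congrArg (fun a : H ((OnePoint.infty : P1), t) => -a) h3).trans ?_
    have alg : ∀ L : K t →ₗ[ℂ] K t, ∀ e : H ((OnePoint.infty : P1), t) ≃ₗ[ℂ] K t,
        ∀ a : H ((OnePoint.infty : P1), t),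
        - e.symm (((w : ℂ) / 2) • e a - L (e a)) = e.symm (L (e a)) - ((w : ℂ) / 2) • a := by
      intro L e a
      simp
    exact alg (Φ.V t) (χ.toEquiv ((OnePoint.infty : P1), t)) _

theorem exists_holFunAt_g (h : IsTwistedPullback Φ (T.transport χ)) {t : M} {a b : Π x, H x}
    (ha : HolSecAt (𝓘(ℂ, ℂ).prod 𝓘(ℂ, E)) F a (((0 : ℂ) : P1), t))
    (hb : HolSecAt (𝓘(ℂ, ℂ).prod 𝓘(ℂ, E)) F b (((0 : ℂ) : P1), t)) :
    ∃ f : P1 × M → ℂ, HolFunAt (𝓘(ℂ, ℂ).prod 𝓘(ℂ, E)) f (((0 : ℂ) : P1), t) ∧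
      (∀ᶠ y in 𝓝 (((0 : ℂ) : P1), t), y.1 ∈ Cstar →
        f y = zCoord y.1 ^ (-w) * pairFun T.P a b y) ∧
      f (((0 : ℂ) : P1), t) = Φ.g t (χ.toEquiv (((0 : ℂ) : P1), t) (a (((0 : ℂ) : P1), t)))
        (χ.toEquiv (((0 : ℂ) : P1), t) (b (((0 : ℂ) : P1), t))) := by
  have h0 : neg ((0 : ℂ) : P1) = ((0 : ℂ) : P1) := congrArg ((↑) : ℂ → P1) neg_zero
  have hb' : HolSecAt (𝓘(ℂ, ℂ).prod 𝓘(ℂ, E)) F b (neg ((0 : ℂ) : P1), t) := by rwa [h0]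
  refine ⟨_, holFunAt_pairFun_pullPair Φ.g_hol ((χ.holSec_iff a _).1 ha)
    ((χ.holSec_iff b _).1 hb'), Eventually.of_forall fun y hy => ?_, ?_⟩
  · have key := pairFun_eq_zpow_mul (isTwistedPullback_iff.1 h).2 (fun y => χ.toEquiv y (a y))
      (fun y => χ.toEquiv y (b y)) hy
    have h1 : pairFun T.P a b y = pairFun (T.transport χ).P (fun y => χ.toEquiv y (a y))
        (fun y => χ.toEquiv y (b y)) y := (T.isIso_transport χ).P y.1 hy y.2 _ _
    rw [h1, key, ← mul_assoc, ← zpow_add₀ (zCoord_ne_zero hy), neg_add_cancel, zpow_zero, one_mul]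
  · have : ∀ q : P1, q = ((0 : ℂ) : P1) →
        Φ.g t (χ.toEquiv (((0 : ℂ) : P1), t) (a (((0 : ℂ) : P1), t))) (χ.toEquiv (q, t) (b (q, t)))
        = Φ.g t (χ.toEquiv (((0 : ℂ) : P1), t) (a (((0 : ℂ) : P1), t)))
          (χ.toEquiv (((0 : ℂ) : P1), t) (b (((0 : ℂ) : P1), t))) := by
      rintro _ rfl
      rfl
    exact this _ h0

end IsTwistedPullback

end Residues

end HolBundle

namespace HolBundle

open RiemannSphere VectorField

/-! ### Part (b) for an arbitrary bundle -/

section Restriction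

variable {E : Type*} [NormedAddCommGroup E] [NormedSpace ℂ E] [FiniteDimensional ℂ E]
  {M : Type*} [TopologicalSpace M] [ChartedSpace E M] [IsManifold 𝓘(ℂ, E) ω M]
  {F : Type*} [NormedAddCommGroup F] [NormedSpace ℂ F] [FiniteDimensional ℂ F]
  {H : P1 × M → Type*} [TopologicalSpace (TotalSpace F H)] [∀ x, AddCommGroup (H x)]
  [∀ x, Module ℂ (H x)] [∀ x, TopologicalSpace (H x)] [∀ x, IsTopologicalAddGroup (H x)]
  [∀ x, ContinuousSMul ℂ (H x)] [FiberBundle F H] [VectorBundle ℂ F H]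
  [ContMDiffVectorBundle ω F H (𝓘(ℂ, ℂ).prod 𝓘(ℂ, E))]
  {w : ℤ} (T : TrTLEPStructure E F w H)

namespace TrTLEPStructure

/-- The isomorphism `ψ : H → π^*(H|_{0 × M})`. -/
noncomputable abbrev psiIso : HolIso (𝓘(ℂ, ℂ).prod 𝓘(ℂ, E)) F H
    (projM E M *ᵖ (inclM E M ((0 : ℂ) : P1) *ᵖ H)) :=
  fiberHolIso T.trivial_fibers

variable {T} in
-- Over `0` the map `ψ` is the identity, so `C`, `U` and `g` carry over unchanged. Over `∞` it is
-- exactly the shift in the definition of `∇^r` and `V`.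
theorem induces_of_isTwistedPullback
    {Φ : FrobeniusTypeStructure 𝓘(ℂ, E) F (inclM E M ((0 : ℂ) : P1) *ᵖ H)}
    (h : IsTwistedPullback Φ (T.transport T.psiIso)) : T.Induces Φ := by
  have h0 : ∀ (t : M) (a : H (((0 : ℂ) : P1), t)), T.psiIso.toEquiv (((0 : ℂ) : P1), t) a = a :=
    fun t a => fiberIso_zero T.trivial_fibers t a
  have h0' : ∀ (t : M) (a : H (((0 : ℂ) : P1), t)),
      (T.psiIso.toEquiv (((0 : ℂ) : P1), t)).symm a = a :=
    fun t a => (LinearEquiv.symm_apply_eq _).2 (h0 t a).symm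
  refine ⟨fun t σ X hσ hX => ?_, fun t σ hσ => ?_, fun t a b ha hb => ?_,
    fun t σ X hσ hX => h.extendsTo_conn hσ hX, fun t σ hσ => h.extendsTo_V hσ⟩
  · have key := h.extendsTo_C hσ hX
    rw [h0] at key
    exact Eq.mp (congrArg _ (h0' t _)) key
  · have key := h.extendsTo_U hσ
    rw [h0] at key
    exact Eq.mp (congrArg _ (h0' t _)) key
  · have key := h.exists_holFunAt_g ha hb
    rw [h0, h0] at key
    exact key

theorem existsUnique_induces :
    ∃! Φ : FrobeniusTypeStructure 𝓘(ℂ, E) F (inclM E M ((0 : ℂ) : P1) *ᵖ H), T.Induces Φ := by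
  obtain ⟨Φ, h⟩ := (T.transport T.psiIso).exists_isTwistedPullback
  exact ⟨Φ, induces_of_isTwistedPullback h, fun Φ' h' =>
    h'.unique (induces_of_isTwistedPullback h)⟩

variable {T} in
-- By uniqueness in (b), `Φ` is the structure from which the transport of `T` along `ψ` arises. By
-- uniqueness in (a), `T'` is that transport.
theorem Induces.isIso {Φ : FrobeniusTypeStructure 𝓘(ℂ, E) F (inclM E M ((0 : ℂ) : P1) *ᵖ H)}
    {T' : TrTLEPStructure E F w (projM E M *ᵖ (inclM E M ((0 : ℂ) : P1) *ᵖ H))}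
    (h : T.Induces Φ) (h' : IsTwistedPullback Φ T') : T.IsIso T' T.psiIso := by
  obtain ⟨Φ₁, h₁⟩ := (T.transport T.psiIso).exists_isTwistedPullback
  obtain rfl := (induces_of_isTwistedPullback h₁).unique h
  rw [h'.unique h₁]
  exact T.isIso_transport _

end TrTLEPStructure

end Restriction

/-! ### Part (a) followed by part (b), and isomorphisms -/

section Extension

variable {E : Type*} [NormedAddCommGroup E] [NormedSpace ℂ E] [FiniteDimensional ℂ E]
  {M : Type*} [TopologicalSpace M] [ChartedSpace E M] [IsManifold 𝓘(ℂ, E) ω M]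
  {F : Type*} [NormedAddCommGroup F] [NormedSpace ℂ F] [FiniteDimensional ℂ F]
  {K : M → Type*} [TopologicalSpace (TotalSpace F K)]
  [∀ t, AddCommGroup (K t)] [∀ t, Module ℂ (K t)] [∀ t, TopologicalSpace (K t)]
  [∀ t, IsTopologicalAddGroup (K t)] [∀ t, ContinuousSMul ℂ (K t)]
  [FiberBundle F K] [VectorBundle ℂ F K] [ContMDiffVectorBundle ω F K 𝓘(ℂ, E)]
  {K' : M → Type*} [TopologicalSpace (TotalSpace F K')]
  [∀ t, AddCommGroup (K' t)] [∀ t, Module ℂ (K' t)] [∀ t, TopologicalSpace (K' t)]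
  [∀ t, IsTopologicalAddGroup (K' t)] [∀ t, ContinuousSMul ℂ (K' t)]
  [FiberBundle F K'] [VectorBundle ℂ F K'] [ContMDiffVectorBundle ω F K' 𝓘(ℂ, E)]
  {w : ℤ}

theorem holSecAt_inclP1_const (p : P1) (t : M) (a : K t) :
    HolSecAt (V := inclP1 E t *ᵖ (projM E M *ᵖ K)) 𝓘(ℂ, ℂ) F (fun _ => a) p := by
  obtain ⟨α, hα, rfl⟩ := exists_holSecAt_eq (I := 𝓘(ℂ, E)) (F := F) (V := K) t a
  exact HolSecAt.pullback (inclP1 E t) (hα.pullSec (x := (p, t)))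

theorem holSecAt_inclM_pullSec {s : Π t, K t} {t : M} (hs : HolSecAt 𝓘(ℂ, E) F s t) (p : P1) :
    HolSecAt (V := inclM E M p *ᵖ (projM E M *ᵖ K)) 𝓘(ℂ, E) F s t :=
  HolSecAt.pullback (inclM E M p) (hs.pullSec (x := (p, t)))

variable (E F K) in
/-- The canonical isomorphism of `K` with the restriction of `π^*K` to `{p} × M`. -/
noncomputable def inclProjIso (p : P1) :
    HolIso 𝓘(ℂ, E) F K (inclM E M p *ᵖ (projM E M *ᵖ K)) :=
  HolIso.ofMap 𝓘(ℂ, E) F (V := K) (V' := inclM E M p *ᵖ (projM E M *ᵖ K))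
    (fun t => LinearEquiv.refl ℂ (K t)) fun _ _ hs => holSecAt_inclM_pullSec hs p

/-- On a bundle pulled back from `M`, the maps `ψ` are the identity. -/
theorem TrTLEPStructure.psi_projM (T : TrTLEPStructure E F w (projM E M *ᵖ K)) (p : P1) (t : M)
    (a : K t) : T.psi (p, t) a = a := by
  have h1 : ContMDiff 𝓘(ℂ, ℂ) 𝓘(ℂ, F) ω (fun p => (T.trivial_fibers t).some.toEquiv p a) :=
    fun p => holSecAt_trivial_iff.1
      (((T.trivial_fibers t).some.holSec_iff _ p).1 (holSecAt_inclP1_const p t a))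
  exact (LinearEquiv.symm_apply_eq _).2 (apply_eq_of_contMDiff h1 p ((0 : ℂ) : P1))

/-- Each component of `Φ` and of `Φ'` is the value of the same extension, evaluated on pulled back
sections, on which `ψ` is the identity. -/
theorem IsTwistedPullback.isIso_of_induces {Φ : FrobeniusTypeStructure 𝓘(ℂ, E) F K}
    {T : TrTLEPStructure E F w (projM E M *ᵖ K)}
    {Φ' : FrobeniusTypeStructure 𝓘(ℂ, E) F (inclM E M ((0 : ℂ) : P1) *ᵖ (projM E M *ᵖ K))}
    (h : IsTwistedPullback Φ T) (h' : T.Induces Φ') :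
    Φ.IsIso Φ' (inclProjIso E F K ((0 : ℂ) : P1)) := by
  -- Transport along the identity brings `T` into the form for which the residual data were
  -- computed.
  let χ : HolIso (𝓘(ℂ, ℂ).prod 𝓘(ℂ, E)) F (projM E M *ᵖ K) (projM E M *ᵖ K) :=
    ⟨fun x => LinearEquiv.refl ℂ (K x.2), fun _ _ => Iff.rfl⟩
  have hχ : IsTwistedPullback Φ (T.transport χ) := ⟨h.conn, h.P⟩
  have hpsi : ∀ (t : M) (a : K t), (T.psi ((OnePoint.infty : P1), t)).symm a = a := fun t a =>
    (LinearEquiv.symm_apply_eq _).2 (T.psi_projM _ t a).symm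
  have lift : ∀ (t : M) (a : K t), ∃ s : Π t, K t, HolSecAt 𝓘(ℂ, E) F s t ∧ s t = a :=
    fun t a => exists_holSecAt_eq (I := 𝓘(ℂ, E)) (F := F) (V := K) t a
  refine ⟨fun t s v hs => ?_, fun t v a => ?_, fun t a => ?_, fun t a => ?_, fun t a b => ?_⟩
  · obtain ⟨X, hX, rfl⟩ := exists_holVFAt_eq (E := E) t v
    have hσ := hs.pullSec (E := E) (x := ((OnePoint.infty : P1), t))
    have key := (hχ.extendsTo_conn hσ hX).unique (h'.conn t _ X hσ hX)
    have hs' : (fun t' : M => T.psi ((OnePoint.infty : P1), t') (s t')) = s :=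
      funext fun t' => T.psi_projM _ t' _
    refine key.trans ((hpsi t _).trans ?_)
    exact congrArg (fun s => Φ'.conn.toFun s t (X t)) hs'
  · obtain ⟨X, hX, rfl⟩ := exists_holVFAt_eq (E := E) t v
    obtain ⟨s, hs, rfl⟩ := lift t a
    have hσ := hs.pullSec (E := E) (x := (((0 : ℂ) : P1), t))
    exact (hχ.extendsTo_C hσ hX).unique (h'.C t _ X hσ hX)
  · obtain ⟨s, hs, rfl⟩ := lift t a
    have hσ := hs.pullSec (E := E) (x := (((0 : ℂ) : P1), t))
    exact (hχ.extendsTo_U hσ).unique (h'.U t _ hσ)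
  · obtain ⟨s, hs, rfl⟩ := lift t a
    have hσ := hs.pullSec (E := E) (x := ((OnePoint.infty : P1), t))
    have key := sub_left_injective ((hχ.extendsTo_V hσ).unique (h'.V t _ hσ))
    refine key.trans ((hpsi t _).trans ?_)
    exact congrArg (Φ'.V t) (T.psi_projM _ t _)
  · obtain ⟨s, hs, rfl⟩ := lift t a
    obtain ⟨s', hs', rfl⟩ := lift t b
    have hσ := hs.pullSec (E := E) (x := (((0 : ℂ) : P1), t))
    have hσ' := hs'.pullSec (E := E) (x := (((0 : ℂ) : P1), t))
    obtain ⟨f, f1, f2, f3⟩ := hχ.exists_holFunAt_g hσ hσ'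
    obtain ⟨f', f1', f2', f3'⟩ := h'.g t _ _ hσ hσ'
    refine f3.symm.trans (Eq.trans ?_ f3')
    refine f1.eq_of_eventually_Cstar f1' ?_
    filter_upwards [f2, f2'] with y h1 h2 hy
    rw [h1 hy, h2 hy]

section Isomorphisms

variable {Φ : FrobeniusTypeStructure 𝓘(ℂ, E) F K} {Φ' : FrobeniusTypeStructure 𝓘(ℂ, E) F K'}
  {T : TrTLEPStructure E F w (projM E M *ᵖ K)} {T' : TrTLEPStructure E F w (projM E M *ᵖ K')}

/-- The transport of `T` satisfies the formulas of (a) for `Φ'`, so it is `T'` by uniqueness. -/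
theorem FrobeniusTypeStructure.IsIso.pullback {φ : HolIso 𝓘(ℂ, E) F K K'} (hφ : Φ.IsIso Φ' φ)
    (h : IsTwistedPullback Φ T) (h' : IsTwistedPullback Φ' T') :
    T.IsIso T' (φ.pullback (projM E M)) := by
  have key : IsTwistedPullback Φ' (T.transport (φ.pullback (projM E M))) := by
    refine ⟨fun z t s ζ v hz hs => ?_, fun z t a b hz => ?_⟩
    · have hs' : HolSecAt 𝓘(ℂ, E) F (fun y => (φ.toEquiv y).symm (s y)) t :=
        (φ.symm.holSec_iff s t).1 hs
      have e1 := hφ.conn t _ v hs'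
      simp only [LinearEquiv.apply_symm_apply] at e1
      refine (congrArg (φ.toEquiv t) (h.conn z t _ ζ v hz hs')).trans ?_
      simp only [map_add, map_sub, map_smul, e1, hφ.C, hφ.U, hφ.V, LinearEquiv.apply_symm_apply]
    · refine (h.P z t ((φ.toEquiv t).symm a) ((φ.toEquiv t).symm b) hz).trans ?_
      rw [hφ.g]
      simp only [LinearEquiv.apply_symm_apply]
  rw [h'.unique key]
  exact T.isIso_transport _

/-- An isomorphism of pulled back bundles is constant along `P1`. -/
theorem HolIso.apply_eq_of_projM
    (ψ : HolIso (𝓘(ℂ, ℂ).prod 𝓘(ℂ, E)) F (projM E M *ᵖ K) (projM E M *ᵖ K')) (p q : P1) (t : M)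
    (a : K t) : @Eq (K' t) (ψ.toEquiv (p, t) a) (ψ.toEquiv (q, t) a) := by
  have h1 : ContMDiff 𝓘(ℂ, ℂ) 𝓘(ℂ, F) ω (fun p => fiberCoord (K := K') F t (ψ.toEquiv (p, t) a)) :=
    fun p => contMDiffAt_of_holSecAt_inclP1 (K := K') (fiberCoord (K := K') F t).toLinearMap
      (((ψ.pullback (inclP1 E t)).holSec_iff _ p).1 (holSecAt_inclP1_const p t a))
  exact (fiberCoord (K := K') F t).injective (apply_eq_of_contMDiff h1 p q)

/-- The restriction to `{p} × M` of an isomorphism of pulled back bundles. -/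
noncomputable def HolIso.restrict
    (ψ : HolIso (𝓘(ℂ, ℂ).prod 𝓘(ℂ, E)) F (projM E M *ᵖ K) (projM E M *ᵖ K')) (p : P1) :
    HolIso 𝓘(ℂ, E) F K K' :=
  HolIso.ofMap 𝓘(ℂ, E) F (V := K) (V' := K') (fun t => ψ.toEquiv (p, t)) fun t _ hs =>
    HolSecAt.slice (K := K') ((ψ.holSec_iff _ _).1 (hs.pullSec (x := (p, t))))

/-- Since `ψ` does not depend on the point of `P1`, it can be moved through the formula for `∇` at
every `z` at once. Comparing the coefficients of `1` and `z⁻¹` separates `∇^r` from `C` and `V` from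
`U`; the terms with `w/2` cancel. -/
theorem TrTLEPStructure.IsIso.restrict
    {ψ : HolIso (𝓘(ℂ, ℂ).prod 𝓘(ℂ, E)) F (projM E M *ᵖ K) (projM E M *ᵖ K')}
    (hψ : T.IsIso T' ψ) (h : IsTwistedPullback Φ T) (h' : IsTwistedPullback Φ' T') (p : P1) :
    Φ.IsIso Φ' (ψ.restrict p) := by
  have hc : ∀ (q : P1) (t : M) (a : K t),
      @Eq (K' t) (ψ.toEquiv (q, t) a) ((ψ.restrict p).toEquiv t a) :=
    fun q t a => ψ.apply_eq_of_projM q p t a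
  have key : ∀ (z : ℂ) (t : M) (s : Π t, K t) (ζ : ℂ) (v : TangentSpace 𝓘(ℂ, E) t), z ≠ 0 →
      HolSecAt 𝓘(ℂ, E) F s t → (ψ.restrict p).toEquiv t (Φ.conn.toFun s t v + z⁻¹ • Φ.C t v (s t)
        + (ζ / z) • (z⁻¹ • Φ.U t (s t) - Φ.V t (s t) + ((w : ℂ) / 2) • s t))
      = Φ'.conn.toFun (fun y => (ψ.restrict p).toEquiv y (s y)) t v
        + z⁻¹ • Φ'.C t v ((ψ.restrict p).toEquiv t (s t))
        + (ζ / z) • (z⁻¹ • Φ'.U t ((ψ.restrict p).toEquiv t (s t))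
          - Φ'.V t ((ψ.restrict p).toEquiv t (s t))
          + ((w : ℂ) / 2) • (ψ.restrict p).toEquiv t (s t)) := by
    intro z t s ζ v hz hs
    have hs' := ((ψ.restrict p).holSec_iff s t).1 hs
    refine Eq.trans ?_ (h'.conn z t _ ζ v hz hs')
    refine ((hc z t _).symm.trans (congrArg (ψ.toEquiv ((z : P1), t))
      (h.conn z t s ζ v hz hs).symm)).trans ?_
    refine (hψ.conn ((z : P1), t) _ _ (by simpa using hz) (hs.pullSec (x := ((z : P1), t)))).trans
        ?_
    refine congrArg (fun σ => T'.conn.toFun σ ((z : P1), t) (tvec ((z : P1), t) ζ v)) ?_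
    exact funext fun y => hc y.1 y.2 _
  have keyM : ∀ (t : M) (s : Π t, K t) (v : TangentSpace 𝓘(ℂ, E) t), HolSecAt 𝓘(ℂ, E) F s t → _ :=
    fun t s v hs => eq_of_forall_inv_smul fun z hz => by
      have := key z t s 0 v hz hs
      simp only [zero_div, zero_smul, add_zero, map_add, map_smul] at this
      exact this
  have keyE : ∀ (t : M) (s : Π t, K t), HolSecAt 𝓘(ℂ, E) F s t → _ :=
    fun t s hs => eq_of_forall_inv_smul (a := - (ψ.restrict p).toEquiv t (Φ.V t (s t)))
        (a' := - Φ'.V t ((ψ.restrict p).toEquiv t (s t))) fun z hz => by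
      have := key z t s z 0 hz hs
      simp only [div_self hz, one_smul, map_zero, LinearMap.zero_apply, smul_zero, zero_add,
        map_add, map_smul, map_neg, add_left_inj, sub_eq_neg_add] at this
      exact this
  have lift : ∀ (t : M) (a : K t), ∃ s : Π t, K t, HolSecAt 𝓘(ℂ, E) F s t ∧ s t = a :=
    fun t a => exists_holSecAt_eq (I := 𝓘(ℂ, E)) (F := F) (V := K) t a
  refine ⟨fun t s v hs => (keyM t s v hs).1, fun t v a => ?_, fun t a => ?_, fun t a => ?_,
    fun t a b => ?_⟩
  · obtain ⟨s, hs, rfl⟩ := lift t a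
    exact (keyM t s v hs).2
  · obtain ⟨s, hs, rfl⟩ := lift t a
    exact (keyE t s hs).2
  · obtain ⟨s, hs, rfl⟩ := lift t a
    exact neg_injective (keyE t s hs).1
  · have e1 := h.P 1 t a b one_ne_zero
    have e2 := h'.P 1 t ((ψ.restrict p).toEquiv t a) ((ψ.restrict p).toEquiv t b) one_ne_zero
    rw [one_zpow, one_mul] at e1 e2
    refine e1.symm.trans (Eq.trans ?_ e2)
    refine (hψ.P ((1 : ℂ) : P1) one_mem_Cstar t a b).trans ?_
    exact congrArg₂ (fun a b : K' t => T'.P ((1 : ℂ) : P1) t a b) (hc _ t a) (hc _ t b)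

end Isomorphisms

end Extension

end HolBundle

open HolBundle RiemannSphere in
theorem theorem5p7
    {E : Type*} [NormedAddCommGroup E] [NormedSpace ℂ E] [FiniteDimensional ℂ E]
    {M : Type*} [TopologicalSpace M] [T2Space M] [ChartedSpace E M] [IsManifold 𝓘(ℂ, E) ω M]
    (F : Type*) [NormedAddCommGroup F] [NormedSpace ℂ F] [FiniteDimensional ℂ F] (w : ℤ) :
    -- (a) a Frobenius type structure on `K` gives a `(trTLEP(w))`-structure on `π^*K`
    (∀ (K : M → Type v) [TopologicalSpace (TotalSpace F K)]
      [∀ t, AddCommGroup (K t)] [∀ t, Module ℂ (K t)] [∀ t, TopologicalSpace (K t)]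
      [∀ t, IsTopologicalAddGroup (K t)] [∀ t, ContinuousSMul ℂ (K t)]
      [FiberBundle F K] [VectorBundle ℂ F K] [ContMDiffVectorBundle ω F K 𝓘(ℂ, E)]
      (Φ : FrobeniusTypeStructure 𝓘(ℂ, E) F K),
      ∃! T : TrTLEPStructure E F w (projM E M *ᵖ K), IsTwistedPullback Φ T) ∧
    -- (b) a `(trTLEP(w))`-structure on `H` gives a Frobenius type structure on `K = H|_{0 × M}`
    (∀ (H : P1 × M → Type v) [TopologicalSpace (TotalSpace F H)]
      [∀ x, AddCommGroup (H x)] [∀ x, Module ℂ (H x)] [∀ x, TopologicalSpace (H x)]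
      [∀ x, IsTopologicalAddGroup (H x)] [∀ x, ContinuousSMul ℂ (H x)]
      [FiberBundle F H] [VectorBundle ℂ F H]
      [ContMDiffVectorBundle ω F H (𝓘(ℂ, ℂ).prod 𝓘(ℂ, E))]
      (T : TrTLEPStructure E F w H),
      (∃! Φ : FrobeniusTypeStructure 𝓘(ℂ, E) F (inclM E M ((0 : ℂ) : P1) *ᵖ H), T.Induces Φ) ∧
      -- (b) followed by (a): `ψ : H → π^*K` is an isomorphism of `(trTLEP(w))`-structures
      ∃ ψ : HolIso (𝓘(ℂ, ℂ).prod 𝓘(ℂ, E)) F H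
          (projM E M *ᵖ (inclM E M ((0 : ℂ) : P1) *ᵖ H)),
        (∀ (x : P1 × M) (a : H x), ψ.toEquiv x a = T.psi x a) ∧
        ∀ (Φ : FrobeniusTypeStructure 𝓘(ℂ, E) F (inclM E M ((0 : ℂ) : P1) *ᵖ H))
          (T' : TrTLEPStructure E F w (projM E M *ᵖ (inclM E M ((0 : ℂ) : P1) *ᵖ H))),
          T.Induces Φ → IsTwistedPullback Φ T' → T.IsIso T' ψ) ∧
    -- (a) followed by (b) gives back the Frobenius type structure on `K = (π^*K)|_{0 × M}`
    (∀ (K : M → Type v) [TopologicalSpace (TotalSpace F K)]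
      [∀ t, AddCommGroup (K t)] [∀ t, Module ℂ (K t)] [∀ t, TopologicalSpace (K t)]
      [∀ t, IsTopologicalAddGroup (K t)] [∀ t, ContinuousSMul ℂ (K t)]
      [FiberBundle F K] [VectorBundle ℂ F K] [ContMDiffVectorBundle ω F K 𝓘(ℂ, E)],
      ∃ φ : HolIso 𝓘(ℂ, E) F K (inclM E M ((0 : ℂ) : P1) *ᵖ (projM E M *ᵖ K)),
        (∀ (t : M) (a : K t), φ.toEquiv t a = a) ∧
        ∀ (Φ : FrobeniusTypeStructure 𝓘(ℂ, E) F K)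
          (T : TrTLEPStructure E F w (projM E M *ᵖ K))
          (Φ' : FrobeniusTypeStructure 𝓘(ℂ, E) F
            (inclM E M ((0 : ℂ) : P1) *ᵖ (projM E M *ᵖ K))),
          IsTwistedPullback Φ T → T.Induces Φ' → Φ.IsIso Φ' φ) ∧
    -- isomorphic structures on one side correspond to isomorphic structures on the other side
    (∀ (K K' : M → Type v)
      [TopologicalSpace (TotalSpace F K)]
      [∀ t, AddCommGroup (K t)] [∀ t, Module ℂ (K t)] [∀ t, TopologicalSpace (K t)]
      [∀ t, IsTopologicalAddGroup (K t)] [∀ t, ContinuousSMul ℂ (K t)]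
      [FiberBundle F K] [VectorBundle ℂ F K] [ContMDiffVectorBundle ω F K 𝓘(ℂ, E)]
      [TopologicalSpace (TotalSpace F K')]
      [∀ t, AddCommGroup (K' t)] [∀ t, Module ℂ (K' t)] [∀ t, TopologicalSpace (K' t)]
      [∀ t, IsTopologicalAddGroup (K' t)] [∀ t, ContinuousSMul ℂ (K' t)]
      [FiberBundle F K'] [VectorBundle ℂ F K'] [ContMDiffVectorBundle ω F K' 𝓘(ℂ, E)]
      (Φ : FrobeniusTypeStructure 𝓘(ℂ, E) F K) (Φ' : FrobeniusTypeStructure 𝓘(ℂ, E) F K')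
      (T : TrTLEPStructure E F w (projM E M *ᵖ K)) (T' : TrTLEPStructure E F w (projM E M *ᵖ K')),
      IsTwistedPullback Φ T → IsTwistedPullback Φ' T' →
        ((∃ φ, Φ.IsIso Φ' φ) ↔ ∃ ψ, T.IsIso T' ψ)) := by
  refine ⟨?_, ?_, ?_, ?_⟩
  · intro K _ _ _ _ _ _ _ _ _ Φ
    obtain ⟨T, h⟩ := exists_isTwistedPullback Φ w
    exact ⟨T, h, fun T' h' => h'.unique h⟩
  · intro H _ _ _ _ _ _ _ _ _ T
    exact ⟨T.existsUnique_induces, T.psiIso, fun _ _ => rfl, fun _ _ h h' => h.isIso h'⟩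
  · intro K _ _ _ _ _ _ _ _ _
    exact ⟨inclProjIso E F K ((0 : ℂ) : P1), fun _ _ => rfl,
      fun _ _ _ h h' => h.isIso_of_induces h'⟩
  · intro K K' _ _ _ _ _ _ _ _ _ _ _ _ _ _ _ _ _ _ Φ Φ' T T' h h'
    exact ⟨fun ⟨_, hφ⟩ => ⟨_, hφ.pullback h h'⟩,
      fun ⟨_, hψ⟩ => ⟨_, hψ.restrict h h' ((0 : ℂ) : P1)⟩⟩
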